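/- Let $n\ge 1$ and $\varepsilon>0$. For every $k\in\mathbb N=\{0,1,2,\dots\}$ let $Z_k$ be a maximal set of points of the annulus $2^{k-1}\le|\xi|<2^k$ in $\mathbb R^n$ with mutual distances $>2^{k/2}$. Put $\Gamma=\{\gamma=(k,\xi,\alpha): k\in\mathbb N,\ \xi\in Z_k,\ \alpha\in\mathbb Z^n\}$ and, for $\gamma=(k,\xi,\alpha)$ and a constant $C_\varepsilon>0$, put $\xi_\gamma=\xi$, $\Delta x_\gamma=C_\varepsilon2^{-k/2-\varepsilon k}$, $x_\gamma=\Delta x_\gamma\,\alpha$ and $$\phi_\gamma(x)=\Big(\frac{|\xi_\gamma|\Delta x_\gamma}{2\pi}\Big)^{n/2}\exp\big(i\xi_\gamma\cdot(x-x_\gamma)-|\xi_\gamma||x-x_\gamma|^2\big).$$ Let $P_1f=(c(\gamma))_\gamma$ with $c(\gamma)=\int\overline{\phi_\gamma}f\,dx$, $P_2d=\sum_\gamma d(\gamma)\phi_\gamma$ and $\Pi^0=P_2P_1$. There is $c_0>0$, depending only on $n$ and $\varepsilon$, such that the following holds whenever $0<C_\varepsilon\le c_0$. The operator $\Pi^0$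 is bounded and invertible on $L^2(\mathbb R^n)$. Further, let $T>0$ and let $A(t,x)=(a_{ij}(t,x))$, $(t,x)\in[-T,T]\times\mathbb R^n$, be a real symmetric matrix with $|\xi|^2/C\le\sum a_{ij}(t,x)\xi_i\xi_j\le C|\xi|^2$, whose entries are Lipschitz in $(t,x)$ and have first $x$-derivatives that are Lipschitz in $x$, uniformly in $t$. With $q(t,x,\xi)=(\sum a_{ij}(t,x)\xi_i\xi_j)^{1/2}$ let $(x_\gamma(t),\xi_\gamma(t))$ be the solution of $\dot x=-q_\xi$, $\dot\xi=q_x$ on $[-T,T]$ that starts at $(x_\gamma,\xi_\gamma)$ at $t=0$, and let $$\phi_\gamma(t,x)=\Big(\frac{|\xi_\gamma(t)|\Delta x_\gamma}{2\pi}\Big)^{n/2}\exp\big(i\xi_\gamma(t)\cdot(x-x_\gamma(t))-|\xi_\gamma(t)||x-x_\gamma(t)|^2\big).$$ (a) The matrix $B_E(t)$ with entries $b_E(\gamma,\gamma',t)=\int\overline{\phi_\gamma(x)}\,\phi_{\gamma'}(t,x)\,dx$ satisfies $\sum_{\gamma}|b_E(\gamma,\gamma',t)|\le C$ and $\sum_{\gamma'}|b_E(\gamma,\gamma',t)|\le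 C$, with $C$ independent of $\gamma,\gamma'$ and of $t\in[-T,T]$. The operator $E(t)$ defined by $\Pi^0E(t)\Pi^0=P_2B_E(t)P_1$ exists as a bounded operator on $L^2(\mathbb R^n)$ and is bounded of order $0$, uniformly in time: for every $r\in\mathbb R$ there is $C_r$ with $\|E(t)h\|_{H^r}\le C_r\|h\|_{H^r}$ for all $t\in[-T,T]$ and all $h\in L^2\cap H^r$. (b) Suppose moreover that the first $x$-derivatives of the $a_{ij}$ are Lipschitz in $t$, uniformly in $x$ (as they are if $a_{ij}\in C^{1,1}([-T,T]\times\mathbb R^n)$). Then for almost every $t\in[-T,T]$ all the curves $(x_\gamma,\xi_\gamma)$ are twice differentiable at $t$. Let $\mathcal R$ be the set of these $t$ and, for $t\in\mathcal R$, let $B_T(t)$ be the matrix with entries $b_T(\gamma,\gamma',t)=\int\overline{\phi_\gamma(x)}\,\big(\partial_t^2-\sum a_{ij}(t,x)\partial_i\partial_j\big)\phi_{\gamma'}(t,x)\,dx$. For $t\in\mathcal R$ the operator $TE(t)$ defined by $\Pi^0\,TE(t)\,\Pi^0=P_2B_T(t)P_1$ exists as a linear operator $H^1(\mathbb R^n)\to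 L^2(\mathbb R^n)$ and is bounded of order $1$, uniformly in time: for every $r\in[0,3]$ there is $C_r$ with $\|TE(t)h\|_{H^{r-1}}\le C_r\|h\|_{H^r}$ for all $t\in\mathcal R$ and all $h\in H^1\cap H^r$. -/

import Mathlib

open MeasureTheory Set FourierTransform
open scoped ENNReal NNReal ComplexConjugate

noncomputable section

namespace GaussianFrame

/-- Euclidean space `ℝⁿ`. -/
abbrev Rn (n : ℕ) : Type := EuclideanSpace ℝ (Fin n)

/-- The Hilbert space `L²(ℝⁿ)` of complex valued functions. -/
abbrev L2 (n : ℕ) : Type := Lp ℂ 2 (volume : Measure (Rn n))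

/-! ### Sobolev norms -/

/-- The Sobolev norm `‖f‖_{H^r}` of `f ∈ L²(ℝⁿ)`, for any real order `r`:
the `L²` norm of `(1 + |ξ|²)^{r/2} f̂(ξ)`. It is `∞` exactly when `f ∉ H^r`. (The Fourier
transform has the kernel `exp (-2πi x·ξ)`, so that the norm is equivalent to, not equal to,
the one written with the kernel `exp (-i x·ξ)`.) -/
def sobolevNorm {n : ℕ} (r : ℝ) (f : L2 n) : ℝ≥0∞ :=
  eLpNorm (fun ξ : Rn n => (((1 + ‖ξ‖ ^ 2) ^ (r / 2) : ℝ) : ℂ) * (𝓕 f : L2 n) ξ) 2 volume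

lemma aestronglyMeasurable_sobolev {n : ℕ} (r : ℝ) (f : L2 n) :
    AEStronglyMeasurable
      (fun ξ : Rn n => (((1 + ‖ξ‖ ^ 2) ^ (r / 2) : ℝ) : ℂ) * (𝓕 f : L2 n) ξ) volume := by
  refine AEStronglyMeasurable.mul ?_ (Lp.aestronglyMeasurable _)
  refine (Continuous.aestronglyMeasurable ?_)
  refine Complex.continuous_ofReal.comp ?_
  exact Continuous.rpow_const (by fun_prop) (fun x => Or.inl (by positivity))

/-- `L²(ℝⁿ) ∩ H^r(ℝⁿ)`, which is `H^r(ℝⁿ)` when `r ≥ 0`. -/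
def sobolevSpace (n : ℕ) (r : ℝ) : Submodule ℂ (L2 n) where
  carrier := {f | sobolevNorm r f < ∞}
  zero_mem' := by
    have h : (fun ξ : Rn n => (((1 + ‖ξ‖ ^ 2) ^ (r / 2) : ℝ) : ℂ) * (𝓕 (0 : L2 n) : L2 n) ξ)
        =ᵐ[volume] 0 := by
      have h0 : (𝓕 (0 : L2 n) : L2 n) = 0 := map_zero (Lp.fourierTransformₗᵢ (Rn n) ℂ)
      rw [h0]
      filter_upwards [Lp.coeFn_zero (E := ℂ) (p := 2) (μ := (volume : Measure (Rn n)))] with ξ hξ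
      rw [hξ, Pi.zero_apply, mul_zero]
    simp only [Set.mem_ofPred_eq, sobolevNorm]
    rw [eLpNorm_congr_ae h]
    simp
  add_mem' := by
    intro f g hf hg
    simp only [Set.mem_ofPred_eq, sobolevNorm] at hf hg ⊢
    have h : (fun ξ : Rn n => (((1 + ‖ξ‖ ^ 2) ^ (r / 2) : ℝ) : ℂ) * (𝓕 (f + g) : L2 n) ξ)
        =ᵐ[volume]
        (fun ξ : Rn n => (((1 + ‖ξ‖ ^ 2) ^ (r / 2) : ℝ) : ℂ) * (𝓕 f : L2 n) ξ) +
        (fun ξ : Rn n => (((1 + ‖ξ‖ ^ 2) ^ (r / 2) : ℝ) : ℂ) * (𝓕 g : L2 n) ξ) := by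
      have h0 : (𝓕 (f + g) : L2 n) = 𝓕 f + 𝓕 g :=
        map_add (Lp.fourierTransformₗᵢ (Rn n) ℂ) f g
      rw [h0]
      filter_upwards [Lp.coeFn_add (𝓕 f : L2 n) (𝓕 g : L2 n)] with ξ hξ
      rw [hξ, Pi.add_apply, Pi.add_apply, mul_add]
    rw [eLpNorm_congr_ae h]
    exact eLpNorm_add_lt_top ⟨aestronglyMeasurable_sobolev r f, hf⟩
      ⟨aestronglyMeasurable_sobolev r g, hg⟩
  smul_mem' := by
    intro c f hf
    simp only [Set.mem_ofPred_eq, sobolevNorm] at hf ⊢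
    have h : (fun ξ : Rn n => (((1 + ‖ξ‖ ^ 2) ^ (r / 2) : ℝ) : ℂ) * (𝓕 (c • f) : L2 n) ξ)
        =ᵐ[volume]
        c • (fun ξ : Rn n => (((1 + ‖ξ‖ ^ 2) ^ (r / 2) : ℝ) : ℂ) * (𝓕 f : L2 n) ξ) := by
      have h0 : (𝓕 (c • f) : L2 n) = c • 𝓕 f :=
        map_smul (Lp.fourierTransformₗᵢ (Rn n) ℂ) c f
      rw [h0]
      filter_upwards [Lp.coeFn_smul c (𝓕 f : L2 n)] with ξ hξ
      simp only [hξ, Pi.smul_apply, smul_eq_mul]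
      ring
    rw [eLpNorm_congr_ae h]
    exact (MemLp.const_smul ⟨aestronglyMeasurable_sobolev r f, hf⟩ c).2

/-! ### The frame -/

/-- The dyadic annulus `2^(k-1) ≤ |ξ| < 2^k`. -/
def annulus (n k : ℕ) : Set (Rn n) := {ξ | (2 : ℝ) ^ k / 2 ≤ ‖ξ‖ ∧ ‖ξ‖ < (2 : ℝ) ^ k}

/-- An admissible choice of the frequencies `2^k ω_{i,k}`: in every dyadic annulus
a maximal set of points with mutual distances larger than `2^(k/2)`. (A separated set with the
largest possible number of points is in particular maximal.) -/
structure FrequencyNet (n : ℕ) where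
  /-- the frequencies in the `k`-th annulus -/
  pts : ℕ → Set (Rn n)
  subset_annulus : ∀ k, pts k ⊆ annulus n k
  separated : ∀ k, ∀ ξ ∈ pts k, ∀ η ∈ pts k, ξ ≠ η → (2 : ℝ) ^ ((k : ℝ) / 2) < dist ξ η
  maximal : ∀ k, ∀ η ∈ annulus n k, ∃ ξ ∈ pts k, dist η ξ ≤ (2 : ℝ) ^ ((k : ℝ) / 2)

/-- The index set `Γ` of the frame: a level `k`, a frequency of level `k`, and `α ∈ ℤⁿ`. -/
abbrev Index {n : ℕ} (Z : FrequencyNet n) : Type := Σ k : ℕ, Z.pts k × (Fin n → ℤ)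

/-- The lattice spacing `Δx = c 2^(-k/2 - εk)` of level `k`. -/
def spacing (ε c : ℝ) (k : ℕ) : ℝ := c * (2 : ℝ) ^ (-((k : ℝ) / 2) - ε * k)

/-- The frequency `ξ_γ`. -/
def freq {n : ℕ} {Z : FrequencyNet n} (γ : Index Z) : Rn n := γ.2.1

/-- The position `x_γ = Δx_γ α`. -/
def pos {n : ℕ} {Z : FrequencyNet n} (ε c : ℝ) (γ : Index Z) : Rn n :=
  WithLp.toLp 2 (fun i => spacing ε c γ.1 * (γ.2.2 i : ℝ))

/-- The Gaussian `(|η| δ / 2π)^(n/2) exp (i η·(x - y) - |η| |x - y|²)`. -/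
def gaussian {n : ℕ} (δ : ℝ) (y η : Rn n) (x : Rn n) : ℂ :=
  (((‖η‖ * δ / (2 * Real.pi)) ^ ((n : ℝ) / 2) : ℝ) : ℂ) *
    Complex.exp (Complex.I * ((inner ℝ η (x - y) : ℝ) : ℂ) - ((‖η‖ * ‖x - y‖ ^ 2 : ℝ) : ℂ))

lemma continuous_gaussian {n : ℕ} (δ : ℝ) (y η : Rn n) : Continuous (gaussian δ y η) := by
  unfold gaussian
  fun_prop

lemma memLp_gaussian {n : ℕ} (δ : ℝ) (y : Rn n) {η : Rn n} (hη : η ≠ 0) :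
    MemLp (gaussian δ y η) 2 volume := by
  have hη' : 0 < ‖η‖ := norm_pos_iff.mpr hη
  rw [memLp_two_iff_integrable_sq_norm (continuous_gaussian δ y η).aestronglyMeasurable]
  have h1 : Integrable (fun v : Rn n => Complex.exp (-((2 * ‖η‖ : ℝ) : ℂ) * (‖v‖ : ℂ) ^ 2 +
      0 * ((inner ℝ (0 : Rn n) v : ℝ) : ℂ))) :=
    GaussianFourier.integrable_cexp_neg_mul_sq_norm_add
      (by rw [Complex.ofReal_re]; positivity) 0 0
  have h2 := ((h1.norm.comp_sub_right y).const_mul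
    (((‖η‖ * δ / (2 * Real.pi)) ^ ((n : ℝ) / 2)) ^ 2))
  refine h2.congr (Filter.Eventually.of_forall fun x => ?_)
  have e1 : (-((2 * ‖η‖ : ℝ) : ℂ) * (‖x - y‖ : ℂ) ^ 2 +
      0 * ((inner ℝ (0 : Rn n) (x - y) : ℝ) : ℂ)) = ((-(2 * ‖η‖) * ‖x - y‖ ^ 2 : ℝ) : ℂ) := by
    push_cast
    ring
  have e2 : (Complex.I * ((inner ℝ η (x - y) : ℝ) : ℂ) - ((‖η‖ * ‖x - y‖ ^ 2 : ℝ) : ℂ)).re =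
      -(‖η‖ * ‖x - y‖ ^ 2) := by
    rw [Complex.sub_re, Complex.ofReal_re, Complex.re_mul_ofReal, Complex.I_re]
    ring
  simp only [gaussian]
  rw [e1, norm_mul, Complex.norm_exp, Complex.norm_exp, e2, Complex.ofReal_re, Complex.norm_real,
    mul_pow, Real.norm_eq_abs, sq_abs, ← Real.exp_nat_mul]
  congr 2
  push_cast
  ring

lemma freq_ne_zero {n : ℕ} {Z : FrequencyNet n} (γ : Index Z) : freq γ ≠ 0 := by
  intro h
  have h1 := (Z.subset_annulus γ.1 γ.2.1.2).1
  have h2 : ((γ.2.1 : Rn n)) = 0 := h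
  rw [h2, norm_zero] at h1
  have : (0 : ℝ) < 2 ^ γ.1 := by positivity
  linarith

/-- The frame function `φ_γ`. -/
def frameFun {n : ℕ} {Z : FrequencyNet n} (ε c : ℝ) (γ : Index Z) : Rn n → ℂ :=
  gaussian (spacing ε c γ.1) (pos ε c γ) (freq γ)

/-- The frame function `φ_γ` as an element of `L²(ℝⁿ)`. -/
def frameVec {n : ℕ} {Z : FrequencyNet n} (ε c : ℝ) (γ : Index Z) : L2 n :=
  (memLp_gaussian (spacing ε c γ.1) (pos ε c γ) (freq_ne_zero γ)).toLp (frameFun ε c γ)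

/-- The analysis operator `P₁`: the coefficients `c(γ) = ∫ conj φ_γ f`. -/
def frameCoeff {n : ℕ} (Z : FrequencyNet n) (ε c : ℝ) (f : L2 n) (γ : Index Z) : ℂ :=
  ∫ x, conj (frameFun ε c γ x) * f x

/-- `P₂ d = g`, where `P₂ d = ∑_γ d(γ) φ_γ`, the sum being taken in `L²(ℝⁿ)`. -/
def HasSynthesis {n : ℕ} (Z : FrequencyNet n) (ε c : ℝ) (d : Index Z → ℂ) (g : L2 n) : Prop :=
  HasSum (fun γ => d γ • frameVec ε c γ) g

/-- `S` is the frame operator `Π⁰ = P₂ P₁`. -/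
def IsFrameOperator {n : ℕ} (Z : FrequencyNet n) (ε c : ℝ) (S : L2 n → L2 n) : Prop :=
  ∀ f, HasSynthesis Z ε c (frameCoeff Z ε c f) (S f)

/-- `P₂ B P₁ f = g` for the infinite matrix `B`: the series `∑_γ' B(γ,γ') c(γ')` converge
absolutely, and they are the coefficients of a synthesis of `g`. -/
def HasMatrixImage {n : ℕ} (Z : FrequencyNet n) (ε c : ℝ) (B : Index Z → Index Z → ℂ)
    (f g : L2 n) : Prop :=
  (∀ γ, Summable fun γ' => B γ γ' * frameCoeff Z ε c f γ') ∧
    HasSynthesis Z ε c (fun γ => ∑' γ', B γ γ' * frameCoeff Z ε c f γ') g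

/-! ### The wave operator and its bicharacteristics -/

/-- Coefficients on `[-T,T] × ℝⁿ` of the wave operator: symmetric, uniformly positive definite
and bounded, Lipschitz in `(t,x)`, with first `x`-derivatives that are Lipschitz in `x`. -/
structure IsWaveCoefficient {n : ℕ} (T : ℝ) (a : ℝ → Rn n → Matrix (Fin n) (Fin n) ℝ) :
    Prop where
  symm : ∀ t ∈ Icc (-T) T, ∀ x, (a t x).IsSymm
  elliptic : ∃ C > 0, ∀ t ∈ Icc (-T) T, ∀ x ξ : Rn n,
    ‖ξ‖ ^ 2 / C ≤ ∑ i, ∑ j, a t x i j * ξ i * ξ j ∧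
      ∑ i, ∑ j, a t x i j * ξ i * ξ j ≤ C * ‖ξ‖ ^ 2
  lipschitz : ∃ C, ∀ t ∈ Icc (-T) T, ∀ s ∈ Icc (-T) T, ∀ x y : Rn n, ∀ i j,
    |a t x i j - a s y i j| ≤ C * (|t - s| + ‖x - y‖)
  differentiable : ∀ t ∈ Icc (-T) T, ∀ i j, Differentiable ℝ fun x => a t x i j
  grad_lipschitz : ∃ C, ∀ t ∈ Icc (-T) T, ∀ x y : Rn n, ∀ i j,
    ‖gradient (fun z => a t z i j) x - gradient (fun z => a t z i j) y‖ ≤ C * ‖x - y‖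

/-- The first `x`-derivatives of the coefficients are Lipschitz in `t` as well (as they are when
the coefficients are `C^{1,1}` in all the variables). -/
def GradLipschitzInTime {n : ℕ} (T : ℝ) (a : ℝ → Rn n → Matrix (Fin n) (Fin n) ℝ) : Prop :=
  ∃ C, ∀ t ∈ Icc (-T) T, ∀ s ∈ Icc (-T) T, ∀ x : Rn n, ∀ i j,
    ‖gradient (fun z => a t z i j) x - gradient (fun z => a s z i j) x‖ ≤ C * |t - s|

/-- The symbol `q(t,x,ξ) = (∑ a_ij(t,x) ξ_i ξ_j)^(1/2)`. -/
def q {n : ℕ} (a : ℝ → Rn n → Matrix (Fin n) (Fin n) ℝ) (t : ℝ) (x ξ : Rn n) : ℝ :=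
  Real.sqrt (∑ i, ∑ j, a t x i j * ξ i * ξ j)

/-- `c = (x(t), ξ(t))` solves `dx/dt = -q_ξ`, `dξ/dt = q_x` on `[-T,T]`, off the zero section,
with `c(0) = (y, η)`. -/
structure IsBicharacteristic {n : ℕ} (a : ℝ → Rn n → Matrix (Fin n) (Fin n) ℝ) (T : ℝ)
    (y η : Rn n) (c : ℝ → Rn n × Rn n) : Prop where
  init : c 0 = (y, η)
  ne_zero : ∀ t ∈ Icc (-T) T, (c t).2 ≠ 0
  deriv_pos : ∀ t ∈ Icc (-T) T, HasDerivWithinAt (fun s => (c s).1)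
    (-gradient (fun ζ => q a t (c t).1 ζ) (c t).2) (Icc (-T) T) t
  deriv_freq : ∀ t ∈ Icc (-T) T, HasDerivWithinAt (fun s => (c s).2)
    (gradient (fun z => q a t z (c t).2) (c t).1) (Icc (-T) T) t

/-- The null bicharacteristic through `(y, η)` at time `0`: the solution of the Hamiltonian system
above, which is unique on `[-T,T]` when `η ≠ 0`. -/
def bichar {n : ℕ} (a : ℝ → Rn n → Matrix (Fin n) (Fin n) ℝ) (T : ℝ) (y η : Rn n) :
    ℝ → Rn n × Rn n :=
  Classical.epsilon (IsBicharacteristic a T y η)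

/-- The wave operator `∂_t² - ∑ a_ij ∂_i ∂_j` on `[-T,T] × ℝⁿ`, applied to `u` at `(t,x)`
(with one-sided time derivatives at the end points). -/
def waveOp {n : ℕ} (a : ℝ → Rn n → Matrix (Fin n) (Fin n) ℝ) (T : ℝ) (u : ℝ → Rn n → ℂ)
    (t : ℝ) (x : Rn n) : ℂ :=
  derivWithin (fun s => derivWithin (fun τ => u τ x) (Icc (-T) T) s) (Icc (-T) T) t -
    ∑ i, ∑ j, (a t x i j : ℂ) *
      lineDeriv ℝ (fun z => lineDeriv ℝ (u t) z (EuclideanSpace.single j 1)) x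
        (EuclideanSpace.single i 1)

/-- The bicharacteristic `(x_γ(t), ξ_γ(t))` that starts at `(x_γ, ξ_γ)`. -/
def framePath {n : ℕ} {Z : FrequencyNet n} (ε c T : ℝ)
    (a : ℝ → Rn n → Matrix (Fin n) (Fin n) ℝ) (γ : Index Z) : ℝ → Rn n × Rn n :=
  bichar a T (pos ε c γ) (freq γ)

/-- The propagated frame function `φ_γ(t,x)`. -/
def movedFrameFun {n : ℕ} {Z : FrequencyNet n} (ε c T : ℝ)
    (a : ℝ → Rn n → Matrix (Fin n) (Fin n) ℝ) (γ : Index Z) (t : ℝ) : Rn n → ℂ :=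
  gaussian (spacing ε c γ.1) (framePath ε c T a γ t).1 (framePath ε c T a γ t).2

/-- The matrix `b_E(γ,γ',t) = ∫ conj φ_γ(x) φ_γ'(t,x) dx`. -/
def bE {n : ℕ} {Z : FrequencyNet n} (ε c T : ℝ) (a : ℝ → Rn n → Matrix (Fin n) (Fin n) ℝ)
    (t : ℝ) (γ γ' : Index Z) : ℂ :=
  ∫ x, conj (frameFun ε c γ x) * movedFrameFun ε c T a γ' t x

/-- The matrix `b_T(γ,γ',t) = ∫ conj φ_γ(x) (∂_t² - ∑ a_ij ∂_i ∂_j) φ_γ'(t,x) dx`. -/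
def bT {n : ℕ} {Z : FrequencyNet n} (ε c T : ℝ) (a : ℝ → Rn n → Matrix (Fin n) (Fin n) ℝ)
    (t : ℝ) (γ γ' : Index Z) : ℂ :=
  ∫ x, conj (frameFun ε c γ x) * waveOp a T (movedFrameFun ε c T a γ') t x

/-- The times in `[-T,T]` at which all the bicharacteristics of the frame, hence all the
propagated frame functions, have a second time derivative. -/
def regularTimes {n : ℕ} (Z : FrequencyNet n) (ε c T : ℝ)
    (a : ℝ → Rn n → Matrix (Fin n) (Fin n) ℝ) : Set ℝ :=
  {t | t ∈ Icc (-T) T ∧ ∀ γ : Index Z,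
    DifferentiableWithinAt ℝ (derivWithin (framePath ε c T a γ) (Icc (-T) T)) (Icc (-T) T) t}

end GaussianFrame

end

open GaussianFrame

/-!
# Gaussian frames and the parametrix of the wave equation

*The frame operator.* By Parseval's identity for periodizations, the coefficients of `f` with a
fixed frequency `ξ` of level `k` have the energy `2^(-n) ∫ exp (-|2πη - ξ|²/(2|ξ|)) |f̂(η)|² dη`,
up to an aliasing error of relative size `exp (-2^(2εk)/c²)`, because the lattice of the positions
is finer than `2^(-k/2)`. Hence `Π⁰` is the sum of a Fourier multiplier, whose symbol `frameSymbol`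
lies between two positive constants, and of a symmetric operator whose quadratic form is small for
small `c` and is bounded on every `H^(-s)`. So `Π⁰` is positive, and `(Π⁰)⁻¹` is bounded on all
`H^r` (`exists_frameOperator_equiv`). In the same way `P₁` maps `H^r` into `ℓ²` with the weights
`2^(rk)`.

*Reduction to synthesis.* The entries of the matrices are inner products with the frame functions,
so that `P₂ B P₁ f = Π⁰ ∑_γ c(γ) P_γ`, where `P_γ` is the moved frame function, or its image under
the wave operator (`IsFrameOperator.hasMatrixImage`). Therefore `E(t) h = ∑_γ ⟨φ_γ, (Π⁰)⁻¹ h⟩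
φ_γ(t)`, and likewise for `TE(t)`. What is needed is that the maps `d ↦ ∑ d_γ P_γ` are bounded from
weighted `ℓ²` spaces into Sobolev spaces, uniformly in `t`.

*One level.* The bicharacteristic flow is homogeneous in the frequency and bi-Lipschitz for the
metric `|dx|² + |dξ|²/4^k` at frequencies of size `2^k` (`WaveBound.exists_flow_lower`), so that
the moved centres of one level stay separated. The explicit Gaussian integrals then give the decay
of the matrices (`WaveBound.exists_tsum_bE_le`), and Schur's test bounds the sums over one level.
This remains true for the functions `f_γ φ_γ(t)` with amplitudes `f_γ` that locally separate into a
factor in `γ` and a factor in `x`, of polynomial growth on the scale `2^(-k/2)`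
(`IsMultiplier.exists_level_sum_le`).

*Different levels.* No smoothness beyond that of the coefficients may be used. A packet `f φ` is a
sum of first derivatives of packets smaller by `2^(-k)`, up to a remainder smaller by `2^(-k/2)`.
With `k` the higher of two levels, an integration by parts moves these derivatives to the packet of
the lower level, and the inner products decay exponentially in the difference of the levels
(`IsPacketSystem.isBoundedFamily`); one derivative of the amplitudes suffices. An amplitude with
`N` derivatives (`IsSymbol`) gives bounds into `H^N`, and one with two derivatives gives a bound
into `H^(-1)`. `SobolevBound.interpolate` yields the orders between.

*The wave operator.* It multiplies the moved Gaussian by a polynomial in the distance from the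
centre, with coefficients that contain the `a_ij(t,x)`. When these are expanded to first order at
the centre, the terms of order `2` and `3/2` cancel because the centre moves along a
bicharacteristic of `q = (∑ a_ij ξ_i ξ_j)^(1/2)`. The Taylor remainder of a function with Lipschitz
gradient is a symbol of order `-1` with two derivatives (`IsPacketSystem.isSymbol_taylor`), so that
the amplitude is a symbol of order `1` with two derivatives (`IsPacketSystem.isSymbol_wave`). This
gives bounds into `H^(-1)` and `H^2`, whence the range `0 ≤ r ≤ 3` for `TE(t)`. At almost every `t`
the second derivatives of the paths exist by Rademacher's theorem, for all of the countably many
paths at once.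
-/

noncomputable section

namespace GaussianFrame

open scoped Real
open Real (exp exp_pos exp_add norm_eq_abs rpow_natCast rpow_mul rpow_add sqrt_nonneg sq_sqrt
  sqrt_mul norm_of_nonneg)
open Complex (I norm_real)
open ENNReal (ofReal ofReal_mul ofReal_pow ofReal_le_ofReal ofReal_sum_of_nonneg ofReal_ne_top)
open Finset (sum_congr mul_sum sum_le_sum sum_nonneg sum_mul sum_add_distrib)
open EuclideanSpace (single)

/-! ### Gaussian integrals and sums over separated sets -/

lemma integral_exp_neg_mul_sq {n : ℕ} {s : ℝ} (hs : 0 < s) (x : Rn n) :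
    ∫ y : Rn n, exp (-s * ‖y - x‖ ^ 2) = (√π / √s) ^ n := by
  rw [integral_sub_right_eq_self (fun y : Rn n => exp (-s * ‖y‖ ^ 2)) x,
    GaussianFourier.integral_rexp_neg_mul_sq_norm hs]
  rw [← Real.sqrt_div Real.pi_pos.le, Real.sqrt_eq_rpow, ← rpow_natCast,
    ← rpow_mul (by positivity)]
  congr 1
  simp
  ring

lemma integrable_exp_neg_mul_sq {n : ℕ} {s : ℝ} (hs : 0 < s) (x : Rn n) :
    Integrable fun y : Rn n => exp (-s * ‖y - x‖ ^ 2) := by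
  have h1 : Integrable (fun v : Rn n => Complex.exp (-(s : ℂ) * (‖v‖ : ℂ) ^ 2 +
      0 * ((inner ℝ (0 : Rn n) v : ℝ) : ℂ))) :=
    GaussianFourier.integrable_cexp_neg_mul_sq_norm_add (by simpa using hs) 0 0
  refine (h1.norm.comp_sub_right x).congr (.of_forall fun y => ?_)
  simp only [Complex.norm_exp]
  congr 1
  simp [← Complex.ofReal_pow]

/-- A Gaussian sum over a `D`-separated family, compared with the integral of the Gaussian. -/
lemma exists_sum_exp_le_of_separated (n : ℕ) : ∃ C > 0, ∀ (ι : Type) (p : ι → Rn n) (D s : ℝ),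
    0 < D → 0 < s → (∀ i j, i ≠ j → D ≤ dist (p i) (p j)) → ∀ (x : Rn n) (F : Finset ι),
    ∑ i ∈ F, exp (-s * ‖p i - x‖ ^ 2) ≤ C * exp (s * D ^ 2) * ((D * √s)⁻¹) ^ n := by
  set v : ℝ := (volume : Measure (Rn n)).real (Metric.ball 0 1) with hv
  have hv0 : 0 < v := by
    rw [hv, measureReal_def]
    exact ENNReal.toReal_pos (Metric.measure_ball_pos _ _ one_pos).ne'
      (measure_ball_lt_top).ne
  refine ⟨(√(2 * π) * 2) ^ n / v, by positivity, ?_⟩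
  intro ι p D s hD hs hsep x F
  have hball : ∀ i, (volume : Measure (Rn n)).real (Metric.ball (p i) (D / 2)) =
      (D / 2) ^ n * v := by
    intro i
    rw [measureReal_def, Measure.addHaar_ball_of_pos _ _ (by positivity : 0 < D / 2), ENNReal.toReal_mul,
      ENNReal.toReal_ofReal (by positivity)]
    simp [hv, measureReal_def]
  have hint : Integrable fun y : Rn n => exp (-(s / 2) * ‖y - x‖ ^ 2) :=
    integrable_exp_neg_mul_sq (by positivity) x
  have h1 : ∀ i ∈ F, exp (-s * ‖p i - x‖ ^ 2) * ((D / 2) ^ n * v) ≤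
      exp (s * D ^ 2) *
        ∫ y in Metric.ball (p i) (D / 2), exp (-(s / 2) * ‖y - x‖ ^ 2) := by
    intro i _
    rw [← hball i, mul_comm, ← smul_eq_mul, ← setIntegral_const, ← integral_const_mul]
    refine setIntegral_mono_on ?_ (hint.const_mul _).integrableOn measurableSet_ball ?_
    · exact integrableOn_const (measure_ball_lt_top.ne)
    intro y hy
    rw [← exp_add]
    apply Real.exp_le_exp.mpr
    have hy' : ‖y - p i‖ < D / 2 := by rwa [mem_ball_iff_norm] at hy
    have h2 : ‖y - x‖ ≤ ‖y - p i‖ + ‖p i - x‖ := by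
      calc ‖y - x‖ = ‖(y - p i) + (p i - x)‖ := by congr 1; abel
        _ ≤ _ := norm_add_le _ _
    have h3 : ‖y - x‖ ^ 2 ≤ 2 * (D / 2) ^ 2 + 2 * ‖p i - x‖ ^ 2 := by
      have a1 := norm_nonneg (y - p i)
      have a2 := norm_nonneg (p i - x)
      have a3 := norm_nonneg (y - x)
      nlinarith [sq_nonneg (‖y - p i‖ - ‖p i - x‖)]
    nlinarith [mul_le_mul_of_nonneg_left h3 hs.le, mul_pos hs (sq_pos_of_pos hD)]
  have hdisj : Pairwise (Function.onFun Disjoint fun i => Metric.ball (p i) (D / 2)) := by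
    intro i j hij
    apply Metric.ball_disjoint_ball
    linarith [hsep i j hij]
  have h2 : ∑ i ∈ F, ∫ y in Metric.ball (p i) (D / 2), exp (-(s / 2) * ‖y - x‖ ^ 2) ≤
      (√π / √(s / 2)) ^ n := by
    rw [← integral_biUnion_finset F (fun i _ => measurableSet_ball)
      (fun i _ j _ hij => hdisj hij) (fun i _ => hint.integrableOn),
      ← integral_exp_neg_mul_sq (by positivity : 0 < s / 2) x]
    exact setIntegral_le_integral hint (.of_forall fun y => (exp_pos _).le)
  have h3 : (∑ i ∈ F, exp (-s * ‖p i - x‖ ^ 2)) * ((D / 2) ^ n * v) ≤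
      exp (s * D ^ 2) * (√π / √(s / 2)) ^ n := by
    rw [sum_mul]
    refine (sum_le_sum h1).trans ?_
    rw [← mul_sum]
    exact mul_le_mul_of_nonneg_left h2 (exp_pos _).le
  rw [← le_div_iff₀ (by positivity)] at h3
  refine h3.trans (le_of_eq ?_)
  have hs2 : √(s / 2) = √s / √2 := Real.sqrt_div hs.le 2
  have h4 : √(2 * π) = √2 * √π := sqrt_mul (by norm_num) _
  have hss : 0 < √s := Real.sqrt_pos.mpr hs
  rw [hs2, h4]
  simp only [div_pow, mul_pow, inv_pow]
  field_simp

/-- The smallest value of `μ|x-z|² + l₁|x-x₁|² + l₂|x-x₂|²`, attained at the barycentre. -/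
def baryVar {n : ℕ} (μ l₁ l₂ : ℝ) (z x₁ x₂ : Rn n) : ℝ :=
  let b := (μ + l₁ + l₂)⁻¹ • (μ • z + l₁ • x₁ + l₂ • x₂)
  μ * ‖b - z‖ ^ 2 + l₁ * ‖b - x₁‖ ^ 2 + l₂ * ‖b - x₂‖ ^ 2

lemma sum_sq_eq_baryVar {n : ℕ} {μ l₁ l₂ : ℝ} (h : 0 < μ + l₁ + l₂) (z x₁ x₂ x : Rn n) :
    μ * ‖x - z‖ ^ 2 + l₁ * ‖x - x₁‖ ^ 2 + l₂ * ‖x - x₂‖ ^ 2 =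
      (μ + l₁ + l₂) * ‖x - (μ + l₁ + l₂)⁻¹ • (μ • z + l₁ • x₁ + l₂ • x₂)‖ ^ 2 +
        baryVar μ l₁ l₂ z x₁ x₂ := by
  set b := (μ + l₁ + l₂)⁻¹ • (μ • z + l₁ • x₁ + l₂ • x₂) with hb
  have e : ∀ w : Rn n, ‖x - w‖ ^ 2 = ‖x - b‖ ^ 2 + 2 * inner ℝ (x - b) (b - w) + ‖b - w‖ ^ 2 := by
    intro w
    rw [← norm_add_sq_real]
    congr 2
    abel
  have h0 : μ • (b - z) + l₁ • (b - x₁) + l₂ • (b - x₂) = 0 := by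
    have : (μ + l₁ + l₂) • b = μ • z + l₁ • x₁ + l₂ • x₂ := by
      rw [hb, smul_smul, mul_inv_cancel₀ h.ne', one_smul]
    rw [smul_sub, smul_sub, smul_sub]
    have h2 : μ • b + l₁ • b + l₂ • b = μ • z + l₁ • x₁ + l₂ • x₂ := by
      rw [← this, add_smul, add_smul]
    rw [← sub_eq_zero] at h2
    rw [← h2]
    abel
  have h1 : μ * inner ℝ (x - b) (b - z) + l₁ * inner ℝ (x - b) (b - x₁) +
      l₂ * inner ℝ (x - b) (b - x₂) = 0 := by
    rw [← real_inner_smul_right, ← real_inner_smul_right, ← real_inner_smul_right,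
      ← inner_add_right, ← inner_add_right, h0, inner_zero_right]
  simp only [baryVar]
  rw [← hb, e z, e x₁, e x₂]
  linear_combination 2 * h1

lemma le_baryVar {n : ℕ} {μ l₁ l₂ m : ℝ} (hm : 0 ≤ m) (hμ : m ≤ μ) (h₁ : m ≤ l₁) (h₂ : m ≤ l₂)
    (z x₁ x₂ : Rn n) :
    m / 4 * (‖z - x₁‖ ^ 2 + ‖z - x₂‖ ^ 2) ≤ baryVar μ l₁ l₂ z x₁ x₂ := by
  simp only [baryVar]
  set b := (μ + l₁ + l₂)⁻¹ • (μ • z + l₁ • x₁ + l₂ • x₂)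
  have tri : ∀ u w : Rn n, ‖u - w‖ ^ 2 ≤ 2 * ‖b - u‖ ^ 2 + 2 * ‖b - w‖ ^ 2 := by
    intro u w
    have : ‖u - w‖ ≤ ‖b - u‖ + ‖b - w‖ := by
      calc ‖u - w‖ = ‖(b - w) - (b - u)‖ := by congr 1; abel
        _ ≤ ‖b - w‖ + ‖b - u‖ := norm_sub_le _ _
        _ = _ := add_comm _ _
    nlinarith [norm_nonneg (u - w), sq_nonneg (‖b - u‖ - ‖b - w‖)]
  have t1 := tri z x₁
  have t2 := tri z x₂
  have p0 := sq_nonneg ‖b - z‖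
  have p1 := sq_nonneg ‖b - x₁‖
  have p2 := sq_nonneg ‖b - x₂‖
  nlinarith [mul_le_mul_of_nonneg_left t1 hm, mul_le_mul_of_nonneg_left t2 hm,
    mul_le_mul_of_nonneg_right hμ p0, mul_le_mul_of_nonneg_right h₁ p1,
    mul_le_mul_of_nonneg_right h₂ p2]

lemma le_baryVar_zero {n : ℕ} {l₁ l₂ m : ℝ} (hm : 0 ≤ m) (h₁ : m ≤ l₁) (h₂ : m ≤ l₂)
    (z x₁ x₂ : Rn n) :
    m / 2 * ‖x₁ - x₂‖ ^ 2 ≤ baryVar 0 l₁ l₂ z x₁ x₂ := by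
  simp only [baryVar]
  set b := (0 + l₁ + l₂)⁻¹ • ((0 : ℝ) • z + l₁ • x₁ + l₂ • x₂)
  have tri : ‖x₁ - x₂‖ ^ 2 ≤ 2 * ‖b - x₁‖ ^ 2 + 2 * ‖b - x₂‖ ^ 2 := by
    have : ‖x₁ - x₂‖ ≤ ‖b - x₁‖ + ‖b - x₂‖ := by
      calc ‖x₁ - x₂‖ = ‖(b - x₂) - (b - x₁)‖ := by congr 1; abel
        _ ≤ ‖b - x₂‖ + ‖b - x₁‖ := norm_sub_le _ _
        _ = _ := add_comm _ _
    nlinarith [norm_nonneg (x₁ - x₂), sq_nonneg (‖b - x₁‖ - ‖b - x₂‖)]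
  nlinarith [mul_le_mul_of_nonneg_left tri hm, mul_le_mul_of_nonneg_right h₁ (sq_nonneg ‖b - x₁‖),
    mul_le_mul_of_nonneg_right h₂ (sq_nonneg ‖b - x₂‖)]

lemma rpow_half_eq {n : ℕ} {x : ℝ} (hx : 0 ≤ x) : x ^ ((n : ℝ) / 2) = √x ^ n := by
  rw [Real.sqrt_eq_rpow, ← rpow_natCast, ← rpow_mul hx]
  congr 1
  ring

lemma norm_integral_gauss {n : ℕ} {Λ : ℝ} (hΛ : 0 < Λ) (b w : Rn n) :
    ‖∫ x : Rn n, Complex.exp (((-Λ * ‖x - b‖ ^ 2 : ℝ) : ℂ) +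
      I * ((inner ℝ w x : ℝ) : ℂ))‖ =
      √(π / Λ) ^ n * exp (-‖w‖ ^ 2 / (4 * Λ)) := by
  have e1 : ∀ x : Rn n, Complex.exp (((-Λ * ‖x - b‖ ^ 2 : ℝ) : ℂ) +
      I * ((inner ℝ w x : ℝ) : ℂ)) = Complex.exp (I * ((inner ℝ w b : ℝ) : ℂ)) *
      Complex.exp (-(Λ : ℂ) * (‖x - b‖ : ℂ) ^ 2 + I * ((inner ℝ w (x - b) : ℝ) : ℂ)) := by
    intro x
    rw [← Complex.exp_add]
    congr 1
    rw [inner_sub_right]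
    push_cast
    ring
  simp_rw [e1]
  rw [integral_const_mul, norm_mul,
    integral_sub_right_eq_self (fun x : Rn n => Complex.exp (-(Λ : ℂ) * (‖x‖ : ℂ) ^ 2 +
      I * ((inner ℝ w x : ℝ) : ℂ))) b,
    GaussianFourier.integral_cexp_neg_mul_sq_norm_add (by simpa using hΛ), norm_mul,
    Complex.norm_exp, Complex.norm_exp, ← rpow_half_eq (by positivity)]
  have h1 : (I * ((inner ℝ w b : ℝ) : ℂ)).re = 0 := by simp
  have h2 : (I ^ 2 * (‖w‖ : ℂ) ^ 2 / (4 * (Λ : ℂ))) = ((-‖w‖ ^ 2 / (4 * Λ) : ℝ) : ℂ) := by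
    rw [Complex.I_sq]
    push_cast
    ring
  rw [h1, h2, Complex.ofReal_re, Real.exp_zero, one_mul]
  congr 1
  have h3 : (π : ℂ) / (Λ : ℂ) = ((π / Λ : ℝ) : ℂ) := by push_cast; ring
  rw [h3, Complex.norm_cpow_eq_rpow_re_of_pos (by positivity)]
  congr 1
  simp

/-- The overlap of two frame Gaussians, localized near `z` by a Gaussian weight. -/
lemma norm_integral_gaussian_mul {n : ℕ} {μ δ δ' : ℝ} (hμ : 0 ≤ μ) (hδ : 0 ≤ δ) (hδ' : 0 ≤ δ')
    {η η' : Rn n} (hη : η ≠ 0) (z y y' : Rn n) :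
    ‖∫ x, (exp (-μ * ‖x - z‖ ^ 2) : ℂ) * (conj (gaussian δ y η x) * gaussian δ' y' η' x)‖ =
      √(‖η‖ * δ / (2 * π)) ^ n * √(‖η'‖ * δ' / (2 * π)) ^ n *
      (√(π / (μ + ‖η‖ + ‖η'‖)) ^ n * exp (-‖η' - η‖ ^ 2 / (4 * (μ + ‖η‖ + ‖η'‖)))) *
        exp (-baryVar μ ‖η‖ ‖η'‖ z y y') := by
  have hη0 : 0 < ‖η‖ := norm_pos_iff.mpr hη
  have hη1 : 0 ≤ ‖η'‖ := norm_nonneg _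
  have hΛ : 0 < μ + ‖η‖ + ‖η'‖ := by positivity
  set b := (μ + ‖η‖ + ‖η'‖)⁻¹ • (μ • z + ‖η‖ • y + ‖η'‖ • y') with hb
  have e : ∀ x, (exp (-μ * ‖x - z‖ ^ 2) : ℂ) * (conj (gaussian δ y η x) *
      gaussian δ' y' η' x) = ((√(‖η‖ * δ / (2 * π)) ^ n * √(‖η'‖ * δ' / (2 * π)) ^ n *
        exp (-baryVar μ ‖η‖ ‖η'‖ z y y') : ℝ) : ℂ) *
        Complex.exp (I * ((inner ℝ η y - inner ℝ η' y' : ℝ) : ℂ)) *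
        Complex.exp (((-(μ + ‖η‖ + ‖η'‖) * ‖x - b‖ ^ 2 : ℝ) : ℂ) +
          I * ((inner ℝ (η' - η) x : ℝ) : ℂ)) := by
    intro x
    simp only [gaussian]
    rw [rpow_half_eq (by positivity), rpow_half_eq (by positivity)]
    rw [map_mul, Complex.conj_ofReal, ← Complex.exp_conj, map_sub, map_mul, Complex.conj_ofReal,
      Complex.conj_ofReal, Complex.conj_I]
    have h1 := sum_sq_eq_baryVar hΛ z y y' x
    rw [← hb] at h1
    push_cast
    have h2 : Complex.exp (-(μ : ℂ) * (‖x - z‖ : ℂ) ^ 2) *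
        (Complex.exp (-I * (inner ℝ η (x - y) : ℂ) - ‖η‖ * (‖x - y‖ : ℂ) ^ 2) *
          Complex.exp (I * (inner ℝ η' (x - y') : ℂ) - ‖η'‖ * (‖x - y'‖ : ℂ) ^ 2)) =
        Complex.exp (-(baryVar μ ‖η‖ ‖η'‖ z y y' : ℂ)) *
        Complex.exp (I * ((inner ℝ η y : ℂ) - (inner ℝ η' y' : ℂ))) *
        Complex.exp (-((μ : ℂ) + ‖η‖ + ‖η'‖) * (‖x - b‖ : ℂ) ^ 2 +
          I * (inner ℝ (η' - η) x : ℂ)) := by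
      simp only [← Complex.exp_add]
      congr 1
      have h3 : (μ : ℂ) * (‖x - z‖ : ℂ) ^ 2 + ‖η‖ * (‖x - y‖ : ℂ) ^ 2 + ‖η'‖ * (‖x - y'‖ : ℂ) ^ 2 =
          ((μ : ℂ) + ‖η‖ + ‖η'‖) * (‖x - b‖ : ℂ) ^ 2 + (baryVar μ ‖η‖ ‖η'‖ z y y' : ℂ) := by
        exact_mod_cast h1
      rw [inner_sub_left, inner_sub_right, inner_sub_right]
      push_cast
      linear_combination -h3
    linear_combination ((√(‖η‖ * δ / (2 * π)) : ℂ) ^ n *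
      (√(‖η'‖ * δ' / (2 * π)) : ℂ) ^ n) * h2
  simp_rw [e]
  rw [integral_const_mul, norm_mul, norm_integral_gauss hΛ, norm_mul, Complex.norm_exp,
    norm_real, norm_of_nonneg (by positivity)]
  have : (I * ((inner ℝ η y - inner ℝ η' y' : ℝ) : ℂ)).re = 0 := by simp
  rw [this, Real.exp_zero]
  ring

/-! ### The Hamiltonian vector field -/

/-- The quadratic form `∑ m_ij ξ_i ξ_j`. -/
def quadForm {n : ℕ} (m : Matrix (Fin n) (Fin n) ℝ) (ξ : Rn n) : ℝ := ∑ i, ∑ j, m i j * ξ i * ξ j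

/-- The vector `m ξ`. -/
def matVec {n : ℕ} (m : Matrix (Fin n) (Fin n) ℝ) (ξ : Rn n) : Rn n :=
  ∑ i, ∑ j, (m i j * ξ j) • single i (1 : ℝ)

/-- The vector `∑ ξ_i ξ_j G_ij`, for a matrix `G` of vectors. -/
def gradForm {n : ℕ} (G : Fin n → Fin n → Rn n) (ξ : Rn n) : Rn n :=
  ∑ i, ∑ j, (ξ i * ξ j) • G i j

/-- The matrix of the gradients of the coefficients. -/
def gradCoeff {n : ℕ} (a : ℝ → Rn n → Matrix (Fin n) (Fin n) ℝ) (t : ℝ) (x : Rn n)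
    (i j : Fin n) : Rn n := gradient (fun z => a t z i j) x

/-- Quantitative form of the hypotheses on the coefficients, with a single constant. -/
structure WaveBound {n : ℕ} (T : ℝ) (a : ℝ → Rn n → Matrix (Fin n) (Fin n) ℝ) (K : ℝ) : Prop where
  one_le : 1 ≤ K
  symm : ∀ t ∈ Icc (-T) T, ∀ x i j, a t x i j = a t x j i
  lower : ∀ t ∈ Icc (-T) T, ∀ x ξ : Rn n, ‖ξ‖ ^ 2 ≤ K * quadForm (a t x) ξ
  upper : ∀ t ∈ Icc (-T) T, ∀ x ξ : Rn n, quadForm (a t x) ξ ≤ K * ‖ξ‖ ^ 2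
  entry : ∀ t ∈ Icc (-T) T, ∀ x i j, |a t x i j| ≤ K
  lipschitz : ∀ t ∈ Icc (-T) T, ∀ s ∈ Icc (-T) T, ∀ x y : Rn n, ∀ i j,
    |a t x i j - a s y i j| ≤ K * (|t - s| + ‖x - y‖)
  differentiable : ∀ t ∈ Icc (-T) T, ∀ i j, Differentiable ℝ fun x => a t x i j
  grad : ∀ t ∈ Icc (-T) T, ∀ x i j, ‖gradCoeff a t x i j‖ ≤ K
  grad_lipschitz : ∀ t ∈ Icc (-T) T, ∀ x y : Rn n, ∀ i j,
    ‖gradCoeff a t x i j - gradCoeff a t y i j‖ ≤ K * ‖x - y‖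

lemma inner_gradient {n : ℕ} {g : Rn n → ℝ} {x : Rn n} (v : Rn n) :
    inner ℝ (gradient g x) v = fderiv ℝ g x v := by
  rw [gradient, InnerProductSpace.toDual_symm_apply]

lemma norm_gradient_eq {n : ℕ} (g : Rn n → ℝ) (x : Rn n) : ‖gradient g x‖ = ‖fderiv ℝ g x‖ := by
  rw [gradient, LinearIsometryEquiv.norm_map]

lemma norm_gradient_sub {n : ℕ} (g h : Rn n → ℝ) (x y : Rn n) :
    ‖gradient g x - gradient h y‖ = ‖fderiv ℝ g x - fderiv ℝ h y‖ := by
  rw [gradient, gradient, ← map_sub, LinearIsometryEquiv.norm_map]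

/-- All the bounds on the coefficients with one constant. -/
lemma IsWaveCoefficient.exists_waveBound {n : ℕ} {T : ℝ}
    {a : ℝ → Rn n → Matrix (Fin n) (Fin n) ℝ} (ha : IsWaveCoefficient T a) :
    ∃ K, WaveBound T a K := by
  obtain ⟨C₁, hC₁, h₁⟩ := ha.elliptic
  obtain ⟨C₂, h₂⟩ := ha.lipschitz
  obtain ⟨C₃, h₃⟩ := ha.grad_lipschitz
  have hsymm : ∀ t ∈ Icc (-T) T, ∀ x i j, a t x i j = a t x j i := fun t ht x i j =>
    ((ha.symm t ht x).apply i j).symm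
  set K := max 1 (max C₁ (max C₂ C₃)) with hK
  have k1 : 1 ≤ K := le_max_left _ _
  have k2 : C₁ ≤ K := (le_max_left _ _).trans (le_max_right _ _)
  have k3 : C₂ ≤ K := ((le_max_left _ _).trans (le_max_right _ _)).trans (le_max_right _ _)
  have k4 : C₃ ≤ K := ((le_max_right _ _).trans (le_max_right _ _)).trans (le_max_right _ _)
  have hup : ∀ t ∈ Icc (-T) T, ∀ x ξ : Rn n, quadForm (a t x) ξ ≤ K * ‖ξ‖ ^ 2 :=
    fun t ht x ξ => ((h₁ t ht x ξ).2).trans (by gcongr)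
  have hlow : ∀ t ∈ Icc (-T) T, ∀ x ξ : Rn n, ‖ξ‖ ^ 2 ≤ K * quadForm (a t x) ξ := by
    intro t ht x ξ
    have h := (h₁ t ht x ξ).1
    rw [div_le_iff₀ hC₁] at h
    have h0 : 0 ≤ quadForm (a t x) ξ := le_trans (by positivity) (h₁ t ht x ξ).1
    calc ‖ξ‖ ^ 2 ≤ quadForm (a t x) ξ * C₁ := h
      _ ≤ quadForm (a t x) ξ * K := by gcongr
      _ = _ := mul_comm _ _
  have hlip : ∀ t ∈ Icc (-T) T, ∀ s ∈ Icc (-T) T, ∀ x y : Rn n, ∀ i j,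
      |a t x i j - a s y i j| ≤ K * (|t - s| + ‖x - y‖) :=
    fun t ht s hs x y i j => (h₂ t ht s hs x y i j).trans (by gcongr)
  refine ⟨K, k1, hsymm, hlow, hup, ?_, hlip, ha.differentiable, ?_, ?_⟩
  · intro t ht x i j
    have hq : ∀ (σ : ℝ), quadForm (a t x) (single i 1 + σ • single j 1)
        = a t x i i + σ * (2 * a t x i j) + σ ^ 2 * a t x j j := by
      intro σ
      have e : ∀ (k : Fin n), (single i (1 : ℝ) + σ • single j (1 : ℝ)
          : Rn n) k = (if k = i then 1 else 0) + σ * (if k = j then 1 else 0) := by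
        intro k
        simp
      simp only [quadForm, e, mul_add, add_mul, sum_add_distrib, mul_ite, mul_one, mul_zero,
        ite_mul, zero_mul, Finset.sum_ite_eq', Finset.mem_univ, if_true]
      rw [hsymm t ht x j i]
      ring
    have hpos : ∀ ξ, 0 ≤ quadForm (a t x) ξ := fun ξ => by
      have := hlow t ht x ξ
      have h2 : 0 ≤ K * quadForm (a t x) ξ := le_trans (sq_nonneg _) this
      exact nonneg_of_mul_nonneg_right h2 (by linarith)
    have hs : ∀ k : Fin n, a t x k k ≤ K := by
      intro k
      have h := hup t ht x (single k 1)
      have e : quadForm (a t x) (single k 1) = a t x k k := by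
        simp [quadForm]
      rw [e] at h
      simpa using h
    have hp := hpos (single i 1 + (1 : ℝ) • single j 1)
    have hm := hpos (single i 1 + (-1 : ℝ) • single j 1)
    rw [hq] at hp hm
    have := hs i
    have := hs j
    rw [abs_le]
    constructor <;> linarith
  · intro t ht x i j
    rw [gradCoeff, norm_gradient_eq]
    refine norm_fderiv_le_of_lipschitz ℝ (C := ⟨K, by linarith⟩) ?_
    refine LipschitzWith.of_dist_le_mul fun y z => ?_
    rw [Real.dist_eq, dist_eq_norm]
    have := hlip t ht t ht y z i j
    rw [sub_self, abs_zero, zero_add] at this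
    exact this
  · exact fun t ht x y i j => (h₃ t ht x y i j).trans (by gcongr)

/-- Taylor's formula of first order, for a function with a Lipschitz gradient. -/
lemma abs_sub_taylor_le {n : ℕ} {g : Rn n → ℝ} {K : ℝ} (hg : Differentiable ℝ g)
    (hK : ∀ x y, ‖gradient g x - gradient g y‖ ≤ K * ‖x - y‖) (hK0 : 0 ≤ K) (x y : Rn n) :
    |g y - g x - inner ℝ (gradient g x) (y - x)| ≤ K * ‖y - x‖ ^ 2 := by
  rw [inner_gradient, ← norm_eq_abs]
  have := (convex_closedBall x ‖y - x‖).norm_image_sub_le_of_norm_fderiv_le' (𝕜 := ℝ)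
    (f := g) (φ := fderiv ℝ g x) (C := K * ‖y - x‖) (x := x) (y := y)
    (fun z _ => hg z) ?_ (Metric.mem_closedBall_self (norm_nonneg _)) ?_
  · rw [pow_two, ← mul_assoc]
    exact this
  · intro z hz
    rw [← norm_gradient_sub]
    refine (hK z x).trans ?_
    rw [mem_closedBall_iff_norm] at hz
    gcongr
  · rw [mem_closedBall_iff_norm]

lemma WaveBound.taylor {n : ℕ} {T K : ℝ} {a : ℝ → Rn n → Matrix (Fin n) (Fin n) ℝ}
    (ha : WaveBound T a K) {t : ℝ} (ht : t ∈ Icc (-T) T) (i j : Fin n) (x y : Rn n) :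
    |a t y i j - a t x i j - inner ℝ (gradCoeff a t x i j) (y - x)| ≤ K * ‖y - x‖ ^ 2 :=
  abs_sub_taylor_le (ha.differentiable t ht i j) (fun x y => ha.grad_lipschitz t ht x y i j)
    (by linarith [ha.one_le]) x y

/-- The gradient of the coefficients is Hölder continuous in time, by interpolation between the
Lipschitz bounds in `t` and in `x`. -/
lemma WaveBound.grad_holder {n : ℕ} {T K : ℝ} {a : ℝ → Rn n → Matrix (Fin n) (Fin n) ℝ}
    (ha : WaveBound T a K) {t s : ℝ} (ht : t ∈ Icc (-T) T) (hs : s ∈ Icc (-T) T) (i j : Fin n)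
    (x : Rn n) : ‖gradCoeff a t x i j - gradCoeff a s x i j‖ ^ 2 ≤ 16 * K ^ 2 * |t - s| := by
  have hK := ha.one_le
  set w := gradCoeff a t x i j - gradCoeff a s x i j with hw
  set h : ℝ := 1 / (4 * K) with hh
  have h0 : 0 < h := by positivity
  have t1 := abs_le.mp (ha.taylor ht i j x (x + h • w))
  have t2 := abs_le.mp (ha.taylor hs i j x (x + h • w))
  have l1 := abs_le.mp (ha.lipschitz t ht s hs (x + h • w) (x + h • w) i j)
  have l2 := abs_le.mp (ha.lipschitz t ht s hs x x i j)
  simp only [add_sub_cancel_left, sub_self, norm_zero, add_zero] at t1 t2 l1 l2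
  have e : inner ℝ (gradCoeff a t x i j) (h • w) - inner ℝ (gradCoeff a s x i j) (h • w) =
      h * ‖w‖ ^ 2 := by
    rw [← inner_sub_left, ← hw, real_inner_smul_right, real_inner_self_eq_norm_sq]
  have e2 : ‖h • w‖ ^ 2 = h ^ 2 * ‖w‖ ^ 2 := by
    rw [norm_smul, mul_pow, norm_eq_abs, sq_abs]
  rw [e2] at t1 t2
  have e3 : 4 * K * h = 1 := by rw [hh]; field_simp
  have key : h * ‖w‖ ^ 2 ≤ 2 * K * |t - s| + 2 * K * (h ^ 2 * ‖w‖ ^ 2) := by linarith [t1.1, t2.2, l1.2, l2.1]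
  have e4 : 2 * K * (h ^ 2 * ‖w‖ ^ 2) = h * ‖w‖ ^ 2 / 2 := by linear_combination (h * ‖w‖ ^ 2 / 2) * e3
  rw [e4] at key
  have : h * ‖w‖ ^ 2 ≤ 4 * K * |t - s| := by linarith
  have := mul_le_mul_of_nonneg_left this (by positivity : 0 ≤ 4 * K)
  calc ‖w‖ ^ 2 = 4 * K * (h * ‖w‖ ^ 2) := by linear_combination (-‖w‖ ^ 2) * e3
    _ ≤ _ := this
    _ = _ := by ring

lemma abs_coord_le {n : ℕ} (x : Rn n) (i : Fin n) : |x i| ≤ ‖x‖ := by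
  simpa using PiLp.norm_apply_le x i

lemma inner_eq_sum {n : ℕ} (x y : Rn n) : inner ℝ x y = ∑ i, x i * y i := by
  simp [PiLp.inner_apply, mul_comm]

lemma inner_matVec {n : ℕ} (m : Matrix (Fin n) (Fin n) ℝ) (ξ v : Rn n) :
    inner ℝ (matVec m ξ) v = ∑ i, ∑ j, m i j * ξ j * v i := by
  simp only [matVec, sum_inner, real_inner_smul_left, EuclideanSpace.inner_single_left]
  simp

lemma inner_gradForm {n : ℕ} (G : Fin n → Fin n → Rn n) (ξ v : Rn n) :
    inner ℝ (gradForm G ξ) v = ∑ i, ∑ j, ξ i * ξ j * inner ℝ (G i j) v := by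
  simp only [gradForm, sum_inner, real_inner_smul_left]

lemma q_eq {n : ℕ} (a : ℝ → Rn n → Matrix (Fin n) (Fin n) ℝ) (t : ℝ) (x ξ : Rn n) :
    q a t x ξ = √(quadForm (a t x) ξ) := rfl

lemma WaveBound.quadForm_pos {n : ℕ} {T K : ℝ} {a : ℝ → Rn n → Matrix (Fin n) (Fin n) ℝ}
    (ha : WaveBound T a K) {t : ℝ} (ht : t ∈ Icc (-T) T) (x : Rn n) {ξ : Rn n} (hξ : ξ ≠ 0) :
    0 < quadForm (a t x) ξ := by
  have h := ha.lower t ht x ξ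
  have h2 : 0 < ‖ξ‖ := norm_pos_iff.mpr hξ
  have h3 : 0 < K * quadForm (a t x) ξ := lt_of_lt_of_le (by positivity) h
  exact pos_of_mul_pos_right h3 (by linarith [ha.one_le])

lemma WaveBound.gradient_q_freq {n : ℕ} {T K : ℝ} {a : ℝ → Rn n → Matrix (Fin n) (Fin n) ℝ}
    (ha : WaveBound T a K) {t : ℝ} (ht : t ∈ Icc (-T) T) (x : Rn n) {ξ : Rn n} (hξ : ξ ≠ 0) :
    gradient (fun ζ => q a t x ζ) ξ = (1 / q a t x ξ) • matVec (a t x) ξ := by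
  have hq := ha.quadForm_pos ht x hξ
  refine HasGradientAt.gradient ?_
  rw [hasGradientAt_iff_hasFDerivAt]
  have h1 : HasFDerivAt (fun ζ : Rn n => quadForm (a t x) ζ)
      (∑ i, ∑ j, ((a t x i j * ξ i) • (EuclideanSpace.proj j : Rn n →L[ℝ] ℝ) +
        (ξ j) • (a t x i j • (EuclideanSpace.proj i : Rn n →L[ℝ] ℝ)))) ξ := by
    unfold quadForm
    refine HasFDerivAt.fun_sum fun i _ => HasFDerivAt.fun_sum fun j _ => ?_
    have hi : HasFDerivAt (fun ζ : Rn n => ζ i) (EuclideanSpace.proj i : Rn n →L[ℝ] ℝ) ξ :=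
      (EuclideanSpace.proj i : Rn n →L[ℝ] ℝ).hasFDerivAt
    have hj : HasFDerivAt (fun ζ : Rn n => ζ j) (EuclideanSpace.proj j : Rn n →L[ℝ] ℝ) ξ :=
      (EuclideanSpace.proj j : Rn n →L[ℝ] ℝ).hasFDerivAt
    exact (hi.const_mul (a t x i j)).mul hj
  have h2 := h1.sqrt hq.ne'
  refine h2.congr_fderiv ?_
  ext v
  have hp : ∀ i, (EuclideanSpace.proj i : Rn n →L[ℝ] ℝ) v = v i := fun _ => rfl
  rw [InnerProductSpace.toDual_apply_apply, real_inner_smul_left, inner_matVec, q_eq]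
  simp only [FunLike.coe_smul, Pi.smul_apply, smul_eq_mul, FunLike.coe_sum,
    Finset.sum_apply, FunLike.coe_add, Pi.add_apply, hp,
    sum_add_distrib]
  have e : ∑ i, ∑ j, a t x i j * ξ i * v j = ∑ i, ∑ j, a t x i j * ξ j * v i := by
    rw [Finset.sum_comm]
    refine sum_congr rfl fun i _ => sum_congr rfl fun j _ => ?_
    rw [ha.symm t ht x j i]
  have e2 : ∑ i, ∑ j, ξ j * (a t x i j * v i) = ∑ i, ∑ j, a t x i j * ξ j * v i := by
    refine sum_congr rfl fun i _ => sum_congr rfl fun j _ => ?_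
    ring
  rw [e, e2]
  have := Real.sqrt_pos.mpr hq
  field_simp
  ring

lemma WaveBound.gradient_q_pos {n : ℕ} {T K : ℝ} {a : ℝ → Rn n → Matrix (Fin n) (Fin n) ℝ}
    (ha : WaveBound T a K) {t : ℝ} (ht : t ∈ Icc (-T) T) (x : Rn n) {ξ : Rn n} (hξ : ξ ≠ 0) :
    gradient (fun z => q a t z ξ) x = (1 / (2 * q a t x ξ)) • gradForm (gradCoeff a t x) ξ := by
  have hq := ha.quadForm_pos ht x hξ
  refine HasGradientAt.gradient ?_
  rw [hasGradientAt_iff_hasFDerivAt]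
  have h1 : HasFDerivAt (fun z : Rn n => quadForm (a t z) ξ)
      (∑ i, ∑ j, (ξ j) • (ξ i • fderiv ℝ (fun z => a t z i j) x)) x := by
    unfold quadForm
    refine HasFDerivAt.fun_sum fun i _ => HasFDerivAt.fun_sum fun j _ => ?_
    exact (((ha.differentiable t ht i j) x).hasFDerivAt.mul_const (ξ i)).mul_const (ξ j)
  have h2 := h1.sqrt hq.ne'
  refine h2.congr_fderiv ?_
  ext v
  rw [InnerProductSpace.toDual_apply_apply, real_inner_smul_left, inner_gradForm, q_eq]
  simp only [FunLike.coe_smul, Pi.smul_apply, smul_eq_mul, FunLike.coe_sum,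
    Finset.sum_apply, gradCoeff, inner_gradient]
  congr 1
  refine sum_congr rfl fun i _ => sum_congr rfl fun j _ => ?_
  ring

section

/-! ### Lipschitz bounds for the Hamiltonian field -/

/-- `u` and `v` are bounded by `C`, and `C d`-close. -/
structure Close {E : Type*} [NormedAddCommGroup E] (d C : ℝ) (u v : E) : Prop where
  left : ‖u‖ ≤ C
  right : ‖v‖ ≤ C
  sub : ‖u - v‖ ≤ C * d

namespace Close

variable {E : Type*} [NormedAddCommGroup E]

lemma nonneg {d C : ℝ} {u v : E} (h : Close d C u v) : 0 ≤ C := (norm_nonneg _).trans h.left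

lemma mono {d C C' : ℝ} {u v : E} (h : Close d C u v) (hC : C ≤ C') (hd : 0 ≤ d) :
    Close d C' u v :=
  ⟨h.left.trans hC, h.right.trans hC, h.sub.trans (by gcongr)⟩

lemma smul [NormedSpace ℝ E] {d C C' : ℝ} {s t : ℝ} {u v : E} (hs : Close d C s t)
    (hu : Close d C' u v) :
    Close d (2 * C * C') (s • u) (t • v) := by
  have h0 := hs.nonneg
  have h1 := hu.nonneg
  refine ⟨?_, ?_, ?_⟩
  · rw [norm_smul]
    nlinarith [mul_le_mul hs.left hu.left (norm_nonneg _) h0, mul_nonneg h0 h1]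
  · rw [norm_smul]
    nlinarith [mul_le_mul hs.right hu.right (norm_nonneg _) h0, mul_nonneg h0 h1]
  · have e : s • u - t • v = s • (u - v) + (s - t) • v := by
      rw [smul_sub, sub_smul]; abel
    rw [e]
    refine (norm_add_le _ _).trans ?_
    rw [norm_smul, norm_smul]
    have a1 := mul_le_mul hs.left hu.sub (norm_nonneg _) h0
    have a2 := mul_le_mul hs.sub hu.right (norm_nonneg _) ((norm_nonneg _).trans hs.sub)
    linarith

lemma sum {n : ℕ} {d C : ℝ} {u v : Fin n → E} (h : ∀ i, Close d C (u i) (v i)) :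
    Close d (n * C) (∑ i, u i) (∑ i, v i) := by
  have hc : ∀ f : Fin n → E, ∀ D, (∀ i, ‖f i‖ ≤ D) → ‖∑ i, f i‖ ≤ n * D := by
    intro f D hf
    refine (norm_sum_le _ _).trans ((sum_le_sum fun i _ => hf i).trans ?_)
    simp
  refine ⟨hc _ _ fun i => (h i).left, hc _ _ fun i => (h i).right, ?_⟩
  rw [← Finset.sum_sub_distrib, mul_assoc]
  exact hc _ _ fun i => (h i).sub

lemma const {d : ℝ} (hd : 0 ≤ d) (u : E) : Close d ‖u‖ u u :=
  ⟨le_rfl, le_rfl, by rw [sub_self, norm_zero]; positivity⟩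

lemma inv_max_sqrt {d C ρ : ℝ} (hρ : 0 < ρ) {u v : ℝ} (h : Close d C u v) (hd : 0 ≤ d) :
    Close d (1 / ρ + C / ρ ^ 3) (1 / max (√u) ρ) (1 / max (√v) ρ) := by
  have key : ∀ w : ℝ, |1 / max (√w) ρ| ≤ 1 / ρ := by
    intro w
    rw [abs_of_nonneg (by positivity)]
    exact one_div_le_one_div_of_le hρ (le_max_right _ _)
  have hC := h.nonneg
  have hle : 1 / ρ ≤ 1 / ρ + C / ρ ^ 3 := by
    have : 0 ≤ C / ρ ^ 3 := by positivity
    linarith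
  refine ⟨(key u).trans hle, (key v).trans hle, ?_⟩
  have e : ∀ w, max (√w) ρ = √(max w (ρ ^ 2)) := by
    intro w
    rcases le_total w (ρ ^ 2) with hw | hw
    · rw [max_eq_right hw, Real.sqrt_sq hρ.le, max_eq_right]
      exact Real.sqrt_le_iff.mpr ⟨hρ.le, hw⟩
    · rw [max_eq_left hw, max_eq_left]
      exact Real.le_sqrt_of_sq_le hw
  set U := max (√u) ρ with hU
  set V := max (√v) ρ with hV
  have hU0 : ρ ≤ U := le_max_right _ _
  have hV0 : ρ ≤ V := le_max_right _ _
  have hU2 : U ^ 2 = max u (ρ ^ 2) := by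
    rw [hU, e, sq_sqrt (le_max_of_le_right (by positivity))]
  have hV2 : V ^ 2 = max v (ρ ^ 2) := by
    rw [hV, e, sq_sqrt (le_max_of_le_right (by positivity))]
  have h1 : |U ^ 2 - V ^ 2| ≤ C * d := by
    rw [hU2, hV2]
    exact (abs_max_sub_max_le_abs _ _ _).trans h.sub
  have hUp : 0 < U := hρ.trans_le hU0
  have hVp : 0 < V := hρ.trans_le hV0
  have h2 : |U - V| * ρ ≤ C * d := by
    calc |U - V| * ρ ≤ |U - V| * (U + V) := by gcongr; linarith
      _ = |U ^ 2 - V ^ 2| := by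
        have e3 : U ^ 2 - V ^ 2 = (U - V) * (U + V) := by ring
        rw [e3, abs_mul, abs_of_pos (a := U + V) (by positivity)]
      _ ≤ _ := h1
  have e2 : 1 / U - 1 / V = (V - U) / (U * V) := by field_simp
  rw [e2, norm_eq_abs, abs_div, abs_of_pos (by positivity : 0 < U * V), abs_sub_comm]
  calc |U - V| / (U * V) ≤ |U - V| / (ρ * ρ) := by gcongr
    _ ≤ (C * d / ρ) / (ρ * ρ) := by
      gcongr
      rwa [le_div_iff₀ hρ]
    _ = C / ρ ^ 3 * d := by field_simp
    _ ≤ _ := by gcongr; linarith [one_div_pos.mpr hρ]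

lemma coord {n : ℕ} {d C : ℝ} {x y : Rn n} (h : Close d C x y) (i : Fin n) :
    Close d C (x i) (y i) :=
  ⟨(abs_coord_le x i).trans h.left, (abs_coord_le y i).trans h.right,
    (abs_coord_le (x - y) i).trans h.sub⟩

end Close

/-- The position component `-m ξ / √(m ξ·ξ)` of the Hamiltonian field, with the denominator
cut off at `ρ`. -/
def fieldPos {n : ℕ} (ρ : ℝ) (m : Matrix (Fin n) (Fin n) ℝ) (ξ : Rn n) : Rn n :=
  (-1 : ℝ) • ((1 / max √(quadForm m ξ) ρ) • matVec m ξ)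

/-- The frequency component of the Hamiltonian field, with the denominator cut off at `ρ`. -/
def fieldFreq {n : ℕ} (ρ : ℝ) (m : Matrix (Fin n) (Fin n) ℝ) (G : Fin n → Fin n → Rn n)
    (ξ : Rn n) : Rn n :=
  (1 / 2 : ℝ) • ((1 / max √(quadForm m ξ) ρ) • gradForm G ξ)

/-- The Hamiltonian field is Lipschitz in the coefficients, their gradients and the frequency,
as long as these stay bounded. -/
lemma exists_close_field (n : ℕ) (K R ρ : ℝ) (hρ : 0 < ρ) :
    ∃ C, 0 ≤ C ∧ ∀ (d : ℝ) (m m' : Matrix (Fin n) (Fin n) ℝ) (ξ ξ' : Rn n), 0 ≤ d →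
      (∀ i j, Close d K (m i j) (m' i j)) → Close d R ξ ξ' →
      Close d C (fieldPos ρ m ξ) (fieldPos ρ m' ξ') ∧
      ∀ G G' : Fin n → Fin n → Rn n, (∀ i j, Close d K (G i j) (G' i j)) →
        Close d C (fieldFreq ρ m G ξ) (fieldFreq ρ m' G' ξ') := by
  set Cq : ℝ := n * (n * (2 * (2 * K * R) * R)) with hCq
  set Ci : ℝ := 1 / ρ + Cq / ρ ^ 3 with hCi
  set C1 : ℝ := 2 * ‖(-1 : ℝ)‖ * (2 * Ci * (n * (n * (2 * (2 * K * R) * 1)))) with hC1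
  set C2 : ℝ := 2 * ‖(1 / 2 : ℝ)‖ * (2 * Ci * (n * (n * (2 * (2 * R * R) * K)))) with hC2
  refine ⟨max 0 (max C1 C2), le_max_left _ _, ?_⟩
  intro d m m' ξ ξ' hd hm hξ
  have hq : Close d Cq (quadForm m ξ) (quadForm m' ξ') :=
    Close.sum fun i => Close.sum fun j => ((hm i j).smul (hξ.coord i)).smul (hξ.coord j)
  have hi : Close d Ci (1 / max √(quadForm m ξ) ρ) (1 / max √(quadForm m' ξ') ρ) :=
    hq.inv_max_sqrt hρ hd
  constructor
  · refine Close.mono (C := C1) ?_ ((le_max_left _ _).trans (le_max_right _ _)) hd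
    refine (Close.const hd _).smul (hi.smul ?_)
    refine Close.sum fun i => Close.sum fun j => ((hm i j).smul (hξ.coord j)).smul ?_
    exact (Close.const hd _).mono (by simp) hd
  · intro G G' hG
    refine Close.mono (C := C2) ?_ ((le_max_right _ _).trans (le_max_right _ _)) hd
    refine (Close.const hd _).smul (hi.smul ?_)
    exact Close.sum fun i => Close.sum fun j => ((hξ.coord i).smul (hξ.coord j)).smul (hG i j)

/-- Coordinatewise truncation at height `R`. -/
def clamp {n : ℕ} (R : ℝ) (ξ : Rn n) : Rn n := WithLp.toLp 2 fun i => max (-R) (min R (ξ i))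

lemma clamp_eq {n : ℕ} {R : ℝ} {ξ : Rn n} (h : ‖ξ‖ ≤ R) : clamp R ξ = ξ := by
  ext i
  have := abs_le.mp ((abs_coord_le ξ i).trans h)
  simp only [clamp]
  rw [min_eq_right this.2, max_eq_right this.1]

lemma norm_sq_eq_sum {n : ℕ} (x : Rn n) : ‖x‖ ^ 2 = ∑ i, x i ^ 2 := by
  rw [EuclideanSpace.norm_sq_eq]
  simp

lemma norm_le_norm_of_abs_le {n : ℕ} {x y : Rn n} (h : ∀ i, |x i| ≤ |y i|) : ‖x‖ ≤ ‖y‖ := by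
  refine le_of_sq_le_sq ?_ (norm_nonneg _)
  rw [norm_sq_eq_sum, norm_sq_eq_sum]
  exact sum_le_sum fun i _ => sq_le_sq.mpr (h i)

lemma norm_clamp_sub_le {n : ℕ} (R : ℝ) (ξ η : Rn n) : ‖clamp R ξ - clamp R η‖ ≤ ‖ξ - η‖ := by
  refine norm_le_norm_of_abs_le fun i => ?_
  simp only [clamp, PiLp.sub_apply]
  refine (abs_max_sub_max_le_max _ _ _ _).trans ?_
  rw [sub_self, abs_zero, max_eq_right (abs_nonneg _)]
  refine (abs_min_sub_min_le_max _ _ _ _).trans ?_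
  rw [sub_self, abs_zero, max_eq_right (abs_nonneg _)]

lemma norm_clamp_le {n : ℕ} {R : ℝ} (hR : 0 ≤ R) (ξ : Rn n) : ‖clamp R ξ‖ ≤ ‖ξ‖ := by
  have h := norm_clamp_sub_le R ξ 0
  rw [clamp_eq (ξ := (0 : Rn n)) (by simpa using hR), sub_zero, sub_zero] at h
  exact h

lemma norm_clamp_le' {n : ℕ} {R : ℝ} (hR : 0 ≤ R) (ξ : Rn n) : ‖clamp R ξ‖ ≤ n * R := by
  have h : ‖clamp R ξ‖ ≤ ∑ i, |clamp R ξ i| := by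
    rw [EuclideanSpace.norm_eq, Real.sqrt_le_left (sum_nonneg fun i _ => abs_nonneg _)]
    simp only [norm_eq_abs]
    exact Finset.sum_sq_le_sq_sum_of_nonneg fun i _ => abs_nonneg _
  refine h.trans ((sum_le_sum (g := fun _ => R) fun i _ => ?_).trans (by simp))
  simp only [clamp]
  rw [abs_le]
  exact ⟨le_max_left _ _, max_le (by linarith) (min_le_left _ _)⟩

/-- Gronwall's inequality, in both directions of time. -/
lemma le_exp_mul_of_abs_deriv_le {T K : ℝ} {f f' : ℝ → ℝ}
    (hf : ∀ t ∈ Icc (-T) T, HasDerivWithinAt f (f' t) (Icc (-T) T) t)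
    (hK : ∀ t ∈ Icc (-T) T, |f' t| ≤ K * f t) {s t : ℝ} (hs : s ∈ Icc (-T) T)
    (ht : t ∈ Icc (-T) T) : f s ≤ exp (K * |s - t|) * f t := by
  have hexp : ∀ (σ x : ℝ), HasDerivAt (fun x => exp (σ * x)) (exp (σ * x) * σ) x := by
    intro σ x
    simpa using ((hasDerivAt_id x).const_mul σ).exp
  have hg : ∀ σ : ℝ, ∀ x ∈ Icc (-T) T, HasDerivWithinAt (fun x => exp (σ * x) * f x)
      (exp (σ * x) * σ * f x + exp (σ * x) * f' x) (Icc (-T) T) x :=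
    fun σ x hx => (hexp σ x).hasDerivWithinAt.mul (hf x hx)
  have hmono : MonotoneOn (fun x => exp (K * x) * f x) (Icc (-T) T) := by
    refine monotoneOn_of_hasDerivWithinAt_nonneg (convex_Icc _ _)
      (fun x hx => (hg K x hx).continuousWithinAt)
      (fun x hx => (hg K x (interior_subset hx)).mono interior_subset) fun x hx => ?_
    have h1 := abs_le.mp (hK x (interior_subset hx))
    have := mul_nonneg (exp_pos (K * x)).le (by linarith [h1.1] : 0 ≤ K * f x + f' x)
    linarith
  have hanti : AntitoneOn (fun x => exp (-K * x) * f x) (Icc (-T) T) := by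
    refine antitoneOn_of_hasDerivWithinAt_nonpos (convex_Icc _ _)
      (fun x hx => (hg (-K) x hx).continuousWithinAt)
      (fun x hx => (hg (-K) x (interior_subset hx)).mono interior_subset) fun x hx => ?_
    have h1 := abs_le.mp (hK x (interior_subset hx))
    have := mul_nonneg (exp_pos (-K * x)).le (by linarith [h1.2] : 0 ≤ K * f x - f' x)
    linarith
  rcases le_total s t with h | h
  · have := hmono hs ht h
    simp only at this
    rw [abs_of_nonpos (by linarith)]
    have h2 := mul_le_mul_of_nonneg_left this (exp_pos (-(K * s))).le
    rw [← mul_assoc, ← mul_assoc, ← exp_add, ← exp_add, neg_add_cancel, Real.exp_zero,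
      one_mul] at h2
    refine h2.trans (le_of_eq ?_)
    congr 2
    ring
  · have := hanti ht hs h
    simp only at this
    rw [abs_of_nonneg (by linarith)]
    have h2 := mul_le_mul_of_nonneg_left this (exp_pos (K * s)).le
    rw [← mul_assoc, ← mul_assoc, ← exp_add, ← exp_add, neg_mul, add_neg_cancel,
      Real.exp_zero, one_mul] at h2
    refine h2.trans (le_of_eq ?_)
    congr 2
    ring

end

section

/-! ### Existence of the bicharacteristics and their dependence on the initial data -/

variable {n : ℕ} {T K : ℝ} {a : ℝ → Rn n → Matrix (Fin n) (Fin n) ℝ}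

lemma norm_sum_sum_le {E : Type*} [NormedAddCommGroup E] {f : Fin n → Fin n → E} {D : ℝ}
    (h : ∀ i j, ‖f i j‖ ≤ D) : ‖∑ i, ∑ j, f i j‖ ≤ n ^ 2 * D := by
  refine (norm_sum_le _ _).trans ((sum_le_sum fun i _ => (norm_sum_le _ _).trans
    (sum_le_sum fun j _ => h i j)).trans (le_of_eq ?_))
  simp
  ring

lemma WaveBound.norm_le_mul_sqrt (ha : WaveBound T a K) {t : ℝ} (ht : t ∈ Icc (-T) T)
    (x ξ : Rn n) : ‖ξ‖ ≤ K * √(quadForm (a t x) ξ) := by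
  have h := ha.lower t ht x ξ
  have hK := ha.one_le
  have h0 : 0 ≤ quadForm (a t x) ξ :=
    nonneg_of_mul_nonneg_right (le_trans (sq_nonneg _) h) (by linarith)
  refine le_of_sq_le_sq ?_ (by positivity)
  rw [mul_pow, sq_sqrt h0]
  nlinarith

lemma norm_matVec_le {m : Matrix (Fin n) (Fin n) ℝ} (hm : ∀ i j, |m i j| ≤ K) (ξ : Rn n) :
    ‖matVec m ξ‖ ≤ n ^ 2 * (K * ‖ξ‖) := by
  refine norm_sum_sum_le fun i j => ?_
  rw [norm_smul, PiLp.norm_single, norm_mul, norm_one, mul_one]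
  exact mul_le_mul (hm i j) (abs_coord_le ξ j) (norm_nonneg _) ((abs_nonneg _).trans (hm i j))

lemma norm_gradForm_le {G : Fin n → Fin n → Rn n} (hG : ∀ i j, ‖G i j‖ ≤ K) (ξ : Rn n) :
    ‖gradForm G ξ‖ ≤ n ^ 2 * (K * ‖ξ‖ ^ 2) := by
  refine norm_sum_sum_le fun i j => ?_
  rw [norm_smul, norm_mul, pow_two, mul_comm]
  exact mul_le_mul (hG i j) (mul_le_mul (abs_coord_le ξ i) (abs_coord_le ξ j) (norm_nonneg _)
    (norm_nonneg _)) (by positivity) ((norm_nonneg _).trans (hG i j))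

lemma WaveBound.norm_fieldPos_le (ha : WaveBound T a K) {t : ℝ} (ht : t ∈ Icc (-T) T)
    (ρ : ℝ) (x ξ : Rn n) : ‖fieldPos ρ (a t x) ξ‖ ≤ n ^ 2 * K ^ 2 := by
  have hK := ha.one_le
  have h1 := norm_matVec_le (ha.entry t ht x) ξ
  have h2 := ha.norm_le_mul_sqrt ht x ξ
  set s := max √(quadForm (a t x) ξ) ρ with hs
  have h3 : √(quadForm (a t x) ξ) ≤ s := le_max_left _ _
  have hs0 : 0 ≤ s := (sqrt_nonneg _).trans h3
  rw [fieldPos, norm_smul, norm_smul, norm_neg, norm_one, one_mul, norm_div, norm_one,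
    norm_of_nonneg hs0, one_div, inv_mul_eq_div]
  refine div_le_of_le_mul₀ hs0 (by positivity) (h1.trans ?_)
  have : ‖ξ‖ ≤ K * s := h2.trans (by gcongr)
  calc (n : ℝ) ^ 2 * (K * ‖ξ‖) ≤ n ^ 2 * (K * (K * s)) := by gcongr
    _ = _ := by ring

lemma WaveBound.norm_fieldFreq_le (ha : WaveBound T a K) {t : ℝ} (ht : t ∈ Icc (-T) T)
    (ρ : ℝ) (x ξ : Rn n) :
    ‖fieldFreq ρ (a t x) (gradCoeff a t x) ξ‖ ≤ n ^ 2 * K ^ 2 * ‖ξ‖ := by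
  have hK := ha.one_le
  have h1 := norm_gradForm_le (ha.grad t ht x) ξ
  have h2 := ha.norm_le_mul_sqrt ht x ξ
  set s := max √(quadForm (a t x) ξ) ρ with hs
  have h3 : √(quadForm (a t x) ξ) ≤ s := le_max_left _ _
  have hs0 : 0 ≤ s := (sqrt_nonneg _).trans h3
  rw [fieldFreq, norm_smul, norm_smul, norm_div, norm_div, norm_one, norm_of_nonneg hs0,
    one_div s, inv_mul_eq_div]
  have h4 : ‖gradForm (gradCoeff a t x) ξ‖ / s ≤ n ^ 2 * K ^ 2 * ‖ξ‖ := by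
    refine div_le_of_le_mul₀ hs0 (by positivity) (h1.trans ?_)
    have : ‖ξ‖ ≤ K * s := h2.trans (by gcongr)
    calc (n : ℝ) ^ 2 * (K * ‖ξ‖ ^ 2) = n ^ 2 * (K * (‖ξ‖ * ‖ξ‖)) := by ring
      _ ≤ n ^ 2 * (K * (‖ξ‖ * (K * s))) := by gcongr
      _ = _ := by ring
  refine le_trans ?_ h4
  refine mul_le_of_le_one_left (by positivity) ?_
  norm_num

lemma fieldPos_eq {ρ : ℝ} {m : Matrix (Fin n) (Fin n) ℝ} {ξ : Rn n} (h : ρ ≤ √(quadForm m ξ)) :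
    fieldPos ρ m ξ = -((1 / √(quadForm m ξ)) • matVec m ξ) := by
  rw [fieldPos, max_eq_left h, neg_one_smul]

lemma fieldFreq_eq {ρ : ℝ} {m : Matrix (Fin n) (Fin n) ℝ} {G : Fin n → Fin n → Rn n} {ξ : Rn n}
    (h : ρ ≤ √(quadForm m ξ)) :
    fieldFreq ρ m G ξ = (1 / (2 * √(quadForm m ξ))) • gradForm G ξ := by
  rw [fieldFreq, max_eq_left h, smul_smul]
  congr 1
  rw [one_div, one_div, one_div, mul_inv]

/-- Growth of the frequency along a curve whose derivative is bounded by the curve. -/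
lemma norm_sq_le_exp_mul {ξ ξ' : ℝ → Rn n} {C : ℝ}
    (h : ∀ t ∈ Icc (-T) T, HasDerivWithinAt ξ (ξ' t) (Icc (-T) T) t)
    (hC : ∀ t ∈ Icc (-T) T, ‖ξ' t‖ ≤ C * ‖ξ t‖) {s t : ℝ} (hs : s ∈ Icc (-T) T)
    (ht : t ∈ Icc (-T) T) : ‖ξ s‖ ^ 2 ≤ exp (2 * C * |s - t|) * ‖ξ t‖ ^ 2 := by
  refine le_exp_mul_of_abs_deriv_le (f := fun t => ‖ξ t‖ ^ 2)
    (f' := fun t => 2 * inner ℝ (ξ t) (ξ' t)) (fun t ht => (h t ht).norm_sq) (fun t ht => ?_) hs ht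
  rw [abs_mul, abs_of_pos (by norm_num : (0 : ℝ) < 2)]
  have h1 := abs_real_inner_le_norm (ξ t) (ξ' t)
  have h2 := mul_le_mul_of_nonneg_left (hC t ht) (norm_nonneg (ξ t))
  nlinarith

/-- The bicharacteristics are solutions of the truncated system, which is globally Lipschitz. By
Gronwall's inequality the frequency stays in the range where the truncation has no effect. -/
lemma WaveBound.exists_isBicharacteristic (ha : WaveBound T a K) (hT : 0 ≤ T) (y : Rn n)
    {η : Rn n} (hη : η ≠ 0) : ∃ c, IsBicharacteristic a T y η c := by
  have hK := ha.one_le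
  have hη0 : 0 < ‖η‖ := norm_pos_iff.mpr hη
  have h0T : (0 : ℝ) ∈ Icc (-T) T := ⟨by linarith, hT⟩
  set C₀ : ℝ := n ^ 2 * K ^ 2 with hC₀
  have hC₀0 : 0 ≤ C₀ := by positivity
  set R : ℝ := exp (C₀ * T) * ‖η‖ with hR
  set ρ : ℝ := exp (-(C₀ * T)) * ‖η‖ / K with hρ
  have hR0 : 0 < R := by positivity
  have hρ0 : 0 < ρ := by positivity
  set R' : ℝ := max 1 (n * R) with hR'
  have hR'1 : 1 ≤ R' := le_max_left _ _
  obtain ⟨C, hC, hclose⟩ := exists_close_field n K R' ρ hρ0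
  set f : ℝ → Rn n × Rn n → Rn n × Rn n := fun t p => (fieldPos ρ (a t p.1) (clamp R p.2),
    fieldFreq ρ (a t p.1) (gradCoeff a t p.1) (clamp R p.2)) with hf
  have key : ∀ t ∈ Icc (-T) T, ∀ s ∈ Icc (-T) T, ∀ p p' : Rn n × Rn n, ∀ d : ℝ,
      |t - s| + ‖p - p'‖ ≤ d → (∀ i j, ‖gradCoeff a t p.1 i j - gradCoeff a s p'.1 i j‖ ≤ K * d) →
      ‖f t p‖ ≤ C ∧ ‖f t p - f s p'‖ ≤ C * d := by
    intro t ht s hs p p' d hd hg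
    have hp1 : ‖p.1 - p'.1‖ ≤ ‖p - p'‖ := norm_fst_le (p - p')
    have hp2 : ‖p.2 - p'.2‖ ≤ ‖p - p'‖ := norm_snd_le (p - p')
    have hts := abs_nonneg (t - s)
    have hpp := norm_nonneg (p - p')
    have hd0 : 0 ≤ d := by linarith
    have hξ : Close d R' (clamp R p.2) (clamp R p'.2) := by
      refine ⟨(norm_clamp_le' hR0.le _).trans (le_max_right _ _),
        (norm_clamp_le' hR0.le _).trans (le_max_right _ _), (norm_clamp_sub_le _ _ _).trans ?_⟩
      nlinarith
    have hm : ∀ i j, Close d K (a t p.1 i j) (a s p'.1 i j) := fun i j =>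
      ⟨ha.entry t ht _ i j, ha.entry s hs _ i j, (ha.lipschitz t ht s hs _ _ i j).trans
        (by gcongr; linarith)⟩
    obtain ⟨c1, c2⟩ := hclose d _ _ _ _ hd0 hm hξ
    have c3 := c2 (gradCoeff a t p.1) (gradCoeff a s p'.1) fun i j =>
      ⟨ha.grad t ht _ i j, ha.grad s hs _ i j, hg i j⟩
    exact ⟨max_le c1.left c3.left, max_le c1.sub c3.sub⟩
  have hlip : ∀ t ∈ Icc (-T) T, ∀ p p', ‖f t p‖ ≤ C ∧ ‖f t p - f t p'‖ ≤ C * ‖p - p'‖ := by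
    intro t ht p p'
    refine key t ht t ht p p' _ (by simp) fun i j => (ha.grad_lipschitz t ht _ _ i j).trans ?_
    have : ‖p.1 - p'.1‖ ≤ ‖p - p'‖ := norm_fst_le (p - p')
    gcongr
  have hpl : IsPicardLindelof f (⟨0, h0T⟩ : Icc (-T) T) (y, η) (⟨C * T, by positivity⟩ : ℝ≥0) 0
      (⟨C, hC⟩ : ℝ≥0) (⟨C, hC⟩ : ℝ≥0) := by
    refine ⟨fun t ht => ?_, fun p _ => ?_, fun t ht p _ => (hlip t ht p p).1, ?_⟩
    · refine LipschitzOnWith.of_dist_le_mul fun p _ p' _ => ?_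
      rw [dist_eq_norm, dist_eq_norm]
      exact (hlip t ht p p').2
    · intro t ht
      have hb : ∀ s ∈ Icc (-T) T, dist (f s p) (f t p) ≤ C * (|s - t| + 4 * √|s - t|) := by
        intro s hs
        rw [dist_eq_norm]
        refine (key s hs t ht p p _ (by simp) fun i j => ?_).2
        refine le_of_sq_le_sq ?_ (by positivity)
        refine (ha.grad_holder hs ht i j _).trans ?_
        have h1 := sq_sqrt (abs_nonneg (s - t))
        have h2 := sqrt_nonneg |s - t|
        rw [mul_pow]
        have h3 : 16 * |s - t| ≤ (|s - t| + 4 * √|s - t|) ^ 2 := by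
          nlinarith [abs_nonneg (s - t), mul_nonneg (abs_nonneg (s - t)) h2]
        nlinarith [sq_nonneg K]
      rw [ContinuousWithinAt, tendsto_iff_dist_tendsto_zero]
      refine squeeze_zero' (.of_forall fun s => dist_nonneg)
        (eventually_mem_nhdsWithin.mono hb) ?_
      have hc : Continuous fun s : ℝ => C * (|s - t| + 4 * √|s - t|) := by fun_prop
      have := (hc.tendsto t).mono_left (nhdsWithin_le_nhds (s := Icc (-T) T))
      simpa using this
    · simp only [sub_zero, zero_sub, neg_neg, max_self, NNReal.coe_zero]
      exact le_rfl
  obtain ⟨c, hc0, hc⟩ := hpl.exists_eq_forall_mem_Icc_hasDerivWithinAt₀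
  have hd2 : ∀ t ∈ Icc (-T) T, HasDerivWithinAt (fun s => (c s).2) (f t (c t)).2 (Icc (-T) T) t :=
    fun t ht => (hc t ht).snd
  have hd1 : ∀ t ∈ Icc (-T) T, HasDerivWithinAt (fun s => (c s).1) (f t (c t)).1 (Icc (-T) T) t :=
    fun t ht => (hc t ht).fst
  have hbound : ∀ t ∈ Icc (-T) T, ‖(f t (c t)).2‖ ≤ C₀ * ‖(c t).2‖ := fun t ht =>
    (ha.norm_fieldFreq_le ht ρ _ _).trans (by gcongr; exact norm_clamp_le hR0.le _)
  have c0 : c 0 = (y, η) := hc0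
  have habs : ∀ t ∈ Icc (-T) T, |t| ≤ T := fun t ht => abs_le.mpr ht
  have hupper : ∀ t ∈ Icc (-T) T, ‖(c t).2‖ ≤ R := by
    intro t ht
    have h := norm_sq_le_exp_mul hd2 hbound ht h0T
    simp only [c0, sub_zero] at h
    refine le_of_sq_le_sq (h.trans ?_) hR0.le
    rw [hR, mul_pow, ← Real.exp_nat_mul]
    have := habs t ht
    gcongr exp ?_ * _
    push_cast
    nlinarith
  have hlower : ∀ t ∈ Icc (-T) T, exp (-(C₀ * T)) * ‖η‖ ≤ ‖(c t).2‖ := by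
    intro t ht
    have h := norm_sq_le_exp_mul hd2 hbound h0T ht
    simp only [c0, zero_sub, abs_neg] at h
    have h1 : ‖η‖ ≤ exp (C₀ * T) * ‖(c t).2‖ := by
      refine le_of_sq_le_sq (h.trans ?_) (by positivity)
      rw [mul_pow, ← Real.exp_nat_mul]
      have := habs t ht
      gcongr exp ?_ * _
      push_cast
      nlinarith
    rw [Real.exp_neg, inv_mul_le_iff₀ (exp_pos _)]
    exact h1
  have hne : ∀ t ∈ Icc (-T) T, (c t).2 ≠ 0 := fun t ht => by
    rw [← norm_pos_iff]
    exact lt_of_lt_of_le (by positivity) (hlower t ht)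
  have hcut : ∀ t ∈ Icc (-T) T, ρ ≤ √(quadForm (a t (c t).1) (c t).2) := by
    intro t ht
    rw [hρ, div_le_iff₀ (by linarith)]
    refine (hlower t ht).trans ((ha.norm_le_mul_sqrt ht (c t).1 _).trans (le_of_eq (mul_comm _ _)))
  refine ⟨c, c0, hne, fun t ht => ?_, fun t ht => ?_⟩
  · refine (hd1 t ht).congr_deriv ?_
    simp only [hf]
    rw [clamp_eq (hupper t ht), fieldPos_eq (hcut t ht), ha.gradient_q_freq ht _ (hne t ht), q_eq]
  · refine (hd2 t ht).congr_deriv ?_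
    simp only [hf]
    rw [clamp_eq (hupper t ht), fieldFreq_eq (hcut t ht), ha.gradient_q_pos ht _ (hne t ht), q_eq]

end

section

/-! ### The flow along the bicharacteristics -/

variable {n : ℕ} {T K : ℝ} {a : ℝ → Rn n → Matrix (Fin n) (Fin n) ℝ}

lemma quadForm_smul (r : ℝ) (m : Matrix (Fin n) (Fin n) ℝ) (ξ : Rn n) :
    quadForm m (r • ξ) = r ^ 2 * quadForm m ξ := by
  simp only [quadForm, mul_sum, PiLp.smul_apply, smul_eq_mul]
  refine sum_congr rfl fun i _ => sum_congr rfl fun j _ => ?_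
  ring

lemma matVec_smul (r : ℝ) (m : Matrix (Fin n) (Fin n) ℝ) (ξ : Rn n) :
    matVec m (r • ξ) = r • matVec m ξ := by
  simp only [matVec, Finset.smul_sum, PiLp.smul_apply, smul_eq_mul, smul_smul]
  refine sum_congr rfl fun i _ => sum_congr rfl fun j _ => ?_
  congr 1
  ring

lemma gradForm_smul (r : ℝ) (G : Fin n → Fin n → Rn n) (ξ : Rn n) :
    gradForm G (r • ξ) = r ^ 2 • gradForm G ξ := by
  simp only [gradForm, Finset.smul_sum, PiLp.smul_apply, smul_eq_mul, smul_smul]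
  refine sum_congr rfl fun i _ => sum_congr rfl fun j _ => ?_
  congr 1
  ring

lemma fieldPos_smul {r : ℝ} (hr : 0 < r) (m : Matrix (Fin n) (Fin n) ℝ) (ξ : Rn n) :
    fieldPos 0 m (r • ξ) = fieldPos 0 m ξ := by
  rw [fieldPos_eq (sqrt_nonneg _), fieldPos_eq (sqrt_nonneg _), quadForm_smul,
    matVec_smul, sqrt_mul (by positivity), Real.sqrt_sq hr.le, smul_smul]
  congr 2
  field_simp

lemma fieldFreq_smul {r : ℝ} (hr : 0 < r) (m : Matrix (Fin n) (Fin n) ℝ)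
    (G : Fin n → Fin n → Rn n) (ξ : Rn n) :
    fieldFreq 0 m G (r • ξ) = r • fieldFreq 0 m G ξ := by
  rw [fieldFreq_eq (sqrt_nonneg _), fieldFreq_eq (sqrt_nonneg _), quadForm_smul,
    gradForm_smul, sqrt_mul (by positivity), Real.sqrt_sq hr.le, smul_smul, smul_smul]
  congr 1
  field_simp

/-- The bicharacteristics exist, so that `bichar` is one. -/
lemma WaveBound.isBicharacteristic (ha : WaveBound T a K) (hT : 0 ≤ T) (y : Rn n) {η : Rn n}
    (hη : η ≠ 0) : IsBicharacteristic a T y η (bichar a T y η) :=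
  Classical.epsilon_spec (ha.exists_isBicharacteristic hT y hη)

variable {y η y₁ η₁ y₂ η₂ : Rn n} {c c₁ c₂ : ℝ → Rn n × Rn n}

lemma IsBicharacteristic.hasDeriv_pos (hc : IsBicharacteristic a T y η c) (ha : WaveBound T a K)
    {t : ℝ} (ht : t ∈ Icc (-T) T) : HasDerivWithinAt (fun s => (c s).1)
      (fieldPos 0 (a t (c t).1) (c t).2) (Icc (-T) T) t := by
  rw [fieldPos_eq (sqrt_nonneg _), ← q_eq, ← ha.gradient_q_freq ht _ (hc.ne_zero t ht)]
  exact hc.deriv_pos t ht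

lemma IsBicharacteristic.hasDeriv_freq (hc : IsBicharacteristic a T y η c) (ha : WaveBound T a K)
    {t : ℝ} (ht : t ∈ Icc (-T) T) : HasDerivWithinAt (fun s => (c s).2)
      (fieldFreq 0 (a t (c t).1) (gradCoeff a t (c t).1) (c t).2) (Icc (-T) T) t := by
  rw [fieldFreq_eq (sqrt_nonneg _), ← q_eq, ← ha.gradient_q_pos ht _ (hc.ne_zero t ht)]
  exact hc.deriv_freq t ht

/-- The factor by which frequencies may grow or decay along the flow. -/
def flowFactor (n : ℕ) (K T : ℝ) : ℝ := exp (n ^ 2 * K ^ 2 * (2 * T))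

lemma one_le_flowFactor (hT : 0 ≤ T) : 1 ≤ flowFactor n K T := by
  rw [flowFactor, Real.one_le_exp_iff]
  positivity

lemma IsBicharacteristic.norm_freq_le (hc : IsBicharacteristic a T y η c) (ha : WaveBound T a K)
    {s t : ℝ} (hs : s ∈ Icc (-T) T) (ht : t ∈ Icc (-T) T) :
    ‖(c s).2‖ ≤ flowFactor n K T * ‖(c t).2‖ := by
  have h := norm_sq_le_exp_mul (fun t ht => hc.hasDeriv_freq ha ht)
    (fun t ht => ha.norm_fieldFreq_le ht 0 _ _) hs ht
  refine le_of_sq_le_sq (h.trans ?_) (by unfold flowFactor; positivity)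
  rw [mul_pow, flowFactor, ← Real.exp_nat_mul]
  gcongr exp ?_ * _
  have h1 : |s - t| ≤ 2 * T := by
    rw [abs_le]
    constructor <;> linarith [hs.1, hs.2, ht.1, ht.2]
  have := mul_le_mul_of_nonneg_left h1 (by positivity : 0 ≤ 2 * ((n : ℝ) ^ 2 * K ^ 2))
  push_cast
  linarith

/-- The closeness of the Hamiltonian field at two points, in the scaling of frequencies of
size `l`. -/
lemma WaveBound.exists_close_field (ha : WaveBound T a K) (M : ℝ) (hM : 1 ≤ M) :
    ∃ C, 0 ≤ C ∧ ∀ (l d : ℝ) (t s : ℝ) (x₁ ξ₁ x₂ ξ₂ : Rn n), t ∈ Icc (-T) T → s ∈ Icc (-T) T →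
      0 < l → 0 ≤ d → l ≤ M * ‖ξ₁‖ → ‖ξ₁‖ ≤ M * l → l ≤ M * ‖ξ₂‖ → ‖ξ₂‖ ≤ M * l →
      |t - s| + ‖x₁ - x₂‖ ≤ d → ‖ξ₁ - ξ₂‖ ≤ l * d →
      (∀ i j, ‖gradCoeff a t x₁ i j - gradCoeff a s x₂ i j‖ ≤ K * d) →
      ‖fieldPos 0 (a t x₁) ξ₁ - fieldPos 0 (a s x₂) ξ₂‖ ≤ C * d ∧
      ‖fieldFreq 0 (a t x₁) (gradCoeff a t x₁) ξ₁ - fieldFreq 0 (a s x₂) (gradCoeff a s x₂) ξ₂‖ ≤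
        C * l * d := by
  have hK := ha.one_le
  obtain ⟨C, hC, h⟩ := GaussianFrame.exists_close_field n K M (1 / (K * M)) (by positivity)
  refine ⟨C, hC, ?_⟩
  intro l d t s x₁ ξ₁ x₂ ξ₂ ht hs hl hd l₁ u₁ l₂ u₂ hx hξ hg
  have hcut : ∀ τ ∈ Icc (-T) T, ∀ x ξ : Rn n, l ≤ M * ‖ξ‖ →
      1 / (K * M) ≤ √(quadForm (a τ x) (l⁻¹ • ξ)) := by
    intro τ hτ x ξ hlξ
    have h1 := ha.norm_le_mul_sqrt hτ x (l⁻¹ • ξ)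
    rw [norm_smul, norm_inv, norm_of_nonneg hl.le] at h1
    have h2 : 1 ≤ M * (l⁻¹ * ‖ξ‖) := by
      rw [← mul_assoc, mul_comm M, mul_assoc, ← div_eq_inv_mul, one_le_div hl]
      exact hlξ
    rw [div_le_iff₀ (by positivity)]
    nlinarith
  have hsc : ∀ ξ : Rn n, ξ = l • (l⁻¹ • ξ) := fun ξ => by
    rw [smul_smul, mul_inv_cancel₀ hl.ne', one_smul]
  have hn : ∀ ξ : Rn n, ‖ξ‖ ≤ M * l → ‖l⁻¹ • ξ‖ ≤ M := by
    intro ξ h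
    rw [norm_smul, norm_inv, norm_of_nonneg hl.le, ← div_eq_inv_mul, div_le_iff₀ hl]
    exact h
  have hx0 := norm_nonneg (x₁ - x₂)
  have hcl : Close d M (l⁻¹ • ξ₁) (l⁻¹ • ξ₂) := by
    refine ⟨hn _ u₁, hn _ u₂, ?_⟩
    rw [← smul_sub, norm_smul, norm_inv, norm_of_nonneg hl.le, ← div_eq_inv_mul,
      div_le_iff₀ hl]
    nlinarith [mul_nonneg hl.le hd]
  obtain ⟨c1, c2⟩ := h d (a t x₁) (a s x₂) _ _ hd (fun i j => ⟨ha.entry t ht _ i j,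
    ha.entry s hs _ i j, (ha.lipschitz t ht s hs _ _ i j).trans (by gcongr)⟩) hcl
  have c3 := c2 (gradCoeff a t x₁) (gradCoeff a s x₂) fun i j =>
    ⟨ha.grad t ht _ i j, ha.grad s hs _ i j, hg i j⟩
  have e1 : ∀ τ ∈ Icc (-T) T, ∀ x ξ : Rn n, l ≤ M * ‖ξ‖ →
      fieldPos 0 (a τ x) ξ = fieldPos (1 / (K * M)) (a τ x) (l⁻¹ • ξ) := by
    intro τ hτ x ξ hlξ
    conv_lhs => rw [hsc ξ, fieldPos_smul hl]
    rw [fieldPos_eq (sqrt_nonneg _), fieldPos_eq (hcut τ hτ x ξ hlξ)]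
  have e2 : ∀ τ ∈ Icc (-T) T, ∀ x ξ : Rn n, l ≤ M * ‖ξ‖ →
      fieldFreq 0 (a τ x) (gradCoeff a τ x) ξ =
        l • fieldFreq (1 / (K * M)) (a τ x) (gradCoeff a τ x) (l⁻¹ • ξ) := by
    intro τ hτ x ξ hlξ
    conv_lhs => rw [hsc ξ, fieldFreq_smul hl]
    rw [fieldFreq_eq (sqrt_nonneg _), fieldFreq_eq (hcut τ hτ x ξ hlξ)]
  constructor
  · rw [e1 t ht _ _ l₁, e1 s hs _ _ l₂]
    exact c1.sub
  · rw [e2 t ht _ _ l₁, e2 s hs _ _ l₂, ← smul_sub, norm_smul, norm_of_nonneg hl.le]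
    calc l * _ ≤ l * (C * d) := by gcongr; exact c3.sub
      _ = _ := by ring

/-- The flow does not contract distances in phase space by more than a constant factor, in the
metric `|dx|² + |dξ|² / l²` of frequencies of size `l`. -/
lemma WaveBound.exists_flow_lower (ha : WaveBound T a K) (hT : 0 ≤ T) :
    ∃ L, 1 ≤ L ∧ ∀ (l : ℝ) (y₁ η₁ y₂ η₂ : Rn n) (c₁ c₂ : ℝ → Rn n × Rn n), 0 < l →
      l ≤ 2 * ‖η₁‖ → ‖η₁‖ ≤ l → l ≤ 2 * ‖η₂‖ → ‖η₂‖ ≤ l →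
      IsBicharacteristic a T y₁ η₁ c₁ → IsBicharacteristic a T y₂ η₂ c₂ → ∀ t ∈ Icc (-T) T,
      ‖y₁ - y₂‖ ^ 2 + (l⁻¹ * ‖η₁ - η₂‖) ^ 2 ≤
        L * (‖(c₁ t).1 - (c₂ t).1‖ ^ 2 + (l⁻¹ * ‖(c₁ t).2 - (c₂ t).2‖) ^ 2) := by
  have hK := ha.one_le
  have hF := one_le_flowFactor (n := n) (K := K) hT
  set M := 2 * flowFactor n K T with hM
  obtain ⟨C, hC, h⟩ := ha.exists_close_field M (by linarith)
  refine ⟨exp (4 * C * (2 * T)), by rw [Real.one_le_exp_iff]; positivity, ?_⟩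
  intro l y₁ η₁ y₂ η₂ c₁ c₂ hl l₁ u₁ l₂ u₂ h₁ h₂ t ht
  have h0T : (0 : ℝ) ∈ Icc (-T) T := ⟨by linarith, hT⟩
  have hlow : ∀ (y η : Rn n) (c : ℝ → Rn n × Rn n), IsBicharacteristic a T y η c → l ≤ 2 * ‖η‖ →
      ‖η‖ ≤ l → ∀ s ∈ Icc (-T) T, l ≤ M * ‖(c s).2‖ ∧ ‖(c s).2‖ ≤ M * l := by
    intro y η c hc hl1 hu1 s hs
    have b1 := hc.norm_freq_le ha h0T hs
    have b2 := hc.norm_freq_le ha hs h0T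
    rw [hc.init] at b1 b2
    simp only at b1 b2
    constructor
    · rw [hM]; linarith
    · rw [hM]
      nlinarith [norm_nonneg η]
  set N : ℝ → ℝ := fun s => ‖(c₁ s).1 - (c₂ s).1‖ ^ 2 + (l⁻¹ * ‖(c₁ s).2 - (c₂ s).2‖) ^ 2 with hN
  set P : ℝ → Rn n := fun s => fieldPos 0 (a s (c₁ s).1) (c₁ s).2 -
    fieldPos 0 (a s (c₂ s).1) (c₂ s).2 with hP
  set Q : ℝ → Rn n := fun s => fieldFreq 0 (a s (c₁ s).1) (gradCoeff a s (c₁ s).1) (c₁ s).2 -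
    fieldFreq 0 (a s (c₂ s).1) (gradCoeff a s (c₂ s).1) (c₂ s).2 with hQ
  have hder : ∀ s ∈ Icc (-T) T, HasDerivWithinAt N
      (2 * inner ℝ ((c₁ s).1 - (c₂ s).1) (P s) +
        (l⁻¹) ^ 2 * (2 * inner ℝ ((c₁ s).2 - (c₂ s).2) (Q s))) (Icc (-T) T) s := by
    intro s hs
    have d1 := ((h₁.hasDeriv_pos ha hs).sub (h₂.hasDeriv_pos ha hs)).norm_sq
    have d2 := (((h₁.hasDeriv_freq ha hs).sub (h₂.hasDeriv_freq ha hs)).norm_sq).const_mul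
      ((l⁻¹) ^ 2)
    have := d1.add d2
    refine this.congr_of_eventuallyEq (.of_forall fun τ => ?_) ?_ <;>
    simp [hN, mul_pow]
  have hb : ∀ s ∈ Icc (-T) T, |2 * inner ℝ ((c₁ s).1 - (c₂ s).1) (P s) +
        (l⁻¹) ^ 2 * (2 * inner ℝ ((c₁ s).2 - (c₂ s).2) (Q s))| ≤ 4 * C * N s := by
    intro s hs
    set X := ‖(c₁ s).1 - (c₂ s).1‖ with hX
    set Y := l⁻¹ * ‖(c₁ s).2 - (c₂ s).2‖ with hY
    have hX0 : 0 ≤ X := norm_nonneg _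
    have hY0 : 0 ≤ Y := by positivity
    have hlY : ‖(c₁ s).2 - (c₂ s).2‖ = l * Y := by rw [hY]; field_simp
    obtain ⟨p1, p2⟩ := h l (X + Y) s s (c₁ s).1 (c₁ s).2 (c₂ s).1 (c₂ s).2 hs hs hl (by positivity)
      (hlow _ _ _ h₁ l₁ u₁ s hs).1 (hlow _ _ _ h₁ l₁ u₁ s hs).2
      (hlow _ _ _ h₂ l₂ u₂ s hs).1 (hlow _ _ _ h₂ l₂ u₂ s hs).2 (by simp; linarith)
      (by rw [hlY]; nlinarith [mul_nonneg hl.le hX0])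
      (fun i j => (ha.grad_lipschitz s hs _ _ i j).trans (by gcongr; linarith))
    have i1 := (abs_real_inner_le_norm ((c₁ s).1 - (c₂ s).1) (P s)).trans
      (by gcongr)
    have i2 := (abs_real_inner_le_norm ((c₁ s).2 - (c₂ s).2) (Q s)).trans
      (mul_le_mul_of_nonneg_left p2 (norm_nonneg _))
    rw [hlY] at i2
    have i3 : (l⁻¹) ^ 2 * |inner ℝ ((c₁ s).2 - (c₂ s).2) (Q s)| ≤ Y * (C * (X + Y)) := by
      calc (l⁻¹) ^ 2 * |inner ℝ ((c₁ s).2 - (c₂ s).2) (Q s)| ≤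
          (l⁻¹) ^ 2 * (l * Y * (C * l * (X + Y))) := by gcongr
        _ = _ := by field_simp
    refine (abs_add_le _ _).trans ?_
    rw [abs_mul, abs_mul, abs_mul, abs_of_pos (by norm_num : (0 : ℝ) < 2),
      abs_of_nonneg (by positivity : 0 ≤ (l⁻¹) ^ 2)]
    have hNs : N s = X ^ 2 + Y ^ 2 := rfl
    rw [hNs]
    nlinarith [mul_nonneg hC (sq_nonneg (X - Y))]
  have hfin := le_exp_mul_of_abs_deriv_le hder hb h0T ht
  have hN0 : N 0 = ‖y₁ - y₂‖ ^ 2 + (l⁻¹ * ‖η₁ - η₂‖) ^ 2 := by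
    simp only [hN, h₁.init, h₂.init]
  rw [← hN0]
  refine hfin.trans ?_
  gcongr exp ?_ * _
  gcongr
  rw [abs_le]
  constructor <;> linarith [ht.1, ht.2]

/-- The derivative of a bicharacteristic is Lipschitz in time when the gradients of the
coefficients are. -/
lemma WaveBound.exists_deriv_lipschitz (ha : WaveBound T a K) (hT : 0 ≤ T)
    (hg : GradLipschitzInTime T a) :
    ∃ C, 0 ≤ C ∧ ∀ (y η : Rn n) (c : ℝ → Rn n × Rn n), η ≠ 0 → IsBicharacteristic a T y η c →
      ∀ t ∈ Icc (-T) T, ∀ s ∈ Icc (-T) T,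
      ‖fieldPos 0 (a t (c t).1) (c t).2 - fieldPos 0 (a s (c s).1) (c s).2‖ ≤ C * |t - s| ∧
      ‖fieldFreq 0 (a t (c t).1) (gradCoeff a t (c t).1) (c t).2 -
        fieldFreq 0 (a s (c s).1) (gradCoeff a s (c s).1) (c s).2‖ ≤ C * ‖η‖ * |t - s| := by
  have hK := ha.one_le
  have h0T : (0 : ℝ) ∈ Icc (-T) T := ⟨by linarith, hT⟩
  obtain ⟨C₁, hC₁⟩ := hg
  have hF := one_le_flowFactor (n := n) (K := K) hT
  set M := flowFactor n K T with hM
  obtain ⟨C, hC, h⟩ := ha.exists_close_field M hF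
  set B : ℝ := n ^ 2 * K ^ 2 * M with hB
  have hB0 : 0 ≤ B := by positivity
  set D : ℝ := 1 + B + |C₁| with hD
  refine ⟨C * D, by positivity, ?_⟩
  intro y η c hη hc t ht s hs
  have hη0 : 0 < ‖η‖ := norm_pos_iff.mpr hη
  have f1 : ∀ τ ∈ Icc (-T) T, ‖(c τ).2‖ ≤ M * ‖η‖ := by
    intro τ hτ
    have := hc.norm_freq_le ha hτ h0T
    rwa [hc.init] at this
  have f2 : ∀ τ ∈ Icc (-T) T, ‖η‖ ≤ M * ‖(c τ).2‖ := by
    intro τ hτ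
    have := hc.norm_freq_le ha h0T hτ
    rwa [hc.init] at this
  have m1 : ‖(c t).1 - (c s).1‖ ≤ B * |t - s| := by
    refine (convex_Icc (-T) T).norm_image_sub_le_of_norm_hasDerivWithin_le
      (fun τ hτ => hc.hasDeriv_pos ha hτ) (fun τ hτ => ?_) hs ht
    refine (ha.norm_fieldPos_le hτ 0 _ _).trans ?_
    rw [hB]
    exact le_mul_of_one_le_right (by positivity) hF
  have m2 : ‖(c t).2 - (c s).2‖ ≤ B * ‖η‖ * |t - s| := by
    refine (convex_Icc (-T) T).norm_image_sub_le_of_norm_hasDerivWithin_le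
      (fun τ hτ => hc.hasDeriv_freq ha hτ) (fun τ hτ => ?_) hs ht
    refine (ha.norm_fieldFreq_le hτ 0 _ _).trans ?_
    rw [hB, mul_assoc _ M]
    gcongr
    exact f1 τ hτ
  have hts := abs_nonneg (t - s)
  have e1 : |t - s| + ‖(c t).1 - (c s).1‖ ≤ D * |t - s| := by
    rw [hD]
    nlinarith [mul_nonneg (abs_nonneg C₁) hts]
  have e2 : ‖(c t).2 - (c s).2‖ ≤ ‖η‖ * (D * |t - s|) := by
    refine m2.trans ?_
    rw [mul_comm B, mul_assoc]
    gcongr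
    rw [hD]
    linarith [abs_nonneg C₁]
  have e3 : ∀ i j, ‖gradCoeff a t (c t).1 i j - gradCoeff a s (c s).1 i j‖ ≤
      K * (D * |t - s|) := by
    intro i j
    have g1 := hC₁ t ht s hs (c t).1 i j
    have g2 := ha.grad_lipschitz s hs (c t).1 (c s).1 i j
    have g3 : ‖gradCoeff a t (c t).1 i j - gradCoeff a s (c s).1 i j‖ ≤
        C₁ * |t - s| + K * ‖(c t).1 - (c s).1‖ := by
      refine (le_of_eq ?_).trans ((norm_add_le _ _).trans (add_le_add g1 g2))
      congr 1
      simp only [gradCoeff]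
      abel
    refine g3.trans ?_
    have : C₁ * |t - s| ≤ K * |C₁| * |t - s| := by
      gcongr
      nlinarith [le_abs_self C₁, abs_nonneg C₁]
    rw [hD]
    nlinarith [mul_le_mul_of_nonneg_left m1 (by linarith : 0 ≤ K)]
  obtain ⟨r1, r2⟩ := h ‖η‖ (D * |t - s|) t s (c t).1 (c t).2 (c s).1 (c s).2 ht hs hη0
    (by positivity) (f2 t ht) (f1 t ht) (f2 s hs) (f1 s hs) e1 e2 e3
  exact ⟨r1.trans (le_of_eq (by ring)), r2.trans (le_of_eq (by ring))⟩

end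

section

/-! ### The paths of the frame functions -/

section Paths

variable {n : ℕ} {T K : ℝ} {a : ℝ → Rn n → Matrix (Fin n) (Fin n) ℝ} {Z : FrequencyNet n}

lemma FrequencyNet.countable_pts (Z : FrequencyNet n) (k : ℕ) : (Z.pts k).Countable := by
  have h0 : (0 : ℝ) < (2 : ℝ) ^ ((k : ℝ) / 2) := by positivity
  refine Set.PairwiseDisjoint.countable_of_isOpen (ι := Rn n)
    (s := fun ξ => Metric.ball ξ ((2 : ℝ) ^ ((k : ℝ) / 2) / 2)) ?_ (fun _ _ => Metric.isOpen_ball)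
    (fun ξ _ => ⟨ξ, Metric.mem_ball_self (by positivity)⟩)
  intro ξ hξ η hη hne
  apply Metric.ball_disjoint_ball
  linarith [Z.separated k ξ hξ η hη hne]

instance (Z : FrequencyNet n) : Countable (Index Z) := by
  have : ∀ k, Countable (Z.pts k) := fun k => (Z.countable_pts k).to_subtype
  infer_instance

lemma two_pow_le_norm_freq (γ : Index Z) : (2 : ℝ) ^ γ.1 ≤ 2 * ‖freq γ‖ := by
  have := (Z.subset_annulus γ.1 γ.2.1.2).1
  simp only [freq]
  linarith

lemma norm_freq_le_two_pow (γ : Index Z) : ‖freq γ‖ ≤ (2 : ℝ) ^ γ.1 :=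
  (Z.subset_annulus γ.1 γ.2.1.2).2.le

lemma WaveBound.isBicharacteristic_framePath (ha : WaveBound T a K) (hT : 0 ≤ T) (ε c : ℝ)
    (γ : Index Z) :
    IsBicharacteristic a T (pos ε c γ) (freq γ) (framePath ε c T a γ) :=
  ha.isBicharacteristic hT _ (freq_ne_zero γ)

lemma uniqueDiffOn_window (hT : 0 < T) : UniqueDiffOn ℝ (Icc (-T) T) :=
  uniqueDiffOn_Icc (by linarith)

lemma WaveBound.derivWithin_framePath (ha : WaveBound T a K) (hT : 0 < T) (ε c : ℝ) (γ : Index Z)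
    {t : ℝ} (ht : t ∈ Icc (-T) T) :
    derivWithin (framePath ε c T a γ) (Icc (-T) T) t = (fieldPos 0 (a t (framePath ε c T a γ t).1)
        (framePath ε c T a γ t).2,
      fieldFreq 0 (a t (framePath ε c T a γ t).1) (gradCoeff a t (framePath ε c T a γ t).1)
        (framePath ε c T a γ t).2) := by
  have h := ha.isBicharacteristic_framePath hT.le ε c γ
  exact ((h.hasDeriv_pos ha ht).prodMk (h.hasDeriv_freq ha ht)).derivWithin
    (uniqueDiffOn_window hT t ht)

lemma WaveBound.exists_path_lipschitz (ha : WaveBound T a K) (hT : 0 < T)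
    (hg : GradLipschitzInTime T a) (Z : FrequencyNet n) (ε c : ℝ) :
    ∃ C, 0 ≤ C ∧ ∀ γ : Index Z, ∀ t ∈ Icc (-T) T, ∀ s ∈ Icc (-T) T,
      ‖(derivWithin (framePath ε c T a γ) (Icc (-T) T) t).1 -
        (derivWithin (framePath ε c T a γ) (Icc (-T) T) s).1‖ ≤ C * |t - s| ∧
      ‖(derivWithin (framePath ε c T a γ) (Icc (-T) T) t).2 -
        (derivWithin (framePath ε c T a γ) (Icc (-T) T) s).2‖ ≤ C * ‖freq γ‖ * |t - s| := by
  obtain ⟨C, hC, h⟩ := ha.exists_deriv_lipschitz hT.le hg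
  refine ⟨C, hC, fun γ t ht s hs => ?_⟩
  rw [ha.derivWithin_framePath hT ε c γ ht, ha.derivWithin_framePath hT ε c γ hs]
  exact h _ _ _ (freq_ne_zero γ) (ha.isBicharacteristic_framePath hT.le ε c γ) t ht s hs

/-- Rademacher's theorem for the derivatives of the countably many paths. -/
lemma WaveBound.ae_mem_regularTimes (ha : WaveBound T a K) (hT : 0 < T)
    (hg : GradLipschitzInTime T a) (Z : FrequencyNet n) (ε c : ℝ) :
    ∀ᵐ t ∂(volume.restrict (Icc (-T) T)), t ∈ regularTimes Z ε c T a := by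
  obtain ⟨C, hC, h⟩ := ha.exists_path_lipschitz hT hg Z ε c
  have h1 : ∀ γ : Index Z, ∀ᵐ t ∂(volume.restrict (Icc (-T) T)), DifferentiableWithinAt ℝ
      (derivWithin (framePath ε c T a γ) (Icc (-T) T)) (Icc (-T) T) t := by
    intro γ
    refine LipschitzOnWith.ae_differentiableWithinAt (C := ⟨max C (C * ‖freq γ‖), by positivity⟩)
      (LipschitzOnWith.of_dist_le_mul fun t ht s hs => ?_) measurableSet_Icc
    rw [dist_eq_norm, Real.dist_eq]
    obtain ⟨h2, h3⟩ := h γ t ht s hs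
    refine max_le (h2.trans ?_) (h3.trans ?_)
    · gcongr
      exact le_max_left _ _
    · gcongr
      exact le_max_right _ _
  filter_upwards [ae_all_iff.mpr h1, ae_restrict_mem measurableSet_Icc] with t ht hI
  exact ⟨hI, ht⟩

lemma norm_le_of_hasDerivWithinAt_lipschitz {E : Type*} [NormedAddCommGroup E] [NormedSpace ℝ E]
    (hT : 0 < T) {f : ℝ → E} {v : E} {t C : ℝ} (ht : t ∈ Icc (-T) T)
    (hf : HasDerivWithinAt f v (Icc (-T) T) t)
    (h : ∀ s ∈ Icc (-T) T, ‖f s - f t‖ ≤ C * |s - t|) : ‖v‖ ≤ C := by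
  rw [hasDerivWithinAt_iff_tendsto_slope] at hf
  have : (nhdsWithin t (Icc (-T) T \ {t})).NeBot := by
    have := (uniqueDiffOn_window hT t ht)
    rwa [uniqueDiffWithinAt_iff_accPt, accPt_principal_iff_nhdsWithin] at this
  refine le_of_tendsto hf.norm ?_
  filter_upwards [self_mem_nhdsWithin] with s hs
  have hne : s - t ≠ 0 := sub_ne_zero.mpr hs.2
  rw [slope_def_module, norm_smul, norm_inv, norm_eq_abs, inv_mul_le_iff₀ (abs_pos.mpr hne),
    mul_comm]
  exact h s hs.1

/-- Second derivatives of the paths at regular times, with their sizes. -/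
lemma WaveBound.exists_second_deriv (ha : WaveBound T a K) (hT : 0 < T)
    (hg : GradLipschitzInTime T a) (Z : FrequencyNet n) (ε c : ℝ) :
    ∃ C, 0 ≤ C ∧ ∀ t ∈ regularTimes Z ε c T a, ∀ γ : Index Z, ∃ v w : Rn n,
      HasDerivWithinAt (fun s =>
        (derivWithin (framePath ε c T a γ) (Icc (-T) T) s).1) v (Icc (-T) T) t ∧
      HasDerivWithinAt (fun s =>
        (derivWithin (framePath ε c T a γ) (Icc (-T) T) s).2) w (Icc (-T) T) t ∧
      ‖v‖ ≤ C ∧ ‖w‖ ≤ C * ‖freq γ‖ := by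
  obtain ⟨C, hC, h⟩ := ha.exists_path_lipschitz hT hg Z ε c
  refine ⟨C, hC, fun t ht γ => ?_⟩
  have hd := (ht.2 γ).hasDerivWithinAt
  refine ⟨_, _, hd.fst, hd.snd, ?_, ?_⟩
  · exact norm_le_of_hasDerivWithinAt_lipschitz hT ht.1 hd.fst fun s hs => (h γ s hs t ht.1).1
  · exact norm_le_of_hasDerivWithinAt_lipschitz hT ht.1 hd.snd fun s hs => (h γ s hs t ht.1).2

end Paths

/-! ### Families of points in phase space -/

/-- The square of the distance `|dx|² + |dξ|² / 4ᵏ` in phase space. -/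
def phaseSq {n : ℕ} (k : ℕ) (x ξ x' ξ' : Rn n) : ℝ :=
  ‖x - x'‖ ^ 2 + (((2 : ℝ) ^ k)⁻¹ * ‖ξ - ξ'‖) ^ 2

lemma phaseSq_nonneg {n : ℕ} (k : ℕ) (x ξ x' ξ' : Rn n) : 0 ≤ phaseSq k x ξ x' ξ' := by
  unfold phaseSq; positivity

lemma phaseSq_triangle {n : ℕ} (k : ℕ) (x ξ x₁ ξ₁ x₂ ξ₂ : Rn n) :
    phaseSq k x₁ ξ₁ x₂ ξ₂ ≤ 2 * phaseSq k x ξ x₁ ξ₁ + 2 * phaseSq k x ξ x₂ ξ₂ := by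
  have tri : ∀ u v w : Rn n, ‖v - w‖ ^ 2 ≤ 2 * ‖u - v‖ ^ 2 + 2 * ‖u - w‖ ^ 2 := by
    intro u v w
    have : ‖v - w‖ ≤ ‖u - v‖ + ‖u - w‖ := by
      calc ‖v - w‖ = ‖(u - w) - (u - v)‖ := by congr 1; abel
        _ ≤ ‖u - w‖ + ‖u - v‖ := norm_sub_le _ _
        _ = _ := add_comm _ _
    nlinarith [norm_nonneg (v - w), sq_nonneg (‖u - v‖ - ‖u - w‖)]
  have h1 := tri x x₁ x₂
  have h2 := mul_le_mul_of_nonneg_left (tri ξ ξ₁ ξ₂) (sq_nonneg (((2 : ℝ) ^ k)⁻¹))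
  simp only [phaseSq, mul_pow]
  linarith

/-- A family of phase space points, indexed like the frame, whose frequencies have size `2ᵏ` on
level `k`, and which is at least as spread out on each level as the frame itself, up to
constants. -/
structure PhaseFamily {n : ℕ} (Z : FrequencyNet n) (ε c M L : ℝ) (X Ξ : Index Z → Rn n) :
    Prop where
  lower : ∀ γ, (2 : ℝ) ^ γ.1 ≤ M * ‖Ξ γ‖
  upper : ∀ γ, ‖Ξ γ‖ ≤ M * (2 : ℝ) ^ γ.1
  spread : ∀ k p p', phaseSq k (pos ε c (⟨k, p⟩ : Index Z)) (freq (⟨k, p⟩ : Index Z))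
    (pos ε c (⟨k, p'⟩ : Index Z)) (freq (⟨k, p'⟩ : Index Z)) ≤
      L * phaseSq k (X ⟨k, p⟩) (Ξ ⟨k, p⟩) (X ⟨k, p'⟩) (Ξ ⟨k, p'⟩)

lemma WaveBound.exists_phaseFamily {n : ℕ} {T K : ℝ} {a : ℝ → Rn n → Matrix (Fin n) (Fin n) ℝ}
    (ha : WaveBound T a K) (hT : 0 < T) (Z : FrequencyNet n) (ε c : ℝ) :
    ∃ M L, 1 ≤ M ∧ 1 ≤ L ∧ ∀ t ∈ Icc (-T) T, PhaseFamily Z ε c M L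
      (fun γ => (framePath ε c T a γ t).1)
      (fun γ => (framePath ε c T a γ t).2) := by
  obtain ⟨L, hL, h⟩ := ha.exists_flow_lower hT.le
  have hF := one_le_flowFactor (n := n) (K := K) hT.le
  have h0T : (0 : ℝ) ∈ Icc (-T) T := ⟨by linarith, hT.le⟩
  refine ⟨2 * flowFactor n K T, L, by linarith, hL, fun t ht => ⟨fun γ => ?_, fun γ => ?_,
    fun k p p' => ?_⟩⟩
  · have := (ha.isBicharacteristic_framePath hT.le ε c γ).norm_freq_le ha h0T ht
    rw [(ha.isBicharacteristic_framePath hT.le ε c γ).init] at this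
    have h2 := two_pow_le_norm_freq γ
    simp only at this
    linarith
  · have := (ha.isBicharacteristic_framePath hT.le ε c γ).norm_freq_le ha ht h0T
    rw [(ha.isBicharacteristic_framePath hT.le ε c γ).init] at this
    have h2 := norm_freq_le_two_pow γ
    simp only at this ⊢
    have h3 : (0 : ℝ) < 2 ^ γ.1 := by positivity
    nlinarith
  · exact h _ _ _ _ _ _ _ (by positivity) (two_pow_le_norm_freq (⟨k, p⟩ : Index Z))
      (norm_freq_le_two_pow (⟨k, p⟩ : Index Z)) (two_pow_le_norm_freq (⟨k, p'⟩ : Index Z))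
      (norm_freq_le_two_pow (⟨k, p'⟩ : Index Z)) (ha.isBicharacteristic_framePath hT.le ε c _)
      (ha.isBicharacteristic_framePath hT.le ε c _) t ht

lemma phaseFamily_frame {n : ℕ} (Z : FrequencyNet n) (ε c : ℝ) :
    PhaseFamily Z ε c 2 1 (pos ε c) freq :=
  ⟨two_pow_le_norm_freq, fun γ => (norm_freq_le_two_pow γ).trans
    (by have : (0 : ℝ) < 2 ^ γ.1 := by positivity
        linarith), fun k p p' => by rw [one_mul]⟩

lemma spacing_pos {ε c : ℝ} (hc : 0 < c) (k : ℕ) : 0 < spacing ε c k := by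
  unfold spacing; positivity

/-- `2^(k/2) Δx = c 2^(-εk)`. -/
lemma sqrt_mul_spacing (ε c : ℝ) (k : ℕ) :
    √((2 : ℝ) ^ k) * spacing ε c k = c * (2 : ℝ) ^ (-(ε * k)) := by
  rw [spacing, Real.sqrt_eq_rpow, ← rpow_natCast, ← rpow_mul (by norm_num),
    mul_left_comm, ← rpow_add (by norm_num)]
  congr 2
  ring

lemma sqrt_mul_spacing_le {ε c : ℝ} (hε : 0 < ε) (hc : 0 < c) (k : ℕ) :
    √((2 : ℝ) ^ k) * spacing ε c k ≤ c := by
  rw [sqrt_mul_spacing]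
  refine mul_le_of_le_one_right hc.le (Real.rpow_le_one_of_one_le_of_nonpos (by norm_num) ?_)
  have : 0 ≤ ε * k := by positivity
  linarith

lemma sqrt_two_pow (k : ℕ) : √((2 : ℝ) ^ k) = (2 : ℝ) ^ ((k : ℝ) / 2) := by
  rw [Real.sqrt_eq_rpow, ← rpow_natCast, ← rpow_mul (by norm_num)]
  congr 1
  ring

/-- Gaussian sums over one level of the frame: a sum over the positions times one over the
frequencies. -/
lemma sum_exp_phaseSq_frame_le {n : ℕ} {ε c κ : ℝ} (hε : 0 < ε) (hc : 0 < c) (hκ : 0 < κ) :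
    ∃ C, 0 < C ∧ ∀ (Z : FrequencyNet n) (k : ℕ) (s : ℝ), 0 < s → s ≤ 2 ^ k → ∀ (x ξ : Rn n)
      (F : Finset (Z.pts k × (Fin n → ℤ))),
      ∑ p ∈ F, exp (-(κ * s * phaseSq k x ξ (pos ε c (⟨k, p⟩ : Index Z))
        (freq (⟨k, p⟩ : Index Z)))) ≤ C * (√((2 : ℝ) ^ k) / (s * spacing ε c k)) ^ n := by
  obtain ⟨C, hC, h⟩ := exists_sum_exp_le_of_separated n
  refine ⟨C * exp κ * (C * exp (κ * c ^ 2)) * ((1 / κ) ^ n), by positivity, ?_⟩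
  intro Z k s hs hsk x ξ F
  classical
  have h2k : (0 : ℝ) < 2 ^ k := by positivity
  have hq : 0 < √((2 : ℝ) ^ k) := by positivity
  have hΔ := spacing_pos (ε := ε) hc k
  have hqs : √((2 : ℝ) ^ k) ^ 2 = 2 ^ k := sq_sqrt h2k.le
  set posα : (Fin n → ℤ) → Rn n := fun α => WithLp.toLp 2 fun i => spacing ε c k * (α i : ℝ)
    with hposα
  have hsepα : ∀ α β, α ≠ β → spacing ε c k ≤ dist (posα α) (posα β) := by
    intro α β hαβ
    obtain ⟨i, hi⟩ := Function.ne_iff.mp hαβ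
    rw [dist_eq_norm]
    refine le_trans ?_ (abs_coord_le _ i)
    simp only [hposα, PiLp.sub_apply, ← mul_sub, abs_mul, abs_of_pos hΔ]
    refine le_mul_of_one_le_right hΔ.le ?_
    have : (1 : ℤ) ≤ |α i - β i| := Int.one_le_abs (sub_ne_zero.mpr hi)
    exact_mod_cast this
  have hsepξ : ∀ u v : Z.pts k, u ≠ v → √((2 : ℝ) ^ k) ≤ dist (u : Rn n) (v : Rn n) := by
    intro u v huv
    rw [sqrt_two_pow]
    exact (Z.separated k u u.2 v v.2 (fun e => huv (Subtype.ext e))).le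
  have b1 := h (Z.pts k) (fun u => (u : Rn n)) (√((2 : ℝ) ^ k)) (κ * s * (((2 : ℝ) ^ k)⁻¹) ^ 2) hq
    (by positivity) hsepξ ξ (F.image Prod.fst)
  have b2 := h (Fin n → ℤ) posα (spacing ε c k) (κ * s) hΔ (by positivity) hsepα x
    (F.image Prod.snd)
  have e1 : κ * s * (((2 : ℝ) ^ k)⁻¹) ^ 2 * √((2 : ℝ) ^ k) ^ 2 ≤ κ := by
    rw [hqs]
    have : κ * s * (((2 : ℝ) ^ k)⁻¹) ^ 2 * 2 ^ k = κ * (s / 2 ^ k) := by field_simp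
    rw [this]
    exact mul_le_of_le_one_right hκ.le ((div_le_one h2k).mpr hsk)
  have e2 : κ * s * spacing ε c k ^ 2 ≤ κ * c ^ 2 := by
    have h1 := sqrt_mul_spacing_le hε hc k
    have h3 : 2 ^ k * spacing ε c k ^ 2 ≤ c ^ 2 := by
      rw [← hqs, ← mul_pow]
      gcongr
    calc κ * s * spacing ε c k ^ 2 ≤ κ * 2 ^ k * spacing ε c k ^ 2 := by gcongr
      _ = κ * (2 ^ k * spacing ε c k ^ 2) := by ring
      _ ≤ _ := by gcongr
  calc ∑ p ∈ F, exp (-(κ * s * phaseSq k x ξ (pos ε c (⟨k, p⟩ : Index Z))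
        (freq (⟨k, p⟩ : Index Z)))) ≤ ∑ p ∈ F.image Prod.fst ×ˢ F.image Prod.snd,
          exp (-(κ * s * phaseSq k x ξ (pos ε c (⟨k, p⟩ : Index Z))
        (freq (⟨k, p⟩ : Index Z)))) :=
        Finset.sum_le_sum_of_subset_of_nonneg Finset.subset_product (fun _ _ _ => (exp_pos _).le)
    _ = (∑ u ∈ F.image Prod.fst, exp (-(κ * s * (((2 : ℝ) ^ k)⁻¹) ^ 2) *
          ‖(u : Rn n) - ξ‖ ^ 2)) * ∑ α ∈ F.image Prod.snd,
          exp (-(κ * s) * ‖posα α - x‖ ^ 2) := by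
        rw [Finset.sum_product, Finset.sum_mul_sum]
        refine sum_congr rfl fun u _ => sum_congr rfl fun α _ => ?_
        rw [← exp_add]
        congr 1
        simp only [phaseSq, freq, pos, hposα]
        rw [norm_sub_rev x, norm_sub_rev ξ]
        ring
    _ ≤ (C * exp κ * ((√((2 : ℝ) ^ k) * √(κ * s * (((2 : ℝ) ^ k)⁻¹) ^ 2))⁻¹) ^ n) *
        (C * exp (κ * c ^ 2) * ((spacing ε c k * √(κ * s))⁻¹) ^ n) := by
        refine mul_le_mul (b1.trans ?_) (b2.trans ?_)
          (sum_nonneg fun _ _ => (exp_pos _).le) (by positivity)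
        · gcongr
        · gcongr
    _ = _ := by
        have r1 : √(κ * s * (((2 : ℝ) ^ k)⁻¹) ^ 2) = √(κ * s) * ((2 : ℝ) ^ k)⁻¹ := by
          rw [sqrt_mul (by positivity), Real.sqrt_sq (by positivity)]
        have r2 : (√((2 : ℝ) ^ k) * (√(κ * s) * ((2 : ℝ) ^ k)⁻¹))⁻¹ * (spacing ε c k * √(κ * s))⁻¹ =
            (1 / κ) * (√((2 : ℝ) ^ k) / (s * spacing ε c k)) := by
          have r3 : √(κ * s) * √(κ * s) = κ * s := Real.mul_self_sqrt (by positivity)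
          have r4 : 0 < √(κ * s) := by positivity
          rw [← mul_inv]
          have r5 : √((2 : ℝ) ^ k) * (√(κ * s) * ((2 : ℝ) ^ k)⁻¹) * (spacing ε c k * √(κ * s)) =
              κ * s * spacing ε c k / √((2 : ℝ) ^ k) := by
            rw [eq_div_iff hq.ne']
            calc _ = √((2 : ℝ) ^ k) ^ 2 * (√(κ * s) * √(κ * s)) * ((2 : ℝ) ^ k)⁻¹ *
                spacing ε c k := by ring
              _ = _ := by rw [hqs, r3]; field_simp
          rw [r5]
          field_simp
        rw [r1]
        calc _ = C * exp κ * (C * exp (κ * c ^ 2)) *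
            ((√((2 : ℝ) ^ k) * (√(κ * s) * ((2 : ℝ) ^ k)⁻¹))⁻¹ *
              (spacing ε c k * √(κ * s))⁻¹) ^ n := by rw [mul_pow]; ring
          _ = _ := by rw [r2, mul_pow]; ring

/-- Gaussian sums over one level of a phase space family, about an arbitrary centre. The centre
is replaced by the nearest member of the family, and the family by the frame. -/
lemma sum_exp_phaseSq_le {n : ℕ} {ε c κ L : ℝ} (hε : 0 < ε) (hc : 0 < c) (hκ : 0 < κ)
    (hL : 0 < L) :
    ∃ C, 0 < C ∧ ∀ (Z : FrequencyNet n) (M : ℝ) (X Ξ : Index Z → Rn n),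
      PhaseFamily Z ε c M L X Ξ → ∀ (k : ℕ) (s : ℝ), 0 < s → s ≤ 2 ^ k → ∀ (x ξ : Rn n)
      (F : Finset (Z.pts k × (Fin n → ℤ))),
      ∑ p ∈ F, exp (-(κ * s * phaseSq k x ξ (X ⟨k, p⟩) (Ξ ⟨k, p⟩))) ≤
        C * (√((2 : ℝ) ^ k) / (s * spacing ε c k)) ^ n := by
  obtain ⟨C, hC, h⟩ := sum_exp_phaseSq_frame_le (n := n) hε hc (by positivity : 0 < κ / (4 * L))
  refine ⟨C, hC, ?_⟩
  intro Z M X Ξ hP k s hs hsk x ξ F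
  rcases F.eq_empty_or_nonempty with rfl | hF
  · rw [Finset.sum_empty]
    have := spacing_pos (ε := ε) hc k
    positivity
  obtain ⟨p₀, hp₀, hmin⟩ := F.exists_min_image (fun p => phaseSq k x ξ (X ⟨k, p⟩) (Ξ ⟨k, p⟩)) hF
  refine le_trans (sum_le_sum fun p hp => Real.exp_le_exp.mpr ?_)
    (h Z k s hs hsk (pos ε c (⟨k, p₀⟩ : Index Z)) (freq (⟨k, p₀⟩ : Index Z)) F)
  have h1 := hmin p hp
  have h2 := phaseSq_triangle k x ξ (X ⟨k, p₀⟩) (Ξ ⟨k, p₀⟩) (X ⟨k, p⟩) (Ξ ⟨k, p⟩)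
  have h3 := hP.spread k p₀ p
  have h4 : phaseSq k (pos ε c (⟨k, p₀⟩ : Index Z)) (freq (⟨k, p₀⟩ : Index Z))
      (pos ε c (⟨k, p⟩ : Index Z)) (freq (⟨k, p⟩ : Index Z)) ≤
      4 * L * phaseSq k x ξ (X ⟨k, p⟩) (Ξ ⟨k, p⟩) := by nlinarith
  rw [neg_le_neg_iff]
  calc κ / (4 * L) * s * _ ≤ κ / (4 * L) * s * (4 * L * phaseSq k x ξ (X ⟨k, p⟩) (Ξ ⟨k, p⟩)) := by
        gcongr
    _ = _ := by field_simp

end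

/-! ### Almost diagonal matrices -/

lemma exists_pow_mul_exp_le (p : ℕ) {κ : ℝ} (hκ : 0 < κ) :
    ∃ C, 0 < C ∧ ∀ x : ℝ, 0 ≤ x → x ^ p * exp (-(κ * x)) ≤ C := by
  refine ⟨p.factorial / κ ^ p, by positivity, fun x hx => ?_⟩
  have h := Real.pow_div_factorial_le_exp (κ * x) (by positivity) p
  rw [Real.exp_neg, ← div_eq_mul_inv, div_le_div_iff₀ (exp_pos _) (by positivity)]
  rw [div_le_iff₀ (by positivity), mul_pow] at h
  linarith

/-- An integer bounding the rate `1/2 + ε` at which the lattice spacing decreases. -/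
def spacingRate (ε : ℝ) : ℕ := ⌈1 / 2 + ε⌉₊

lemma spacing_le_mul {ε c : ℝ} (hε : 0 < ε) (hc : 0 < c) (j k : ℕ) :
    spacing ε c j ≤ (2 : ℝ) ^ (spacingRate ε * (k - j)) * spacing ε c k := by
  have hr : 1 / 2 + ε ≤ spacingRate ε := Nat.le_ceil _
  unfold spacing
  rw [mul_left_comm, ← rpow_natCast, ← rpow_add (by norm_num)]
  refine mul_le_mul_of_nonneg_left (Real.rpow_le_rpow_of_exponent_le (by norm_num) ?_) hc.le
  push_cast
  have h1 : (k : ℝ) - j ≤ ((k - j : ℕ) : ℝ) := by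
    rcases le_total j k with h | h
    · simp_all
    · simp_all
  have h2 : (0 : ℝ) ≤ ((k - j : ℕ) : ℝ) := by positivity
  nlinarith [mul_le_mul_of_nonneg_right hr h2]

/-- The distance of two levels. -/
def gap (j k : ℕ) : ℕ := (j - k) + (k - j)

lemma gap_comm (j k : ℕ) : gap j k = gap k j := by unfold gap; omega

/-- The size of the overlap of two Gaussians of the frequencies `ξ` and `ξ'`. -/
def overlap {n : ℕ} (δ δ' : ℝ) (x ξ x' ξ' : Rn n) : ℝ :=
  √(‖ξ‖ * δ / (2 * π)) ^ n * √(‖ξ'‖ * δ' / (2 * π)) ^ n *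
      (√(π / (‖ξ‖ + ‖ξ'‖)) ^ n * exp (-‖ξ' - ξ‖ ^ 2 / (4 * (‖ξ‖ + ‖ξ'‖)))) *
        exp (-(min ‖ξ‖ ‖ξ'‖ / 2 * ‖x - x'‖ ^ 2))

lemma overlap_comm {n : ℕ} (δ δ' : ℝ) (x ξ x' ξ' : Rn n) :
    overlap δ δ' x ξ x' ξ' = overlap δ' δ x' ξ' x ξ := by
  unfold overlap
  rw [add_comm ‖ξ‖, norm_sub_rev ξ', norm_sub_rev x, min_comm]
  ring

lemma norm_integral_gaussian_mul_le {n : ℕ} {δ δ' : ℝ} (hδ : 0 ≤ δ) (hδ' : 0 ≤ δ') (x : Rn n)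
    {ξ : Rn n} (hξ : ξ ≠ 0) (x' ξ' : Rn n) :
    ‖∫ y, conj (gaussian δ x ξ y) * gaussian δ' x' ξ' y‖ ≤ overlap δ δ' x ξ x' ξ' := by
  have h := norm_integral_gaussian_mul le_rfl hδ hδ' hξ (η' := ξ') (0 : Rn n) x x'
  simp only [neg_zero, zero_mul, Real.exp_zero, Complex.ofReal_one, one_mul, zero_add] at h
  rw [h, overlap]
  gcongr
  exact le_baryVar_zero (le_min (norm_nonneg _) (norm_nonneg _)) (min_le_left _ _)
    (min_le_right _ _) _ _ _

lemma overlap_amplitude_le {n : ℕ} {M δ δ' : ℝ} (hδ : 0 ≤ δ) (hδ' : 0 ≤ δ') {ξ ξ' : Rn n}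
    (hξ : 0 < ‖ξ‖) (hM : ‖ξ'‖ ≤ M) :
    √(‖ξ‖ * δ / (2 * π)) ^ n * √(‖ξ'‖ * δ' / (2 * π)) ^ n *
      √(π / (‖ξ‖ + ‖ξ'‖)) ^ n ≤ √(M * δ * δ') ^ n := by
  have hpi := Real.pi_gt_three
  have h0 := norm_nonneg ξ'
  have hM0 : 0 ≤ M := h0.trans hM
  rw [← mul_pow, ← mul_pow, ← sqrt_mul (by positivity), ← sqrt_mul (by positivity)]
  refine pow_le_pow_left₀ (sqrt_nonneg _) (Real.sqrt_le_sqrt ?_) n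
  rw [div_mul_div_comm, div_mul_div_comm, div_le_iff₀ (by positivity)]
  have h1 : ‖ξ‖ * ‖ξ'‖ ≤ M * (‖ξ‖ + ‖ξ'‖) := by nlinarith
  have h2 : π ≤ 2 * π * (2 * π) := by nlinarith
  calc ‖ξ‖ * δ * (‖ξ'‖ * δ') * π = (‖ξ‖ * ‖ξ'‖) * (δ * δ') * π := by ring
    _ ≤ (M * (‖ξ‖ + ‖ξ'‖)) * (δ * δ') * (2 * π * (2 * π)) := by gcongr
    _ = _ := by ring

/-- The frequency part of the overlap of a Gaussian of level `j` and one of a level `k` that is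
far from `j` is exponentially small. -/
lemma far_freq_le {n : ℕ} {M : ℝ} (hM : 1 ≤ M) {K₀ j k : ℕ} (hK₀ : 4 * M ^ 2 < 2 ^ K₀)
    (hjk : j + K₀ < k ∨ k + K₀ < j) {ξ ξ' : Rn n} (hξ : 0 < ‖ξ‖) (hl : (2 : ℝ) ^ j ≤ M * ‖ξ‖)
    (hu : ‖ξ‖ ≤ M * 2 ^ j) (hl' : (2 : ℝ) ^ k ≤ M * ‖ξ'‖) (hu' : ‖ξ'‖ ≤ M * 2 ^ k) :
    1 / (32 * M ^ 3) * 2 ^ max j k ≤ ‖ξ' - ξ‖ ^ 2 / (4 * (‖ξ‖ + ‖ξ'‖)) := by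
  have hM0 : 0 < M := by linarith
  have h2k : (0 : ℝ) < 2 ^ k := by positivity
  wlog h : j + K₀ < k generalizing j k ξ ξ'
  · have := this hjk.symm (pos_of_mul_pos_right (h2k.trans_le hl') hM0.le) hl' hu' hl hu
      (by positivity) (hjk.resolve_left h)
    rwa [max_comm, norm_sub_rev, add_comm ‖ξ‖]
  rw [max_eq_right (by omega), le_div_iff₀ (by positivity)]
  have h4 : 4 * M ^ 2 * 2 ^ j ≤ 2 ^ k := calc
    _ ≤ (2 : ℝ) ^ K₀ * 2 ^ j := by gcongr
    _ ≤ 2 ^ k := by rw [← pow_add]; exact pow_le_pow_right₀ one_le_two (by omega)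
  have hjk : (2 : ℝ) ^ j ≤ 2 ^ k := pow_le_pow_right₀ one_le_two (by omega)
  have a0 : (2 : ℝ) ^ k ≤ 2 * M * ‖ξ' - ξ‖ := by nlinarith [norm_sub_norm_le ξ' ξ]
  calc 1 / (32 * M ^ 3) * 2 ^ k * (4 * (‖ξ‖ + ‖ξ'‖)) ≤
        1 / (32 * M ^ 3) * 2 ^ k * (4 * (2 * M * 2 ^ k)) := by gcongr; nlinarith
    _ = (2 ^ k) ^ 2 / (4 * M ^ 2) := by field_simp; norm_num
    _ ≤ (2 * M * ‖ξ' - ξ‖) ^ 2 / (4 * M ^ 2) := by gcongr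
    _ = _ := by field_simp; ring

lemma near_exponent_le {n : ℕ} {M : ℝ} (hM : 1 ≤ M) {K₀ j k : ℕ} (hjk1 : j ≤ K₀ + k)
    (hjk2 : k ≤ K₀ + j) (x x' : Rn n) {ξ ξ' : Rn n} (hξ : 0 < ‖ξ‖)
    (hl : (2 : ℝ) ^ j ≤ M * ‖ξ‖)
    (hu : ‖ξ‖ ≤ M * 2 ^ j) (hl' : (2 : ℝ) ^ k ≤ M * ‖ξ'‖) (hu' : ‖ξ'‖ ≤ M * 2 ^ k) :
    1 / (4 * M * (2 ^ K₀ + 1)) * 2 ^ k * phaseSq k x ξ x' ξ' ≤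
      ‖ξ' - ξ‖ ^ 2 / (4 * (‖ξ‖ + ‖ξ'‖)) + min ‖ξ‖ ‖ξ'‖ / 2 * ‖x - x'‖ ^ 2 := by
  have hM0 : 0 < M := by linarith
  have h1 : (2 : ℝ) ^ j ≤ 2 ^ K₀ * 2 ^ k := by
    rw [← pow_add]; exact pow_le_pow_right₀ one_le_two hjk1
  have h2 : (2 : ℝ) ^ k ≤ 2 ^ K₀ * 2 ^ j := by
    rw [← pow_add]; exact pow_le_pow_right₀ one_le_two hjk2
  have hP : (1 : ℝ) ≤ 2 ^ K₀ := one_le_pow₀ one_le_two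
  set P : ℝ := 2 ^ K₀
  have h0 := norm_nonneg ξ'
  have a1 : ‖ξ‖ + ‖ξ'‖ ≤ M * (P + 1) * 2 ^ k := by nlinarith
  have a3 : 2 ^ k / (P * M) ≤ min ‖ξ‖ ‖ξ'‖ := by
    refine le_min ?_ ?_ <;> rw [div_le_iff₀ (by positivity)]
    · nlinarith
    · nlinarith [mul_le_mul_of_nonneg_right hP (mul_nonneg hM0.le h0)]
  rw [phaseSq, mul_add, norm_sub_rev ξ, add_comm (‖ξ' - ξ‖ ^ 2 / _)]
  refine add_le_add (mul_le_mul_of_nonneg_right ?_ (sq_nonneg _)) ?_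
  · calc 1 / (4 * M * (P + 1)) * 2 ^ k ≤ 1 / (2 * (P * M)) * 2 ^ k := by
          refine mul_le_mul_of_nonneg_right (one_div_le_one_div_of_le (by positivity) ?_)
            (by positivity)
          nlinarith [mul_nonneg hM0.le (zero_le_one.trans hP)]
      _ = 2 ^ k / (P * M) / 2 := by field_simp
      _ ≤ _ := by gcongr
  · calc _ = ‖ξ' - ξ‖ ^ 2 / (4 * (M * (P + 1) * 2 ^ k)) := by field_simp
      _ ≤ _ := by gcongr

/-- The overlaps of a Gaussian of level `j` with the Gaussians of level `k` of a phase space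
family: they are summable over the family, with a sum that decays rapidly in `|j - k|`. -/
lemma exists_sum_overlap_le (n : ℕ) {ε c M L : ℝ} (hε : 0 < ε) (hc : 0 < c) (hM : 1 ≤ M)
    (hL : 0 < L) :
    ∃ C, 0 < C ∧ ∀ (Z : FrequencyNet n) (X Ξ : Index Z → Rn n), PhaseFamily Z ε c M L X Ξ →
      ∀ (j k : ℕ) (x ξ : Rn n), (2 : ℝ) ^ j ≤ M * ‖ξ‖ → ‖ξ‖ ≤ M * (2 : ℝ) ^ j →
      ∀ F : Finset (Z.pts k × (Fin n → ℤ)),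
      ∑ p ∈ F, overlap (spacing ε c j) (spacing ε c k) x ξ (X ⟨k, p⟩) (Ξ ⟨k, p⟩) ≤
        C * (1 / 2 : ℝ) ^ gap j k := by
  have hM0 : 0 < M := by linarith
  obtain ⟨K₀, hK₀⟩ := pow_unbounded_of_one_lt (4 * M ^ 2) (by norm_num : (1 : ℝ) < 2)
  set q := spacingRate ε
  set κ₁ : ℝ := 1 / (4 * M * (2 ^ K₀ + 1)) with hκ₁
  set κ₂ : ℝ := 1 / (2 * M) with hκ₂
  set κ₃ : ℝ := 1 / (32 * M ^ 3) with hκ₃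
  obtain ⟨C₁, hC₁, h₁⟩ := sum_exp_phaseSq_le (n := n) (κ := κ₁) hε hc (by positivity) hL
  obtain ⟨C₂, hC₂, h₂⟩ := sum_exp_phaseSq_le (n := n) (κ := κ₂) hε hc (by positivity) hL
  obtain ⟨C₃, hC₃, h₃⟩ := exists_pow_mul_exp_le ((2 + q) * n + 1) (by positivity : 0 < κ₃)
  set A₁ : ℝ := √(M * 2 ^ (q * K₀)) ^ n * C₁ * 2 ^ (2 * K₀) with hA₁
  set A₂ : ℝ := √M ^ n * (C₂ * exp (κ₂ * M ^ 2)) * C₃ with hA₂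
  refine ⟨A₁ + A₂, by positivity, ?_⟩
  intro Z X Ξ hP j k x ξ hl hu F
  have hA₁0 : 0 < A₁ := by positivity
  have hA₂0 : 0 < A₂ := by positivity
  have h2k : (0 : ℝ) < 2 ^ k := by positivity
  have hξ : 0 < ‖ξ‖ := pos_of_mul_pos_right (lt_of_lt_of_le (by positivity) hl) hM0.le
  have hΔj := spacing_pos (ε := ε) hc j
  have hΔk := spacing_pos (ε := ε) hc k
  set δ := spacing ε c k
  have hsq : √((2 : ℝ) ^ k) ^ 2 = 2 ^ k := sq_sqrt h2k.le
  have key : ∀ r : ℕ, k - j ≤ r → ∀ v : Z.pts k × (Fin n → ℤ) → ℝ,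
      (∀ p, v p ≤ ‖Ξ ⟨k, p⟩ - ξ‖ ^ 2 / (4 * (‖ξ‖ + ‖Ξ ⟨k, p⟩‖)) +
        min ‖ξ‖ ‖Ξ ⟨k, p⟩‖ / 2 * ‖x - X ⟨k, p⟩‖ ^ 2) →
      ∑ p ∈ F, overlap (spacing ε c j) δ x ξ (X ⟨k, p⟩) (Ξ ⟨k, p⟩) ≤
        √(M * 2 ^ (q * r)) ^ n * ((√((2 : ℝ) ^ k) * δ) ^ n * ∑ p ∈ F, exp (-v p)) := by
    intro r hr v hv
    rw [← mul_assoc, mul_sum]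
    refine sum_le_sum fun p _ => ?_
    unfold overlap
    rw [← mul_assoc, mul_assoc _ (exp _), ← exp_add, neg_div, ← neg_add]
    refine mul_le_mul ((overlap_amplitude_le hΔj.le hΔk.le hξ (hP.upper ⟨k, p⟩)).trans ?_)
      (Real.exp_le_exp.mpr (neg_le_neg (hv p))) (exp_pos _).le (by positivity)
    have h3 : spacing ε c j ≤ 2 ^ (q * r) * δ :=
      (spacing_le_mul hε hc j k).trans (by gcongr; norm_num)
    calc √(M * 2 ^ k * spacing ε c j * δ) ^ n ≤ √(M * 2 ^ k * (2 ^ (q * r) * δ) * δ) ^ n := by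
          gcongr
      _ = √(M * 2 ^ (q * r) * 2 ^ k * δ ^ 2) ^ n := by ring_nf
      _ = _ := by
        rw [sqrt_mul (by positivity), sqrt_mul (by positivity), Real.sqrt_sq hΔk.le, ← mul_pow,
          mul_assoc]
  by_cases hjk : j ≤ K₀ + k ∧ k ≤ K₀ + j
  · -- comparable levels: one sum over the phase space, at the scale of level `k`
    have e3 : √((2 : ℝ) ^ k) * δ * (√((2 : ℝ) ^ k) / (2 ^ k * δ)) = 1 := by
      field_simp
      exact hsq
    have e4 : 1 ≤ (2 : ℝ) ^ (2 * K₀) * (1 / 2 : ℝ) ^ gap j k := by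
      rw [one_div, inv_pow, ← div_eq_mul_inv, le_div_iff₀ (by positivity), one_mul]
      exact pow_le_pow_right₀ one_le_two (by unfold gap; omega)
    calc _ ≤ _ := key K₀ (by omega) _ fun p => near_exponent_le hM hjk.1 hjk.2 x _ hξ hl hu
          (hP.lower ⟨k, p⟩) (hP.upper ⟨k, p⟩)
      _ ≤ √(M * 2 ^ (q * K₀)) ^ n * ((√((2 : ℝ) ^ k) * δ) ^ n *
          (C₁ * (√((2 : ℝ) ^ k) / (2 ^ k * δ)) ^ n)) := by
        gcongr
        exact h₁ Z M X Ξ hP k (2 ^ k) h2k le_rfl x ξ F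
      _ = √(M * 2 ^ (q * K₀)) ^ n * C₁ *
          (√((2 : ℝ) ^ k) * δ * (√((2 : ℝ) ^ k) / (2 ^ k * δ))) ^ n := by
        rw [mul_pow _ (√((2 : ℝ) ^ k) / (2 ^ k * δ))]
        ring
      _ ≤ √(M * 2 ^ (q * K₀)) ^ n * C₁ * (2 ^ (2 * K₀) * (1 / 2 : ℝ) ^ gap j k) := by
        rw [e3, one_pow]
        gcongr
      _ = A₁ * (1 / 2 : ℝ) ^ gap j k := by ring
      _ ≤ _ := by gcongr; linarith
  · -- distant levels: the gap between the frequencies gives a factor `exp (-κ₃ 2^m)`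
    set m := max j k with hm
    have h2m : (0 : ℝ) < 2 ^ m := by positivity
    have e1 : ∀ p, κ₃ * 2 ^ m + (-(κ₂ * M ^ 2) +
        κ₂ * 1 * phaseSq k x 0 (X ⟨k, p⟩) (Ξ ⟨k, p⟩)) ≤
        ‖Ξ ⟨k, p⟩ - ξ‖ ^ 2 / (4 * (‖ξ‖ + ‖Ξ ⟨k, p⟩‖)) +
        min ‖ξ‖ ‖Ξ ⟨k, p⟩‖ / 2 * ‖x - X ⟨k, p⟩‖ ^ 2 := by
      intro p
      have hup := hP.upper ⟨k, p⟩
      have hlo := hP.lower ⟨k, p⟩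
      simp only at hup hlo
      have a2 := far_freq_le hM hK₀ (by omega : j + K₀ < k ∨ k + K₀ < j) hξ hl hu hlo hup
      have a4 : κ₂ ≤ min ‖ξ‖ ‖Ξ ⟨k, p⟩‖ / 2 := by
        rw [hκ₂, ← div_div, div_right_comm]
        gcongr
        have h1 : ∀ i : ℕ, (1 : ℝ) ≤ 2 ^ i := fun i => one_le_pow₀ one_le_two
        refine le_min ?_ ?_ <;> rw [div_le_iff₀ hM0] <;> linarith [h1 j, h1 k]
      have a5 := mul_le_mul_of_nonneg_right a4 (sq_nonneg ‖x - X ⟨k, p⟩‖)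
      have a6 : (((2 : ℝ) ^ k)⁻¹ * ‖0 - Ξ ⟨k, p⟩‖) ^ 2 ≤ M ^ 2 := by
        rw [zero_sub, norm_neg]
        refine pow_le_pow_left₀ (by positivity) ?_ 2
        rw [inv_mul_le_iff₀ h2k]
        linarith
      rw [phaseSq]
      nlinarith [mul_le_mul_of_nonneg_left a6 (by positivity : 0 ≤ κ₂)]
    have r0 : √(M * 2 ^ (q * k)) * ((√((2 : ℝ) ^ k) * δ) * (√((2 : ℝ) ^ k) / (1 * δ))) ≤
        √M * (2 ^ m) ^ (2 + q) := calc
      _ = √M * (√((2 : ℝ) ^ (q * k)) * 2 ^ k) := by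
        rw [sqrt_mul hM0.le]
        field_simp
        rw [hsq]
      _ ≤ √M * (2 ^ (q * k) * 2 ^ k) := by
        gcongr
        exact Real.sqrt_le_self_iff.mpr (Or.inr (one_le_pow₀ one_le_two))
      _ ≤ _ := by
        rw [← pow_add, ← pow_mul]
        gcongr
        · norm_num
        · nlinarith [le_max_right j k]
    calc _ ≤ _ := key k (by omega) _ e1
      _ = (√(M * 2 ^ (q * k)) * (√((2 : ℝ) ^ k) * δ)) ^ n * (exp (-(κ₃ * 2 ^ m)) *
          (exp (κ₂ * M ^ 2) *
          ∑ p ∈ F, exp (-(κ₂ * 1 * phaseSq k x 0 (X ⟨k, p⟩) (Ξ ⟨k, p⟩))))) := by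
        simp only [neg_add, exp_add, neg_neg, ← mul_sum, mul_pow, mul_assoc]
      _ ≤ (√(M * 2 ^ (q * k)) * (√((2 : ℝ) ^ k) * δ)) ^ n * (exp (-(κ₃ * 2 ^ m)) *
          (exp (κ₂ * M ^ 2) * (C₂ * (√((2 : ℝ) ^ k) / (1 * δ)) ^ n))) := by
        gcongr
        exact h₂ Z M X Ξ hP k 1 one_pos (one_le_pow₀ one_le_two) x 0 F
      _ = (√(M * 2 ^ (q * k)) * ((√((2 : ℝ) ^ k) * δ) * (√((2 : ℝ) ^ k) / (1 * δ)))) ^ n *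
          (C₂ * exp (κ₂ * M ^ 2) * exp (-(κ₃ * 2 ^ m))) := by
        simp only [mul_pow]; ring
      _ ≤ (√M * (2 ^ m) ^ (2 + q)) ^ n * (C₂ * exp (κ₂ * M ^ 2) * exp (-(κ₃ * 2 ^ m))) := by
        gcongr
      _ = √M ^ n * (C₂ * exp (κ₂ * M ^ 2)) *
          ((2 ^ m) ^ ((2 + q) * n + 1) * exp (-(κ₃ * 2 ^ m))) * (1 / 2 : ℝ) ^ m := by
        have e5 : (2 : ℝ) ^ m * (1 / 2 : ℝ) ^ m = 1 := by rw [← mul_pow]; norm_num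
        rw [pow_succ ((2 : ℝ) ^ m), pow_mul ((2 : ℝ) ^ m), mul_pow]
        linear_combination (-(√M ^ n * ((2 ^ m) ^ (2 + q)) ^ n *
          (C₂ * exp (κ₂ * M ^ 2)) * exp (-(κ₃ * 2 ^ m)))) * e5
      _ ≤ A₂ * (1 / 2 : ℝ) ^ gap j k := by
        have e6 : (1 / 2 : ℝ) ^ m ≤ (1 / 2 : ℝ) ^ gap j k :=
          pow_le_pow_of_le_one (by norm_num) (by norm_num) (by unfold gap; omega)
        rw [hA₂]
        gcongr
        exact h₃ _ h2m.le
      _ ≤ _ := by gcongr; linarith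

lemma sum_pow_gap_le {ρ : ℝ} (h0 : 0 ≤ ρ) (h1 : ρ < 1) (j : ℕ) (F : Finset ℕ) :
    ∑ k ∈ F, ρ ^ gap j k ≤ 2 * (1 - ρ)⁻¹ := by
  have key : ∀ (G : Finset ℕ) (e : ℕ → ℕ), Set.InjOn e G → ∑ k ∈ G, ρ ^ e k ≤ (1 - ρ)⁻¹ := by
    intro G e he
    rw [← Finset.sum_image (f := fun i => ρ ^ i) he, ← tsum_geometric_of_lt_one h0 h1]
    exact (summable_geometric_of_lt_one h0 h1).sum_le_tsum _ (fun _ _ => pow_nonneg h0 _)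
  rw [← Finset.sum_filter_add_sum_filter_not F (fun k => j ≤ k), two_mul]
  refine add_le_add (key _ _ ?_) (key _ _ ?_)
  · intro a ha b hb hab
    simp only [Finset.coe_filter, Set.mem_ofPred_eq] at ha hb
    simp only [gap] at hab
    omega
  · intro a ha b hb hab
    simp only [Finset.coe_filter, Set.mem_ofPred_eq] at ha hb
    simp only [gap] at hab
    omega

lemma PhaseFamily.mono {n : ℕ} {Z : FrequencyNet n} {ε c M M' L L' : ℝ} {X Ξ : Index Z → Rn n}
    (h : PhaseFamily Z ε c M L X Ξ) (hM : M ≤ M') (hL : L ≤ L') : PhaseFamily Z ε c M' L' X Ξ :=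
  ⟨fun γ => (h.lower γ).trans (by gcongr),
    fun γ => (h.upper γ).trans (by gcongr),
    fun k p p' => (h.spread k p p').trans
      (mul_le_mul_of_nonneg_right hL (phaseSq_nonneg _ _ _ _ _))⟩

lemma tsum_enorm_le_of_level {n : ℕ} {Z : FrequencyNet n} {C : ℝ} (hC : 0 ≤ C) (j : ℕ)
    (u : Index Z → ℂ) (v : Index Z → ℝ) (huv : ∀ γ, ‖u γ‖ ≤ v γ)
    (h : ∀ k, ∀ F : Finset (Z.pts k × (Fin n → ℤ)), ∑ p ∈ F, v ⟨k, p⟩ ≤ C * (1 / 2 : ℝ) ^ gap j k) :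
    ∑' γ, ‖u γ‖ₑ ≤ ofReal (4 * C) := by
  have hv : ∀ γ, 0 ≤ v γ := fun γ => (norm_nonneg _).trans (huv γ)
  rw [ENNReal.tsum_sigma']
  have h1 : ∀ k, ∑' p, ‖u ⟨k, p⟩‖ₑ ≤ ofReal (C * (1 / 2 : ℝ) ^ gap j k) := by
    intro k
    rw [ENNReal.tsum_eq_iSup_sum]
    refine iSup_le fun F => ?_
    calc ∑ p ∈ F, ‖u ⟨k, p⟩‖ₑ ≤ ∑ p ∈ F, ofReal (v ⟨k, p⟩) :=
          sum_le_sum fun p _ => by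
            rw [← ofReal_norm]; bound
      _ = ofReal (∑ p ∈ F, v ⟨k, p⟩) := (ofReal_sum_of_nonneg fun p _ => hv _).symm
      _ ≤ _ := ofReal_le_ofReal (h k F)
  refine (ENNReal.tsum_le_tsum h1).trans ?_
  rw [ENNReal.tsum_eq_iSup_sum]
  refine iSup_le fun F => ?_
  rw [← ofReal_sum_of_nonneg fun p _ => by positivity, ← mul_sum]
  refine ofReal_le_ofReal ?_
  have := sum_pow_gap_le (ρ := 1 / 2) (by norm_num) (by norm_num) j F
  norm_num at this
  norm_num
  nlinarith

/-- The row and column sums of the matrix of `E(t)` are bounded, uniformly in time. -/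
lemma WaveBound.exists_tsum_bE_le {n : ℕ} {ε c T K : ℝ} {Z : FrequencyNet n}
    {a : ℝ → Rn n → Matrix (Fin n) (Fin n) ℝ} (h : WaveBound T a K) (hε : 0 < ε) (hc : 0 < c)
    (hT : 0 < T) :
    ∃ C : ℝ≥0, ∀ t ∈ Icc (-T) T, (∀ γ : Index Z, ∑' γ' : Index Z, ‖bE ε c T a t γ γ'‖ₑ ≤ C) ∧
      (∀ γ' : Index Z, ∑' γ : Index Z, ‖bE ε c T a t γ γ'‖ₑ ≤ C) := by
  obtain ⟨M₀, L₀, hM, hL, hflow⟩ := h.exists_phaseFamily hT Z ε c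
  set M := max M₀ 2
  set L := max L₀ 1
  obtain ⟨C, hC, hsum⟩ := exists_sum_overlap_le n (M := M) (L := L) hε hc
    (hM.trans (le_max_left _ _)) (by positivity)
  refine ⟨(4 * C).toNNReal, fun t ht => ⟨fun γ => ?_, fun γ' => ?_⟩⟩
  · refine tsum_enorm_le_of_level hC.le γ.1 _ (fun γ' => overlap (spacing ε c γ.1)
      (spacing ε c γ'.1) (pos ε c γ) (freq γ) (framePath ε c T a γ' t).1
      (framePath ε c T a γ' t).2) (fun γ' => ?_) fun k F => ?_
    · exact norm_integral_gaussian_mul_le (spacing_pos hc _).le (spacing_pos hc _).le _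
        (freq_ne_zero γ) _ _
    · have hF := (phaseFamily_frame Z ε c).mono (le_max_right M₀ 2) (le_max_right L₀ 1)
      exact hsum Z _ _ ((hflow t ht).mono (le_max_left _ _) (le_max_left _ _)) γ.1 k _ _
        (hF.lower γ) (hF.upper γ) F
  · refine tsum_enorm_le_of_level hC.le γ'.1 _ (fun γ => overlap (spacing ε c γ.1)
      (spacing ε c γ'.1) (pos ε c γ) (freq γ) (framePath ε c T a γ' t).1
      (framePath ε c T a γ' t).2) (fun γ => ?_) fun k F => ?_
    · exact norm_integral_gaussian_mul_le (spacing_pos hc _).le (spacing_pos hc _).le _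
        (freq_ne_zero γ) _ _
    · have hF := (hflow t ht).mono (le_max_left M₀ 2) (le_max_left L₀ 1)
      simp only [overlap_comm (spacing ε c k)]
      exact hsum Z _ _ ((phaseFamily_frame Z ε c).mono (le_max_right _ _) (le_max_right _ _))
        γ'.1 k _ _ (hF.lower γ') (hF.upper γ') F

/-! ### Sums of modulated Gaussians of one level -/

lemma sum_mul_mul_le_of_row_sum_le {ι : Type*} (F : Finset ι) (u : ι → ℝ) {H : ι → ι → ℝ} {R : ℝ}
    (h0 : ∀ i j, 0 ≤ H i j) (hs : ∀ i j, H i j = H j i) (hR : ∀ i ∈ F, ∑ j ∈ F, H i j ≤ R) :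
    ∑ i ∈ F, ∑ j ∈ F, u i * u j * H i j ≤ R * ∑ i ∈ F, u i ^ 2 := by
  have h1 : ∑ i ∈ F, ∑ j ∈ F, u i ^ 2 * H i j ≤ R * ∑ i ∈ F, u i ^ 2 := by
    simp_rw [mul_sum, ← mul_sum F _ (_ ^ 2), mul_comm R]
    exact sum_le_sum fun i hi => mul_le_mul_of_nonneg_left (hR i hi) (sq_nonneg _)
  have h2 : ∑ i ∈ F, ∑ j ∈ F, u j ^ 2 * H i j = ∑ i ∈ F, ∑ j ∈ F, u i ^ 2 * H i j := by
    rw [Finset.sum_comm]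
    simp_rw [hs]
  calc _ ≤ ∑ i ∈ F, ∑ j ∈ F, (u i ^ 2 * H i j + u j ^ 2 * H i j) / 2 := by
        gcongr with i _ j _
        nlinarith [mul_nonneg (sq_nonneg (u i - u j)) (h0 i j)]
    _ ≤ _ := by
        simp_rw [← Finset.sum_div, sum_add_distrib]
        linarith

/-- Schur's test for the Gram matrix of the functions `G p` in a weighted `L²` space. -/
lemma lintegral_mul_enorm_sum_sq_le {n : ℕ} {ι : Type*} (F : Finset ι) (β : ι → ℂ)
    (G : ι → Rn n → ℂ) {w : Rn n → ℝ} (hw : ∀ x, 0 ≤ w x)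
    (hint : ∀ p p', Integrable fun x => (w x : ℂ) * (conj (G p x) * G p' x)) {A R : ℝ}
    (hA : 0 ≤ A) {g : ι → ℝ} {H : ι → ι → ℝ} (h0 : ∀ p p', 0 ≤ H p p')
    (hs : ∀ p p', H p p' = H p' p) (hR : ∀ p ∈ F, ∑ p' ∈ F, H p p' ≤ R)
    (hK : ∀ p p', ‖∫ x, (w x : ℂ) * (conj (G p x) * G p' x)‖ ≤ A * (g p * g p' * H p p')) :
    ∫⁻ x, ofReal (w x) * ‖∑ p ∈ F, β p * G p x‖ₑ ^ 2 ≤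
      ofReal (A * (R * ∑ p ∈ F, (‖β p‖ * g p) ^ 2)) := by
  have hexp : ∀ x, ((w x * ‖∑ p ∈ F, β p * G p x‖ ^ 2 : ℝ) : ℂ) =
      ∑ p ∈ F, ∑ p' ∈ F, (conj (β p) * β p') * ((w x : ℂ) * (conj (G p x) * G p' x)) := by
    intro x
    push_cast
    rw [← Complex.conj_mul', map_sum, Finset.sum_mul_sum]
    simp_rw [mul_sum, map_mul]
    exact sum_congr rfl fun p _ => sum_congr rfl fun p' _ => by ring
  have hp := fun p p' => (hint p p').const_mul (conj (β p) * β p')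
  have hI : Integrable fun x => ((w x * ‖∑ p ∈ F, β p * G p x‖ ^ 2 : ℝ) : ℂ) := by
    simp_rw [hexp]
    exact integrable_finsetSum _ fun p _ => integrable_finsetSum _ fun p' _ => hp p p'
  have h0' : ∀ x, 0 ≤ w x * ‖∑ p ∈ F, β p * G p x‖ ^ 2 := fun x =>
    mul_nonneg (hw x) (by positivity)
  have hI' : Integrable fun x => w x * ‖∑ p ∈ F, β p * G p x‖ ^ 2 := hI.re
  simp_rw [← ofReal_norm, ← ofReal_pow (norm_nonneg _), ← ofReal_mul (hw _)]
  rw [← ofReal_integral_eq_lintegral_ofReal hI' (.of_forall h0')]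
  refine ofReal_le_ofReal ?_
  rw [← abs_of_nonneg (integral_nonneg h0'), ← norm_eq_abs, ← norm_real,
    ← integral_complex_ofReal]
  simp_rw [hexp]
  rw [integral_finsetSum _ fun p _ => integrable_finsetSum _ fun p' _ => hp p p']
  refine le_trans ?_ (mul_le_mul_of_nonneg_left
    (sum_mul_mul_le_of_row_sum_le F (fun p => ‖β p‖ * g p) h0 hs hR) hA)
  rw [mul_sum]
  refine (norm_sum_le _ _).trans (sum_le_sum fun p _ => ?_)
  rw [integral_finsetSum _ fun p' _ => hp p p', mul_sum]
  refine (norm_sum_le _ _).trans (sum_le_sum fun p' _ => ?_)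
  rw [integral_const_mul, norm_mul, norm_mul, RCLike.norm_conj]
  exact (mul_le_mul_of_nonneg_left (hK p p') (by positivity)).trans_eq (by ring)

lemma norm_gaussian {n : ℕ} {δ : ℝ} (hδ : 0 ≤ δ) (y η x : Rn n) :
    ‖gaussian δ y η x‖ = √(‖η‖ * δ / (2 * π)) ^ n * exp (-(‖η‖ * ‖x - y‖ ^ 2)) := by
  have h0 : 0 ≤ ‖η‖ * δ / (2 * π) := by positivity
  rw [gaussian, rpow_half_eq h0, norm_mul, Complex.norm_exp, norm_real, norm_eq_abs,
    abs_of_nonneg (by positivity)]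
  congr 2
  rw [Complex.sub_re, Complex.ofReal_re, Complex.re_mul_ofReal, Complex.I_re]
  ring

lemma integrable_exp_mul_gaussian_mul {n : ℕ} {δ μ : ℝ} (hμ : 0 ≤ μ) (y y' z : Rn n) {η η' : Rn n}
    (hη : η ≠ 0) (hη' : η' ≠ 0) :
    Integrable fun x => (exp (-μ * ‖x - z‖ ^ 2) : ℂ) *
      (conj (gaussian δ y η x) * gaussian δ y' η' x) := by
  have h1 := (memLp_gaussian δ y hη).star.integrable_mul (memLp_gaussian δ y' hη') (p := 2) (q := 2)
  refine h1.bdd_mul (c := 1) ?_ ?_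
  · exact (Complex.continuous_ofReal.comp (by fun_prop)).aestronglyMeasurable
  · refine .of_forall fun x => ?_
    rw [norm_real, norm_eq_abs, abs_of_pos (exp_pos _)]
    exact Real.exp_le_one_iff.mpr (by nlinarith [sq_nonneg ‖x - z‖])

/-- A Gaussian localization of the `L²` norm of a sum of Gaussians of one level only sees the
Gaussians that are concentrated nearby. -/
lemma exists_localized_sum_le (n : ℕ) {ε c M L : ℝ} (hε : 0 < ε) (hc : 0 < c) (hM : 1 ≤ M)
    (hL : 0 < L) :
    ∃ C, 0 < C ∧ ∀ (Z : FrequencyNet n) (X Ξ : Index Z → Rn n), PhaseFamily Z ε c M L X Ξ →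
      ∀ (k : ℕ) (z : Rn n) (F : Finset (Z.pts k × (Fin n → ℤ))) (β : Z.pts k × (Fin n → ℤ) → ℂ),
      ∫⁻ x, ofReal (exp (-2 ^ k * ‖x - z‖ ^ 2)) *
        ‖∑ p ∈ F, β p * gaussian (spacing ε c k) (X ⟨k, p⟩) (Ξ ⟨k, p⟩) x‖ₑ ^ 2 ≤
      ofReal (C * ∑ p ∈ F, (‖β p‖ *
        exp (-(2 ^ k / (8 * M) * ‖z - X ⟨k, p⟩‖ ^ 2))) ^ 2) := by
  have hM0 : 0 < M := by linarith
  obtain ⟨C₁, hC₁, h₁⟩ := sum_exp_phaseSq_le (n := n) (κ := 1 / (16 * M)) hε hc (by positivity) hL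
  refine ⟨√M ^ n * C₁, by positivity, fun Z X Ξ hP k z F β => ?_⟩
  have h2k : (0 : ℝ) < 2 ^ k := by positivity
  have hΔ := spacing_pos (ε := ε) hc k
  set Δ := spacing ε c k
  have hΞ : ∀ p, 0 < ‖Ξ ⟨k, p⟩‖ := fun p =>
    pos_of_mul_pos_right (lt_of_lt_of_le h2k (hP.lower ⟨k, p⟩)) hM0.le
  have hA : √(M * 2 ^ k * Δ * Δ) ^ n * (C₁ * (√((2 : ℝ) ^ k) / (2 ^ k * Δ)) ^ n) =
      √M ^ n * C₁ := by
    have hsq : √((2 : ℝ) ^ k) ^ 2 = 2 ^ k := sq_sqrt h2k.le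
    rw [mul_left_comm, ← mul_pow, mul_comm C₁, mul_assoc (M * 2 ^ k), sqrt_mul (by positivity),
      sqrt_mul (by positivity), Real.sqrt_mul_self hΔ.le]
    congr 2
    field_simp
    rw [hsq]
  rw [← hA, mul_assoc]
  refine lintegral_mul_enorm_sum_sq_le F β (fun p => gaussian Δ (X ⟨k, p⟩) (Ξ ⟨k, p⟩))
    (H := fun p p' => exp (-(1 / (16 * M) * 2 ^ k *
      phaseSq k (X ⟨k, p⟩) (Ξ ⟨k, p⟩) (X ⟨k, p'⟩) (Ξ ⟨k, p'⟩))))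
    (fun x => (exp_pos _).le) (fun p p' => integrable_exp_mul_gaussian_mul h2k.le _ _ _
      (norm_pos_iff.mp (hΞ p)) (norm_pos_iff.mp (hΞ p'))) (by positivity)
    (fun _ _ => (exp_pos _).le) (fun p p' => ?_)
    (fun p _ => h₁ Z M X Ξ hP k (2 ^ k) h2k le_rfl _ _ F) (fun p p' => ?_)
  · simp only [phaseSq, norm_sub_rev (X ⟨k, p⟩), norm_sub_rev (Ξ ⟨k, p⟩)]
  rw [norm_integral_gaussian_mul h2k.le hΔ.le hΔ.le (norm_pos_iff.mp (hΞ p))]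
  have hp := hP.upper ⟨k, p⟩
  have hp' := hP.upper ⟨k, p'⟩
  have hl := hP.lower ⟨k, p⟩
  have hl' := hP.lower ⟨k, p'⟩
  have hξ := hΞ p
  have hξ' := hΞ p'
  simp only at hp hp' hl hl'
  set ξ := Ξ ⟨k, p⟩
  set ξ' := Ξ ⟨k, p'⟩
  set x := X ⟨k, p⟩
  set x' := X ⟨k, p'⟩
  have b2 := overlap_amplitude_le (n := n) hΔ.le hΔ.le hξ hp'
  have h2M : (2 : ℝ) ^ k ≤ M * 2 ^ k := le_mul_of_one_le_left h2k.le hM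
  have b3 : 2 ^ k / M / 4 * (‖z - x‖ ^ 2 + ‖z - x'‖ ^ 2) ≤ baryVar (2 ^ k) ‖ξ‖ ‖ξ'‖ z x x' := by
    refine le_baryVar (by positivity) ?_ ?_ ?_ _ _ _ <;> rw [div_le_iff₀ hM0] <;> linarith
  have b4 : 1 / (16 * M) * 2 ^ k * (((2 : ℝ) ^ k)⁻¹ * ‖ξ - ξ'‖) ^ 2 ≤
      ‖ξ' - ξ‖ ^ 2 / (4 * (2 ^ k + ‖ξ‖ + ‖ξ'‖)) := by
    rw [norm_sub_rev]
    calc _ = ‖ξ' - ξ‖ ^ 2 / (4 * (4 * M * 2 ^ k)) := by field_simp; ring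
      _ ≤ _ := by gcongr; linarith
  have b5 : ‖x - x'‖ ^ 2 ≤ 2 * (‖z - x‖ ^ 2 + ‖z - x'‖ ^ 2) := by
    have := norm_sub_le (z - x') (z - x)
    rw [sub_sub_sub_cancel_left] at this
    nlinarith [sq_nonneg (‖z - x'‖ - ‖z - x‖), norm_nonneg (x - x')]
  have b6 := mul_le_mul_of_nonneg_left b5 (by positivity : 0 ≤ 1 / (16 * M) * 2 ^ k)
  have b7 : 2 ^ k / M / 4 * (‖z - x‖ ^ 2 + ‖z - x'‖ ^ 2) = 2 ^ k / (8 * M) * ‖z - x‖ ^ 2 +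
      2 ^ k / (8 * M) * ‖z - x'‖ ^ 2 +
      1 / (16 * M) * 2 ^ k * (2 * (‖z - x‖ ^ 2 + ‖z - x'‖ ^ 2)) := by ring
  rw [← mul_assoc, mul_assoc _ (exp _)]
  refine mul_le_mul (le_trans (by gcongr; linarith) b2) ?_ (by positivity) (by positivity)
  rw [← exp_add, ← exp_add, ← exp_add, phaseSq, neg_div]
  exact Real.exp_le_exp.mpr (by linarith)

section

/-! ### Multipliers of a given order -/

lemma exists_one_add_pow_mul_exp_le (p : ℕ) {κ : ℝ} (hκ : 0 < κ) :
    ∃ C, 0 < C ∧ ∀ s : ℝ, 0 ≤ s → (1 + s) ^ p * exp (-(κ * s ^ 2)) ≤ C := by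
  refine ⟨p.factorial * exp (1 + 1 / (4 * κ)), by positivity, fun s hs => ?_⟩
  have h := Real.pow_div_factorial_le_exp (1 + s) (by positivity) p
  rw [div_le_iff₀ (by positivity)] at h
  have h1 : 1 + s - κ * s ^ 2 ≤ 1 + 1 / (4 * κ) := by
    have e : 1 / (4 * κ) - s + κ * s ^ 2 = κ * (s - 1 / (2 * κ)) ^ 2 := by field_simp; ring
    have := mul_nonneg hκ.le (sq_nonneg (s - 1 / (2 * κ)))
    linarith
  calc (1 + s) ^ p * exp (-(κ * s ^ 2)) ≤
      exp (1 + s) * p.factorial * exp (-(κ * s ^ 2)) := by gcongr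
    _ = p.factorial * exp (1 + s - κ * s ^ 2) := by rw [sub_eq_add_neg, exp_add (1 + s)]; ring
    _ ≤ _ := by gcongr

/-- The scale `2^(k/2)`: the frequency localization of the frame functions of level `k`, and the
inverse of their spatial width. -/
def scale (k : ℕ) : ℝ := √(2 ^ k)

lemma scale_pos (k : ℕ) : 0 < scale k := Real.sqrt_pos.mpr (by positivity)

lemma scale_sq (k : ℕ) : scale k ^ 2 = 2 ^ k := sq_sqrt (by positivity)

lemma one_le_scale (k : ℕ) : 1 ≤ scale k :=
  Real.one_le_sqrt.mpr (one_le_pow₀ (by norm_num))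

/-- Functions on `ℝⁿ` indexed by the frame, depending on parameters `θ ∈ Θ` as well. -/
abbrev Amplitude {n : ℕ} (Z : FrequencyNet n) (Θ : Type*) := Θ → Index Z → Rn n → ℂ

variable {n : ℕ} {Z : FrequencyNet n} {Θ : Type*} {X Ξ : Θ → Index Z → Rn n}
  {m m' : ℤ} {f g : Amplitude Z Θ}

/-- A family of multipliers `f_γ(x)`, depending on parameters `θ` as well, is of order `m / 2`
relative to the positions `X_γ` when near any point `z` it separates into finitely many products
`α(γ) μ(x)`, where `α(γ)` has the size `2^(mk/2)` and both factors grow polynomially in the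
distances from `z`, measured in the unit `2^(-k/2)`. -/
def IsMultiplier (X : Θ → Index Z → Rn n) (m : ℤ) (f : Amplitude Z Θ) : Prop :=
  ∃ (ι : Type) (_ : Fintype ι) (p : ℕ) (A : ℝ), 0 < A ∧ ∀ θ k (z : Rn n),
    ∃ (μ : ι → Rn n → ℂ) (α : ι → Z.pts k × (Fin n → ℤ) → ℂ), (∀ ν, Measurable (μ ν)) ∧
      (∀ q x, f θ ⟨k, q⟩ x = ∑ ν, α ν q * μ ν x) ∧
      (∀ ν x, ‖μ ν x‖ ≤ A * (1 + scale k * ‖x - z‖) ^ p) ∧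
      (∀ ν q, ‖α ν q‖ ≤ A * scale k ^ m * (1 + scale k * ‖z - X θ ⟨k, q⟩‖) ^ p)

lemma IsMultiplier.measurable
    (hf : IsMultiplier X m f) (θ : Θ) (γ : Index Z) : Measurable (f θ γ) := by
  obtain ⟨ι, _, p, A, hA, h⟩ := hf
  obtain ⟨μ, α, hμ, hf, -⟩ := h θ γ.1 0
  have : f θ γ = fun x => ∑ ν, α ν γ.2 * μ ν x := by bound
  rw [this]
  fun_prop

lemma IsMultiplier.norm_le (hf : IsMultiplier X m f) : ∃ (p : ℕ) (A : ℝ), 0 < A ∧ ∀ θ γ x,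
      ‖f θ γ x‖ ≤ A * scale γ.1 ^ m * (1 + scale γ.1 * ‖x - X θ γ‖) ^ p := by
  obtain ⟨ι, _, p, A, hA, h⟩ := hf
  refine ⟨p, (Fintype.card ι + 1) * (A * A), by positivity, fun θ γ x => ?_⟩
  obtain ⟨μ, α, hμ, hf, h1, h2⟩ := h θ γ.1 (X θ γ)
  have hs := scale_pos γ.1
  have h3 : f θ γ x = ∑ ν, α ν γ.2 * μ ν x := hf γ.2 x
  rw [h3]
  have h4 : ∀ ν, ‖α ν γ.2 * μ ν x‖ ≤
      A * A * (scale γ.1 ^ m * (1 + scale γ.1 * ‖x - X θ γ‖) ^ p) := by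
    intro ν
    have h5 : ‖α ν γ.2‖ ≤ A * scale γ.1 ^ m := by simpa using h2 ν γ.2
    rw [norm_mul]
    refine (mul_le_mul h5 (h1 ν x) (norm_nonneg _) (by positivity)).trans_eq ?_
    ring
  refine (norm_sum_le _ _).trans ((sum_le_sum fun ν _ => h4 ν).trans ?_)
  rw [Finset.sum_const, Finset.card_univ, nsmul_eq_mul]
  have h6 : 0 ≤ A * A * (scale γ.1 ^ m * (1 + scale γ.1 * ‖x - X θ γ‖) ^ p) := by positivity
  nlinarith

lemma IsMultiplier.add
    (hf : IsMultiplier X m f) (hg : IsMultiplier X m g) :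
    IsMultiplier X m fun θ γ x => f θ γ x + g θ γ x := by
  obtain ⟨ι, _, p, A, hA, hf⟩ := hf
  obtain ⟨ι', _, p', A', hA', hg⟩ := hg
  have hpow : ∀ s : ℝ, 0 ≤ s → (1 + s) ^ p ≤ (1 + s) ^ (p + p') ∧
      (1 + s) ^ p' ≤ (1 + s) ^ (p + p') := by bound
  refine ⟨ι ⊕ ι', inferInstance, p + p', A + A', by positivity, fun θ k z => ?_⟩
  obtain ⟨μ, α, hμ, h1, h2, h3⟩ := hf θ k z
  obtain ⟨μ', α', hμ', h1', h2', h3'⟩ := hg θ k z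
  have hs := scale_pos k
  refine ⟨Sum.elim μ μ', Sum.elim α α', ?_, ?_, ?_, ?_⟩
  · bound
  · intro q x
    simp only [Fintype.sum_sum_type, h1, h1', Sum.elim_inl, Sum.elim_inr]
  · rintro (ν | ν) x
    · exact (h2 ν x).trans (mul_le_mul (by linarith) (hpow _ (by positivity)).1 (by positivity)
        (by positivity))
    · exact (h2' ν x).trans (mul_le_mul (by linarith) (hpow _ (by positivity)).2 (by positivity)
        (by positivity))
  · rintro (ν | ν) q
    · exact (h3 ν q).trans (mul_le_mul (by gcongr; exact by linarith)
        (hpow _ (by positivity)).1 (by positivity) (by positivity))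
    · exact (h3' ν q).trans (mul_le_mul (by gcongr; exact by linarith)
        (hpow _ (by positivity)).2 (by positivity) (by positivity))

lemma IsMultiplier.mul
    (hf : IsMultiplier X m f) (hg : IsMultiplier X m' g) :
    IsMultiplier X (m + m') fun θ γ x => f θ γ x * g θ γ x := by
  obtain ⟨ι, _, p, A, hA, hf⟩ := hf
  obtain ⟨ι', _, p', A', hA', hg⟩ := hg
  refine ⟨ι × ι', inferInstance, p + p', A * A', by positivity, fun θ k z => ?_⟩
  obtain ⟨μ, α, hμ, h1, h2, h3⟩ := hf θ k z
  obtain ⟨μ', α', hμ', h1', h2', h3'⟩ := hg θ k z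
  have hs := scale_pos k
  refine ⟨fun ν x => μ ν.1 x * μ' ν.2 x, fun ν q => α ν.1 q * α' ν.2 q, fun ν =>
    (hμ ν.1).mul (hμ' ν.2), ?_, ?_, ?_⟩
  · intro q x
    simp only [h1, h1', Finset.sum_mul_sum, Fintype.sum_prod_type]
    grind
  · intro ν x
    rw [norm_mul, pow_add]
    refine (mul_le_mul (h2 _ x) (h2' _ x) (norm_nonneg _) (by positivity)).trans_eq ?_
    ring
  · intro ν q
    rw [norm_mul, pow_add, zpow_add₀ hs.ne']
    refine (mul_le_mul (h3 _ q) (h3' _ q) (norm_nonneg _) (by positivity)).trans_eq ?_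
    ring

lemma IsMultiplier.mono (hf : IsMultiplier X m f) (h : m ≤ m') : IsMultiplier X m' f := by
  obtain ⟨ι, _, p, A, hA, hf⟩ := hf
  refine ⟨ι, inferInstance, p, A, hA, fun θ k z => ?_⟩
  obtain ⟨μ, α, hμ, h1, h2, h3⟩ := hf θ k z
  have hs := scale_pos k
  refine ⟨μ, α, hμ, h1, h2, fun ν q => (h3 ν q).trans ?_⟩
  exact mul_le_mul_of_nonneg_right (mul_le_mul_of_nonneg_left
    (zpow_le_zpow_right₀ (one_le_scale k) h) hA.le) (by positivity)

lemma isMultiplier_const {u : Θ → Index Z → ℂ} {A : ℝ}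
    (h : ∀ θ γ, ‖u θ γ‖ ≤ A * scale γ.1 ^ m) : IsMultiplier X m fun θ γ _ => u θ γ := by
  refine ⟨Unit, inferInstance, 0, |A| + 1, by positivity, fun θ k z =>
    ⟨fun _ _ => 1, fun _ q => u θ ⟨k, q⟩, fun _ => measurable_const, fun q x => by simp,
      fun _ x => ?_, fun _ q => ?_⟩⟩
  · simp
  · have hs := scale_pos k
    rw [pow_zero, mul_one]
    refine (h θ ⟨k, q⟩).trans (mul_le_mul_of_nonneg_right ?_ (by positivity))
    grind

lemma IsMultiplier.finsetSum {κ : Type*} (s : Finset κ)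
    {f : κ → Amplitude Z Θ} (hf : ∀ i ∈ s, IsMultiplier X m (f i)) :
    IsMultiplier X m fun θ γ x => ∑ i ∈ s, f i θ γ x := by
  classical
  induction s using Finset.induction_on with
  | empty =>
    simp only [Finset.sum_empty]
    exact isMultiplier_const (u := fun _ _ => 0) (A := 0) (by simp)
  | insert i s hi ih =>
    simp_rw [Finset.sum_insert hi]
    exact (hf i (Finset.mem_insert_self _ _)).add
      (ih fun j hj => hf j (Finset.mem_insert_of_mem hj))

/-- A bounded function that does not depend on the index. -/
lemma isMultiplier_of_bounded {u : Θ → Rn n → ℂ} {A : ℝ}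
    (hu : ∀ θ, Measurable (u θ)) (h : ∀ θ x, ‖u θ x‖ ≤ A) :
    IsMultiplier X 0 fun θ (_ : Index Z) x => u θ x := by
  refine ⟨Unit, inferInstance, 0, |A| + 1, by positivity, fun θ k z =>
    ⟨fun _ => u θ, fun _ q => 1, fun _ => hu θ, fun q x => by simp, fun _ x => ?_, fun _ q => ?_⟩⟩
  · grind
  simp

/-- Functions that near any point `z` separate into products of the homogeneity `N` in the
distances from `z`. -/
lemma isMultiplier_of_homogeneous {ι : Type} [Fintype ι] {N : ℕ} {K : ℝ} (hK : 0 ≤ K) (e : ι → ℕ)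
    (he : ∀ ν, e ν ≤ N) {φ : Θ → Rn n → Rn n → ℝ} (μ α : Θ → Rn n → ι → Rn n → ℝ)
    (hm : ∀ θ z ν, Measurable (μ θ z ν)) (h : ∀ θ z y x, φ θ y x = ∑ ν, α θ z ν y * μ θ z ν x)
    (hμ : ∀ θ z ν x, |μ θ z ν x| ≤ K * ‖x - z‖ ^ e ν)
    (hα : ∀ θ z ν y, |α θ z ν y| ≤ K * ‖z - y‖ ^ (N - e ν)) :
    IsMultiplier X (-N) fun θ (γ : Index Z) x => ((φ θ (X θ γ) x : ℝ) : ℂ) := by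
  have hp : ∀ t : ℝ, 0 ≤ t → ∀ p ≤ N, K * t ^ p ≤ (K + 1) * (1 + t) ^ N := fun t ht p hp => by
    have : t ^ p ≤ (1 + t) ^ N := (pow_le_pow_left₀ ht (by linarith) p).trans
      (pow_le_pow_right₀ (by linarith) hp)
    gcongr
    linarith
  refine ⟨ι, inferInstance, N, K + 1, by positivity, fun θ k z => ?_⟩
  have hs := scale_pos k
  refine ⟨fun ν x => ((scale k ^ e ν * μ θ z ν x : ℝ) : ℂ),
    fun ν q => (((scale k ^ e ν)⁻¹ * α θ z ν (X θ ⟨k, q⟩) : ℝ) : ℂ), fun ν =>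
      Complex.measurable_ofReal.comp ((hm θ z ν).const_mul _), fun q x => ?_, fun ν x => ?_,
      fun ν q => ?_⟩
  · simp only [h θ z, ← Complex.ofReal_mul, ← Complex.ofReal_sum]
    exact congrArg _ (sum_congr rfl fun ν _ => by field_simp)
  · rw [norm_real, norm_eq_abs, abs_mul, abs_of_pos (by positivity)]
    refine le_trans ?_ (hp (scale k * ‖x - z‖) (by positivity) _ (he ν))
    rw [mul_pow, mul_left_comm]
    gcongr
    exact hμ θ z ν x
  · rw [norm_real, norm_eq_abs, abs_mul, abs_of_pos (by positivity), zpow_neg, zpow_natCast,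
      mul_right_comm]
    calc _ ≤ (scale k ^ e ν)⁻¹ * (K * ‖z - X θ ⟨k, q⟩‖ ^ (N - e ν)) := by gcongr; exact hα θ z ν _
      _ = K * (scale k * ‖z - X θ ⟨k, q⟩‖) ^ (N - e ν) * (scale k ^ N)⁻¹ := by
        rw [mul_pow, ← pow_sub_mul_pow _ (he ν)]
        field_simp
      _ ≤ _ := mul_le_mul_of_nonneg_right (hp _ (by positivity) _ (Nat.sub_le _ _)) (by positivity)

lemma isMultiplier_sub_of_lipschitz {h : Θ → Rn n → ℝ} {K : ℝ} (hK : 0 ≤ K)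
    (hh : ∀ θ x y, |h θ x - h θ y| ≤ K * ‖x - y‖) :
    IsMultiplier X (-1) fun θ (γ : Index Z) x => ((h θ x - h θ (X θ γ) : ℝ) : ℂ) := by
  have hc : ∀ θ, Continuous (h θ) := fun θ => (LipschitzWith.of_dist_le_mul (K := K.toNNReal)
    fun x y => by simpa [dist_eq_norm, hK] using hh θ x y).continuous
  refine isMultiplier_of_homogeneous (N := 1) (K := K + 1) (by positivity) Bool.toNat Bool.toNat_le
    (φ := fun θ y x => h θ x - h θ y) (fun θ z b x => cond b (h θ x - h θ z) 1)
    (fun θ z b y => cond b 1 (h θ z - h θ y)) ?_ ?_ ?_ ?_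
  · rintro θ z (_ | _)
    exacts [measurable_const, ((hc θ).sub continuous_const).measurable]
  · simp
  all_goals
    rintro θ z (_ | _) x <;> simp [hK]
    exact (hh θ _ _).trans (by gcongr; linarith)

lemma isMultiplier_coord (X : Θ → Index Z → Rn n) (j : Fin n) :
    IsMultiplier X (-1) fun θ γ x => (((x - X θ γ) j : ℝ) : ℂ) :=
  isMultiplier_sub_of_lipschitz (h := fun _ x => x j) zero_le_one fun _ x y => by
    rw [one_mul]; exact abs_coord_le (x - y) j

lemma lintegral_exp_neg_mul_sq {n : ℕ} {s : ℝ} (hs : 0 < s) (x : Rn n) :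
    ∫⁻ z, ofReal (exp (-s * ‖z - x‖ ^ 2)) = ofReal ((√π / √s) ^ n) := by
  rw [← integral_exp_neg_mul_sq hs x, ofReal_integral_eq_lintegral_ofReal
    (integrable_exp_neg_mul_sq hs _) (.of_forall fun x => (exp_pos _).le)]

/-- Bounds for all Gaussian localizations of an integral are integrated over the centre of the
localization. -/
lemma lintegral_le_of_localized {n : ℕ} {ι : Type*} (F : Finset ι) {s r : ℝ} (hs : 0 < s)
    (hr : 0 < r) {u : Rn n → ℝ≥0∞} (hu : Measurable u) (a : ι → ℝ≥0∞) (X : ι → Rn n)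
    (h : ∀ z, ∫⁻ x, ofReal (exp (-s * ‖x - z‖ ^ 2)) * u x ≤
      ∑ q ∈ F, a q * ofReal (exp (-r * ‖z - X q‖ ^ 2))) :
    ∫⁻ x, u x ≤ ofReal (√(s / r) ^ n) * ∑ q ∈ F, a q := by
  have hw : 0 < (√π / √s) ^ n := by have := Real.pi_pos; positivity
  have hw' : (√π / √r) ^ n = (√π / √s) ^ n * √(s / r) ^ n := by
    rw [← mul_pow, Real.sqrt_div hs.le, div_mul_div_cancel₀ (Real.sqrt_pos.mpr hs).ne']
  have hm : Measurable (Function.uncurry fun x z : Rn n =>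
      ofReal (exp (-s * ‖x - z‖ ^ 2)) * u x) :=
    Measurable.mul (ENNReal.measurable_ofReal.comp (by fun_prop)) (hu.comp measurable_fst)
  have hm3 : ∀ q, Measurable fun z : Rn n => ofReal (exp (-r * ‖z - X q‖ ^ 2)) := by fun_prop
  rw [← ENNReal.mul_le_mul_iff_right (by simpa using hw) (ofReal_ne_top (r := (√π / √s) ^ n)),
    ← mul_assoc, ← ofReal_mul hw.le, ← hw', mul_sum]
  calc _ = ∫⁻ x, ∫⁻ z, ofReal (exp (-s * ‖x - z‖ ^ 2)) * u x := by
        rw [← lintegral_const_mul _ hu]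
        refine lintegral_congr fun x => ?_
        simp_rw [norm_sub_rev x]
        rw [lintegral_mul_const _ (by fun_prop), lintegral_exp_neg_mul_sq hs]
    _ = ∫⁻ z, ∫⁻ x, ofReal (exp (-s * ‖x - z‖ ^ 2)) * u x :=
        lintegral_lintegral_swap hm.aemeasurable
    _ ≤ ∫⁻ z, ∑ q ∈ F, a q * ofReal (exp (-r * ‖z - X q‖ ^ 2)) := lintegral_mono h
    _ = _ := by
        rw [lintegral_finsetSum _ fun q _ => (hm3 q).const_mul _]
        refine sum_congr rfl fun q _ => ?_
        rw [lintegral_const_mul _ (hm3 q), lintegral_exp_neg_mul_sq hr, mul_comm]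

/-- A sum of modulated Gaussians of one level is bounded in `L²` by the coefficients. -/
lemma IsMultiplier.exists_level_sum_le {ε c M L : ℝ}
    (hε : 0 < ε) (hc : 0 < c) (hM : 1 ≤ M) (hL : 0 < L)
    (hP : ∀ θ, PhaseFamily Z ε c M L (X θ) (Ξ θ))
    (hf : IsMultiplier X m f) :
    ∃ C, 0 < C ∧ ∀ θ k (F : Finset (Z.pts k × (Fin n → ℤ))) (d : Z.pts k × (Fin n → ℤ) → ℂ),
      ∫⁻ x, ‖∑ q ∈ F, d q * (f θ ⟨k, q⟩ x *
        gaussian (spacing ε c k) (X θ ⟨k, q⟩) (Ξ θ ⟨k, q⟩) x)‖ₑ ^ 2 ≤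
      ofReal (C * (scale k ^ m) ^ 2 * ∑ q ∈ F, ‖d q‖ ^ 2) := by
  have hmeas := hf.measurable
  obtain ⟨ι, _, p, A, hA, hf⟩ := hf
  have hM0 : 0 < M := by linarith
  obtain ⟨C₁, hC₁, h₁⟩ := exists_localized_sum_le n hε hc hM hL
  obtain ⟨C₂, hC₂, h₂⟩ := exists_one_add_pow_mul_exp_le (p * 2) one_pos
  obtain ⟨C₃, hC₃, h₃⟩ := exists_one_add_pow_mul_exp_le (p * 2) (by positivity : 0 < 1 / (8 * M))
  set N : ℝ := (Fintype.card ι : ℝ) with hN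
  set B : ℝ := N * (N * (A ^ 2 * C₂) * (C₁ * (A ^ 2 * C₃))) with hB
  refine ⟨√(16 * M) ^ n * (B + 1), by positivity, fun θ k F d => ?_⟩
  have hs := scale_pos k
  set Φ : Z.pts k × (Fin n → ℤ) → Rn n → ℂ := fun q =>
    gaussian (spacing ε c k) (X θ ⟨k, q⟩) (Ξ θ ⟨k, q⟩) with hΦ
  have hSm : Measurable fun x => ∑ q ∈ F, d q * (f θ ⟨k, q⟩ x * Φ q x) :=
    Finset.measurable_sum _ fun q _ =>
      ((hmeas θ ⟨k, q⟩).mul (continuous_gaussian _ _ _).measurable).const_mul _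
  refine (lintegral_le_of_localized F (s := 2 * 2 ^ k) (r := 2 ^ k / (8 * M)) (by positivity)
    (by positivity) (hSm.enorm.pow_const 2) (fun q => ofReal (B * (scale k ^ m) ^ 2 * ‖d q‖ ^ 2))
    (fun q => X θ ⟨k, q⟩) fun z => ?_).trans ?_
  swap
  · have e : (2 : ℝ) * 2 ^ k / (2 ^ k / (8 * M)) = 16 * M := by field_simp; norm_num
    rw [e, ← ofReal_sum_of_nonneg fun q _ => by positivity, ← ofReal_mul (by positivity),
      ← mul_sum, mul_assoc _ (B + 1), mul_assoc (√_ ^ n), mul_assoc (B + 1)]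
    refine ofReal_le_ofReal ?_
    rw [mul_assoc B]
    gcongr
    linarith
  obtain ⟨μ, α, hμ, hfz, hμz, hαz⟩ := hf θ k z
  set T : ι → Rn n → ℂ := fun ν x => ∑ q ∈ F, (d q * α ν q) * Φ q x with hT
  have hpt : ∀ x, exp (-(2 * 2 ^ k) * ‖x - z‖ ^ 2) * ‖∑ q ∈ F, d q * (f θ ⟨k, q⟩ x * Φ q x)‖ ^ 2 ≤
        ∑ ν, N * (A ^ 2 * C₂) * (exp (-2 ^ k * ‖x - z‖ ^ 2) * ‖T ν x‖ ^ 2) := by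
    intro x
    have e1 : ∑ q ∈ F, d q * (f θ ⟨k, q⟩ x * Φ q x) = ∑ ν, μ ν x * T ν x := by
      simp only [hT, hfz, sum_mul, mul_sum]
      rw [Finset.sum_comm]
      exact sum_congr rfl fun ν _ => sum_congr rfl fun q _ => by ring
    set t := scale k * ‖x - z‖ with ht
    have e2 : -(2 * 2 ^ k) * ‖x - z‖ ^ 2 = -(1 * t ^ 2) + -(1 * t ^ 2) := by
      rw [ht, mul_pow, scale_sq]; ring
    have e3 : -2 ^ k * ‖x - z‖ ^ 2 = -(1 * t ^ 2) := by rw [ht, mul_pow, scale_sq]; ring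
    rw [e1, e2, e3, exp_add]
    set E := exp (-(1 * t ^ 2))
    calc E * E * ‖∑ ν, μ ν x * T ν x‖ ^ 2 ≤ E * E * (N * ∑ ν, ‖μ ν x * T ν x‖ ^ 2) := by
          gcongr
          exact (pow_le_pow_left₀ (norm_nonneg _) (norm_sum_le _ _) 2).trans
            sq_sum_le_card_mul_sum_sq
      _ = ∑ ν, N * (E * ‖μ ν x‖ ^ 2) * (E * ‖T ν x‖ ^ 2) := by
          simp_rw [mul_sum, norm_mul]
          exact sum_congr rfl fun ν _ => by ring
      _ ≤ _ := by
          refine sum_le_sum fun ν _ => mul_le_mul_of_nonneg_right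
            (mul_le_mul_of_nonneg_left ?_ (by positivity)) (by positivity)
          calc E * ‖μ ν x‖ ^ 2 ≤ E * (A * (1 + t) ^ p) ^ 2 := by gcongr; exact hμz ν x
            _ = A ^ 2 * ((1 + t) ^ (p * 2) * E) := by rw [pow_mul]; ring
            _ ≤ _ := by gcongr; exact h₂ t (by positivity)
  have hcoef : ∀ ν, ∑ q ∈ F, (‖d q * α ν q‖ *
      exp (-(2 ^ k / (8 * M) * ‖z - X θ ⟨k, q⟩‖ ^ 2))) ^ 2 ≤ ∑ q ∈ F,
        A ^ 2 * C₃ * (scale k ^ m) ^ 2 *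
          (‖d q‖ ^ 2 * exp (-(2 ^ k / (8 * M)) * ‖z - X θ ⟨k, q⟩‖ ^ 2)) := by
    refine fun ν => sum_le_sum fun q _ => ?_
    rw [neg_mul]
    set r := scale k * ‖z - X θ ⟨k, q⟩‖ with hr
    have h6 : 2 ^ k / (8 * M) * ‖z - X θ ⟨k, q⟩‖ ^ 2 = 1 / (8 * M) * r ^ 2 := by
      rw [hr, mul_pow, scale_sq]; ring
    rw [h6]
    set e := exp (-(1 / (8 * M) * r ^ 2))
    calc (‖d q * α ν q‖ * e) ^ 2 = ‖d q‖ ^ 2 * e ^ 2 * ‖α ν q‖ ^ 2 := by rw [norm_mul]; ring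
      _ ≤ ‖d q‖ ^ 2 * e ^ 2 * (A * scale k ^ m * (1 + r) ^ p) ^ 2 := by gcongr; exact hαz ν q
      _ = A ^ 2 * ((1 + r) ^ (p * 2) * e) * (scale k ^ m) ^ 2 * (‖d q‖ ^ 2 * e) := by
          rw [pow_mul]; ring
      _ ≤ _ := by gcongr; exact h₃ _ (by positivity)
  have hm : ∀ ν, Measurable fun x => ofReal (exp (-2 ^ k * ‖x - z‖ ^ 2)) * ‖T ν x‖ₑ ^ 2 := by
    intro ν
    have : Continuous (T ν) :=
      continuous_finsetSum _ fun q _ => continuous_const.mul (continuous_gaussian _ _ _)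
    exact Measurable.mul (by fun_prop) (this.measurable.enorm.pow_const 2)
  have hNC : 0 ≤ N * (A ^ 2 * C₂) := by positivity
  calc _ ≤ ∫⁻ x, ∑ ν, ofReal (N * (A ^ 2 * C₂)) *
        (ofReal (exp (-2 ^ k * ‖x - z‖ ^ 2)) * ‖T ν x‖ₑ ^ 2) := by
        refine lintegral_mono fun x => ?_
        simp_rw [← ofReal_norm, ← ofReal_pow (norm_nonneg _), ← ofReal_mul (exp_pos _).le,
          ← ofReal_mul hNC]
        rw [← ofReal_sum_of_nonneg fun ν _ => by positivity]
        exact ofReal_le_ofReal (hpt x)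
    _ = ∑ ν, ofReal (N * (A ^ 2 * C₂)) * ∫⁻ x,
        ofReal (exp (-2 ^ k * ‖x - z‖ ^ 2)) * ‖T ν x‖ₑ ^ 2 := by
        rw [lintegral_finsetSum _ fun ν _ => (hm ν).const_mul _]
        simp_rw [lintegral_const_mul' _ _ ofReal_ne_top]
    _ ≤ ∑ ν : ι, ofReal (N * (A ^ 2 * C₂)) * ofReal (C₁ * ∑ q ∈ F, A ^ 2 * C₃ * (scale k ^ m) ^ 2 *
          (‖d q‖ ^ 2 * exp (-(2 ^ k / (8 * M)) * ‖z - X θ ⟨k, q⟩‖ ^ 2))) := by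
        gcongr with ν
        exact (h₁ Z (X θ) (Ξ θ) (hP θ) k z F _).trans
          (ofReal_le_ofReal (mul_le_mul_of_nonneg_left (hcoef ν) hC₁.le))
    _ = ofReal (∑ q ∈ F, B * (scale k ^ m) ^ 2 * ‖d q‖ ^ 2 *
          exp (-(2 ^ k / (8 * M)) * ‖z - X θ ⟨k, q⟩‖ ^ 2)) := by
        rw [Finset.sum_const, Finset.card_univ, nsmul_eq_mul, ← ENNReal.ofReal_natCast,
          ← ofReal_mul hNC, ← ofReal_mul (by positivity)]
        simp_rw [mul_sum]
        exact congrArg _ (sum_congr rfl fun q _ => by ring)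
    _ = _ := by
        rw [ofReal_sum_of_nonneg fun q _ => by positivity]
        exact sum_congr rfl fun q _ => ofReal_mul (by positivity)

end

section

/-! ### Functions of rapid decay with locally Lipschitz regularity -/

variable {n : ℕ}

/-- Polynomial growth. -/
def PolyBdd (f : Rn n → ℂ) : Prop := ∃ (N : ℕ) (A : ℝ), 0 < A ∧ ∀ x, ‖f x‖ ≤ A * (1 + ‖x‖) ^ N

/-- Local Lipschitz continuity with constants of polynomial growth. -/
def PolyLip (f : Rn n → ℂ) : Prop :=
  ∃ (N : ℕ) (A : ℝ), 0 < A ∧ ∀ x v, ‖v‖ ≤ 1 → ‖f (x + v) - f x‖ ≤ A * (1 + ‖x‖) ^ N * ‖v‖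

/-- Rapid decay. -/
def RapidBdd (f : Rn n → ℂ) : Prop := ∀ N : ℕ, ∃ A, 0 < A ∧ ∀ x, ‖f x‖ * (1 + ‖x‖) ^ N ≤ A

/-- Local Lipschitz continuity with rapidly decaying constants. -/
def RapidLip (f : Rn n → ℂ) : Prop :=
  ∀ N : ℕ, ∃ A, 0 < A ∧ ∀ x v, ‖v‖ ≤ 1 → ‖f (x + v) - f x‖ * (1 + ‖x‖) ^ N ≤ A * ‖v‖

/-- The segment from the origin is divided into steps of length at most one. -/
lemma PolyLip.polyBdd {f : Rn n → ℂ} (hf : PolyLip f) : PolyBdd f := by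
  obtain ⟨N, A, hA, h⟩ := hf
  refine ⟨N + 1, ‖f 0‖ + 2 * A, by positivity, fun x => ?_⟩
  set k := ⌈‖x‖⌉₊
  have hxk : ‖x‖ ≤ k := Nat.le_ceil _
  have hk : (k : ℝ) ≤ 1 + ‖x‖ := by linarith [Nat.ceil_lt_add_one (norm_nonneg x)]
  have step : ∀ {j : ℕ}, j < k → dist (f (((j : ℝ) / k) • x)) (f (((j + 1 : ℕ) / k : ℝ) • x)) ≤
      A * (1 + ‖x‖) ^ N := by
    intro j hj
    have hk0 : (0 : ℝ) < k := by exact_mod_cast (Nat.zero_le j).trans_lt hj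
    have hv : ‖(1 / k : ℝ) • x‖ ≤ 1 := by
      rw [norm_smul, norm_of_nonneg (by positivity), one_div_mul_eq_div]
      exact (div_le_one hk0).mpr hxk
    have hy : ‖((j : ℝ) / k) • x‖ ≤ ‖x‖ := by
      rw [norm_smul, norm_of_nonneg (by positivity)]
      refine mul_le_of_le_one_left (norm_nonneg x) ((div_le_one hk0).mpr ?_)
      exact_mod_cast hj.le
    have h1 := h (((j : ℝ) / k) • x) _ hv
    rw [← add_smul, ← add_div] at h1
    rw [dist_comm, dist_eq_norm, Nat.cast_succ]
    calc _ ≤ _ := h1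
      _ ≤ A * (1 + ‖x‖) ^ N * 1 := by gcongr
      _ = _ := mul_one _
  have h1 := dist_le_range_sum_of_dist_le k step
  have hx : ((k : ℝ) / k) • x = x := by
    rcases eq_or_ne (k : ℝ) 0 with h0 | h0
    · simp [norm_le_zero_iff.mp (hxk.trans_eq h0)]
    · rw [div_self h0, one_smul]
  simp only [Nat.cast_zero, zero_div, zero_smul, hx, Finset.sum_const, Finset.card_range,
    nsmul_eq_mul] at h1
  have h2 : (1 : ℝ) ≤ (1 + ‖x‖) ^ (N + 1) := one_le_pow₀ (by linarith [norm_nonneg x])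
  calc ‖f x‖ ≤ ‖f 0‖ + dist (f 0) (f x) := by
        rw [dist_comm, dist_eq_norm]; exact norm_le_norm_add_norm_sub' _ _
    _ ≤ ‖f 0‖ * (1 + ‖x‖) ^ (N + 1) + (1 + ‖x‖) * (A * (1 + ‖x‖) ^ N) := by
        refine add_le_add (le_mul_of_one_le_right (norm_nonneg _) h2) (h1.trans (by gcongr))
    _ ≤ _ := by
        have : 0 ≤ A * (1 + ‖x‖) ^ (N + 1) := by positivity
        rw [pow_succ] at this ⊢
        linarith

lemma PolyLip.add {f g : Rn n → ℂ} (hf : PolyLip f) (hg : PolyLip g) :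
    PolyLip fun x => f x + g x := by
  obtain ⟨N, A, hA, hf⟩ := hf
  obtain ⟨N', A', hA', hg⟩ := hg
  refine ⟨N + N', A + A', by positivity, fun x v hv => ?_⟩
  have h1 : (1 + ‖x‖) ^ N ≤ (1 + ‖x‖) ^ (N + N') :=
    pow_le_pow_right₀ (by linarith [norm_nonneg x]) (by omega)
  have h2 : (1 + ‖x‖) ^ N' ≤ (1 + ‖x‖) ^ (N + N') :=
    pow_le_pow_right₀ (by linarith [norm_nonneg x]) (by omega)
  have e : f (x + v) + g (x + v) - (f x + g x) = (f (x + v) - f x) + (g (x + v) - g x) := by ring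
  rw [e, add_mul, add_mul]
  refine (norm_add_le _ _).trans (add_le_add ((hf x v hv).trans ?_) ((hg x v hv).trans ?_))
  · gcongr
  · gcongr

lemma one_add_norm_add_le (x : Rn n) {v : Rn n} (hv : ‖v‖ ≤ 1) : 1 + ‖x + v‖ ≤ 2 * (1 + ‖x‖) := by
  have := norm_add_le x v
  linarith [norm_nonneg x]

lemma one_add_norm_le (x : Rn n) {v : Rn n} (hv : ‖v‖ ≤ 1) : 1 + ‖x‖ ≤ 2 * (1 + ‖x + v‖) := by
  have := norm_sub_le (x + v) v
  rw [add_sub_cancel_right] at this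
  linarith [norm_nonneg (x + v)]

lemma PolyLip.mul {f g : Rn n → ℂ} (hf : PolyLip f) (hg : PolyLip g) :
    PolyLip fun x => f x * g x := by
  obtain ⟨P, B, hB, hfb⟩ := hf.polyBdd
  obtain ⟨P', B', hB', hgb⟩ := hg.polyBdd
  obtain ⟨N, A, hA, hf⟩ := hf
  obtain ⟨N', A', hA', hg⟩ := hg
  refine ⟨(N + P') + (P + N'), A * (B' * 2 ^ P') + B * A', by positivity, fun x v hv => ?_⟩
  have e : f (x + v) * g (x + v) - f x * g x =
      (f (x + v) - f x) * g (x + v) + f x * (g (x + v) - g x) := by ring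
  have hx1 : 1 ≤ 1 + ‖x‖ := by linarith [norm_nonneg x]
  rw [e, add_mul, add_mul]
  refine (norm_add_le _ _).trans (add_le_add ?_ ?_)
  · rw [norm_mul]
    have h2 : (1 + ‖x + v‖) ^ P' ≤ 2 ^ P' * (1 + ‖x‖) ^ P' := by
      rw [← mul_pow]
      exact pow_le_pow_left₀ (by positivity) (one_add_norm_add_le x hv) _
    have h1 : ‖g (x + v)‖ ≤ B' * (2 ^ P' * (1 + ‖x‖) ^ P') :=
      (hgb _).trans (by gcongr)
    calc ‖f (x + v) - f x‖ * ‖g (x + v)‖ ≤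
        (A * (1 + ‖x‖) ^ N * ‖v‖) * (B' * (2 ^ P' * (1 + ‖x‖) ^ P')) :=
          mul_le_mul (hf x v hv) h1 (norm_nonneg _) (by positivity)
      _ = A * (B' * 2 ^ P') * (1 + ‖x‖) ^ (N + P') * ‖v‖ := by rw [pow_add]; ring
      _ ≤ _ := by
        refine mul_le_mul_of_nonneg_right (mul_le_mul_of_nonneg_left ?_ (by positivity))
          (norm_nonneg _)
        exact pow_le_pow_right₀ hx1 (by omega)
  · rw [norm_mul]
    calc ‖f x‖ * ‖g (x + v) - g x‖ ≤ (B * (1 + ‖x‖) ^ P) * (A' * (1 + ‖x‖) ^ N' * ‖v‖) :=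
          mul_le_mul (hfb x) (hg x v hv) (norm_nonneg _) (by positivity)
      _ = B * A' * (1 + ‖x‖) ^ (P + N') * ‖v‖ := by rw [pow_add]; ring
      _ ≤ _ := by
        refine mul_le_mul_of_nonneg_right (mul_le_mul_of_nonneg_left ?_ (by positivity))
          (norm_nonneg _)
        exact pow_le_pow_right₀ hx1 (by omega)

lemma polyLip_const (u : ℂ) : PolyLip fun _ : Rn n => u :=
  ⟨0, 1, one_pos, fun x v _ => by simp⟩

/-- A globally Lipschitz function. -/
lemma polyLip_of_lipschitz {f : Rn n → ℂ} {A : ℝ} (h : ∀ x y, ‖f x - f y‖ ≤ A * ‖x - y‖) :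
    PolyLip f := by
  refine ⟨0, |A| + 1, by positivity, fun x v _ => (h _ _).trans ?_⟩
  rw [add_sub_cancel_left, pow_zero, mul_one]
  gcongr
  exact by linarith [le_abs_self A]

lemma polyLip_coord (X : Rn n) (j : Fin n) : PolyLip fun x : Rn n => (((x - X) j : ℝ) : ℂ) := by
  refine polyLip_of_lipschitz (A := 1) fun x y => ?_
  rw [← Complex.ofReal_sub, norm_real, one_mul, norm_eq_abs]
  have := abs_coord_le (x - y) j
  simpa using this

lemma PolyBdd.mul_rapidBdd {f g : Rn n → ℂ} (hf : PolyBdd f) (hg : RapidBdd g) :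
    RapidBdd fun x => f x * g x := by
  obtain ⟨P, B, hB, hf⟩ := hf
  intro N
  obtain ⟨A, hA, hg⟩ := hg (P + N)
  refine ⟨B * A, by positivity, fun x => ?_⟩
  calc ‖f x * g x‖ * (1 + ‖x‖) ^ N = ‖f x‖ * (‖g x‖ * (1 + ‖x‖) ^ N) := by rw [norm_mul]; ring
    _ ≤ (B * (1 + ‖x‖) ^ P) * (‖g x‖ * (1 + ‖x‖) ^ N) := by gcongr; exact hf x
    _ = B * (‖g x‖ * (1 + ‖x‖) ^ (P + N)) := by rw [pow_add]; ring
    _ ≤ _ := by gcongr; exact hg x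

lemma PolyLip.mul_rapidLip {f g : Rn n → ℂ} (hf : PolyLip f) (hg : RapidLip g)
    (hg' : RapidBdd g) : RapidLip fun x => f x * g x := by
  obtain ⟨P, B, hB, hfb⟩ := hf.polyBdd
  obtain ⟨P', B', hB', hf⟩ := hf
  intro N
  obtain ⟨A, hA, hg⟩ := hg (P + N)
  obtain ⟨A', hA', hg'⟩ := hg' (P' + N)
  refine ⟨B' * A' * 2 ^ (P' + N) + B * A, by positivity, fun x v hv => ?_⟩
  have e : f (x + v) * g (x + v) - f x * g x =
      (f (x + v) - f x) * g (x + v) + f x * (g (x + v) - g x) := by ring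
  have h1 : (1 + ‖x‖) ^ (P' + N) ≤ 2 ^ (P' + N) * (1 + ‖x + v‖) ^ (P' + N) := by
    rw [← mul_pow]
    exact pow_le_pow_left₀ (by positivity) (one_add_norm_le x hv) _
  calc ‖f (x + v) * g (x + v) - f x * g x‖ * (1 + ‖x‖) ^ N ≤
      (‖f (x + v) - f x‖ * ‖g (x + v)‖ + ‖f x‖ * ‖g (x + v) - g x‖) * (1 + ‖x‖) ^ N := by
        rw [e, ← norm_mul, ← norm_mul]
        gcongr
        exact norm_add_le _ _
    _ ≤ ((B' * (1 + ‖x‖) ^ P' * ‖v‖) * ‖g (x + v)‖ +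
        (B * (1 + ‖x‖) ^ P) * ‖g (x + v) - g x‖) * (1 + ‖x‖) ^ N := by
        refine mul_le_mul_of_nonneg_right (add_le_add ?_ ?_) (by positivity)
        · gcongr
          exact hf x v hv
        · exact mul_le_mul_of_nonneg_right (hfb x) (norm_nonneg _)
    _ = B' * ‖v‖ * (‖g (x + v)‖ * (1 + ‖x‖) ^ (P' + N)) +
        B * (‖g (x + v) - g x‖ * (1 + ‖x‖) ^ (P + N)) := by rw [pow_add, pow_add]; ring
    _ ≤ B' * ‖v‖ * (‖g (x + v)‖ * (2 ^ (P' + N) * (1 + ‖x + v‖) ^ (P' + N))) +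
        B * (A * ‖v‖) := by
        refine add_le_add ?_ (mul_le_mul_of_nonneg_left (hg x v hv) hB.le)
        exact mul_le_mul_of_nonneg_left (by gcongr)
          (by positivity)
    _ = B' * ‖v‖ * 2 ^ (P' + N) * (‖g (x + v)‖ * (1 + ‖x + v‖) ^ (P' + N)) +
        B * (A * ‖v‖) := by ring
    _ ≤ B' * ‖v‖ * 2 ^ (P' + N) * A' + B * (A * ‖v‖) :=
        add_le_add (mul_le_mul_of_nonneg_left (hg' _) (by positivity)) le_rfl
    _ = _ := by ring

lemma integrable_one_add_norm_inv_pow :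
    Integrable fun x : Rn n => ((1 + ‖x‖) ^ (n + 1))⁻¹ := by
  have h := integrable_one_add_norm (E := Rn n) (μ := volume) (r := (n : ℝ) + 1) (by simp)
  refine h.congr (.of_forall fun x => ?_)
  have hx : 0 < 1 + ‖x‖ := by positivity
  simp only
  rw [Real.rpow_neg hx.le, ← Nat.cast_succ, rpow_natCast]

lemma RapidBdd.exists_norm_le {f : Rn n → ℂ} (hf : RapidBdd f) :
    ∃ A, 0 < A ∧ ∀ x, ‖f x‖ ≤ A * ((1 + ‖x‖) ^ (n + 1))⁻¹ := by
  obtain ⟨A, hA, h⟩ := hf (n + 1)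
  refine ⟨A, hA, fun x => ?_⟩
  rw [← div_eq_mul_inv, le_div_iff₀ (by positivity)]
  exact h x

lemma RapidBdd.integrable {f : Rn n → ℂ} (hf : RapidBdd f) (hm : Measurable f) :
    Integrable f := by
  obtain ⟨A, hA, h⟩ := hf.exists_norm_le
  exact (integrable_one_add_norm_inv_pow.const_mul A).mono' hm.aestronglyMeasurable
    (.of_forall h)

lemma RapidBdd.memLp {f : Rn n → ℂ} (hf : RapidBdd f) (hm : Measurable f) :
    MemLp f 2 := by
  rw [memLp_two_iff_integrable_sq_norm hm.aestronglyMeasurable]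
  obtain ⟨A, hA, h⟩ := hf.exists_norm_le
  refine (integrable_one_add_norm_inv_pow.const_mul (A * A)).mono'
    (hm.norm.pow_const 2).aestronglyMeasurable (.of_forall fun x => ?_)
  have hx : (1 : ℝ) ≤ (1 + ‖x‖) ^ (n + 1) := one_le_pow₀ (by linarith [norm_nonneg x])
  have hx' : ((1 + ‖x‖) ^ (n + 1))⁻¹ ≤ 1 := inv_le_one_of_one_le₀ hx
  have h0 : 0 ≤ ((1 + ‖x‖) ^ (n + 1))⁻¹ := by positivity
  rw [norm_eq_abs, abs_of_nonneg (by positivity), sq]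
  calc ‖f x‖ * ‖f x‖ ≤ (A * ((1 + ‖x‖) ^ (n + 1))⁻¹) * (A * ((1 + ‖x‖) ^ (n + 1))⁻¹) :=
        mul_le_mul (h x) (h x) (norm_nonneg _) (by positivity)
    _ = A * A * ((1 + ‖x‖) ^ (n + 1))⁻¹ * ((1 + ‖x‖) ^ (n + 1))⁻¹ := by ring
    _ ≤ A * A * ((1 + ‖x‖) ^ (n + 1))⁻¹ * 1 := mul_le_mul_of_nonneg_left hx' (by positivity)
    _ = _ := by ring

/-- The integral of a derivative vanishes. -/
lemma integral_lineDeriv_eq_zero {P P' : Rn n → ℂ} {v : Rn n} (hv : ‖v‖ ≤ 1) (hP : RapidBdd P)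
    (hP' : RapidLip P) (hm : Measurable P) (hd : ∀ᵐ x, HasLineDerivAt ℝ P (P' x) x v) :
    ∫ x, P' x = 0 := by
  obtain ⟨A, hA, h⟩ := hP' (n + 1)
  have hI := hP.integrable hm
  set s : ℕ → ℝ := fun k => 1 / ((k : ℝ) + 1) with hs
  have hs0 : ∀ k, 0 < s k := fun k => Nat.one_div_pos_of_nat
  have hs1 : ∀ k, s k ≤ 1 := fun k => by
    rw [hs]; simp only; rw [div_le_one (by positivity)]; linarith [k.cast_nonneg (α := ℝ)]
  have hst : Filter.Tendsto s Filter.atTop (nhdsWithin 0 {0}ᶜ) :=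
    tendsto_nhdsWithin_iff.mpr ⟨tendsto_one_div_add_atTop_nhds_zero_nat,
      .of_forall fun k => (hs0 k).ne'⟩
  have hlim : Filter.Tendsto (fun k => ∫ x, (s k)⁻¹ • (P (x + s k • v) - P x)) Filter.atTop
      (nhds (∫ x, P' x)) := by
    refine tendsto_integral_of_dominated_convergence (fun x => A * ((1 + ‖x‖) ^ (n + 1))⁻¹)
      (fun k => ?_) (integrable_one_add_norm_inv_pow.const_mul A) (fun k => ?_) ?_
    · have : Measurable fun x => P (x + s k • v) := hm.comp (measurable_id.add_const _)
      exact ((this.sub hm).const_smul ((s k)⁻¹ : ℝ)).aestronglyMeasurable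
    · refine .of_forall fun x => ?_
      have hsv : ‖s k • v‖ ≤ s k := by
        rw [norm_smul, norm_eq_abs, abs_of_pos (hs0 k)]
        exact mul_le_of_le_one_right (hs0 k).le hv
      have h1 := h x (s k • v) (hsv.trans (hs1 k))
      rw [norm_smul, norm_inv, norm_eq_abs, abs_of_pos (hs0 k), ← div_eq_mul_inv,
        le_div_iff₀ (by positivity), mul_assoc, inv_mul_le_iff₀ (hs0 k), mul_comm _ A]
      exact h1.trans (by gcongr)
    · filter_upwards [hd] with x hx
      exact hx.tendsto_slope_zero.comp hst
  refine tendsto_nhds_unique hlim ?_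
  have : ∀ k, ∫ x, (s k)⁻¹ • (P (x + s k • v) - P x) = 0 := by
    intro k
    rw [integral_smul, integral_sub (hI.comp_add_right _) hI,
      integral_add_right_eq_self (μ := volume) P, sub_self, smul_zero]
  simp_rw [this]
  exact tendsto_const_nhds

/-- The Fourier transform in `L²` of an integrable function. -/
lemma fourier_toLp_ae_eq {F : Rn n → ℂ} (h1 : Integrable F) (h2 : MemLp F 2) :
    (𝓕 (h2.toLp F) : L2 n) =ᵐ[volume] 𝓕 F := by
  have hc : Continuous (𝓕 F) := VectorFourier.fourierIntegral_continuous
    Real.continuous_fourierChar (innerSL ℝ).continuous₂ h1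
  have hL : LocallyIntegrable (fun η => (𝓕 (h2.toLp F) : L2 n) η - 𝓕 F η) volume :=
    ((Lp.memLp _).locallyIntegrable (by norm_num)).sub hc.locallyIntegrable
  have := ae_eq_zero_of_integral_contDiff_smul_eq_zero hL fun g hg hgc => ?_
  · filter_upwards [this] with η hη
    exact sub_eq_zero.mp hη
  have hgc' : HasCompactSupport fun x => (g x : ℂ) := hgc.comp_left Complex.ofReal_zero
  have hg' : ContDiff ℝ ((⊤ : ℕ∞) : WithTop ℕ∞) fun x => (g x : ℂ) :=
    Complex.ofRealCLM.contDiff.comp hg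
  set G : SchwartzMap (Rn n) ℂ := hgc'.toSchwartzMap hg' with hG
  have hGx : ∀ x, G x = (g x : ℂ) := fun x => rfl
  have e1 := congrArg (fun T => T G) (Lp.fourier_toTemperedDistribution_eq (h2.toLp F))
  simp only [TemperedDistribution.fourier_apply, Lp.toTemperedDistribution_apply] at e1
  have e2 : ∫ x, (𝓕 G) x • (h2.toLp F) x = ∫ x, (𝓕 G) x • F x := by
    refine integral_congr_ae ?_
    filter_upwards [h2.coeFn_toLp] with x hx
    rw [hx]
  have e3 : ∫ x, 𝓕 (G : Rn n → ℂ) x • F x = ∫ x, G x • 𝓕 F x := by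
    have := VectorFourier.integral_fourierIntegral_smul_eq_flip (μ := volume) (ν := volume)
      (L := innerₗ (Rn n)) Real.continuous_fourierChar continuous_inner G.integrable h1
    rw [flip_innerₗ] at this
    exact this
  have hGF : Integrable fun x => G x • (𝓕 (h2.toLp F) : L2 n) x :=
    (Lp.memLp (𝓕 (h2.toLp F) : L2 n)).integrable_mul (G.memLp 2 volume) |>.congr
      (.of_forall fun x => mul_comm _ _)
  have hGF' : Integrable fun x => G x • 𝓕 F x := by
    have hloc := hc.locallyIntegrable (μ := (volume : Measure (Rn n)))
    exact hloc.integrable_smul_left_of_hasCompactSupport G.continuous hgc'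
  calc ∫ x, g x • ((𝓕 (h2.toLp F) : L2 n) x - 𝓕 F x) =
      ∫ x, (G x • (𝓕 (h2.toLp F) : L2 n) x - G x • 𝓕 F x) := by
        refine integral_congr_ae (.of_forall fun x => ?_)
        simp only [hGx, smul_sub]
        rfl
    _ = 0 := by
        rw [integral_sub hGF hGF', ← e1, ← e3]
        exact sub_eq_zero.mpr e2

end

section

/-! ### Derivatives in `L²` and Sobolev norms -/

variable {n : ℕ}

/-- `v` is the weak partial derivative `∂_j u`, for `u` and `v` in `L²`. -/
def IsPartial (j : Fin n) (u v : L2 n) : Prop :=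
  (𝓕 v : L2 n) =ᵐ[volume] fun η => 2 * π * I * (η j : ℂ) * (𝓕 u : L2 n) η

lemma coeFn_fourier_add (u v : L2 n) :
    (𝓕 (u + v) : L2 n) =ᵐ[volume] fun η => (𝓕 u : L2 n) η + (𝓕 v : L2 n) η := by
  have h0 : (𝓕 (u + v) : L2 n) = 𝓕 u + 𝓕 v := by simp
  rw [h0]
  exact Lp.coeFn_add _ _

lemma coeFn_fourier_smul (a : ℂ) (u : L2 n) :
    (𝓕 (a • u) : L2 n) =ᵐ[volume] fun η => a * (𝓕 u : L2 n) η := by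
  have h0 : (𝓕 (a • u) : L2 n) = a • 𝓕 u := by simp
  rw [h0]
  exact Lp.coeFn_smul _ _

lemma coeFn_fourier_zero : (𝓕 (0 : L2 n) : L2 n) =ᵐ[volume] fun _ => 0 := by
  have h0 : (𝓕 (0 : L2 n) : L2 n) = 0 := by simp
  rw [h0]
  exact Lp.coeFn_zero _ _ _

lemma IsPartial.add {j : Fin n} {u v u' v' : L2 n} (h : IsPartial j u v) (h' : IsPartial j u' v') :
    IsPartial j (u + u') (v + v') := by
  filter_upwards [h, h', coeFn_fourier_add u u', coeFn_fourier_add v v'] with η h1 h2 h3 h4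
  rw [h3, h4, h1, h2]
  ring

lemma IsPartial.smul {j : Fin n} {u v : L2 n} (a : ℂ) (h : IsPartial j u v) :
    IsPartial j (a • u) (a • v) := by
  filter_upwards [h, coeFn_fourier_smul a u, coeFn_fourier_smul a v] with η h1 h2 h3
  rw [h2, h3, h1]
  ring

lemma isPartial_zero (j : Fin n) : IsPartial j (0 : L2 n) 0 := by
  filter_upwards [coeFn_fourier_zero (n := n)] with η h1
  rw [h1, mul_zero]

lemma IsPartial.sum {ι : Type*} {j : Fin n} (s : Finset ι) {u v : ι → L2 n}
    (h : ∀ i ∈ s, IsPartial j (u i) (v i)) : IsPartial j (∑ i ∈ s, u i) (∑ i ∈ s, v i) := by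
  classical
  induction s using Finset.induction_on with
  | empty => simpa using isPartial_zero j
  | insert i s hi ih =>
    rw [Finset.sum_insert hi, Finset.sum_insert hi]
    exact (h i (Finset.mem_insert_self _ _)).add (ih fun k hk => h k (Finset.mem_insert_of_mem hk))

/-- Integration by parts. -/
lemma IsPartial.inner_eq {j : Fin n} {u v u' v' : L2 n} (h : IsPartial j u v)
    (h' : IsPartial j u' v') : inner ℂ v u' = -inner ℂ u v' := by
  rw [← Lp.inner_fourier_eq v u', ← Lp.inner_fourier_eq u v', L2.inner_def, L2.inner_def,
    ← integral_neg]
  refine integral_congr_ae ?_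
  filter_upwards [h, h'] with η h1 h2
  rw [h1, h2, RCLike.inner_apply', RCLike.inner_apply']
  simp only [map_mul, Complex.conj_I, Complex.conj_ofReal, Complex.conj_ofNat]
  ring

lemma HasLineDerivAt.mul_apply {f g : Rn n → ℂ} {f' g' : ℂ} {x v : Rn n}
    (hf : HasLineDerivAt ℝ f f' x v) (hg : HasLineDerivAt ℝ g g' x v) :
    HasLineDerivAt ℝ (fun y => f y * g y) (f' * g x + f x * g') x v := by
  have := HasDerivAt.mul hf hg
  simp only [zero_smul, add_zero] at this
  exact this

lemma norm_exp_mul_I_sub_le (a b : ℝ) : ‖Complex.exp (a * I) - Complex.exp (b * I)‖ ≤ |a - b| := by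
  have e : Complex.exp (a * I) - Complex.exp (b * I) =
      Complex.exp (b * I) * (Complex.exp (I * ((a - b : ℝ) : ℂ)) - 1) := by
    rw [mul_sub, ← Complex.exp_add]
    congr 2
    · push_cast; ring
    · ring
  rw [e, norm_mul, Complex.norm_exp_ofReal_mul_I, one_mul]
  exact Real.norm_exp_I_mul_ofReal_sub_one_le

lemma inner_single_one (x : Rn n) (j : Fin n) : inner ℝ (single j (1 : ℝ)) x = x j := by
  rw [EuclideanSpace.inner_single_left]; simp

/-- An almost everywhere defined derivative of a locally Lipschitz function is a weak one. -/
lemma isPartial_toLp {F F' : Rn n → ℂ} {j : Fin n} (h1 : RapidBdd F) (h2 : RapidLip F)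
    (hm : Measurable F) (h1' : RapidBdd F') (hm' : Measurable F')
    (hd : ∀ᵐ x, HasLineDerivAt ℝ F (F' x) x (single j 1)) :
    IsPartial j ((h1.memLp hm).toLp F) ((h1'.memLp hm').toLp F') := by
  have hF := h1.integrable hm
  have hF' := h1'.integrable hm'
  have key : ∀ η, 𝓕 F' η = 2 * π * I * (η j : ℂ) * 𝓕 F η := by
    intro η
    set e : Rn n → ℂ := fun x => Complex.exp (((-2 * π * inner ℝ x η : ℝ) : ℂ) * I)
      with he
    have hec : Continuous e := by rw [he]; fun_prop
    have heL : PolyLip e := by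
      refine polyLip_of_lipschitz (A := 2 * π * ‖η‖) fun x y => ?_
      refine (norm_exp_mul_I_sub_le _ _).trans ?_
      rw [← mul_sub, ← inner_sub_left, abs_mul, abs_mul, abs_neg, abs_of_pos Real.pi_pos,
        abs_of_pos (by norm_num : (0 : ℝ) < 2), mul_assoc (2 * π), mul_comm ‖η‖]
      exact mul_le_mul_of_nonneg_left (abs_real_inner_le_norm _ _) (by positivity)
    have hed : ∀ x, HasLineDerivAt ℝ e (-(2 * π * I * (η j : ℂ)) * e x) x
        (single j 1) := by
      intro x
      have h3 : HasDerivAt (fun t : ℝ => ((-2 * π * (inner ℝ x η + t * η j) : ℝ) : ℂ) *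
          I) (((-2 * π * η j : ℝ) : ℂ) * I) 0 := by
        refine HasDerivAt.mul_const (HasDerivAt.ofReal_comp ?_) _
        have := (((hasDerivAt_id (0 : ℝ)).mul_const (η j)).const_add (inner ℝ x η)).const_mul
          (-2 * π)
        simpa using this
      have h4 := h3.cexp
      refine (HasDerivAt.congr_deriv (HasDerivAt.congr_of_eventuallyEq h4
        (.of_forall fun t => ?_)) ?_)
      · simp only [he, inner_add_left, real_inner_smul_left, inner_single_one]
      · simp only [he]
        push_cast
        ring_nf
    have hP : RapidBdd fun x => e x * F x := heL.polyBdd.mul_rapidBdd h1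
    have h5 := integral_lineDeriv_eq_zero (v := single j 1)
      (P' := fun x => -(2 * π * I * (η j : ℂ)) * e x * F x + e x * F' x)
      (by simp) hP (heL.mul_rapidLip h2 h1) (hec.measurable.mul hm) (by
        filter_upwards [hd] with x hx
        exact HasLineDerivAt.mul_apply (hed x) hx)
    have i1 : Integrable fun x => e x * F x := hP.integrable (hec.measurable.mul hm)
    have i2 : Integrable fun x => e x * F' x :=
      (heL.polyBdd.mul_rapidBdd h1').integrable (hec.measurable.mul hm')
    simp_rw [mul_assoc _ (e _)] at h5
    rw [integral_add (i1.const_mul _) i2, integral_const_mul] at h5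
    rw [Real.fourier_eq', Real.fourier_eq']
    simp only [smul_eq_mul]
    linear_combination h5
  filter_upwards [fourier_toLp_ae_eq hF (h1.memLp hm), fourier_toLp_ae_eq hF' (h1'.memLp hm')]
    with η h3 h4
  rw [h3, h4, key]

lemma measurable_weight (r : ℝ) : Measurable fun η : Rn n => ofReal ((1 + ‖η‖ ^ 2) ^ r) := by
  refine ENNReal.measurable_ofReal.comp (Continuous.measurable ?_)
  exact Continuous.rpow_const (by fun_prop) (fun x => Or.inl (by positivity))

lemma aemeasurable_fourier_sq (u : L2 n) : AEMeasurable (fun η => ‖(𝓕 u : L2 n) η‖ₑ ^ 2) volume :=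
  (Lp.aestronglyMeasurable (𝓕 u : L2 n)).enorm.pow_const 2

lemma sobolevNorm_sq (r : ℝ) (u : L2 n) :
    sobolevNorm r u ^ 2 = ∫⁻ η, ofReal ((1 + ‖η‖ ^ 2) ^ r) * ‖(𝓕 u : L2 n) η‖ₑ ^ 2 := by
  rw [sobolevNorm, eLpNorm_eq_lintegral_rpow_enorm_toReal (by norm_num) (by norm_num)]
  rw [← ENNReal.rpow_natCast, ← ENNReal.rpow_mul]
  norm_num
  refine lintegral_congr fun η => ?_
  rw [mul_pow]
  congr 1
  rw [← ofReal_norm, norm_real, norm_eq_abs, abs_of_nonneg (by positivity),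
    ← ofReal_pow (by positivity), ← rpow_natCast, ← rpow_mul (by positivity)]
  congr 2
  push_cast
  ring

lemma enorm_sq_eq_lintegral (u : L2 n) : ‖u‖ₑ ^ 2 = ∫⁻ x, ‖u x‖ₑ ^ 2 := by
  rw [Lp.enorm_def, eLpNorm_eq_lintegral_rpow_enorm_toReal (by norm_num) (by norm_num)]
  rw [← ENNReal.rpow_natCast, ← ENNReal.rpow_mul]
  norm_num

lemma enorm_fourier (u : L2 n) : ‖(𝓕 u : L2 n)‖ₑ = ‖u‖ₑ := by
  rw [← ofReal_norm, ← ofReal_norm, Lp.norm_fourier_eq]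

lemma le_of_sq_le_sq_ennreal {a b : ℝ≥0∞} (h : a ^ 2 ≤ b ^ 2) : a ≤ b :=
  (ENNReal.pow_le_pow_left_iff two_ne_zero).mp h

lemma sobolevNorm_zero_eq (u : L2 n) : sobolevNorm 0 u = ‖u‖ₑ := by
  have h : sobolevNorm 0 u ^ 2 = ‖u‖ₑ ^ 2 := by
    rw [sobolevNorm_sq, ← enorm_fourier, enorm_sq_eq_lintegral]
    simp
  exact le_antisymm (le_of_sq_le_sq_ennreal h.le) (le_of_sq_le_sq_ennreal h.ge)

lemma sobolevNorm_mono {r r' : ℝ} (h : r ≤ r') (u : L2 n) : sobolevNorm r u ≤ sobolevNorm r' u := by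
  refine le_of_sq_le_sq_ennreal ?_
  rw [sobolevNorm_sq, sobolevNorm_sq]
  refine lintegral_mono fun η => mul_le_mul_left (ofReal_le_ofReal ?_) _
  exact Real.rpow_le_rpow_of_exponent_le (by linarith [sq_nonneg ‖η‖]) h

lemma sobolevNorm_add_le (r : ℝ) (u v : L2 n) :
    sobolevNorm r (u + v) ≤ sobolevNorm r u + sobolevNorm r v := by
  unfold sobolevNorm
  refine le_trans (le_of_eq ?_) (eLpNorm_add_le (aestronglyMeasurable_sobolev r u)
    (aestronglyMeasurable_sobolev r v) (by norm_num))
  refine eLpNorm_congr_ae ?_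
  filter_upwards [coeFn_fourier_add u v] with η h
  rw [h, Pi.add_apply]
  ring

lemma sobolevNorm_zero (r : ℝ) : sobolevNorm r (0 : L2 n) = 0 := by
  unfold sobolevNorm
  simp

lemma sobolevNorm_sum_le {ι : Type*} (r : ℝ) (s : Finset ι) (u : ι → L2 n) :
    sobolevNorm r (∑ i ∈ s, u i) ≤ ∑ i ∈ s, sobolevNorm r (u i) := by
  classical
  induction s using Finset.induction_on with
  | empty => simp [sobolevNorm_zero]
  | insert i s hi ih =>
    rw [Finset.sum_insert hi, Finset.sum_insert hi]
    exact (sobolevNorm_add_le r _ _).trans (add_le_add le_rfl ih)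

lemma enorm_two_pi_I_mul_sq (t : ℝ) (z : ℂ) :
    ‖2 * π * I * (t : ℂ) * z‖ₑ ^ 2 = ofReal ((2 * π) ^ 2 * t ^ 2) * ‖z‖ₑ ^ 2 := by
  rw [enorm_mul, mul_pow, ← ofReal_norm, ← ofReal_pow (norm_nonneg _), ← mul_pow,
    ← sq_abs (2 * π * t)]
  simp [abs_mul, abs_of_pos Real.pi_pos]

lemma IsPartial.sobolevNorm_le {j : Fin n} {u v : L2 n} (h : IsPartial j u v) (r : ℝ) :
    sobolevNorm (r - 1) v ≤ ofReal (2 * π) * sobolevNorm r u := by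
  refine le_of_sq_le_sq_ennreal ?_
  rw [mul_pow, sobolevNorm_sq, sobolevNorm_sq, ← ofReal_pow (by positivity),
    ← lintegral_const_mul' _ _ ofReal_ne_top]
  refine lintegral_mono_ae ?_
  filter_upwards [h] with η hη
  have h0 : 0 < 1 + ‖η‖ ^ 2 := by positivity
  rw [hη, enorm_two_pi_I_mul_sq, ← mul_assoc, ← mul_assoc, ← ofReal_mul (by positivity),
    ← ofReal_mul (by positivity), mul_left_comm, Real.rpow_sub_one h0.ne']
  gcongr
  rw [div_mul_eq_mul_div, div_le_iff₀ h0]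
  gcongr
  have := sq_le_sq.mpr ((abs_coord_le η j).trans (le_abs_self _))
  linarith

lemma sobolevNorm_succ_sq_le (r : ℝ) {u : L2 n} {v : Fin n → L2 n} (h : ∀ j, IsPartial j u (v j)) :
    sobolevNorm (r + 1) u ^ 2 ≤ sobolevNorm r u ^ 2 + ∑ j, sobolevNorm r (v j) ^ 2 := by
  simp_rw [sobolevNorm_sq]
  have hm : ∀ w : L2 n, AEMeasurable (fun η => ofReal ((1 + ‖η‖ ^ 2) ^ r) *
      ‖(𝓕 w : L2 n) η‖ₑ ^ 2) volume := fun w =>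
    (measurable_weight r).aemeasurable.mul (aemeasurable_fourier_sq _)
  rw [← lintegral_finsetSum' _ fun j _ => hm (v j), ← lintegral_add_left' (hm u)]
  refine lintegral_mono_ae ?_
  filter_upwards [ae_all_iff.mpr h] with η hη
  have h0 : 0 < 1 + ‖η‖ ^ 2 := by positivity
  simp_rw [hη, enorm_two_pi_I_mul_sq, ← mul_assoc, ← sum_mul, ← add_mul, ← mul_sum,
    ← ofReal_sum_of_nonneg fun (j : Fin n) _ => (by positivity : 0 ≤ (2 * π) ^ 2 * η j ^ 2)]
  rw [← ofReal_mul (by positivity), ← ENNReal.ofReal_add (by positivity) (by positivity),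
    Real.rpow_add_one h0.ne', mul_add, mul_one, ← mul_sum, ← norm_sq_eq_sum]
  gcongr
  exact le_mul_of_one_le_left (sq_nonneg _) (one_le_pow₀ (by linarith [Real.pi_gt_three]))

/-! ### Gaussians are rapidly decreasing -/

lemma hasLineDerivAt_gaussian (δ : ℝ) (y η x v : Rn n) :
    HasLineDerivAt ℝ (gaussian δ y η) ((I * ((inner ℝ η v : ℝ) : ℂ) -
      ((2 * ‖η‖ * inner ℝ (x - y) v : ℝ) : ℂ)) * gaussian δ y η x) x v := by
  have h1 : HasDerivAt (fun t : ℝ => I * ((inner ℝ η (x - y) + t * inner ℝ η v : ℝ) : ℂ) -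
      ((‖η‖ * (‖x - y‖ ^ 2 + 2 * (t * inner ℝ (x - y) v) + t ^ 2 * ‖v‖ ^ 2) : ℝ) : ℂ))
      (I * ((inner ℝ η v : ℝ) : ℂ) - ((2 * ‖η‖ * inner ℝ (x - y) v : ℝ) : ℂ)) 0 := by
    refine HasDerivAt.sub (HasDerivAt.const_mul _ (HasDerivAt.ofReal_comp ?_))
      (HasDerivAt.ofReal_comp ?_)
    · simpa using ((hasDerivAt_id (0 : ℝ)).mul_const (inner ℝ η v)).const_add (inner ℝ η (x - y))
    · have h2 := ((((hasDerivAt_id (0 : ℝ)).mul_const (inner ℝ (x - y) v)).const_mul 2).const_add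
        (‖x - y‖ ^ 2)).add (((hasDerivAt_id (0 : ℝ)).pow 2).mul_const (‖v‖ ^ 2))
      have h3 := h2.const_mul ‖η‖
      refine HasDerivAt.congr_deriv h3 ?_
      simp
      ring
  have h4 := (h1.cexp).const_mul (((‖η‖ * δ / (2 * π)) ^ ((n : ℝ) / 2) : ℝ) : ℂ)
  refine HasDerivAt.congr_deriv (HasDerivAt.congr_of_eventuallyEq h4
    (.of_forall fun t => ?_)) ?_
  · simp only [gaussian]
    have e : x + t • v - y = (x - y) + t • v := by abel
    rw [e, inner_add_right, real_inner_smul_right, norm_add_sq_real, real_inner_smul_right,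
      norm_smul, mul_pow, norm_eq_abs, sq_abs]
  · simp only [gaussian]
    simp
    ring

lemma rapidBdd_gaussian {δ : ℝ} (hδ : 0 ≤ δ) (y : Rn n) {η : Rn n} (hη : η ≠ 0) :
    RapidBdd (gaussian δ y η) := by
  intro N
  have hη' : 0 < ‖η‖ := norm_pos_iff.mpr hη
  obtain ⟨C, hC, h⟩ := exists_one_add_pow_mul_exp_le N hη'
  refine ⟨(√(‖η‖ * δ / (2 * π)) ^ n + 1) * C * (1 + ‖y‖) ^ N, by positivity, fun x => ?_⟩
  have h1 : (1 + ‖x‖) ^ N ≤ (1 + ‖y‖) ^ N * (1 + ‖x - y‖) ^ N := by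
    rw [← mul_pow]
    refine pow_le_pow_left₀ (by positivity) ?_ N
    have := norm_le_norm_add_norm_sub' x y
    nlinarith [mul_nonneg (norm_nonneg y) (norm_nonneg (x - y))]
  rw [norm_gaussian hδ]
  have h2 := h ‖x - y‖ (norm_nonneg _)
  set a := √(‖η‖ * δ / (2 * π)) ^ n
  calc a * exp (-(‖η‖ * ‖x - y‖ ^ 2)) * (1 + ‖x‖) ^ N ≤
      a * exp (-(‖η‖ * ‖x - y‖ ^ 2)) * ((1 + ‖y‖) ^ N * (1 + ‖x - y‖) ^ N) := by gcongr
    _ = a * (1 + ‖y‖) ^ N * ((1 + ‖x - y‖) ^ N * exp (-(‖η‖ * ‖x - y‖ ^ 2))) := by ring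
    _ ≤ (a + 1) * (1 + ‖y‖) ^ N * C :=
        mul_le_mul (mul_le_mul_of_nonneg_right (by linarith) (by positivity)) h2 (by positivity)
          (by positivity)
    _ = _ := by ring

lemma rapidLip_gaussian {δ : ℝ} (hδ : 0 ≤ δ) (y : Rn n) {η : Rn n} (hη : η ≠ 0) :
    RapidLip (gaussian δ y η) := by
  intro N
  obtain ⟨A, hA, h⟩ := rapidBdd_gaussian hδ y hη (N + 1)
  set B : ℝ := ‖η‖ * (1 + 2 * (1 + ‖y‖)) with hB
  refine ⟨(B + 1) * A * 2 ^ N, by positivity, fun x v hv => ?_⟩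
  have hd : ∀ s ∈ Icc (0 : ℝ) 1, HasDerivWithinAt (fun t : ℝ => gaussian δ y η (x + t • v))
      ((I * ((inner ℝ η v : ℝ) : ℂ) - ((2 * ‖η‖ * inner ℝ (x + s • v - y) v : ℝ) : ℂ)) *
        gaussian δ y η (x + s • v)) (Icc 0 1) s := by
    intro s _
    have h1 := hasLineDerivAt_gaussian δ y η (x + s • v) v
    rw [HasLineDerivAt, ← sub_self s] at h1
    refine (h1.comp_sub_const s s |>.congr_of_eventuallyEq
      (.of_forall fun t => ?_)).hasDerivWithinAt
    simp only [sub_smul, add_assoc, add_sub_cancel]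
  have hb : ∀ s ∈ Ico (0 : ℝ) 1,
      ‖(I * ((inner ℝ η v : ℝ) : ℂ) - ((2 * ‖η‖ * inner ℝ (x + s • v - y) v : ℝ) : ℂ)) *
        gaussian δ y η (x + s • v)‖ ≤ B * A * 2 ^ N * ‖v‖ / (1 + ‖x‖) ^ N := by
    intro s hs
    set z := x + s • v with hz
    have hsv : ‖s • v‖ ≤ 1 := by
      rw [norm_smul, norm_of_nonneg hs.1]
      exact mul_le_one₀ hs.2.le (norm_nonneg v) hv
    have h1 := one_add_norm_le x hsv
    have h2 : ‖I * ((inner ℝ η v : ℝ) : ℂ) - ((2 * ‖η‖ * inner ℝ (z - y) v : ℝ) : ℂ)‖ ≤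
        B * (1 + ‖z‖) * ‖v‖ := by
      refine (norm_sub_le _ _).trans ?_
      rw [norm_mul, Complex.norm_I, one_mul, norm_real, norm_real,
        norm_eq_abs, norm_eq_abs, abs_mul, abs_of_nonneg (by positivity : 0 ≤ 2 * ‖η‖)]
      calc _ ≤ ‖η‖ * ‖v‖ + 2 * ‖η‖ * ((‖z‖ + ‖y‖) * ‖v‖) := by
            gcongr
            · exact abs_real_inner_le_norm η v
            · exact (abs_real_inner_le_norm _ v).trans (by gcongr; exact norm_sub_le z y)
        _ = ‖η‖ * (1 + 2 * (‖z‖ + ‖y‖)) * ‖v‖ := by ring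
        _ ≤ _ := by
            rw [hB, mul_assoc ‖η‖ _ (1 + ‖z‖)]
            gcongr
            nlinarith [norm_nonneg z, mul_nonneg (norm_nonneg y) (norm_nonneg z)]
    rw [le_div_iff₀ (by positivity), norm_mul]
    calc _ ≤ (B * (1 + ‖z‖) * ‖v‖) * ‖gaussian δ y η z‖ * (2 * (1 + ‖z‖)) ^ N := by gcongr
      _ = B * ‖v‖ * 2 ^ N * (‖gaussian δ y η z‖ * (1 + ‖z‖) ^ (N + 1)) := by
          rw [mul_pow]; ring
      _ ≤ B * ‖v‖ * 2 ^ N * A := by gcongr; exact h z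
      _ = _ := by ring
  have hmv := norm_image_sub_le_of_norm_deriv_le_segment_01' hd hb
  simp only [one_smul, zero_smul, add_zero] at hmv
  rw [le_div_iff₀ (by positivity)] at hmv
  have : 0 ≤ A * 2 ^ N * ‖v‖ := by positivity
  linarith

end

section

/-! ### Almost orthogonality of the levels -/

variable {n : ℕ} {Z : FrequencyNet n} {Θ : Type*}

/-- The Gaussians with the phase space centres `(X_γ, Ξ_γ)`, depending on parameters `θ`, are
spread out like the Gaussians of the frame, uniformly in `θ`. -/
structure IsPacketSystem (Z : FrequencyNet n) (ε c : ℝ) (X Ξ : Θ → Index Z → Rn n) : Prop where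
  ε_pos : 0 < ε
  c_pos : 0 < c
  spread : ∃ M L, 1 ≤ M ∧ 0 < L ∧ ∀ θ, PhaseFamily Z ε c M L (X θ) (Ξ θ)

/-- The function `f_γ φ_γ`, where `φ_γ` is the Gaussian at `(X_γ, Ξ_γ)`, as an element of `L²`
(and zero when it is not square integrable). -/
def packet (ε c : ℝ) (X Ξ : Θ → Index Z → Rn n) (f : Amplitude Z Θ) (θ : Θ) (γ : Index Z) : L2 n :=
  open Classical in
  if h : MemLp (fun x => f θ γ x * gaussian (spacing ε c γ.1) (X θ γ) (Ξ θ γ) x) 2 volume then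
    h.toLp _ else 0

/-- The derivatives of the multipliers `f_γ` are the `f'_γ`, almost everywhere. -/
def IsGradient (f : Amplitude Z Θ) (f' : Fin n → Amplitude Z Θ) : Prop :=
  (∀ θ γ, PolyLip (f θ γ)) ∧ ∀ j θ γ, ∀ᵐ x, HasLineDerivAt ℝ (f θ γ) (f' j θ γ x) x (single j 1)

/-- The multiplier of `∂_j (f_γ φ_γ)`. -/
def derivSymbol (X Ξ : Θ → Index Z → Rn n) (f : Amplitude Z Θ)
    (f' : Fin n → Amplitude Z Θ) (j : Fin n) (θ : Θ) (γ : Index Z) (x : Rn n) : ℂ :=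
  f' j θ γ x + (I * (Ξ θ γ j : ℂ) - 2 * (‖Ξ θ γ‖ : ℂ) * (((x - X θ γ) j : ℝ) : ℂ)) * f θ γ x

/-- The factor `i ξ_j / |ξ|²`. -/
def invFreq (Ξ : Θ → Index Z → Rn n) (j : Fin n) (θ : Θ) (γ : Index Z) : ℂ :=
  I * (Ξ θ γ j : ℂ) / (‖Ξ θ γ‖ : ℂ) ^ 2

/-- The components of an antiderivative of `f_γ φ_γ`, up to lower order: they are the multiples
`-i ξ_j |ξ|⁻²` of it. -/
def primitive (Ξ : Θ → Index Z → Rn n) (j : Fin n) (f : Amplitude Z Θ) : Amplitude Z Θ :=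
  fun θ γ x => -invFreq Ξ j θ γ * f θ γ x

/-- The multiplier of the remainder in the representation of `f_γ φ_γ` as a sum of derivatives:
`f φ = ∑ ∂_j (-i ξ_j |ξ|⁻² f φ) + g φ`, where `g` is of lower order than `f`. -/
def remainderSymbol (X Ξ : Θ → Index Z → Rn n) (f : Amplitude Z Θ)
    (f' : Fin n → Amplitude Z Θ) (θ : Θ) (γ : Index Z) (x : Rn n) : ℂ :=
  ∑ j, invFreq Ξ j θ γ * (f' j θ γ x + (-2 * (‖Ξ θ γ‖ : ℂ)) * (((x - X θ γ) j : ℝ) : ℂ) * f θ γ x)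

variable {ε c : ℝ} {X Ξ : Θ → Index Z → Rn n}
  {m m' : ℤ} {f g : Amplitude Z Θ} {f' : Fin n → Amplitude Z Θ}

lemma IsMultiplier.polyBdd (hf : IsMultiplier X m f) (θ : Θ) (γ : Index Z) : PolyBdd (f θ γ) := by
  obtain ⟨p, A, hA, h⟩ := hf.norm_le
  have hs := scale_pos γ.1
  refine ⟨p, A * scale γ.1 ^ m * ((1 + scale γ.1) * (1 + ‖X θ γ‖)) ^ p, by positivity, fun x =>
    (h θ γ x).trans ?_⟩
  rw [mul_assoc _ (_ ^ p), ← mul_pow]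
  refine mul_le_mul_of_nonneg_left (pow_le_pow_left₀ (by positivity) ?_ p) (by positivity)
  have h1 := norm_sub_le x (X θ γ)
  have h0 := norm_nonneg x
  have h0' := norm_nonneg (X θ γ)
  nlinarith [mul_nonneg hs.le h0, mul_nonneg hs.le h0', mul_nonneg h0 h0',
    mul_nonneg hs.le (mul_nonneg h0 h0'), mul_le_mul_of_nonneg_left h1 hs.le]

lemma IsPacketSystem.freq_ne_zero (hS : IsPacketSystem Z ε c X Ξ) (θ : Θ) (γ : Index Z) :
    Ξ θ γ ≠ 0 := by
  obtain ⟨M, L, hM, hL, h⟩ := hS.spread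
  intro h0
  have := (h θ).lower γ
  rw [h0, norm_zero, mul_zero] at this
  have h2 : (0 : ℝ) < 2 ^ γ.1 := by positivity
  linarith

lemma IsPacketSystem.exists_freq_bound (hS : IsPacketSystem Z ε c X Ξ) :
    ∃ M, 0 < M ∧ ∀ θ γ, scale γ.1 ^ 2 ≤ M * ‖Ξ θ γ‖ ∧ ‖Ξ θ γ‖ ≤ M * scale γ.1 ^ 2 := by
  obtain ⟨M, L, hM, hL, h⟩ := hS.spread
  refine ⟨M, by linarith, fun θ γ => ?_⟩
  rw [scale_sq]
  exact ⟨(h θ).lower γ, (h θ).upper γ⟩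

lemma IsMultiplier.rapidBdd (hS : IsPacketSystem Z ε c X Ξ) (hf : IsMultiplier X m f) (θ : Θ)
    (γ : Index Z) :
    RapidBdd fun x => f θ γ x * gaussian (spacing ε c γ.1) (X θ γ) (Ξ θ γ) x :=
  (hf.polyBdd θ γ).mul_rapidBdd
    (rapidBdd_gaussian (spacing_pos hS.c_pos _).le _ (hS.freq_ne_zero θ γ))

lemma IsMultiplier.measurable_mul (hf : IsMultiplier X m f) (θ : Θ) (γ : Index Z) :
    Measurable fun x => f θ γ x * gaussian (spacing ε c γ.1) (X θ γ) (Ξ θ γ) x :=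
  (hf.measurable θ γ).mul (continuous_gaussian _ _ _).measurable

lemma IsMultiplier.packet_eq (hS : IsPacketSystem Z ε c X Ξ) (hf : IsMultiplier X m f) (θ : Θ)
    (γ : Index Z) :
    packet ε c X Ξ f θ γ = ((hf.rapidBdd hS θ γ).memLp (hf.measurable_mul θ γ)).toLp _ := by
  rw [packet, dif_pos]

lemma IsMultiplier.coeFn_packet (hS : IsPacketSystem Z ε c X Ξ) (hf : IsMultiplier X m f) (θ : Θ)
    (γ : Index Z) :
    packet ε c X Ξ f θ γ =ᵐ[volume]
      fun x => f θ γ x * gaussian (spacing ε c γ.1) (X θ γ) (Ξ θ γ) x := by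
  rw [hf.packet_eq hS]
  exact MemLp.coeFn_toLp _

lemma coeFn_sum {ι : Type*} (s : Finset ι) (u : ι → L2 n) :
    (∑ i ∈ s, u i : L2 n) =ᵐ[volume] fun x => ∑ i ∈ s, u i x := by
  classical
  induction s using Finset.induction_on with
  | empty =>
    exact .of_forall fun x => by simp
  | insert i s hi ih =>
    rw [Finset.sum_insert hi]
    filter_upwards [Lp.coeFn_add (u i) (∑ i ∈ s, u i), ih] with x h1 h2
    rw [h1, Pi.add_apply, h2, Finset.sum_insert hi]

lemma coeFn_sum_smul {ι : Type*} (s : Finset ι) (d : ι → ℂ) (u : ι → L2 n) :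
    (∑ i ∈ s, d i • u i : L2 n) =ᵐ[volume] fun x => ∑ i ∈ s, d i * u i x := by
  have h : ∀ᵐ x, ∀ i ∈ s, (d i • u i : L2 n) x = d i * u i x := by
    rw [Filter.eventually_all_finset]
    intro i _
    filter_upwards [Lp.coeFn_smul (d i) (u i)] with x hx
    rw [hx, Pi.smul_apply, smul_eq_mul]
  filter_upwards [coeFn_sum s fun i => d i • u i, h] with x h1 h2
  rw [h1]
  exact sum_congr rfl h2

/-- Sums of packets of one level. -/
lemma IsMultiplier.exists_norm_level_le (hS : IsPacketSystem Z ε c X Ξ) (hf : IsMultiplier X m f) :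
    ∃ C, 0 < C ∧ ∀ θ k (F : Finset (Index Z)) (d : Index Z → ℂ), (∀ γ ∈ F, γ.1 = k) →
      ‖∑ γ ∈ F, d γ • packet ε c X Ξ f θ γ‖ ≤ C * (scale k ^ m * √(∑ γ ∈ F, ‖d γ‖ ^ 2)) := by
  obtain ⟨M, L, hM, hL, hP⟩ := hS.spread
  obtain ⟨C, hC, h⟩ := hf.exists_level_sum_le hS.ε_pos hS.c_pos hM hL hP
  refine ⟨√C, by positivity, fun θ k F d hF => ?_⟩
  have hinj : Function.Injective fun q : Z.pts k × (Fin n → ℤ) => (⟨k, q⟩ : Index Z) :=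
    fun a b hab => by simpa using hab
  set F' : Finset (Z.pts k × (Fin n → ℤ)) := F.preimage (fun q => ⟨k, q⟩) hinj.injOn
  have hsum : ∀ {E : Type} [AddCommMonoid E] (u : Index Z → E),
      ∑ γ ∈ F, u γ = ∑ q ∈ F', u ⟨k, q⟩ := by
    refine fun u => (Finset.sum_preimage (fun q => ⟨k, q⟩) F hinj.injOn u ?_).symm
    rintro ⟨k', q⟩ hγ hγ'
    obtain rfl := hF _ hγ
    exact absurd ⟨q, rfl⟩ hγ'
  have hs := scale_pos k
  refine le_of_sq_le_sq ?_ (by positivity)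
  rw [mul_pow, mul_pow, sq_sqrt hC.le, sq_sqrt (by positivity), hsum fun γ => ‖d γ‖ ^ 2,
    ← mul_assoc, ← ENNReal.ofReal_le_ofReal_iff (by positivity), ofReal_pow (norm_nonneg _),
    ofReal_norm, enorm_sq_eq_lintegral]
  refine le_trans (le_of_eq (lintegral_congr_ae ?_)) (h θ k F' fun q => d ⟨k, q⟩)
  have h2 : ∀ᵐ x, ∀ q ∈ F', packet ε c X Ξ f θ ⟨k, q⟩ x = f θ ⟨k, q⟩ x *
      gaussian (spacing ε c k) (X θ ⟨k, q⟩) (Ξ θ ⟨k, q⟩) x :=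
    Filter.eventually_all_finset _ |>.mpr fun q _ => hf.coeFn_packet hS θ ⟨k, q⟩
  rw [hsum fun γ => d γ • packet ε c X Ξ f θ γ]
  filter_upwards [coeFn_sum_smul F' (fun q => d ⟨k, q⟩)
    fun q => packet ε c X Ξ f θ ⟨k, q⟩, h2] with x h3 h4
  rw [h3, sum_congr rfl fun q hq => by rw [h4 q hq]]

lemma isMultiplier_complex (u : ℂ) : IsMultiplier X 0 fun _ (_ : Index Z) _ => u :=
  isMultiplier_const (A := ‖u‖) fun _ _ => by simp

lemma IsMultiplier.congr_order (hf : IsMultiplier X m f)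
    (h : m = m') : IsMultiplier X m' f := h ▸ hf

lemma IsPacketSystem.isMultiplier_freq (hS : IsPacketSystem Z ε c X Ξ) (j : Fin n) :
    IsMultiplier X 2 fun θ γ _ => (Ξ θ γ j : ℂ) := by
  obtain ⟨M, hM, h⟩ := hS.exists_freq_bound
  refine isMultiplier_const (A := M) fun θ γ => ?_
  rw [norm_real, norm_eq_abs]
  exact (abs_coord_le _ j).trans (h θ γ).2

lemma IsPacketSystem.isMultiplier_norm_freq (hS : IsPacketSystem Z ε c X Ξ) :
    IsMultiplier X 2 fun θ γ _ => (‖Ξ θ γ‖ : ℂ) := by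
  obtain ⟨M, hM, h⟩ := hS.exists_freq_bound
  refine isMultiplier_const (A := M) fun θ γ => ?_
  rw [norm_real, norm_norm]
  exact (h θ γ).2

lemma IsPacketSystem.isMultiplier_invFreq (hS : IsPacketSystem Z ε c X Ξ) (j : Fin n) :
    IsMultiplier X (-2) fun θ γ _ => invFreq Ξ j θ γ := by
  obtain ⟨M, hM, h⟩ := hS.exists_freq_bound
  refine isMultiplier_const (A := M) fun θ γ => ?_
  have h0 : 0 < ‖Ξ θ γ‖ := norm_pos_iff.mpr (hS.freq_ne_zero θ γ)
  have hs := scale_pos γ.1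
  rw [invFreq, norm_div, norm_mul, norm_pow, Complex.norm_I, one_mul, norm_real, norm_real,
    norm_norm, norm_eq_abs, zpow_neg, zpow_ofNat, ← div_eq_mul_inv]
  calc |Ξ θ γ j| / ‖Ξ θ γ‖ ^ 2 ≤ ‖Ξ θ γ‖ / ‖Ξ θ γ‖ ^ 2 := by gcongr; exact abs_coord_le _ j
    _ = 1 / ‖Ξ θ γ‖ := by field_simp
    _ ≤ _ := by rw [div_le_div_iff₀ h0 (by positivity), one_mul]; exact (h θ γ).1

lemma IsPacketSystem.isMultiplier_primitive (hS : IsPacketSystem Z ε c X Ξ)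
    (hf : IsMultiplier X m f) (j : Fin n) : IsMultiplier X (m - 2) (primitive Ξ j f) := by
  have e : primitive Ξ j f = fun θ γ x => -1 * invFreq Ξ j θ γ * f θ γ x := by
    simp [primitive, funext_iff]
  rw [e]
  exact (((isMultiplier_complex (-1)).mul (hS.isMultiplier_invFreq j)).mul hf).congr_order (by ring)

lemma IsPacketSystem.isMultiplier_derivSymbol (hS : IsPacketSystem Z ε c X Ξ)
    (hf : IsMultiplier X m f)
    {j : Fin n} (hf' : IsMultiplier X (m + 1) (f' j)) :
    IsMultiplier X (m + 2) (derivSymbol X Ξ f f' j) := by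
  have h1 : IsMultiplier X 2 fun θ γ x =>
      I * (Ξ θ γ j : ℂ) + (-2) * (‖Ξ θ γ‖ : ℂ) * (((x - X θ γ) j : ℝ) : ℂ) :=
    (((isMultiplier_complex I).mul (hS.isMultiplier_freq j)).congr_order (by norm_num)).add
      ((((isMultiplier_complex (-2)).mul hS.isMultiplier_norm_freq).mul
        (isMultiplier_coord X j)).mono (by norm_num))
  have h2 := (hf'.mono (by omega : m + 1 ≤ m + 2)).add ((h1.mul hf).congr_order (add_comm 2 m))
  have e : derivSymbol X Ξ f f' j = fun θ γ x => f' j θ γ x + (I * (Ξ θ γ j : ℂ) +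
      (-2) * (‖Ξ θ γ‖ : ℂ) * (((x - X θ γ) j : ℝ) : ℂ)) * f θ γ x := by
    funext θ γ x
    rw [derivSymbol]
    ring
  rw [e]
  exact h2

lemma IsPacketSystem.isMultiplier_remainderSymbol (hS : IsPacketSystem Z ε c X Ξ)
    (hf : IsMultiplier X m f)
    (hf' : ∀ j, IsMultiplier X (m + 1) (f' j)) :
    IsMultiplier X (m - 1) (remainderSymbol X Ξ f f') := by
  refine IsMultiplier.finsetSum _ fun j _ => ?_
  refine ((hS.isMultiplier_invFreq j).mul (m' := m + 1) ((hf' j).add ?_)).congr_order (by ring)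
  exact ((((isMultiplier_complex (-2)).mul hS.isMultiplier_norm_freq).mul
    (isMultiplier_coord X j)).mul hf).congr_order (by ring)

/-- The packets of the derivative symbols are the derivatives of the packets. -/
lemma IsPacketSystem.isPartial_packet (hS : IsPacketSystem Z ε c X Ξ) (hg : IsGradient f f')
    (hf : IsMultiplier X m f) {j : Fin n} (hf' : IsMultiplier X (m + 1) (f' j)) (θ : Θ)
    (γ : Index Z) :
    IsPartial j (packet ε c X Ξ f θ γ) (packet ε c X Ξ (derivSymbol X Ξ f f' j) θ γ) := by
  have hD := hS.isMultiplier_derivSymbol hf hf'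
  rw [hf.packet_eq hS, hD.packet_eq hS]
  have hδ := (spacing_pos (ε := ε) hS.c_pos γ.1).le
  have h0 := hS.freq_ne_zero θ γ
  refine isPartial_toLp (hf.rapidBdd hS θ γ) ?_ (hf.measurable_mul θ γ) (hD.rapidBdd hS θ γ)
    (hD.measurable_mul θ γ) ?_
  · exact (hg.1 θ γ).mul_rapidLip (rapidLip_gaussian hδ _ h0) (rapidBdd_gaussian hδ _ h0)
  · filter_upwards [hg.2 j θ γ] with x hx
    have := HasLineDerivAt.mul_apply hx
      (hasLineDerivAt_gaussian (spacing ε c γ.1) (X θ γ) (Ξ θ γ) x (single j 1))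
    rw [real_inner_comm _ (Ξ θ γ), real_inner_comm _ (x - X θ γ), inner_single_one,
      inner_single_one] at this
    convert this using 1
    rw [derivSymbol]
    push_cast
    ring

lemma IsGradient.primitive (hg : IsGradient f f') (j : Fin n) :
    IsGradient (primitive Ξ j f) fun k => primitive Ξ j (f' k) := by
  refine ⟨fun θ γ => (polyLip_const _).mul (hg.1 θ γ), fun k θ γ => ?_⟩
  filter_upwards [hg.2 k θ γ] with x hx
  exact HasDerivAt.const_mul (-invFreq Ξ j θ γ) hx

/-- A packet is a sum of derivatives of packets of order one less, up to a remainder of order one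
half less. -/
lemma IsPacketSystem.packet_eq_sum_add (hS : IsPacketSystem Z ε c X Ξ) (hf : IsMultiplier X m f)
    (hf' : ∀ j, IsMultiplier X (m + 1) (f' j)) (θ : Θ) (γ : Index Z) :
    packet ε c X Ξ f θ γ = ∑ j, packet ε c X Ξ (derivSymbol X Ξ
      (primitive Ξ j f) (fun k => primitive Ξ j (f' k)) j) θ γ +
        packet ε c X Ξ (remainderSymbol X Ξ f f') θ γ := by
  have hR := hS.isMultiplier_remainderSymbol hf hf'
  set u : Fin n → L2 n := fun j => packet ε c X Ξ (derivSymbol X Ξ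
    (primitive Ξ j f) (fun k => primitive Ξ j (f' k)) j) θ γ
  have h1 : ∀ᵐ x, ∀ j, u j x = _ := ae_all_iff.mpr fun j =>
    (hS.isMultiplier_derivSymbol (f' := fun k => primitive Ξ j (f' k)) (j := j)
      (hS.isMultiplier_primitive hf j) ((hS.isMultiplier_primitive (hf' j) j).congr_order
        (by ring))).coeFn_packet hS θ γ
  refine Lp.ext ?_
  filter_upwards [hf.coeFn_packet hS θ γ, hR.coeFn_packet hS θ γ, h1,
    Lp.coeFn_add (∑ j, u j) (packet ε c X Ξ (remainderSymbol X Ξ f f') θ γ),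
    coeFn_sum Finset.univ u] with x e1 e2 e3 e4 e5
  rw [e4, Pi.add_apply, e5, e1, e2]
  simp_rw [e3]
  rw [← sum_mul, ← add_mul, remainderSymbol, ← sum_add_distrib]
  congr 1
  have h0 : (‖Ξ θ γ‖ : ℂ) ≠ 0 :=
    Complex.ofReal_ne_zero.mpr (norm_ne_zero_iff.mpr (hS.freq_ne_zero θ γ))
  have h2 : ∑ j, (Ξ θ γ j : ℂ) ^ 2 = (‖Ξ θ γ‖ : ℂ) ^ 2 := by
    rw [← Complex.ofReal_pow, norm_sq_eq_sum]
    push_cast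
    rfl
  have h3 : ∀ j, derivSymbol X Ξ (primitive Ξ j f) (fun k => primitive Ξ j (f' k)) j θ γ x +
      invFreq Ξ j θ γ *
      (f' j θ γ x + (-2 * (‖Ξ θ γ‖ : ℂ)) * (((x - X θ γ) j : ℝ) : ℂ) * f θ γ x) =
      (Ξ θ γ j : ℂ) ^ 2 * (f θ γ x / (‖Ξ θ γ‖ : ℂ) ^ 2) := by
    intro j
    simp only [derivSymbol, primitive, invFreq]
    linear_combination (-(Ξ θ γ j : ℂ) ^ 2 * (f θ γ x / (‖Ξ θ γ‖ : ℂ) ^ 2)) * Complex.I_sq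
  simp_rw [h3]
  rw [← sum_mul, h2]
  field_simp

/-- The sums of the packets `f_γ φ_γ` with the coefficients `d_γ` are bounded in `L²` by the norm
of `d` in the space `ℓ²` with the weights `2^(mk/2)`. -/
def IsBoundedFamily (ε c : ℝ) (X Ξ : Θ → Index Z → Rn n) (m : ℤ) (f : Amplitude Z Θ) : Prop :=
  ∃ C, 0 < C ∧ ∀ θ (F : Finset (Index Z)) (d : Index Z → ℂ),
    ‖∑ γ ∈ F, d γ • packet ε c X Ξ f θ γ‖ ^ 2 ≤ C * ∑ γ ∈ F, (scale γ.1 ^ m * ‖d γ‖) ^ 2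

lemma scale_div_scale_eq {k l : ℕ} (h : l ≤ k) : scale l / scale k = (√2)⁻¹ ^ gap k l := by
  have hpow : ∀ k, scale k = √2 ^ k := by
    intro k
    rw [scale, Real.sqrt_eq_iff_eq_sq (by positivity) (by positivity), ← pow_mul, mul_comm,
      pow_mul, sq_sqrt (by norm_num)]
  have hg : gap k l = k - l := by unfold gap; omega
  rw [hpow, hpow, hg, inv_pow, div_eq_iff (by positivity), eq_comm, inv_mul_eq_iff_eq_mul₀
    (by positivity), ← pow_add]
  congr 1
  omega

/-- A family of sums over the levels is bounded when the inner products decay off the diagonal. -/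
lemma norm_sum_sq_le_of_inner_le {E : Type*} [NormedAddCommGroup E] [InnerProductSpace ℂ E]
    (s : Finset ℕ) (U : ℕ → E) (a : ℕ → ℝ) {A : ℝ} (hA : 0 ≤ A)
    (h : ∀ k ∈ s, ∀ l ∈ s, l ≤ k → ‖inner ℂ (U k) (U l)‖ ≤ A * (√2)⁻¹ ^ gap k l * (a k * a l)) :
    ‖∑ k ∈ s, U k‖ ^ 2 ≤ A * (2 * (1 - (√2)⁻¹)⁻¹) * ∑ k ∈ s, a k ^ 2 := by
  have hρ1 : (√(2 : ℝ))⁻¹ < 1 := inv_lt_one_of_one_lt₀ (Real.lt_sqrt_of_sq_lt (by norm_num))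
  have h' : ∀ k ∈ s, ∀ l ∈ s, ‖inner ℂ (U k) (U l)‖ ≤ a k * a l * (A * (√2)⁻¹ ^ gap k l) := by
    intro k hk l hl
    rcases le_total l k with hkl | hkl
    · exact (h k hk l hl hkl).trans_eq (by ring)
    · rw [norm_inner_symm, gap_comm]
      exact (h l hl k hk hkl).trans_eq (by ring)
  refine le_trans ?_ (sum_mul_mul_le_of_row_sum_le s a
    (H := fun k l => A * (√2)⁻¹ ^ gap k l) (fun _ _ => by positivity)
    (fun k l => by rw [gap_comm]) fun k _ => ?_)
  · have e0 : ‖∑ k ∈ s, U k‖ ^ 2 = ‖inner ℂ (∑ k ∈ s, U k) (∑ k ∈ s, U k)‖ := by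
      rw [inner_self_eq_norm_sq_to_K]
      simp
    rw [e0, sum_inner]
    refine (norm_sum_le _ _).trans (sum_le_sum fun k hk => ?_)
    rw [inner_sum]
    exact (norm_sum_le _ _).trans (sum_le_sum fun l hl => h' k hk l hl)
  · rw [← mul_sum]
    exact mul_le_mul_of_nonneg_left (sum_pow_gap_le (by positivity) hρ1 k s) hA

/-- Different levels are almost orthogonal, provided that the multipliers have derivatives of
the right order: at the higher level, the function is a derivative of a much smaller function up
to a small remainder, and the derivative falls on the function of the lower level. -/
lemma IsPacketSystem.isBoundedFamily (hS : IsPacketSystem Z ε c X Ξ) (hg : IsGradient f f')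
    (hf : IsMultiplier X m f) (hf' : ∀ j, IsMultiplier X (m + 1) (f' j)) :
    IsBoundedFamily ε c X Ξ m f := by
  obtain ⟨C₀, hC₀, h₀⟩ := hf.exists_norm_level_le hS
  obtain ⟨C₁, hC₁, h₁⟩ := (hS.isMultiplier_remainderSymbol hf hf').exists_norm_level_le hS
  choose C₂ hC₂ h₂ using fun j => (hS.isMultiplier_derivSymbol hf (hf' j)).exists_norm_level_le hS
  choose C₃ hC₃ h₃ using fun j => (hS.isMultiplier_primitive hf j).exists_norm_level_le hS
  set A : ℝ := ∑ j, C₃ j * C₂ j + C₁ * C₀ with hA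
  have hA0 : 0 ≤ A :=
    add_nonneg (sum_nonneg fun j _ => (mul_pos (hC₃ j) (hC₂ j)).le) (by positivity)
  have hρ1 : (√(2 : ℝ))⁻¹ < 1 := inv_lt_one_of_one_lt₀ (Real.lt_sqrt_of_sq_lt (by norm_num))
  have hρ2 : 0 < 2 * (1 - (√(2 : ℝ))⁻¹)⁻¹ := by
    have := sub_pos.mpr hρ1
    positivity
  refine ⟨(A + 1) * (2 * (1 - (√2)⁻¹)⁻¹), by positivity, fun θ F d => ?_⟩
  set P : ℕ → Finset (Index Z) := fun k => F.filter fun γ => γ.1 = k with hP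
  have hPk : ∀ k, ∀ γ ∈ P k, γ.1 = k := fun k γ hγ => (Finset.mem_filter.mp hγ).2
  set D : ℕ → ℝ := fun k => √(∑ γ ∈ P k, ‖d γ‖ ^ 2) with hDdef
  set U : ℕ → L2 n := fun k => ∑ γ ∈ P k, d γ • packet ε c X Ξ f θ γ with hU
  have hUsum : ∑ γ ∈ F, d γ • packet ε c X Ξ f θ γ = ∑ k ∈ F.image Sigma.fst, U k :=
    (Finset.sum_fiberwise_of_maps_to (fun γ hγ => Finset.mem_image_of_mem _ hγ) _).symm
  have hinner : ∀ k ∈ F.image Sigma.fst, ∀ l ∈ F.image Sigma.fst, l ≤ k →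
      ‖inner ℂ (U k) (U l)‖ ≤ A * (√2)⁻¹ ^ gap k l *
        ((scale k ^ m * D k) * (scale l ^ m * D l)) := by
    intro k _ l _ hkl
    set V : Fin n → L2 n := fun j => ∑ γ ∈ P k, d γ • packet ε c X Ξ (primitive Ξ j f) θ γ
    set V' : Fin n → L2 n := fun j => ∑ γ ∈ P k, d γ • packet ε c X Ξ (derivSymbol X Ξ
      (primitive Ξ j f) (fun k => primitive Ξ j (f' k)) j) θ γ with hV'
    set R : L2 n := ∑ γ ∈ P k, d γ • packet ε c X Ξ (remainderSymbol X Ξ f f') θ γ with hRdef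
    set U' : Fin n → L2 n := fun j => ∑ γ ∈ P l, d γ • packet ε c X Ξ (derivSymbol X Ξ f f' j) θ γ
    have hVV : ∀ j, IsPartial j (V j) (V' j) := fun j => IsPartial.sum _ fun γ _ =>
      (hS.isPartial_packet (hg.primitive j) (hS.isMultiplier_primitive hf j)
        ((hS.isMultiplier_primitive (hf' j) j).congr_order (by ring)) θ γ).smul _
    have hUU : ∀ j, IsPartial j (U l) (U' j) := fun j => IsPartial.sum _ fun γ _ =>
      (hS.isPartial_packet hg hf (hf' j) θ γ).smul _
    have hsplit : U k = ∑ j, V' j + R := by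
      simp only [hU, hV', hRdef]
      rw [Finset.sum_comm, ← sum_add_distrib]
      refine sum_congr rfl fun γ _ => ?_
      rw [hS.packet_eq_sum_add hf hf', smul_add, Finset.smul_sum]
    have hsk := scale_pos k
    have hsl := scale_pos l
    have hDk : 0 ≤ D k := sqrt_nonneg _
    have hDl : 0 ≤ D l := sqrt_nonneg _
    have hlk : scale l ≤ scale k := Real.sqrt_le_sqrt (pow_le_pow_right₀ one_le_two hkl)
    set a : ℝ := (scale k ^ m * D k) * (scale l ^ m * D l) with ha
    have ha0 : 0 ≤ a := by positivity
    set q : ℝ := scale l / scale k with hq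
    have hq0 : 0 < q := by positivity
    have hq1 : q ≤ 1 := (div_le_one hsk).mpr hlk
    have b1 : ∀ j, ‖inner ℂ (V' j) (U l)‖ ≤ C₃ j * C₂ j * (q * a) := by
      intro j
      have h3 := hC₃ j
      have h2 := hC₂ j
      rw [(hVV j).inner_eq (hUU j), norm_neg]
      calc _ ≤ ‖V j‖ * ‖U' j‖ := norm_inner_le_norm _ _
        _ ≤ (C₃ j * (scale k ^ (m - 2) * D k)) * (C₂ j * (scale l ^ (m + 2) * D l)) :=
            mul_le_mul (h₃ j θ k _ d (hPk k)) (h₂ j θ l _ d (hPk l)) (norm_nonneg _) (by positivity)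
        _ = C₃ j * C₂ j * (q * (q * a)) := by
            rw [zpow_sub₀ hsk.ne', zpow_add₀ hsl.ne', hq, ha]
            simp only [zpow_ofNat]
            field_simp
        _ ≤ C₃ j * C₂ j * (1 * (q * a)) := by gcongr
        _ = _ := by rw [one_mul]
    have b2 : ‖inner ℂ R (U l)‖ ≤ C₁ * C₀ * (q * a) := by
      calc _ ≤ ‖R‖ * ‖U l‖ := norm_inner_le_norm _ _
        _ ≤ (C₁ * (scale k ^ (m - 1) * D k)) * (C₀ * (scale l ^ m * D l)) :=
            mul_le_mul (h₁ θ k _ d (hPk k)) (h₀ θ l _ d (hPk l)) (norm_nonneg _) (by positivity)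
        _ = C₁ * C₀ * (1 / scale k * a) := by
            rw [zpow_sub₀ hsk.ne', ha, zpow_one]
            field_simp
        _ ≤ C₁ * C₀ * (q * a) := by rw [hq]; gcongr; exact one_le_scale l
    rw [hsplit, inner_add_left, sum_inner, ← scale_div_scale_eq hkl]
    calc _ ≤ ∑ j, C₃ j * C₂ j * (q * a) + C₁ * C₀ * (q * a) :=
          (norm_add_le _ _).trans (add_le_add ((norm_sum_le _ _).trans
            (sum_le_sum fun j _ => b1 j)) b2)
      _ = _ := by rw [← sum_mul, hA]; ring
  rw [hUsum]
  refine (norm_sum_sq_le_of_inner_le _ U (fun k => scale k ^ m * D k) hA0 hinner).trans ?_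
  have e2 : ∑ k ∈ F.image Sigma.fst, (scale k ^ m * D k) ^ 2 =
      ∑ γ ∈ F, (scale γ.1 ^ m * ‖d γ‖) ^ 2 := by
    rw [← Finset.sum_fiberwise_of_maps_to fun γ hγ => Finset.mem_image_of_mem Sigma.fst hγ]
    refine sum_congr rfl fun k _ => ?_
    rw [mul_pow, sq_sqrt (by positivity), mul_sum]
    exact sum_congr rfl fun γ hγ => by rw [hPk k γ hγ, mul_pow]
  rw [e2]
  gcongr
  linarith

end

section

/-! ### Symbols with several derivatives -/

variable {n : ℕ} {Z : FrequencyNet n} {Θ : Type*} {ε c : ℝ} {X Ξ : Θ → Index Z → Rn n}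
  {m m' : ℤ} {r : ℕ} {f g : Amplitude Z Θ} {f' g' : Fin n → Amplitude Z Θ}

/-- Multipliers of order `m / 2` with derivatives of order `(m + 1) / 2`. -/
def IsLipMultiplier (X : Θ → Index Z → Rn n) (m : ℤ) (f : Amplitude Z Θ) : Prop :=
  IsMultiplier X m f ∧ ∃ f', IsGradient f f' ∧ ∀ j, IsMultiplier X (m + 1) (f' j)

/-- Multipliers of order `m / 2` with `r` derivatives, each of which raises the order by `1 / 2`.
The last derivatives need not be regular, but they define bounded families, also after products
with regular multipliers. -/
def IsSymbol (ε c : ℝ) (X Ξ : Θ → Index Z → Rn n) : ℕ → ℤ → Amplitude Z Θ → Prop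
  | 0, m, f => IsMultiplier X m f ∧ ∀ m' g, IsLipMultiplier X m' g →
      IsBoundedFamily ε c X Ξ (m + m') fun θ γ x => f θ γ x * g θ γ x
  | r + 1, m, f => IsMultiplier X m f ∧ ∃ f', IsGradient f f' ∧ ∀ j, IsSymbol ε c X Ξ r (m + 1) (f' j)

lemma IsSymbol.isMultiplier (h : IsSymbol ε c X Ξ r m f) : IsMultiplier X m f := by
  cases r <;> exact h.1

lemma IsSymbol.isLipMultiplier (h : IsSymbol ε c X Ξ (r + 1) m f) : IsLipMultiplier X m f := by
  obtain ⟨hf, f', hg, hf'⟩ := h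
  exact ⟨hf, f', hg, fun j => (hf' j).isMultiplier⟩

lemma IsGradient.add (hf : IsGradient f f') (hg : IsGradient g g') :
    IsGradient (fun θ γ x => f θ γ x + g θ γ x) fun j θ γ x => f' j θ γ x + g' j θ γ x := by
  refine ⟨fun θ γ => (hf.1 θ γ).add (hg.1 θ γ), fun j θ γ => ?_⟩
  filter_upwards [hf.2 j θ γ, hg.2 j θ γ] with x h1 h2
  exact HasDerivAt.add h1 h2

lemma IsGradient.mul (hf : IsGradient f f') (hg : IsGradient g g') :
    IsGradient (fun θ γ x => f θ γ x * g θ γ x)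
      fun j θ γ x => f' j θ γ x * g θ γ x + f θ γ x * g' j θ γ x := by
  refine ⟨fun θ γ => (hf.1 θ γ).mul (hg.1 θ γ), fun j θ γ => ?_⟩
  filter_upwards [hf.2 j θ γ, hg.2 j θ γ] with x h1 h2
  exact HasLineDerivAt.mul_apply h1 h2

lemma IsLipMultiplier.mul (hf : IsLipMultiplier X m f) (hg : IsLipMultiplier X m' g) :
    IsLipMultiplier X (m + m') fun θ γ x => f θ γ x * g θ γ x := by
  obtain ⟨hf, f', hfg, hf'⟩ := hf
  obtain ⟨hg, g', hgg, hg'⟩ := hg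
  exact ⟨hf.mul hg, _, hfg.mul hgg, fun j => (((hf' j).mul hg).congr_order (by ring)).add
    ((hf.mul (hg' j)).congr_order (by ring))⟩

lemma IsPacketSystem.isBoundedFamily_of_lip (hS : IsPacketSystem Z ε c X Ξ)
    (hf : IsLipMultiplier X m f) : IsBoundedFamily ε c X Ξ m f := by
  obtain ⟨hf, f', hg, hf'⟩ := hf
  exact hS.isBoundedFamily hg hf hf'

lemma isGradient_const (u : Θ → Index Z → ℂ) : IsGradient (fun θ γ _ => u θ γ) fun _ _ _ _ => 0 :=
  ⟨fun _ _ => polyLip_const _, fun _ _ _ => .of_forall fun _ => hasDerivAt_const _ _⟩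

lemma isLipMultiplier_one : IsLipMultiplier X 0 fun _ (_ : Index Z) _ => 1 :=
  ⟨isMultiplier_complex 1, fun _ _ _ _ => 0, isGradient_const _,
    fun _ => (isMultiplier_complex 0).mono (by norm_num)⟩

lemma packet_add (hS : IsPacketSystem Z ε c X Ξ)
    (hf : IsMultiplier X m f) (hg : IsMultiplier X m' g) (θ : Θ) (γ : Index Z) :
    packet ε c X Ξ (fun θ γ x => f θ γ x + g θ γ x) θ γ =
      packet ε c X Ξ f θ γ + packet ε c X Ξ g θ γ := by
  have hfg : IsMultiplier X (max m m') fun θ γ x => f θ γ x + g θ γ x :=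
    (hf.mono (le_max_left _ _)).add (hg.mono (le_max_right _ _))
  refine Lp.ext ?_
  filter_upwards [hf.coeFn_packet hS θ γ, hg.coeFn_packet hS θ γ, hfg.coeFn_packet hS θ γ,
    Lp.coeFn_add (packet ε c X Ξ f θ γ) (packet ε c X Ξ g θ γ)] with x h1 h2 h3 h4
  rw [h4, Pi.add_apply, h1, h2, h3, add_mul]

lemma IsBoundedFamily.add (hS : IsPacketSystem Z ε c X Ξ) (hf : IsMultiplier X m f)
    (hg : IsMultiplier X m g)
    (h : IsBoundedFamily ε c X Ξ m f) (h' : IsBoundedFamily ε c X Ξ m g) :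
    IsBoundedFamily ε c X Ξ m fun θ γ x => f θ γ x + g θ γ x := by
  obtain ⟨C, hC, h⟩ := h
  obtain ⟨C', hC', h'⟩ := h'
  refine ⟨2 * (C + C'), by positivity, fun θ F d => ?_⟩
  have e : ∑ γ ∈ F, d γ • packet ε c X Ξ (fun θ γ x => f θ γ x + g θ γ x) θ γ =
      ∑ γ ∈ F, d γ • packet ε c X Ξ f θ γ + ∑ γ ∈ F, d γ • packet ε c X Ξ g θ γ := by
    rw [← sum_add_distrib]
    exact sum_congr rfl fun γ _ => by rw [packet_add hS hf hg, smul_add]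
  rw [e]
  have h1 := h θ F d
  have h2 := h' θ F d
  set a := ∑ γ ∈ F, d γ • packet ε c X Ξ f θ γ
  set b := ∑ γ ∈ F, d γ • packet ε c X Ξ g θ γ
  have h3 := pow_le_pow_left₀ (norm_nonneg _) (norm_add_le a b) 2
  nlinarith [sq_nonneg (‖a‖ - ‖b‖)]

lemma IsBoundedFamily.mono
    (h : IsBoundedFamily ε c X Ξ m f) (hm : m ≤ m') : IsBoundedFamily ε c X Ξ m' f := by
  obtain ⟨C, hC, h⟩ := h
  refine ⟨C, hC, fun θ F d => (h θ F d).trans (mul_le_mul_of_nonneg_left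
    (sum_le_sum fun γ _ => ?_) hC.le)⟩
  have hs := scale_pos γ.1
  exact pow_le_pow_left₀ (by positivity) (mul_le_mul_of_nonneg_right
    (zpow_le_zpow_right₀ (one_le_scale _) hm) (norm_nonneg _)) 2

lemma IsSymbol.congr_order
    (hf : IsSymbol ε c X Ξ r m f) (h : m = m') : IsSymbol ε c X Ξ r m' f := h ▸ hf

lemma IsSymbol.mono (hf : IsSymbol ε c X Ξ r m f) (h : m ≤ m') : IsSymbol ε c X Ξ r m' f := by
  induction r generalizing m m' f with
  | zero => exact ⟨hf.1.mono h, fun k g hg => (hf.2 k g hg).mono (by omega)⟩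
  | succ r ih =>
    obtain ⟨h1, f', h2, h3⟩ := hf
    exact ⟨h1.mono h, f', h2, fun j => ih (h3 j) (by omega)⟩

lemma IsSymbol.of_succ (hS : IsPacketSystem Z ε c X Ξ) (hf : IsSymbol ε c X Ξ (r + 1) m f) :
    IsSymbol ε c X Ξ r m f := by
  induction r generalizing m f with
  | zero => exact ⟨hf.1, fun k g hg => hS.isBoundedFamily_of_lip (hf.isLipMultiplier.mul hg)⟩
  | succ r ih =>
    obtain ⟨h1, f', h2, h3⟩ := hf
    exact ⟨h1, f', h2, fun j => ih (h3 j)⟩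

lemma IsSymbol.of_le (hS : IsPacketSystem Z ε c X Ξ) {r r' : ℕ} (hf : IsSymbol ε c X Ξ r m f)
    (h : r' ≤ r) :
    IsSymbol ε c X Ξ r' m f := by
  induction r, h using Nat.le_induction with
  | base => exact hf
  | succ r _ ih => exact ih (hf.of_succ hS)

lemma IsSymbol.isBoundedFamily (hS : IsPacketSystem Z ε c X Ξ) (hf : IsSymbol ε c X Ξ r m f) :
    IsBoundedFamily ε c X Ξ m f := by
  have h := (hf.of_le hS (Nat.zero_le r)).2 0 _ isLipMultiplier_one
  simpa using h

lemma IsSymbol.add (hS : IsPacketSystem Z ε c X Ξ)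
    (hf : IsSymbol ε c X Ξ r m f) (hg : IsSymbol ε c X Ξ r m g) :
    IsSymbol ε c X Ξ r m fun θ γ x => f θ γ x + g θ γ x := by
  induction r generalizing m f g with
  | zero =>
    refine ⟨hf.1.add hg.1, fun k u hu => ?_⟩
    simp_rw [add_mul]
    exact (hf.2 k u hu).add hS (hf.1.mul hu.1) (hg.1.mul hu.1) (hg.2 k u hu)
  | succ r ih =>
    obtain ⟨h1, f', h2, h3⟩ := hf
    obtain ⟨k1, g', k2, k3⟩ := hg
    exact ⟨h1.add k1, _, h2.add k2, fun j => ih (h3 j) (k3 j)⟩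

lemma IsSymbol.mul_succ (hS : IsPacketSystem Z ε c X Ξ) (hf : IsSymbol ε c X Ξ r m f)
    (hg : IsSymbol ε c X Ξ (r + 1) m' g) :
    IsSymbol ε c X Ξ r (m + m') fun θ γ x => f θ γ x * g θ γ x := by
  induction r generalizing m m' f g with
  | zero =>
    refine ⟨hf.1.mul hg.1, fun k u hu => ?_⟩
    simp_rw [mul_assoc]
    rw [add_assoc]
    exact hf.2 _ _ (hg.isLipMultiplier.mul hu)
  | succ r ih =>
    obtain ⟨h1, f', h2, h3⟩ := hf
    obtain ⟨k1, g', k2, k3⟩ := hg.of_succ hS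
    refine ⟨h1.mul k1, _, h2.mul k2, fun j => IsSymbol.add hS
      ((ih (h3 j) (hg.of_succ hS)).congr_order (by ring)) ?_⟩
    simp_rw [mul_comm (f _ _ _)]
    exact (ih (k3 j) (⟨h1, f', h2, h3⟩ : IsSymbol ε c X Ξ (r + 1) m f)).congr_order (by ring)

lemma IsSymbol.mul (hS : IsPacketSystem Z ε c X Ξ) (hf : IsSymbol ε c X Ξ (r + 1) m f)
    (hg : IsSymbol ε c X Ξ (r + 1) m' g) :
    IsSymbol ε c X Ξ (r + 1) (m + m') fun θ γ x => f θ γ x * g θ γ x := by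
  obtain ⟨h1, f', h2, h3⟩ := id hf
  obtain ⟨k1, g', k2, k3⟩ := id hg
  refine ⟨h1.mul k1, _, h2.mul k2, fun j => IsSymbol.add hS
      ((IsSymbol.mul_succ hS (h3 j) hg).congr_order (by ring)) ?_⟩
  simp_rw [mul_comm (f _ _ _)]
  exact (IsSymbol.mul_succ hS (k3 j) hf).congr_order (by ring)

lemma IsPacketSystem.isSymbol_const (hS : IsPacketSystem Z ε c X Ξ) (r : ℕ)
    {u : Θ → Index Z → ℂ} (h : IsMultiplier X m fun θ γ _ => u θ γ) :
    IsSymbol ε c X Ξ r m fun θ γ _ => u θ γ := by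
  refine IsSymbol.of_succ hS ⟨h, fun _ _ _ _ => 0, isGradient_const _, fun _ => ?_⟩
  generalize m + 1 = m
  have h0 : ∀ m, IsMultiplier X m fun _ (_ : Index Z) _ => 0 := fun m =>
    isMultiplier_const (A := 0) (by simp)
  induction r generalizing m with
  | zero =>
    refine ⟨h0 m, fun k g _ => ⟨1, one_pos, fun θ F d => ?_⟩⟩
    have : ∀ γ, packet ε c X Ξ (fun θ γ x => 0 * g θ γ x) θ γ = 0 := fun γ => Lp.ext <| by
      simp_rw [zero_mul]
      filter_upwards [(h0 0).coeFn_packet hS θ γ, Lp.coeFn_zero ℂ 2 volume] with x h1 h2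
      rw [h1, h2, zero_mul, Pi.zero_apply]
    simp only [this, smul_zero, Finset.sum_const_zero, norm_zero]
    rw [zero_pow two_ne_zero]
    positivity
  | succ r ih => exact ⟨h0 m, _, isGradient_const _, fun _ => ih _⟩

lemma IsPacketSystem.isSymbol_complex (hS : IsPacketSystem Z ε c X Ξ) (r : ℕ) (u : ℂ) :
    IsSymbol ε c X Ξ r 0 fun _ _ _ => u :=
  hS.isSymbol_const r (isMultiplier_complex u)

lemma IsPacketSystem.isSymbol_coord (hS : IsPacketSystem Z ε c X Ξ) (r : ℕ) (j : Fin n) :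
    IsSymbol ε c X Ξ r (-1) fun θ γ x => (((x - X θ γ) j : ℝ) : ℂ) := by
  refine IsSymbol.of_succ hS ⟨isMultiplier_coord X j, fun k _ _ _ => if k = j then 1 else 0,
    ⟨fun θ γ => polyLip_coord _ j, fun k θ γ => .of_forall fun x => ?_⟩, fun k =>
      hS.isSymbol_complex r _⟩
  have h1 : HasDerivAt (fun t : ℝ => (((x - X θ γ) j + t * (if k = j then 1 else 0) : ℝ) : ℂ))
      (((if k = j then 1 else 0 : ℝ)) : ℂ) 0 := by
    have := (((hasDerivAt_id (0 : ℝ)).mul_const (if k = j then (1 : ℝ) else 0)).const_add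
      ((x - X θ γ) j)).ofReal_comp
    simpa using this
  refine HasDerivAt.congr_deriv (HasDerivAt.congr_of_eventuallyEq h1 (.of_forall fun t => ?_)) ?_
  · simp only [PiLp.sub_apply, PiLp.add_apply, PiLp.smul_apply, smul_eq_mul, PiLp.single_apply]
    congr 1
    simp only [eq_comm (a := k)]
    ring
  · split_ifs with h <;> simp [h]

lemma IsSymbol.const_mul (hS : IsPacketSystem Z ε c X Ξ)
    {u : Θ → Index Z → ℂ} (hu : IsMultiplier X m fun θ γ _ => u θ γ)
    (hf : IsSymbol ε c X Ξ r m' f) :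
    IsSymbol ε c X Ξ r (m + m') fun θ γ x => u θ γ * f θ γ x := by
  simp_rw [mul_comm (u _ _)]
  exact (IsSymbol.mul_succ hS hf (hS.isSymbol_const _ hu)).congr_order (add_comm _ _)

lemma IsPacketSystem.isSymbol_primitive (hS : IsPacketSystem Z ε c X Ξ)
    (hf : IsSymbol ε c X Ξ r m f) (j : Fin n) : IsSymbol ε c X Ξ r (m - 2) (primitive Ξ j f) := by
  have h := IsSymbol.const_mul hS (hS.isMultiplier_invFreq j) hf
  have e : primitive Ξ j f = fun θ γ x => -1 * (invFreq Ξ j θ γ * f θ γ x) := by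
    simp [primitive, funext_iff]
  rw [e]
  exact (IsSymbol.const_mul hS (u := fun _ _ => -1) (isMultiplier_complex (-1)) h).congr_order
    (by ring)

lemma IsPacketSystem.isSymbol_norm_freq_mul_coord (hS : IsPacketSystem Z ε c X Ξ) (r : ℕ)
    (j : Fin n) : IsSymbol ε c X Ξ r (2 + -1) fun θ γ x =>
      -2 * (‖Ξ θ γ‖ : ℂ) * (((x - X θ γ) j : ℝ) : ℂ) :=
  IsSymbol.const_mul hS (u := fun θ γ => -2 * (‖Ξ θ γ‖ : ℂ)) (((isMultiplier_complex (-2)).mul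
    hS.isMultiplier_norm_freq).congr_order (by norm_num)) (hS.isSymbol_coord _ j)

lemma IsSymbol.finsetSum (hS : IsPacketSystem Z ε c X Ξ) {κ : Type*}
    (s : Finset κ) {f : κ → Amplitude Z Θ} (hf : ∀ i ∈ s, IsSymbol ε c X Ξ r m (f i)) :
    IsSymbol ε c X Ξ r m fun θ γ x => ∑ i ∈ s, f i θ γ x := by
  classical
  induction s using Finset.induction_on with
  | empty =>
    simp only [Finset.sum_empty]
    exact hS.isSymbol_const r (isMultiplier_const (A := 0) (by simp))
  | insert i s hi ih =>
    simp_rw [Finset.sum_insert hi]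
    exact IsSymbol.add hS (hf i (Finset.mem_insert_self _ _))
      (ih fun j hj => hf j (Finset.mem_insert_of_mem hj))

lemma IsPacketSystem.isSymbol_derivSymbol (hS : IsPacketSystem Z ε c X Ξ)
    (hf : IsSymbol ε c X Ξ r m f) {j : Fin n} (hf' : IsSymbol ε c X Ξ r (m + 1) (f' j)) :
    IsSymbol ε c X Ξ r (m + 2) (derivSymbol X Ξ f f' j) := by
  have h1 : IsSymbol ε c X Ξ (r + 1) 2 fun θ γ x =>
      I * (Ξ θ γ j : ℂ) + (-2) * (‖Ξ θ γ‖ : ℂ) * (((x - X θ γ) j : ℝ) : ℂ) :=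
    IsSymbol.add hS (hS.isSymbol_const _ (((isMultiplier_complex I).mul
      (hS.isMultiplier_freq j)).congr_order (by norm_num)))
      ((hS.isSymbol_norm_freq_mul_coord _ j).mono (by norm_num))
  have e : derivSymbol X Ξ f f' j = fun θ γ x => f' j θ γ x + f θ γ x * (I *
      (Ξ θ γ j : ℂ) + (-2) * (‖Ξ θ γ‖ : ℂ) * (((x - X θ γ) j : ℝ) : ℂ)) := by
    funext θ γ x
    rw [derivSymbol]
    ring
  rw [e]
  exact IsSymbol.add hS (hf'.mono (by omega)) (IsSymbol.mul_succ hS hf h1)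

lemma IsPacketSystem.isSymbol_remainderSymbol (hS : IsPacketSystem Z ε c X Ξ)
    (hf : IsSymbol ε c X Ξ r m f) (hf' : ∀ j, IsSymbol ε c X Ξ r (m + 1) (f' j)) :
    IsSymbol ε c X Ξ r (m - 1) (remainderSymbol X Ξ f f') := by
  have e : remainderSymbol X Ξ f f' = fun θ γ x => ∑ j, invFreq Ξ j θ γ *
      (f' j θ γ x + f θ γ x * (-2 * (‖Ξ θ γ‖ : ℂ) * (((x - X θ γ) j : ℝ) : ℂ))) := by
    funext θ γ x
    rw [remainderSymbol]
    exact sum_congr rfl fun j _ => by ring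
  rw [e]
  exact IsSymbol.finsetSum hS _ fun j _ => (IsSymbol.const_mul hS (hS.isMultiplier_invFreq j)
    (IsSymbol.add hS (hf' j) (IsSymbol.mul_succ hS hf
      (hS.isSymbol_norm_freq_mul_coord _ j)))).congr_order (by ring)

/-! ### Bounds in Sobolev spaces -/

/-- The sums of packets are bounded from `ℓ²` with the weights `2^(mk/2)` into `H^s`. -/
def IsSobolevBounded (ε c : ℝ) (X Ξ : Θ → Index Z → Rn n) (s : ℝ) (m : ℤ)
    (f : Amplitude Z Θ) : Prop :=
  ∃ C : ℝ, 0 < C ∧ ∀ θ (F : Finset (Index Z)) (d : Index Z → ℂ),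
    sobolevNorm s (∑ γ ∈ F, d γ • packet ε c X Ξ f θ γ) ^ 2 ≤
      ofReal (C * ∑ γ ∈ F, (scale γ.1 ^ m * ‖d γ‖) ^ 2)

lemma isSobolevBounded_zero (h : IsBoundedFamily ε c X Ξ m f) : IsSobolevBounded ε c X Ξ 0 m f := by
  obtain ⟨C, hC, h⟩ := h
  refine ⟨C, hC, fun θ F d => ?_⟩
  rw [sobolevNorm_zero_eq, ← ofReal_norm, ← ofReal_pow (norm_nonneg _)]
  exact ofReal_le_ofReal (h θ F d)

/-- Symbols with `N` derivatives act into `H^N`. -/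
lemma IsSymbol.isSobolevBounded_pos (hS : IsPacketSystem Z ε c X Ξ) (N : ℕ)
    (hf : IsSymbol ε c X Ξ N m f) : IsSobolevBounded ε c X Ξ N (m + 2 * N) f := by
  induction N generalizing m f with
  | zero => simpa using isSobolevBounded_zero (hf.isBoundedFamily hS)
  | succ N ih =>
    obtain ⟨h1, f', h2, h3⟩ := id hf
    obtain ⟨C, hC, hc⟩ := ih ((hf.of_succ hS).mono (by omega : m ≤ m + 2))
    choose C' hC' hc' using fun j => ih (hS.isSymbol_derivSymbol (hf.of_succ hS) (h3 j))
    have hC'' := fun j => (hC' j).le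
    refine ⟨C + ∑ j, C' j, add_pos_of_pos_of_nonneg hC (sum_nonneg fun j _ => hC'' j),
      fun θ F d => ?_⟩
    have hp : ∀ j, IsPartial j (∑ γ ∈ F, d γ • packet ε c X Ξ f θ γ)
        (∑ γ ∈ F, d γ • packet ε c X Ξ (derivSymbol X Ξ f f' j) θ γ) := fun j =>
      IsPartial.sum _ fun γ _ => (hS.isPartial_packet h2 h1 (h3 j).isMultiplier θ γ).smul _
    have hm : m + 2 * ((N + 1 : ℕ) : ℤ) = m + 2 + 2 * N := by push_cast; ring
    rw [hm]
    push_cast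
    refine (sobolevNorm_succ_sq_le N hp).trans ?_
    rw [add_mul, sum_mul, ENNReal.ofReal_add (by positivity) (sum_nonneg fun j _ => by
      have := hC'' j; positivity), ofReal_sum_of_nonneg fun j _ => by have := hC'' j; positivity]
    exact add_le_add (hc θ F d) (sum_le_sum fun j _ => hc' j θ F d)

lemma ennreal_add_sq_le (a b : ℝ≥0∞) : (a + b) ^ 2 ≤ 2 * (a ^ 2 + b ^ 2) := by
  have := ENNReal.rpow_add_le_mul_rpow_add_rpow a b (p := 2) (by norm_num)
  norm_num at this
  exact this

lemma ennreal_sum_sq_le (u : Fin n → ℝ≥0∞) : (∑ j, u j) ^ 2 ≤ n * ∑ j, u j ^ 2 := by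
  have := ENNReal.rpow_sum_le_const_mul_sum_rpow Finset.univ u (p := 2) (by norm_num)
  norm_num at this
  exact this

/-- A sum of derivatives of functions with bounds in `H^(s+1)`, and of one with a bound in `H^s`. -/
lemma IsSobolevBounded.of_decomposition {s : ℝ} {h : Amplitude Z Θ} {g : Fin n → Amplitude Z Θ}
    {v : Fin n → Θ → Index Z → L2 n} (hg : ∀ j, IsSobolevBounded ε c X Ξ (s + 1) m (g j))
    (hh : IsSobolevBounded ε c X Ξ s m h)
    (hp : ∀ j θ γ, IsPartial j (packet ε c X Ξ (g j) θ γ) (v j θ γ))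
    (he : ∀ θ γ, packet ε c X Ξ f θ γ = ∑ j, v j θ γ + packet ε c X Ξ h θ γ) :
    IsSobolevBounded ε c X Ξ s m f := by
  choose C hC hc using hg
  obtain ⟨C', hC', hc'⟩ := hh
  have h0 : ∀ j, 0 ≤ (2 * π) ^ 2 * C j := fun j => by have := (hC j).le; positivity
  have h0s : 0 ≤ ∑ j, (2 * π) ^ 2 * C j := sum_nonneg fun j _ => h0 j
  refine ⟨2 * (n * ∑ j, (2 * π) ^ 2 * C j + C'), by positivity, fun θ F d => ?_⟩
  have e : ∑ γ ∈ F, d γ • packet ε c X Ξ f θ γ =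
      ∑ j, ∑ γ ∈ F, d γ • v j θ γ + ∑ γ ∈ F, d γ • packet ε c X Ξ h θ γ := by
    rw [Finset.sum_comm, ← sum_add_distrib]
    exact sum_congr rfl fun γ _ => by rw [he, smul_add, Finset.smul_sum]
  set D := ∑ γ ∈ F, (scale γ.1 ^ m * ‖d γ‖) ^ 2 with hD
  have hD0 : 0 ≤ D := sum_nonneg fun _ _ => sq_nonneg _
  have h1 : ∀ j, sobolevNorm s (∑ γ ∈ F, d γ • v j θ γ) ^ 2 ≤ ofReal ((2 * π) ^ 2 * C j * D) := by
    intro j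
    have h2 := (IsPartial.sum F fun γ _ => (hp j θ γ).smul (d γ)).sobolevNorm_le (s + 1)
    rw [add_sub_cancel_right] at h2
    refine (ENNReal.pow_le_pow_left h2).trans ?_
    rw [mul_pow, mul_assoc ((2 * π) ^ 2), ofReal_mul (p := (2 * π) ^ 2) (by positivity),
      ofReal_pow (by positivity)]
    exact mul_le_mul_right (hc j θ F d) _
  rw [e]
  calc _ ≤ (∑ j, sobolevNorm s (∑ γ ∈ F, d γ • v j θ γ) +
        sobolevNorm s (∑ γ ∈ F, d γ • packet ε c X Ξ h θ γ)) ^ 2 :=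
        ENNReal.pow_le_pow_left ((sobolevNorm_add_le _ _ _).trans
          (add_le_add (sobolevNorm_sum_le _ _ _) le_rfl))
    _ ≤ 2 * (n * ∑ j, sobolevNorm s (∑ γ ∈ F, d γ • v j θ γ) ^ 2 +
        sobolevNorm s (∑ γ ∈ F, d γ • packet ε c X Ξ h θ γ) ^ 2) := by
        refine (ennreal_add_sq_le _ _).trans ?_
        gcongr
        exact ennreal_sum_sq_le _
    _ ≤ 2 * (n * ∑ j, ofReal ((2 * π) ^ 2 * C j * D) + ofReal (C' * D)) := by
        gcongr with j
        · exact h1 j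
        · exact hc' θ F d
    _ = _ := by
        rw [← ofReal_sum_of_nonneg fun j _ => mul_nonneg (h0 j) hD0, ← sum_mul,
          ← ENNReal.ofReal_natCast, ← ofReal_mul (by positivity),
          ← ENNReal.ofReal_add (by positivity) (by positivity), ← ENNReal.ofReal_ofNat,
          ← ofReal_mul (by positivity)]
        congr 1
        ring

lemma IsSobolevBounded.mono {s s' : ℝ}
    (h : IsSobolevBounded ε c X Ξ s m f) (hs : s' ≤ s) : IsSobolevBounded ε c X Ξ s' m f := by
  obtain ⟨C, hC, h⟩ := h
  exact ⟨C, hC, fun θ F d => (ENNReal.pow_le_pow_left (sobolevNorm_mono hs _)).trans (h θ F d)⟩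

/-- Symbols with `2N` derivatives act into `H^(-N)`, with a gain of `N` orders. -/
lemma IsSymbol.isSobolevBounded_neg (hS : IsPacketSystem Z ε c X Ξ) (N : ℕ)
    (hf : IsSymbol ε c X Ξ (2 * N) m f) : IsSobolevBounded ε c X Ξ (-N) (m - 2 * N) f := by
  induction N generalizing m f with
  | zero => simpa using isSobolevBounded_zero (hf.isBoundedFamily hS)
  | succ N ih =>
    have e2 : ∀ m : ℤ, m - 2 * ((N + 1 : ℕ) : ℤ) = m - 2 - 2 * N := by push_cast; intros; ring
    -- one step: all the terms but the remainder gain a full order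
    have step : ∀ {r : ℕ} {m' : ℤ} {f : Amplitude Z Θ} {f' : Fin n → Amplitude Z Θ}, 2 * N ≤ r →
        m' ≤ m → IsSymbol ε c X Ξ r m' f → IsGradient f f' →
        (∀ j, IsMultiplier X (m' + 1) (f' j)) →
        IsSobolevBounded ε c X Ξ (-(N + 1 : ℕ)) (m - 2 * (N + 1 : ℕ)) (remainderSymbol X Ξ f f') →
        IsSobolevBounded ε c X Ξ (-(N + 1 : ℕ)) (m - 2 * (N + 1 : ℕ)) f := by
      intro r m' f f' hr hm' hf hg hf' hR
      refine IsSobolevBounded.of_decomposition (fun j => ?_) hR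
        (fun j θ γ => hS.isPartial_packet (hg.primitive j)
          (hS.isMultiplier_primitive hf.isMultiplier j)
          ((hS.isMultiplier_primitive (hf' j) j).congr_order (by ring)) θ γ)
        (fun θ γ => hS.packet_eq_sum_add hf.isMultiplier hf' θ γ)
      have h1 := ih ((hS.isSymbol_primitive hf j).of_le hS hr |>.mono (by omega : m' - 2 ≤ m - 2))
      have e1 : -((N + 1 : ℕ) : ℝ) + 1 = -N := by push_cast; ring
      rwa [e1, e2]
    obtain ⟨-, f', h2, h3⟩ := id hf
    have hR := hS.isSymbol_remainderSymbol (hf.of_succ (r := 2 * N + 1) hS) h3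
    obtain ⟨-, g', k2, k3⟩ := id hR
    refine step (by omega) le_rfl hf h2 (fun j => (h3 j).isMultiplier)
      (step (by omega) (by omega) hR k2 (fun j => (k3 j).isMultiplier) ?_)
    have h4 := (ih (hS.isSymbol_remainderSymbol (hR.of_succ hS) k3)).mono
      (by push_cast; linarith : -((N + 1 : ℕ) : ℝ) ≤ -N)
    have e3 : m - 2 * ((N + 1 : ℕ) : ℤ) = m - 1 - 1 - 2 * N := by rw [e2]; ring
    rwa [e3]

end

section

/-! ### Fourier multipliers -/

variable {n : ℕ}

/-- `A` is the Fourier multiplier `b(D)`. -/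
def IsFourierMul (b : Rn n → ℝ) (A : L2 n →L[ℂ] L2 n) : Prop :=
  ∀ u, (𝓕 (A u) : L2 n) =ᵐ[volume] fun η => (b η : ℂ) * (𝓕 u : L2 n) η

lemma exists_isFourierMul {b : Rn n → ℝ} (hb : Measurable b) {M : ℝ} (hM : ∀ η, |b η| ≤ M) :
    ∃ A : L2 n →L[ℂ] L2 n, IsFourierMul b A := by
  have hm : ∀ f : L2 n, MemLp (fun η => (b η : ℂ) * f η) 2 volume := fun f =>
    MemLp.of_le_mul (c := M) (Lp.memLp f)
      ((Complex.measurable_ofReal.comp hb).aestronglyMeasurable.mul (Lp.aestronglyMeasurable f))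
      (.of_forall fun η => by
        rw [norm_mul, norm_real]
        exact mul_le_mul_of_nonneg_right (hM η) (norm_nonneg _))
  have hM0 : 0 ≤ M := (abs_nonneg _).trans (hM 0)
  let L0 : L2 n →ₗ[ℂ] L2 n :=
    { toFun := fun f => (hm f).toLp _
      map_add' := fun f g => by
        refine Lp.ext ?_
        filter_upwards [(hm (f + g)).coeFn_toLp, (hm f).coeFn_toLp, (hm g).coeFn_toLp,
          Lp.coeFn_add f g, Lp.coeFn_add ((hm f).toLp _) ((hm g).toLp _)] with η h1 h2 h3 h4 h5
        rw [h1, h5, Pi.add_apply, h2, h3, h4, Pi.add_apply, mul_add]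
      map_smul' := fun a f => by
        refine Lp.ext ?_
        filter_upwards [(hm (a • f)).coeFn_toLp, (hm f).coeFn_toLp,
          Lp.coeFn_smul a f, Lp.coeFn_smul a ((hm f).toLp _)] with η h1 h2 h3 h4
        rw [RingHom.id_apply, h1, h4, Pi.smul_apply, h2, h3, Pi.smul_apply, smul_eq_mul, smul_eq_mul]
        ring }
  have hL0 : ∀ f, ‖L0 f‖ ≤ M * ‖f‖ := fun f => by
    refine Lp.norm_le_mul_norm_of_ae_le_mul ?_
    filter_upwards [(hm f).coeFn_toLp] with η h1
    change ‖((hm f).toLp _ : L2 n) η‖ ≤ _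
    rw [h1, norm_mul, norm_real]
    gcongr
    exact hM η
  let U := Lp.fourierTransformₗᵢ (Rn n) ℂ
  refine ⟨(U.symm.toContinuousLinearEquiv : L2 n →L[ℂ] L2 n).comp
    ((L0.mkContinuous M hL0).comp (U.toContinuousLinearEquiv : L2 n →L[ℂ] L2 n)), fun u => ?_⟩
  have e : (𝓕 (U.symm (L0 (U u))) : L2 n) = L0 (𝓕 u) := U.apply_symm_apply _
  change (𝓕 (U.symm (L0 (U u))) : L2 n) =ᵐ[volume] _
  rw [e]
  exact (hm _).coeFn_toLp

lemma IsFourierMul.enorm_sq {b : Rn n → ℝ} {A : L2 n →L[ℂ] L2 n} (h : IsFourierMul b A)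
    (u : L2 n) : ‖A u‖ₑ ^ 2 = ∫⁻ η, ofReal (b η ^ 2) * ‖(𝓕 u : L2 n) η‖ₑ ^ 2 := by
  rw [← enorm_fourier, enorm_sq_eq_lintegral]
  refine lintegral_congr_ae ?_
  filter_upwards [h u] with η h1
  rw [h1, enorm_mul, mul_pow, ← ofReal_norm (b η : ℂ), norm_real,
    ← ofReal_pow (norm_nonneg _), norm_eq_abs, sq_abs]

lemma IsFourierMul.sobolevNorm_sq {b : Rn n → ℝ} {A : L2 n →L[ℂ] L2 n} (h : IsFourierMul b A)
    (r : ℝ) (u : L2 n) : sobolevNorm r (A u) ^ 2 =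
      ∫⁻ η, ofReal ((1 + ‖η‖ ^ 2) ^ r * b η ^ 2) * ‖(𝓕 u : L2 n) η‖ₑ ^ 2 := by
  rw [GaussianFrame.sobolevNorm_sq]
  refine lintegral_congr_ae ?_
  filter_upwards [h u] with η h1
  rw [h1, enorm_mul, mul_pow, ← ofReal_norm (b η : ℂ), norm_real,
    ← ofReal_pow (norm_nonneg _), norm_eq_abs, sq_abs, ← mul_assoc,
    ← ofReal_mul (by positivity)]

lemma IsFourierMul.inner_eq {b : Rn n → ℝ} {A : L2 n →L[ℂ] L2 n} (h : IsFourierMul b A)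
    (u v : L2 n) : inner ℂ (A u) v = ∫ η, (b η : ℂ) * (conj ((𝓕 u : L2 n) η) * (𝓕 v : L2 n) η) := by
  rw [← Lp.inner_fourier_eq, L2.inner_def]
  refine integral_congr_ae ?_
  filter_upwards [h u] with η h1
  rw [h1, RCLike.inner_apply', map_mul, Complex.conj_ofReal]
  ring

lemma IsFourierMul.inner_symm {b : Rn n → ℝ} {A : L2 n →L[ℂ] L2 n} (h : IsFourierMul b A)
    (u v : L2 n) : inner ℂ (A u) v = inner ℂ u (A v) := by
  rw [h.inner_eq, ← Lp.inner_fourier_eq u, L2.inner_def]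
  refine integral_congr_ae ?_
  filter_upwards [h v] with η h1
  rw [h1, RCLike.inner_apply']
  ring

/-- The weight of `H^r`, cut off to a ball. -/
def cutoffWeight (r : ℝ) (N : ℕ) (η : Rn n) : ℝ :=
  (Metric.closedBall (0 : Rn n) N).indicator (fun η => (1 + ‖η‖ ^ 2) ^ (r / 2)) η

lemma continuous_weight (r : ℝ) : Continuous fun η : Rn n => (1 + ‖η‖ ^ 2) ^ r :=
  Continuous.rpow_const (by fun_prop) fun x => Or.inl (by positivity)

lemma exists_isFourierMul_cutoffWeight (r : ℝ) (N : ℕ) :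
    ∃ A : L2 n →L[ℂ] L2 n, IsFourierMul (cutoffWeight r N) A := by
  refine exists_isFourierMul (M := (1 + (N : ℝ) ^ 2) ^ (|r| / 2))
    ((continuous_weight _).measurable.indicator Metric.isClosed_closedBall.measurableSet) fun η => ?_
  rw [cutoffWeight, indicator]
  split_ifs with h
  · rw [mem_closedBall_zero_iff] at h
    rw [abs_of_nonneg (by positivity)]
    refine (Real.rpow_le_rpow_of_exponent_le (by nlinarith [sq_nonneg ‖η‖] : (1:ℝ) ≤ 1 + ‖η‖ ^ 2)
      (by linarith [le_abs_self r] : r / 2 ≤ |r| / 2)).trans ?_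
    exact Real.rpow_le_rpow (by positivity) (by have := pow_le_pow_left₀ (norm_nonneg η) h 2; linarith)
      (by positivity)
  · rw [abs_zero]; positivity

lemma ofReal_cutoffWeight_sq (r : ℝ) (N : ℕ) (η : Rn n) :
    ofReal (cutoffWeight r N η ^ 2) =
      (Metric.closedBall (0 : Rn n) N).indicator (fun η => ofReal ((1 + ‖η‖ ^ 2) ^ r)) η := by
  rw [cutoffWeight, indicator, indicator]
  split_ifs with h
  · rw [← rpow_natCast, ← rpow_mul (by positivity)]
    congr 2
    push_cast; ring
  · simp

lemma enorm_cutoff_sq {r : ℝ} {N : ℕ} {A : L2 n →L[ℂ] L2 n}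
    (h : IsFourierMul (cutoffWeight r N) A) (u : L2 n) :
    ‖A u‖ₑ ^ 2 = ∫⁻ η in Metric.closedBall (0 : Rn n) N,
      ofReal ((1 + ‖η‖ ^ 2) ^ r) * ‖(𝓕 u : L2 n) η‖ₑ ^ 2 := by
  rw [h.enorm_sq, ← lintegral_indicator Metric.isClosed_closedBall.measurableSet]
  refine lintegral_congr fun η => ?_
  rw [ofReal_cutoffWeight_sq, indicator, indicator]
  split_ifs <;> simp

lemma enorm_cutoff_le {r : ℝ} {N : ℕ} {A : L2 n →L[ℂ] L2 n}
    (h : IsFourierMul (cutoffWeight r N) A) (u : L2 n) : ‖A u‖ₑ ≤ sobolevNorm r u := by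
  refine le_of_sq_le_sq_ennreal ?_
  rw [enorm_cutoff_sq h, sobolevNorm_sq]
  exact setLIntegral_le_lintegral _ _

lemma sobolevNorm_le_of_cutoff {r : ℝ} {A : ℕ → L2 n →L[ℂ] L2 n}
    (h : ∀ N, IsFourierMul (cutoffWeight r N) (A N)) {u : L2 n} {M : ℝ≥0∞}
    (hM : ∀ N, ‖A N u‖ₑ ≤ M) : sobolevNorm r u ≤ M := by
  refine le_of_sq_le_sq_ennreal ?_
  have e : (⋃ N : ℕ, Metric.closedBall (0 : Rn n) N) = univ := Metric.iUnion_closedBall_nat 0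
  rw [sobolevNorm_sq, ← setLIntegral_univ, ← e, setLIntegral_iUnion_of_directed]
  · exact iSup_le fun N => by
      rw [← enorm_cutoff_sq (h N)]
      exact ENNReal.pow_le_pow_left (hM N)
  · exact Monotone.directed_le fun a b hab => Metric.closedBall_subset_closedBall (by exact_mod_cast hab)

/-- The Sobolev norms are lower semicontinuous on `L²`. -/
lemma sobolevNorm_le_of_tendsto {ι : Type*} {l : Filter ι} [l.NeBot] {r : ℝ} {v : ι → L2 n}
    {u : L2 n} (hv : Filter.Tendsto v l (nhds u)) {M : ℝ≥0∞}
    (hM : ∀ᶠ i in l, sobolevNorm r (v i) ≤ M) : sobolevNorm r u ≤ M := by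
  choose A hA using exists_isFourierMul_cutoffWeight (n := n) r
  refine sobolevNorm_le_of_cutoff hA fun N => ?_
  refine le_of_tendsto ((((A N).continuous.tendsto u).comp hv).enorm) ?_
  filter_upwards [hM] with i hi
  exact (enorm_cutoff_le (hA N) _).trans hi

end

section

/-! ### Interpolation of bounds in Sobolev spaces, and infinite sums -/

variable {n : ℕ} {Z : FrequencyNet n} {Θ : Type*} {X Ξ : Θ → Index Z → Rn n} {m : ℤ}
  {f : Amplitude Z Θ}

lemma enorm_sq_eq_ofReal {E : Type*} [SeminormedAddCommGroup E] (z : E) :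
    ‖z‖ₑ ^ 2 = ofReal (‖z‖ ^ 2) := by
  rw [← ofReal_norm, ofReal_pow (norm_nonneg _)]

/-- The sums of the families `P θ` are bounded, uniformly in `θ`, from `ℓ²` with the weights
`2^(wk)` into `H^s`. -/
def SobolevBound (P : Θ → Index Z → L2 n) (s w : ℝ) : Prop :=
  ∃ C : ℝ, 0 < C ∧ ∀ θ (F : Finset (Index Z)) (d : Index Z → ℂ),
    sobolevNorm s (∑ γ ∈ F, d γ • P θ γ) ^ 2 ≤
      ofReal (C * ∑ γ ∈ F, ((2 : ℝ) ^ (w * γ.1) * ‖d γ‖) ^ 2)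

lemma scale_zpow (k : ℕ) (m : ℤ) : scale k ^ m = (2 : ℝ) ^ ((m / 2 : ℝ) * k) := by
  rw [scale, Real.sqrt_eq_rpow, ← Real.rpow_intCast, ← rpow_natCast, ← rpow_mul two_pos.le,
    ← rpow_mul two_pos.le]
  congr 1
  ring

lemma IsSobolevBounded.sobolevBound {ε c : ℝ} {s : ℝ} (h : IsSobolevBounded ε c X Ξ s m f) :
    SobolevBound (packet ε c X Ξ f) s (m / 2) := by
  obtain ⟨C, hC, h⟩ := h
  refine ⟨C, hC, fun θ F d => ?_⟩
  simp_rw [← scale_zpow]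
  exact h θ F d

lemma exists_dyadic_weight (η : Rn n) : ∃ j : ℕ, (2 : ℝ) ^ (j : ℝ) ≤ (1 + ‖η‖ ^ 2) ^ (1 / 2 : ℝ) ∧
    (1 + ‖η‖ ^ 2) ^ (1 / 2 : ℝ) ≤ (2 : ℝ) ^ ((j : ℝ) + 1) := by
  obtain ⟨j, h1, h2⟩ := exists_nat_pow_near
    (Real.one_le_rpow (by nlinarith [sq_nonneg ‖η‖] : (1:ℝ) ≤ 1 + ‖η‖ ^ 2)
      (by norm_num : (0:ℝ) ≤ 1 / 2)) (one_lt_two (α := ℝ))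
  exact ⟨j, by exact_mod_cast h1, by exact_mod_cast h2.le⟩

/-- The levels of a function are almost orthogonal in `H^s` if they have bounds in a larger and
in a smaller space. -/
lemma exists_weight_mul_sum_sq_le {s₀ s₁ s : ℝ} (h₀ : s₀ < s) (h₁ : s < s₁) :
    ∃ C : ℝ, 0 < C ∧ ∀ (η : Rn n) (F : Finset ℕ) (x : ℕ → ℝ),
      (1 + ‖η‖ ^ 2) ^ s * (∑ k ∈ F, x k) ^ 2 ≤
        C * ∑ k ∈ F, ((2 : ℝ) ^ (2 * (s - s₀) * k) * (1 + ‖η‖ ^ 2) ^ s₀ +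
          (2 : ℝ) ^ (2 * (s - s₁) * k) * (1 + ‖η‖ ^ 2) ^ s₁) * x k ^ 2 := by
  obtain ⟨δ, hδ, hδ₀, hδ₁⟩ : ∃ δ, 0 < δ ∧ δ ≤ 2 * (s - s₀) ∧ δ ≤ 2 * (s₁ - s) :=
    ⟨min _ _, lt_min (by linarith) (by linarith), min_le_left _ _, min_le_right _ _⟩
  set ρ : ℝ := (2 : ℝ) ^ (-δ) with hρ
  have hρ0 : 0 < ρ := by positivity
  have hρ1 : ρ < 1 := Real.rpow_lt_one_of_one_lt_of_neg one_lt_two (neg_neg_of_pos hδ)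
  refine ⟨(2 : ℝ) ^ (2 * (s - s₀)) * (2 * (1 - ρ)⁻¹), by have := sub_pos.mpr hρ1; positivity,
    fun η F x => ?_⟩
  obtain ⟨j, hj1, hj2⟩ := exists_dyadic_weight η
  obtain ⟨t, ht⟩ : ∃ t : ℝ, 1 + ‖η‖ ^ 2 = 2 ^ (2 * t) := ⟨Real.logb 2 (1 + ‖η‖ ^ 2) / 2, by
    rw [mul_div_cancel₀ _ two_ne_zero, Real.rpow_logb two_pos (by norm_num) (by positivity)]⟩
  rw [ht, ← rpow_mul two_pos.le, Real.rpow_le_rpow_left_iff one_lt_two] at hj1 hj2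
  simp only [ht, ← rpow_mul two_pos.le, ← rpow_add two_pos]
  set b : ℕ → ℝ := fun k =>
    (2 : ℝ) ^ (2 * (s - s₀) * k + 2 * t * s₀) + (2 : ℝ) ^ (2 * (s - s₁) * k + 2 * t * s₁) with hb
  have hb0 : ∀ k, 0 < b k := fun k => by positivity
  have key : ∀ k, (2 : ℝ) ^ (2 * t * s) * (b k)⁻¹ ≤ (2 : ℝ) ^ (2 * (s - s₀)) * ρ ^ gap j k := by
    intro k
    rw [← div_eq_mul_inv, div_le_iff₀ (hb0 k), hρ, ← rpow_natCast, ← rpow_mul two_pos.le,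
      ← rpow_add two_pos, hb, mul_add, ← rpow_add two_pos, ← rpow_add two_pos]
    rcases le_total k j with hk | hk
    · refine le_trans ?_ (le_add_of_nonneg_left (by positivity))
      have e : gap j k = j - k := by simp only [gap]; omega
      refine Real.rpow_le_rpow_of_exponent_le one_le_two ?_
      have hk' : (k : ℝ) ≤ j := by exact_mod_cast hk
      rw [e, Nat.cast_sub hk]
      nlinarith
    · refine le_trans ?_ (le_add_of_nonneg_right (by positivity))
      have e : gap j k = k - j := by simp only [gap]; omega
      refine Real.rpow_le_rpow_of_exponent_le one_le_two ?_
      have hk' : (j : ℝ) ≤ k := by exact_mod_cast hk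
      rw [e, Nat.cast_sub hk]
      nlinarith
  have cs : (∑ k ∈ F, x k) ^ 2 ≤ (∑ k ∈ F, (b k)⁻¹) * ∑ k ∈ F, b k * x k ^ 2 :=
    Finset.sum_sq_le_sum_mul_sum_of_sq_le_mul F (fun k _ => (inv_pos.mpr (hb0 k)).le)
      (fun k _ => mul_nonneg (hb0 k).le (sq_nonneg _)) fun k _ => by
        rw [← mul_assoc, inv_mul_cancel₀ (hb0 k).ne', one_mul]
  refine (mul_le_mul_of_nonneg_left cs (by positivity)).trans ?_
  rw [← mul_assoc]
  refine mul_le_mul_of_nonneg_right ?_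
    (sum_nonneg fun k _ => mul_nonneg (hb0 k).le (sq_nonneg _))
  rw [mul_sum]
  refine (sum_le_sum fun k _ => key k).trans ?_
  rw [← mul_sum]
  gcongr
  exact sum_pow_gap_le hρ0.le hρ1 j F

lemma coeFn_fourier_sum {ι : Type*} (s : Finset ι) (u : ι → L2 n) :
    (𝓕 (∑ i ∈ s, u i) : L2 n) =ᵐ[volume] fun η => ∑ i ∈ s, (𝓕 (u i) : L2 n) η := by
  have h0 : (𝓕 (∑ i ∈ s, u i) : L2 n) = ∑ i ∈ s, 𝓕 (u i) :=
    map_sum (Lp.fourierTransformₗᵢ (Rn n) ℂ) u s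
  rw [h0]
  exact coeFn_sum _ _

/-- Interpolation between two bounds of the same order. -/
lemma SobolevBound.interpolate {P : Θ → Index Z → L2 n} {s₀ s₁ w₀ w₁ s : ℝ}
    (h₀ : SobolevBound P s₀ w₀) (h₁ : SobolevBound P s₁ w₁) (hw : w₁ - w₀ = s₁ - s₀)
    (hs₀ : s₀ ≤ s) (hs₁ : s ≤ s₁) : SobolevBound P s (w₀ + (s - s₀)) := by
  rcases hs₀.eq_or_lt with rfl | hs₀
  · simpa using h₀
  rcases hs₁.eq_or_lt with rfl | hs₁
  · rw [← hw]; simpa using h₁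
  obtain ⟨A, hA, hA'⟩ := exists_weight_mul_sum_sq_le (n := n) hs₀ hs₁
  obtain ⟨C₀, hC₀, h₀⟩ := h₀
  obtain ⟨C₁, hC₁, h₁⟩ := h₁
  refine ⟨A * (C₀ + C₁), by positivity, fun θ F d => ?_⟩
  classical
  set K := F.image Sigma.fst with hK
  set G : ℕ → Finset (Index Z) := fun k => F.filter fun γ => γ.1 = k with hG
  set u : ℕ → L2 n := fun k => ∑ γ ∈ G k, d γ • P θ γ with hu
  set D : ℕ → ℝ := fun k => ∑ γ ∈ G k, ‖d γ‖ ^ 2 with hD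
  have hD0 : ∀ k, 0 ≤ D k := fun k => sum_nonneg fun _ _ => sq_nonneg _
  have hsplit : ∀ {M : Type _} [AddCommMonoid M] (v : Index Z → M),
      ∑ k ∈ K, ∑ γ ∈ G k, v γ = ∑ γ ∈ F, v γ := fun v =>
    Finset.sum_fiberwise_of_maps_to (fun γ hγ => Finset.mem_image_of_mem _ hγ) v
  have hweight : ∀ (w' : ℝ) (k : ℕ), ∑ γ ∈ G k, ((2 : ℝ) ^ (w' * γ.1) * ‖d γ‖) ^ 2 =
      (2 : ℝ) ^ (2 * w' * k) * D k := fun w' k => by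
    rw [hD, mul_sum]
    refine sum_congr rfl fun γ hγ => ?_
    rw [(Finset.mem_filter.mp hγ).2, mul_pow, ← rpow_natCast, ← rpow_mul two_pos.le]
    congr 2
    push_cast; ring
  have hm : ∀ (r : ℝ) (w : L2 n), AEMeasurable (fun η => ofReal ((1 + ‖η‖ ^ 2) ^ r) *
      ‖(𝓕 w : L2 n) η‖ₑ ^ 2) volume := fun r w =>
    (measurable_weight r).aemeasurable.mul (aemeasurable_fourier_sq _)
  have hint : sobolevNorm s (∑ k ∈ K, u k) ^ 2 ≤ ofReal A * ∑ k ∈ K,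
      (ofReal ((2 : ℝ) ^ (2 * (s - s₀) * k)) * sobolevNorm s₀ (u k) ^ 2 +
        ofReal ((2 : ℝ) ^ (2 * (s - s₁) * k)) * sobolevNorm s₁ (u k) ^ 2) := by
    simp_rw [sobolevNorm_sq, ← lintegral_const_mul' _ _ ofReal_ne_top]
    simp_rw [← lintegral_add_left' ((hm _ _).const_mul _)]
    rw [← lintegral_finsetSum' K fun k _ => by
        exact ((hm s₀ (u k)).const_mul _).add ((hm s₁ (u k)).const_mul _),
      ← lintegral_const_mul' _ _ ofReal_ne_top]
    refine lintegral_mono_ae ?_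
    filter_upwards [coeFn_fourier_sum K u] with η hη
    rw [hη]
    simp_rw [enorm_sq_eq_ofReal, ← mul_assoc, ← add_mul, ← ofReal_mul (Real.rpow_nonneg
      (two_pos (α := ℝ)).le _)]
    have h3 : ∀ k : ℕ, 0 ≤ (2 : ℝ) ^ (2 * (s - s₀) * k) * (1 + ‖η‖ ^ 2) ^ s₀ := fun k => by
      positivity
    have h4 : ∀ k : ℕ, 0 ≤ (2 : ℝ) ^ (2 * (s - s₁) * k) * (1 + ‖η‖ ^ 2) ^ s₁ := fun k => by
      positivity
    simp_rw [← ENNReal.ofReal_add (h3 _) (h4 _), ← ofReal_mul (add_nonneg (h3 _) (h4 _))]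
    rw [← ofReal_sum_of_nonneg fun k _ => mul_nonneg (add_nonneg (h3 k) (h4 k)) (sq_nonneg _),
      ← ofReal_mul hA.le, ← ofReal_mul (by positivity)]
    refine ofReal_le_ofReal (le_trans ?_ (hA' η K _))
    gcongr
    exact norm_sum_le _ _
  rw [← hsplit]
  refine hint.trans ?_
  have hk : ∀ k ∈ K, (ofReal ((2 : ℝ) ^ (2 * (s - s₀) * k)) * sobolevNorm s₀ (u k) ^ 2 +
        ofReal ((2 : ℝ) ^ (2 * (s - s₁) * k)) * sobolevNorm s₁ (u k) ^ 2) ≤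
      ofReal ((C₀ + C₁) * ((2 : ℝ) ^ (2 * (w₀ + (s - s₀)) * k) * D k)) := by
    intro k _
    refine (add_le_add (mul_le_mul_right (h₀ θ (G k) d) _)
      (mul_le_mul_right (h₁ θ (G k) d) _)).trans ?_
    have := hD0 k
    rw [hweight, hweight, ← ofReal_mul (by positivity), ← ofReal_mul (by positivity),
      ← ENNReal.ofReal_add (by positivity) (by positivity), mul_left_comm, mul_left_comm _ C₁,
      ← mul_assoc (2 ^ _) (2 ^ _), ← mul_assoc (2 ^ _) (2 ^ _), ← rpow_add two_pos,
      ← rpow_add two_pos, add_mul]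
    refine le_of_eq ?_
    congr 5
    · ring
    · linear_combination 2 * (k : ℝ) * hw
  refine (mul_le_mul_right (sum_le_sum hk) _).trans (le_of_eq ?_)
  rw [← ofReal_sum_of_nonneg fun k _ => by have := hD0 k; positivity,
    ← ofReal_mul hA.le, ← mul_sum, ← mul_assoc, ← hsplit]
  simp_rw [hweight]

/-- The square of the norm of `ℓ²` with the weights `2^(wk)`. -/
def seqEnergy (w : ℝ) (d : Index Z → ℂ) : ℝ≥0∞ :=
  ∑' γ, ofReal (((2 : ℝ) ^ (w * γ.1) * ‖d γ‖) ^ 2)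

lemma SobolevBound.summable {P : Θ → Index Z → L2 n} {w : ℝ} (h : SobolevBound P 0 w) (θ : Θ)
    {d : Index Z → ℂ} (hd : seqEnergy w d ≠ ∞) : Summable fun γ => d γ • P θ γ := by
  obtain ⟨C, hC, h⟩ := h
  have hs : Summable fun γ : Index Z => ((2 : ℝ) ^ (w * γ.1) * ‖d γ‖) ^ 2 := by
    have := ENNReal.summable_toReal hd
    exact this.congr fun γ => ENNReal.toReal_ofReal (sq_nonneg _)
  rw [summable_iff_vanishing_norm]
  intro δ hδ
  obtain ⟨F, hF⟩ := summable_iff_vanishing_norm.mp hs (δ ^ 2 / C) (by positivity)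
  refine ⟨F, fun G hG => ?_⟩
  have h1 := h θ G d
  have h2 := hF G hG
  rw [norm_of_nonneg (sum_nonneg fun _ _ => sq_nonneg _), lt_div_iff₀ hC] at h2
  rw [sobolevNorm_zero_eq, enorm_sq_eq_ofReal,
    ENNReal.ofReal_le_ofReal_iff (mul_nonneg hC.le (sum_nonneg fun _ _ => sq_nonneg _))] at h1
  exact lt_of_pow_lt_pow_left₀ 2 hδ.le (by linarith)

lemma SobolevBound.exists_sobolevNorm_le {P : Θ → Index Z → L2 n} {s w : ℝ}
    (h : SobolevBound P s w) : ∃ C : ℝ≥0, ∀ θ (d : Index Z → ℂ) (u : L2 n),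
      HasSum (fun γ => d γ • P θ γ) u → sobolevNorm s u ^ 2 ≤ C * seqEnergy w d := by
  obtain ⟨C, hC, h⟩ := h
  refine ⟨C.toNNReal, fun θ d u hu => ?_⟩
  have h1 : sobolevNorm s u ≤ ((C.toNNReal : ℝ≥0∞) * seqEnergy w d) ^ (1 / 2 : ℝ) := by
    refine sobolevNorm_le_of_tendsto hu (.of_forall fun F => ?_)
    rw [one_div, ENNReal.le_rpow_inv_iff (by norm_num), ENNReal.rpow_ofNat]
    refine (h θ F d).trans ?_
    rw [ofReal_mul hC.le, ofReal_sum_of_nonneg fun _ _ => sq_nonneg _]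
    exact mul_le_mul_right (ENNReal.sum_le_tsum F) _
  refine (ENNReal.pow_le_pow_left h1).trans (le_of_eq ?_)
  rw [← ENNReal.rpow_natCast, ← ENNReal.rpow_mul]
  norm_num

end

section

/-! ### Fourier series of periodizations -/

variable {n : ℕ}

/-- The unit cube, a fundamental domain for the translations by `ℤⁿ`. -/
def unitCube (n : ℕ) : Set (Fin n → ℝ) := {x | ∀ i, x i ∈ Ioc (0 : ℝ) 1}

lemma measurableSet_unitCube : MeasurableSet (unitCube n) :=
  MeasurableSet.univ_pi' fun _ => measurableSet_Ioc

/-- A lattice point as a vector. -/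
def latticePoint (β : Fin n → ℤ) : Fin n → ℝ := fun i => (β i : ℝ)

/-- The character `exp (2πi α·θ)`. -/
def character (α : Fin n → ℤ) (θ : Fin n → ℝ) : ℂ :=
  Complex.exp (((2 * π * ∑ i, (α i : ℝ) * θ i : ℝ) : ℂ) * I)

lemma norm_character (α : Fin n → ℤ) (θ : Fin n → ℝ) : ‖character α θ‖ = 1 :=
  Complex.norm_exp_ofReal_mul_I _

lemma continuous_character (α : Fin n → ℤ) : Continuous (character α) := by
  unfold character
  fun_prop

lemma character_add_latticePoint (α β : Fin n → ℤ) (θ : Fin n → ℝ) :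
    character α (θ + latticePoint β) = character α θ := by
  unfold character
  rw [Complex.exp_eq_exp_iff_exists_int]
  refine ⟨∑ i, α i * β i, ?_⟩
  simp only [Pi.add_apply, latticePoint, mul_add, sum_add_distrib]
  push_cast
  ring

lemma mFourier_coe (α : Fin n → ℤ) (θ : Fin n → ℝ) :
    UnitAddTorus.mFourier α (fun i => (θ i : UnitAddCircle)) = character α θ := by
  simp only [UnitAddTorus.mFourier, ContinuousMap.coe_mk, character]
  have h1 : ∀ i, (_root_.fourier (α i)) (θ i : UnitAddCircle) =
      Complex.exp (2 * π * I * α i * θ i / ((1 : ℝ) : ℂ)) := fun i => fourier_coe_apply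
  simp_rw [h1]
  rw [← Complex.exp_sum]
  congr 1
  push_cast
  rw [mul_sum, sum_mul]
  exact sum_congr rfl fun i _ => by ring

lemma univ_eq_iUnion_cube :
    (⋃ β : Fin n → ℤ, (fun x => x + latticePoint (-β)) ⁻¹' unitCube n) = univ := by
  refine eq_univ_of_forall fun x => mem_iUnion.mpr ⟨fun i => ⌈x i⌉ - 1, fun i => ?_⟩
  simp only [Pi.add_apply, latticePoint, Pi.neg_apply]
  push_cast
  constructor <;> linarith [Int.ceil_lt_add_one (x i), Int.le_ceil (x i)]

lemma pairwise_disjoint_cube :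
    Pairwise (Function.onFun Disjoint
      fun β : Fin n → ℤ => (fun x => x + latticePoint (-β)) ⁻¹' unitCube n) := by
  intro β β' h
  refine Set.disjoint_left.mpr fun x h1 h2 => h (funext fun i => ?_)
  have h3 := h1 i
  have h4 := h2 i
  simp only [Pi.add_apply, latticePoint, Pi.neg_apply, mem_Ioc] at h3 h4
  push_cast at h3 h4
  have h5 : (β i : ℝ) < β' i + 1 := by linarith [h3.1, h4.2]
  have h6 : (β' i : ℝ) < β i + 1 := by linarith [h4.1, h3.2]
  norm_cast at h5 h6
  omega

lemma measurableSet_translate_cube (β : Fin n → ℤ) :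
    MeasurableSet ((fun x => x + latticePoint (-β)) ⁻¹' unitCube n) :=
  measurableSet_unitCube.preimage (measurable_id.add_const _)

lemma latticePoint_neg (β : Fin n → ℤ) : latticePoint (-β) = -latticePoint β := by
  funext i
  simp [latticePoint]

lemma lintegral_eq_tsum_cube (h : (Fin n → ℝ) → ℝ≥0∞) :
    ∫⁻ x, h x = ∑' β : Fin n → ℤ, ∫⁻ x in unitCube n, h (x + latticePoint β) := by
  rw [← setLIntegral_univ, ← univ_eq_iUnion_cube,
    lintegral_iUnion measurableSet_translate_cube pairwise_disjoint_cube]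
  refine tsum_congr fun β => ?_
  have h1 := (measurePreserving_add_right (volume : Measure (Fin n → ℝ))
    (latticePoint (-β))).setLIntegral_comp_preimage_emb
      (MeasurableEquiv.addRight (latticePoint (-β))).measurableEmbedding
      (fun x => h (x + latticePoint β)) (unitCube n)
  rw [← h1]
  refine lintegral_congr fun x => ?_
  rw [latticePoint_neg, neg_add_cancel_right]

lemma integral_eq_tsum_cube {h : (Fin n → ℝ) → ℂ} (hh : Integrable h) :
    ∫ x, h x = ∑' β : Fin n → ℤ, ∫ x in unitCube n, h (x + latticePoint β) := by
  rw [← setIntegral_univ, ← univ_eq_iUnion_cube,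
    integral_iUnion measurableSet_translate_cube pairwise_disjoint_cube hh.integrableOn]
  refine tsum_congr fun β => ?_
  have h1 := (measurePreserving_add_right (volume : Measure (Fin n → ℝ))
    (latticePoint (-β))).setIntegral_preimage_emb
      (MeasurableEquiv.addRight (latticePoint (-β))).measurableEmbedding
      (fun x => h (x + latticePoint β)) (unitCube n)
  rw [← h1]
  refine integral_congr_ae (.of_forall fun x => ?_)
  simp only []
  rw [latticePoint_neg, neg_add_cancel_right]

lemma lintegral_tsum_translate {h : (Fin n → ℝ) → ℝ≥0∞} (hm : AEMeasurable h) :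
    ∫⁻ x in unitCube n, ∑' β : Fin n → ℤ, h (x + latticePoint β) = ∫⁻ x, h x := by
  rw [lintegral_eq_tsum_cube]
  exact lintegral_tsum fun β => (hm.comp_quasiMeasurePreserving
    (measurePreserving_add_right _ _).quasiMeasurePreserving).restrict

/-- Parseval's identity on the unit cube. -/
lemma tsum_enorm_character_sq {g : (Fin n → ℝ) → ℂ}
    (hg : MemLp g 2 (volume.restrict (unitCube n))) :
    ∑' α : Fin n → ℤ, ‖∫ x in unitCube n, character α x * g x‖ₑ ^ 2 =
      ∫⁻ x in unitCube n, ‖g x‖ₑ ^ 2 := by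
  letI : MeasureSpace UnitAddCircle := ⟨AddCircle.haarAddCircle⟩
  have hQ : {x : Fin n → ℝ | ∀ i, x i ∈ Ioc ((0 : Fin n → ℝ) i) ((0 : Fin n → ℝ) i + 1)} =
      unitCube n := by
    simp [unitCube]
  set ψ : UnitAddTorus (Fin n) → Fin n → ℝ :=
    fun x => (UnitAddTorus.measurableEquivPiIoc (0 : Fin n → ℝ) x).1 with hψ
  have hm : MeasurePreserving ψ volume (volume.restrict (unitCube n)) := by
    have h1 := UnitAddTorus.measurePreserving_equivPiIoc (0 : Fin n → ℝ)
    have h2 := measurePreserving_subtype_coe (μa := (volume : Measure (Fin n → ℝ)))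
      (MeasurableSet.univ_pi' (fun i : Fin n =>
        measurableSet_Ioc (a := (0 : Fin n → ℝ) i) (b := (0 : Fin n → ℝ) i + 1)))
    rw [← hQ]
    exact MeasurePreserving.comp (g := Subtype.val) h2 h1
  have hψc : ∀ t i, ((ψ t i : ℝ) : UnitAddCircle) = t i := fun t i => by
    have := congrFun ((UnitAddTorus.measurableEquivPiIoc (0 : Fin n → ℝ)).symm_apply_apply t) i
    rw [UnitAddTorus.coe_symm_measurableEquivPiIoc_apply] at this
    exact this
  have hgt : MemLp (g ∘ ψ) 2 volume := hg.comp_measurePreserving hm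
  have hco : ∀ α, UnitAddTorus.mFourierCoeff (hgt.toLp _) α =
      ∫ x in unitCube n, character (-α) x * g x := by
    intro α
    have e : ∫ x in unitCube n, character (-α) x * g x =
        ∫ t, character (-α) (ψ t) * g (ψ t) := by
      rw [← hm.map_eq, integral_map hm.aemeasurable]
      rw [hm.map_eq]
      exact (continuous_character _).aestronglyMeasurable.mul hg.1
    rw [e, UnitAddTorus.mFourierCoeff]
    refine integral_congr_ae ?_
    filter_upwards [hgt.coeFn_toLp] with t ht
    rw [ht, ← mFourier_coe, smul_eq_mul]
    simp only [hψc]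
    rfl
  have h1 := UnitAddTorus.hasSum_sq_mFourierCoeff (hgt.toLp _)
  have h2 : ∑' α : Fin n → ℤ, ‖∫ x in unitCube n, character (-α) x * g x‖ₑ ^ 2 =
      ∫⁻ x in unitCube n, ‖g x‖ₑ ^ 2 := by
    have h3 : ∀ α : Fin n → ℤ, ‖∫ x in unitCube n, character (-α) x * g x‖ₑ ^ 2 =
        ofReal (‖UnitAddTorus.mFourierCoeff (hgt.toLp _) α‖ ^ 2) := fun α => by
      rw [hco, enorm_sq_eq_ofReal]
    simp_rw [h3]
    rw [← ENNReal.ofReal_tsum_of_nonneg (fun _ => sq_nonneg _) h1.summable, h1.tsum_eq,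
      ofReal_integral_eq_lintegral_ofReal _ (.of_forall fun _ => sq_nonneg _)]
    · have h4 : ∫⁻ x in unitCube n, ‖g x‖ₑ ^ 2 = ∫⁻ t, ‖g (ψ t)‖ₑ ^ 2 := by
        rw [← hm.map_eq, lintegral_map' _ hm.aemeasurable]
        rw [hm.map_eq]
        exact hg.1.enorm.pow_const 2
      rw [h4]
      refine lintegral_congr_ae ?_
      filter_upwards [hgt.coeFn_toLp] with t ht
      rw [ht, ← enorm_sq_eq_ofReal]
      rfl
    · exact (memLp_two_iff_integrable_sq_norm (Lp.aestronglyMeasurable _)).mp (Lp.memLp _)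
  rw [← h2]
  exact ((Equiv.neg (Fin n → ℤ)).tsum_eq
    fun α => ‖∫ x in unitCube n, character α x * g x‖ₑ ^ 2).symm

/-- If the terms of a sum are almost orthogonal, the square of the sum is close to the sum of the
squares. -/
lemma abs_norm_sum_sq_sub_le {ι : Type*} {F : ι → ℂ} {v : ι → ℝ} {K : ι → ι → ℝ} {τ : ℝ}
    (hK : ∀ β β', 0 ≤ K β β') (hsymm : ∀ β β', K β β' = K β' β)
    (hτ : ∀ β (s : Finset ι), β ∉ s → ∑ β' ∈ s, K β β' ≤ τ)
    (h : ∀ β β', β ≠ β' → ‖F β‖ * ‖F β'‖ ≤ K β β' * (v β * v β')) (s : Finset ι) :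
    |‖∑ β ∈ s, F β‖ ^ 2 - ∑ β ∈ s, ‖F β‖ ^ 2| ≤ τ * ∑ β ∈ s, v β ^ 2 := by
  classical
  have e1 : ‖∑ β ∈ s, F β‖ ^ 2 - ∑ β ∈ s, ‖F β‖ ^ 2 =
      ∑ β ∈ s, ∑ β' ∈ s.erase β, inner ℝ (F β) (F β') := by
    rw [← real_inner_self_eq_norm_sq, sum_inner, ← Finset.sum_sub_distrib]
    refine sum_congr rfl fun β hβ => ?_
    rw [inner_sum, ← Finset.add_sum_erase s _ hβ, real_inner_self_eq_norm_sq]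
    ring
  rw [e1]
  calc |∑ β ∈ s, ∑ β' ∈ s.erase β, inner ℝ (F β) (F β')|
      ≤ ∑ β ∈ s, ∑ β' ∈ s.erase β, |inner ℝ (F β) (F β')| :=
        (Finset.abs_sum_le_sum_abs _ _).trans
          (sum_le_sum fun β _ => Finset.abs_sum_le_sum_abs _ _)
    _ ≤ ∑ β ∈ s, ∑ β' ∈ s.erase β, (K β β' * v β ^ 2 / 2 + K β β' * v β' ^ 2 / 2) := by
        refine sum_le_sum fun β _ => sum_le_sum fun β' hβ' => ?_
        refine (abs_real_inner_le_norm _ _).trans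
          ((h β β' (Finset.ne_of_mem_erase hβ').symm).trans ?_)
        have := mul_nonneg (hK β β') (sq_nonneg (v β - v β'))
        linarith
    _ = ∑ β ∈ s, ∑ β' ∈ s.erase β, K β β' * v β ^ 2 := by
        have e2 : ∑ β ∈ s, ∑ β' ∈ s.erase β, K β β' * v β' ^ 2 / 2 =
            ∑ β ∈ s, ∑ β' ∈ s.erase β, K β β' * v β ^ 2 / 2 := by
          rw [Finset.sum_comm' (t' := s) (s' := fun β => s.erase β)]
          · exact sum_congr rfl fun β _ => sum_congr rfl fun β' _ => by rw [hsymm]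
          · intro x y
            simp only [Finset.mem_erase]
            tauto
        simp_rw [sum_add_distrib]
        rw [e2, ← sum_add_distrib]
        refine sum_congr rfl fun β _ => ?_
        rw [← sum_add_distrib]
        exact sum_congr rfl fun β' _ => by ring
    _ ≤ ∑ β ∈ s, τ * v β ^ 2 := by
        refine sum_le_sum fun β _ => ?_
        rw [← sum_mul]
        gcongr
        exact hτ β _ (Finset.notMem_erase β s)
    _ = _ := by rw [mul_sum]

lemma enorm_tsum_sq_le {ι : Type*} {F : ι → ℂ} {v : ι → ℝ} {K : ι → ι → ℝ} {τ : ℝ} (h0 : 0 ≤ τ)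
    (hK : ∀ β β', 0 ≤ K β β') (hsymm : ∀ β β', K β β' = K β' β)
    (hτ : ∀ β (s : Finset ι), β ∉ s → ∑ β' ∈ s, K β β' ≤ τ)
    (h : ∀ β β', β ≠ β' → ‖F β‖ * ‖F β'‖ ≤ K β β' * (v β * v β')) (hF : Summable F) :
    ‖∑' β, F β‖ₑ ^ 2 ≤ ∑' β, ‖F β‖ₑ ^ 2 + ofReal τ * ∑' β, ofReal (v β ^ 2) ∧
    ∑' β, ‖F β‖ₑ ^ 2 ≤ ‖∑' β, F β‖ₑ ^ 2 + ofReal τ * ∑' β, ofReal (v β ^ 2) := by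
  have hlim : Filter.Tendsto (fun s : Finset ι => ‖∑ β ∈ s, F β‖ₑ ^ 2) Filter.atTop
      (nhds (‖∑' β, F β‖ₑ ^ 2)) := (ENNReal.continuous_pow 2).continuousAt.tendsto.comp hF.hasSum.enorm
  have hs : ∀ {x y : ℝ} (s : Finset ι), 0 ≤ y → x ≤ y + τ * ∑ β ∈ s, v β ^ 2 →
      ofReal x ≤ ofReal y + ofReal τ * ∑' β, ofReal (v β ^ 2) := fun s hy hx => by
    refine (ofReal_le_ofReal hx).trans ?_
    rw [ENNReal.ofReal_add hy (mul_nonneg h0 (sum_nonneg fun _ _ => sq_nonneg _)), ofReal_mul h0,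
      ofReal_sum_of_nonneg fun _ _ => sq_nonneg _]
    gcongr
    exact ENNReal.sum_le_tsum s
  have hs1 : ∀ s : Finset ι, ∑ β ∈ s, ‖F β‖ₑ ^ 2 = ofReal (∑ β ∈ s, ‖F β‖ ^ 2) := fun s => by
    simp_rw [ofReal_sum_of_nonneg fun _ _ => sq_nonneg _, enorm_sq_eq_ofReal]
  have hmain := fun s => abs_le.mp (abs_norm_sum_sq_sub_le hK hsymm hτ h s)
  constructor
  · refine le_of_tendsto' hlim fun s => le_trans ?_ (add_le_add_left (ENNReal.sum_le_tsum s) _)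
    rw [hs1, enorm_sq_eq_ofReal]
    exact hs s (sum_nonneg fun _ _ => sq_nonneg _) (by linarith [(hmain s).2])
  · refine le_of_tendsto_of_tendsto' ENNReal.summable.hasSum (hlim.add_const _) fun s => ?_
    rw [hs1, enorm_sq_eq_ofReal]
    exact hs s (sq_nonneg _) (by linarith [(hmain s).1])

/-- The sum of the squares of the Fourier coefficients at the lattice points, for a function whose
translates are almost orthogonal. -/
lemma tsum_enorm_fourier_sq_le {F : (Fin n → ℝ) → ℂ} {v : (Fin n → ℝ) → ℝ}
    {K : (Fin n → ℤ) → (Fin n → ℤ) → ℝ} {τ : ℝ} (h0 : 0 ≤ τ)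
    (hF : Integrable F) (hF2 : ∫⁻ x, ‖F x‖ₑ ^ 2 ≠ ∞) (hvm : AEMeasurable v)
    (hv : ∫⁻ x, ofReal (v x ^ 2) ≠ ∞)
    (hK : ∀ β β', 0 ≤ K β β') (hsymm : ∀ β β', K β β' = K β' β)
    (hτ : ∀ β (s : Finset (Fin n → ℤ)), β ∉ s → ∑ β' ∈ s, K β β' ≤ τ)
    (h : ∀ x β β', β ≠ β' → ‖F (x + latticePoint β)‖ * ‖F (x + latticePoint β')‖ ≤
      K β β' * (v (x + latticePoint β) * v (x + latticePoint β'))) :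
    ∑' α : Fin n → ℤ, ‖∫ x, character α x * F x‖ₑ ^ 2 ≤
      (∫⁻ x, ‖F x‖ₑ ^ 2) + ofReal τ * ∫⁻ x, ofReal (v x ^ 2) ∧
    ∫⁻ x, ‖F x‖ₑ ^ 2 ≤ ∑' α : Fin n → ℤ, ‖∫ x, character α x * F x‖ₑ ^ 2 +
      ofReal τ * ∫⁻ x, ofReal (v x ^ 2) := by
  have hFm : ∀ β : Fin n → ℤ, AEStronglyMeasurable (fun x => F (x + latticePoint β))
      (volume.restrict (unitCube n)) := fun β =>
    (hF.1.comp_measurePreserving (measurePreserving_add_right _ _)).restrict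
  have hsum : ∀ᵐ x ∂(volume.restrict (unitCube n)),
      Summable fun β : Fin n → ℤ => F (x + latticePoint β) := by
    filter_upwards [ae_lt_top' (AEMeasurable.tsum fun β => (hFm β).enorm)
      ((lintegral_tsum_translate hF.1.enorm).trans_ne hF.2.ne)] with x hx
    exact .of_norm ((ENNReal.summable_toReal hx.ne).congr fun β => toReal_enorm _)
  set g : (Fin n → ℝ) → ℂ := fun x => ∑' β : Fin n → ℤ, F (x + latticePoint β) with hg
  have hgm : AEStronglyMeasurable g (volume.restrict (unitCube n)) :=
    aestronglyMeasurable_of_tendsto_ae Filter.atTop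
      (fun s => Finset.aestronglyMeasurable_fun_sum s fun β _ => hFm β)
      (hsum.mono fun x hx => hx.hasSum)
  have hcoef : ∀ α, ∫ x, character α x * F x = ∫ x in unitCube n, character α x * g x := by
    intro α
    have hint : Integrable fun x => character α x * F x :=
      hF.bdd_mul (c := 1) (continuous_character α).aestronglyMeasurable
        (.of_forall fun x => (norm_character α x).le)
    rw [integral_eq_tsum_cube hint, ← integral_tsum]
    · refine integral_congr_ae ?_
      filter_upwards [hsum] with x hx
      simp only [character_add_latticePoint]
      rw [tsum_mul_left]
    · intro β
      simp only [character_add_latticePoint]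
      exact (continuous_character α).aestronglyMeasurable.mul (hFm β)
    · rw [← lintegral_eq_tsum_cube fun x => ‖character α x * F x‖ₑ]
      exact hint.2.ne
  have hpt := hsum.mono fun x hx => enorm_tsum_sq_le h0 hK hsymm hτ (h x) hx
  have e1 := lintegral_tsum_translate (hF.1.enorm.pow_const 2)
  have e2 := lintegral_tsum_translate (hvm.pow_const 2).ennreal_ofReal
  have k1 : ∫⁻ x in unitCube n, ‖g x‖ₑ ^ 2 ≤ (∫⁻ x, ‖F x‖ₑ ^ 2) +
      ofReal τ * ∫⁻ x, ofReal (v x ^ 2) := by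
    rw [← e1, ← e2, ← lintegral_const_mul' _ _ ofReal_ne_top,
      ← lintegral_add_left' (AEMeasurable.tsum fun β => (hFm β).enorm.pow_const 2)]
    exact lintegral_mono_ae (hpt.mono fun x hx => hx.1)
  have k2 : ∫⁻ x, ‖F x‖ₑ ^ 2 ≤ (∫⁻ x in unitCube n, ‖g x‖ₑ ^ 2) +
      ofReal τ * ∫⁻ x, ofReal (v x ^ 2) := by
    rw [← e1, ← e2, ← lintegral_const_mul' _ _ ofReal_ne_top,
      ← lintegral_add_left' (hgm.enorm.pow_const 2)]
    exact lintegral_mono_ae (hpt.mono fun x hx => hx.2)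
  have hgL : MemLp g 2 (volume.restrict (unitCube n)) := by
    refine ⟨hgm, ?_⟩
    rw [eLpNorm_lt_top_iff_lintegral_rpow_enorm_lt_top two_ne_zero ENNReal.ofNat_ne_top]
    simpa [ENNReal.rpow_ofNat] using k1.trans_lt (by finiteness)
  simp_rw [hcoef]
  rw [tsum_enorm_character_sq hgL]
  exact ⟨k1, k2⟩

end

section

/-! ### The frame coefficients on the Fourier side -/

variable {n : ℕ} {Z : FrequencyNet n}

/-- The profile of the Fourier transform of a Gaussian of frequency `ξ`. -/
def profile (ξ η : Rn n) : ℝ := exp (-‖(2 * π) • η - ξ‖ ^ 2 / (4 * ‖ξ‖))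

lemma profile_pos (ξ η : Rn n) : 0 < profile ξ η := exp_pos _

lemma profile_le_one (ξ η : Rn n) : profile ξ η ≤ 1 := by
  rw [profile, Real.exp_le_one_iff, neg_div]
  exact neg_nonpos.mpr (by positivity)

lemma continuous_profile (ξ : Rn n) : Continuous (profile ξ) := by
  unfold profile
  fun_prop

lemma fourier_gaussian {δ : ℝ} (hδ : 0 ≤ δ) (y : Rn n) {ξ : Rn n} (hξ : ξ ≠ 0) (η : Rn n) :
    𝓕 (gaussian δ y ξ) η = ((√(δ / 2) ^ n * profile ξ η : ℝ) : ℂ) *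
      Complex.exp (((-2 * π * inner ℝ y η : ℝ) : ℂ) * I) := by
  have hξ0 : 0 < ‖ξ‖ := norm_pos_iff.mpr hξ
  rw [Real.fourier_eq']
  have e1 : ∀ v : Rn n, Complex.exp (((-2 * π * inner ℝ v η : ℝ) : ℂ) * I) •
      gaussian δ y ξ v = ((√(‖ξ‖ * δ / (2 * π)) ^ n : ℝ) : ℂ) *
        Complex.exp (((-2 * π * inner ℝ y η : ℝ) : ℂ) * I) *
        Complex.exp (-(‖ξ‖ : ℂ) * (‖v - y‖ : ℂ) ^ 2 +
          I * (inner ℝ (ξ - (2 * π) • η) (v - y) : ℂ)) := by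
    intro v
    rw [gaussian, rpow_half_eq (by positivity), smul_eq_mul, mul_left_comm,
      mul_assoc ((√(‖ξ‖ * δ / (2 * π)) ^ n : ℝ) : ℂ),
      ← Complex.exp_add, ← Complex.exp_add]
    congr 2
    rw [inner_sub_left ξ, real_inner_smul_left, inner_sub_right η v y, real_inner_comm v η,
      real_inner_comm y η]
    push_cast
    ring
  simp_rw [e1]
  rw [integral_const_mul, integral_sub_right_eq_self
    (fun w : Rn n => Complex.exp (-(‖ξ‖ : ℂ) * (‖w‖ : ℂ) ^ 2 +
      I * (inner ℝ (ξ - (2 * π) • η) w : ℂ))),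
    GaussianFourier.integral_cexp_neg_mul_sq_norm_add (by simpa using hξ0)]
  have e2 : ((π : ℂ) / ‖ξ‖) ^ (Module.finrank ℝ (Rn n) / 2 : ℂ) =
      ((√(π / ‖ξ‖) ^ n : ℝ) : ℂ) := by
    rw [← rpow_half_eq (by positivity), finrank_euclideanSpace_fin, ← Complex.ofReal_div,
      Complex.ofReal_cpow (by positivity)]
    push_cast
    rfl
  have e3 : Complex.exp (I ^ 2 * (‖ξ - (2 * π) • η‖ : ℂ) ^ 2 / (4 * ‖ξ‖)) =
      ((profile ξ η : ℝ) : ℂ) := by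
    rw [profile, norm_sub_rev, Complex.I_sq]
    push_cast
    congr 2
    ring
  rw [e2, e3]
  have e4 : √(‖ξ‖ * δ / (2 * π)) ^ n * √(π / ‖ξ‖) ^ n = √(δ / 2) ^ n := by
    rw [← mul_pow, ← sqrt_mul (by positivity)]
    congr 2
    field_simp
  rw [← e4]
  push_cast
  ring

lemma frameCoeff_eq_inner (ε c : ℝ) (f : L2 n) (γ : Index Z) :
    frameCoeff Z ε c f γ = inner ℂ (frameVec ε c γ) f := by
  rw [frameCoeff, L2.inner_def]
  refine integral_congr_ae ?_
  filter_upwards [(memLp_gaussian (spacing ε c γ.1) (pos ε c γ) (freq_ne_zero γ)).coeFn_toLp]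
    with x hx
  have hx' : (frameVec ε c γ : L2 n) x = frameFun ε c γ x := hx
  rw [RCLike.inner_apply', hx']

lemma lintegral_dilate {Δ : ℝ} (hΔ : 0 < Δ) {h : Rn n → ℝ≥0∞} (hh : Measurable h) :
    ∫⁻ θ : Fin n → ℝ, h (Δ⁻¹ • WithLp.toLp 2 θ) = ofReal (Δ ^ n) * ∫⁻ η, h η := by
  rw [(PiLp.volume_preserving_toLp (Fin n)).lintegral_comp (f := fun η => h (Δ⁻¹ • η))
    (hh.comp (measurable_const_smul _)), ← lintegral_map hh (measurable_const_smul _),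
    Measure.map_addHaar_smul _ (inv_ne_zero hΔ.ne'), lintegral_smul_measure,
    finrank_euclideanSpace_fin, inv_pow, inv_inv, abs_of_pos (by positivity), smul_eq_mul]

lemma integral_dilate {Δ : ℝ} (hΔ : 0 < Δ) (h : Rn n → ℂ) :
    ∫ θ : Fin n → ℝ, h (Δ⁻¹ • WithLp.toLp 2 θ) = ((Δ ^ n : ℝ) : ℂ) * ∫ η, h η := by
  rw [(PiLp.volume_preserving_toLp (Fin n)).integral_comp
    (MeasurableEquiv.toLp 2 (Fin n → ℝ)).measurableEmbedding (fun η => h (Δ⁻¹ • η)),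
    Measure.integral_comp_smul_of_nonneg _ _ _ (hR := (inv_pos.mpr hΔ).le),
    finrank_euclideanSpace_fin, inv_pow, inv_inv, Complex.real_smul]

lemma measurable_dilate (Δ : ℝ) : Measurable fun θ : Fin n → ℝ => Δ⁻¹ • WithLp.toLp 2 θ :=
  (measurable_const_smul _).comp (MeasurableEquiv.toLp 2 (Fin n → ℝ)).measurable

lemma inner_pos_freq (ε c : ℝ) (γ : Index Z) (η : Rn n) :
    inner ℝ (pos ε c γ) η = ∑ i, spacing ε c γ.1 * (γ.2.2 i : ℝ) * η i := by
  simp only [pos, PiLp.inner_apply, RCLike.inner_apply, conj_trivial]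
  exact sum_congr rfl fun i _ => by ring

lemma frameCoeff_eq_integral {ε c : ℝ} (hc : 0 < c) (f : L2 n) (γ : Index Z) :
    frameCoeff Z ε c f γ =
      ((√(spacing ε c γ.1 / 2) ^ n * (spacing ε c γ.1 ^ n)⁻¹ : ℝ) : ℂ) *
      ∫ θ : Fin n → ℝ, character γ.2.2 θ *
        ((profile (freq γ) ((spacing ε c γ.1)⁻¹ • WithLp.toLp 2 θ) : ℂ) *
          (𝓕 f : L2 n) ((spacing ε c γ.1)⁻¹ • WithLp.toLp 2 θ)) := by
  set Δ := spacing ε c γ.1 with hΔd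
  have hΔ : 0 < Δ := spacing_pos hc γ.1
  have h1 := integral_dilate hΔ fun η => Complex.exp (((2 * π * inner ℝ (pos ε c γ) η : ℝ) : ℂ) *
    I) * ((profile (freq γ) η : ℂ) * (𝓕 f : L2 n) η)
  have e1 : ∀ θ : Fin n → ℝ, Complex.exp (((2 * π * inner ℝ (pos ε c γ)
      (Δ⁻¹ • WithLp.toLp 2 θ) : ℝ) : ℂ) * I) = character γ.2.2 θ := by
    intro θ
    rw [character, inner_pos_freq]
    congr 4
    refine sum_congr rfl fun i _ => ?_
    rw [← hΔd, PiLp.smul_apply, smul_eq_mul]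
    field_simp
  simp only [e1] at h1
  rw [h1, frameCoeff_eq_inner, ← Lp.inner_fourier_eq, L2.inner_def, ← mul_assoc,
    ← Complex.ofReal_mul, mul_assoc _ (Δ ^ n)⁻¹, inv_mul_cancel₀ (by positivity), mul_one,
    ← integral_const_mul]
  refine integral_congr_ae ?_
  have hmem := memLp_gaussian (spacing ε c γ.1) (pos ε c γ) (freq_ne_zero γ)
  have hint : Integrable (gaussian (spacing ε c γ.1) (pos ε c γ) (freq γ)) :=
    (rapidBdd_gaussian hΔ.le _ (freq_ne_zero γ)).integrable (continuous_gaussian _ _ _).measurable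
  filter_upwards [fourier_toLp_ae_eq hint hmem] with η hη
  rw [RCLike.inner_apply', frameVec]
  rw [show (𝓕 (hmem.toLp (frameFun ε c γ)) : L2 n) η = _ from hη,
    fourier_gaussian hΔ.le _ (freq_ne_zero γ), map_mul, Complex.conj_ofReal, ← Complex.exp_conj,
    map_mul, Complex.conj_ofReal, Complex.conj_I]
  push_cast
  rw [show -2 * (π : ℂ) * (inner ℝ (pos ε c γ) η : ℂ) * -I =
    2 * π * (inner ℝ (pos ε c γ) η : ℂ) * I by ring]
  ring

lemma exists_sum_exp_lattice_le (n : ℕ) : ∃ A > 0, ∀ κ : ℝ, 1 ≤ κ → ∀ (β : Fin n → ℤ)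
    (s : Finset (Fin n → ℤ)), β ∉ s →
    ∑ β' ∈ s, exp (-κ * ‖WithLp.toLp 2 (latticePoint β) - WithLp.toLp 2 (latticePoint β')‖ ^ 2) ≤
      A * exp (-κ) := by
  obtain ⟨C, hC, h⟩ := exists_sum_exp_le_of_separated n
  have hsep : ∀ β β' : Fin n → ℤ, β ≠ β' →
      1 ≤ ‖(WithLp.toLp 2 (latticePoint β) - WithLp.toLp 2 (latticePoint β') : Rn n)‖ := by
    intro β β' hne
    obtain ⟨i, hi⟩ := Function.ne_iff.mp hne
    refine le_trans ?_ (abs_coord_le _ i)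
    simp only [PiLp.sub_apply, latticePoint]
    exact_mod_cast Int.one_le_abs (sub_ne_zero.mpr hi)
  refine ⟨exp 1 * (C * exp (1 * 1 ^ 2) * ((1 * √1)⁻¹) ^ n), by positivity,
    fun κ hκ β s hβ => ?_⟩
  calc _ ≤ ∑ β' ∈ s, exp 1 * exp (-κ) * exp (-1 *
        ‖(WithLp.toLp 2 (latticePoint β') - WithLp.toLp 2 (latticePoint β) : Rn n)‖ ^ 2) := by
        refine sum_le_sum fun β' hβ' => ?_
        have h2 := one_le_pow₀ (hsep β β' fun h => hβ (h ▸ hβ')) (n := 2)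
        rw [← exp_add, ← exp_add, norm_sub_rev (WithLp.toLp 2 (latticePoint β')),
          Real.exp_le_exp]
        nlinarith
    _ ≤ exp 1 * exp (-κ) * (C * exp (1 * 1 ^ 2) * ((1 * √1)⁻¹) ^ n) := by
        rw [← mul_sum]
        gcongr
        exact h (Fin n → ℤ) (fun β => WithLp.toLp 2 (latticePoint β)) 1 1 one_pos one_pos
          (fun i j hij => by rw [dist_eq_norm]; exact hsep i j hij) _ s
    _ = _ := by ring

/-- Two lattice translates of a profile are almost orthogonal. -/
lemma profile_mul_profile_le (ξ : Rn n) (η η' : Rn n) :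
    profile ξ η * profile ξ η' ≤ exp (-(π ^ 2 / (4 * ‖ξ‖)) * ‖η - η'‖ ^ 2) *
      (√(profile ξ η) * √(profile ξ η')) := by
  have h1 := parallelogram_law_with_norm ℝ ((2 * π) • η - ξ) ((2 * π) • η' - ξ)
  rw [sub_sub_sub_cancel_right, ← smul_sub, norm_smul, norm_of_nonneg (by positivity)] at h1
  simp only [profile]
  rw [← Real.exp_half, ← Real.exp_half, ← exp_add, ← exp_add, ← exp_add, Real.exp_le_exp]
  have h2 := div_nonneg (sq_nonneg ‖(2 * π) • η - ξ + ((2 * π) • η' - ξ)‖)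
    (by positivity : 0 ≤ 16 * ‖ξ‖)
  rw [← sub_nonneg]
  refine h2.trans_eq ?_
  rw [eq_sub_of_add_eq h1]
  rcases (norm_nonneg ξ).eq_or_lt with h0 | h0
  · simp [← h0]
  · field_simp
    ring

/-- The part of the energy of `f` with frequencies near `ξ`. -/
def profileEnergy (p : ℕ) (ξ : Rn n) (f : L2 n) : ℝ≥0∞ :=
  ∫⁻ η, ofReal (profile ξ η ^ p) * ‖(𝓕 f : L2 n) η‖ₑ ^ 2

lemma profileEnergy_ne_top (p : ℕ) (ξ : Rn n) (f : L2 n) : profileEnergy p ξ f ≠ ∞ := by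
  refine ne_top_of_le_ne_top (b := ‖(𝓕 f : L2 n)‖ₑ ^ 2) (by simp) ?_
  rw [enorm_sq_eq_lintegral]
  exact lintegral_mono fun η => mul_le_of_le_one_left zero_le
    (ENNReal.ofReal_le_one.mpr (pow_le_one₀ (profile_pos _ _).le (profile_le_one _ _)))

lemma integrable_profile (p : ℕ) (hp : p ≠ 0) {ξ : Rn n} (hξ : ξ ≠ 0) :
    Integrable fun η => profile ξ η ^ p := by
  have h0 : 0 < ‖ξ‖ := norm_pos_iff.mpr hξ
  have hp' : (0 : ℝ) < p := by positivity
  refine ((integrable_exp_neg_mul_sq (n := n) (s := p / (4 * ‖ξ‖)) (by positivity) ξ).comp_smul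
    (by positivity : (2 * π) ≠ 0)).congr (.of_forall fun η => ?_)
  simp only [profile, ← Real.exp_nat_mul]
  congr 1
  ring

/-- The size of the terms off the diagonal in the Poisson summation formula of level `k`. -/
def aliasing (ε c : ℝ) (k : ℕ) : ℝ := exp (-((2 : ℝ) ^ (2 * ε * k) / c ^ 2))

/-- The lattice of the frequencies of level `k` is so sparse that the aliases are exponentially
small. -/
lemma le_mul_spacing_inv_sq {ε c : ℝ} (hc : 0 < c) (k : ℕ) {b : ℝ} (hb : 0 < b)
    (hb' : b ≤ 2 ^ k) :
    (2 : ℝ) ^ (2 * ε * k) / c ^ 2 ≤ π ^ 2 / (4 * b) * ((spacing ε c k)⁻¹) ^ 2 := by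
  have e1 : spacing ε c k ^ 2 = c ^ 2 * ((2 : ℝ) ^ k * (2 : ℝ) ^ (2 * ε * k))⁻¹ := by
    rw [spacing, mul_pow, ← rpow_natCast ((2 : ℝ) ^ _), ← rpow_mul two_pos.le,
      ← rpow_natCast 2 k, ← rpow_add two_pos, ← Real.rpow_neg two_pos.le]
    congr 2
    push_cast; ring
  have : (4 : ℝ) ≤ π ^ 2 := by nlinarith [Real.pi_gt_three]
  calc _ = ((2 : ℝ) ^ k)⁻¹ * ((spacing ε c k)⁻¹) ^ 2 := by rw [inv_pow, e1]; field_simp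
    _ ≤ _ := by
      gcongr
      rw [le_div_iff₀ (by positivity), inv_mul_le_iff₀ (by positivity)]
      nlinarith

/-- For each frequency, the frame coefficients have nearly the energy of the part of `f` with
frequencies near `ξ`. -/
lemma exists_tsum_frameCoeff_sq_le (n : ℕ) : ∃ A : ℝ, 0 < A ∧ ∀ (ε c : ℝ), 0 < ε → 0 < c → c ≤ 1 →
    ∀ (Z : FrequencyNet n) (k : ℕ) (ξ : Z.pts k) (f : L2 n),
    (∑' α : Fin n → ℤ, ‖frameCoeff Z ε c f ⟨k, ξ, α⟩‖ₑ ^ 2 ≤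
      ofReal ((2 ^ n)⁻¹) * profileEnergy 2 (ξ : Rn n) f +
        ofReal ((2 ^ n)⁻¹ * (A * aliasing ε c k)) * profileEnergy 1 (ξ : Rn n) f) ∧
    ofReal ((2 ^ n)⁻¹) * profileEnergy 2 (ξ : Rn n) f ≤
      ∑' α : Fin n → ℤ, ‖frameCoeff Z ε c f ⟨k, ξ, α⟩‖ₑ ^ 2 +
        ofReal ((2 ^ n)⁻¹ * (A * aliasing ε c k)) * profileEnergy 1 (ξ : Rn n) f := by
  obtain ⟨A, hA, hA'⟩ := exists_sum_exp_lattice_le n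
  refine ⟨A, hA, fun ε c hε hc hc1 Z k ξ f => ?_⟩
  set Δ := spacing ε c k with hΔd
  have hΔ : 0 < Δ := spacing_pos hc k
  set G := profile (ξ : Rn n) with hG
  have hG0 : ∀ η, 0 ≤ G η := fun η => (profile_pos _ η).le
  have hGm : Measurable G := (continuous_profile _).measurable
  set u : Rn n → ℂ := ((𝓕 f : L2 n) : Rn n → ℂ) with hu
  have hum : Measurable u := (Lp.stronglyMeasurable _).measurable
  set κ := (2 : ℝ) ^ (2 * ε * k) / c ^ 2 with hκ
  have hκ1 : 1 ≤ κ := by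
    rw [hκ, le_div_iff₀ (by positivity), one_mul]
    exact (pow_le_one₀ hc.le hc1).trans (Real.one_le_rpow one_le_two (by positivity))
  set D : (Fin n → ℝ) → Rn n := fun θ => Δ⁻¹ • WithLp.toLp 2 θ with hD
  have hDm : Measurable D := measurable_dilate Δ
  have hξ0 : (ξ : Rn n) ≠ 0 := freq_ne_zero (⟨k, ξ, 0⟩ : Index Z)
  have hsparse : κ ≤ π ^ 2 / (4 * ‖(ξ : Rn n)‖) * (Δ⁻¹) ^ 2 :=
    le_mul_spacing_inv_sq hc k (norm_pos_iff.mpr hξ0) (Z.subset_annulus k ξ.2).2.le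
  have hdil : ∀ p, ∫⁻ θ, ofReal (G (D θ) ^ p) * ‖u (D θ)‖ₑ ^ 2 =
      ofReal (Δ ^ n) * profileEnergy p (ξ : Rn n) f := fun p =>
    lintegral_dilate hΔ (h := fun η => ofReal (G η ^ p) * ‖u η‖ₑ ^ 2) (by fun_prop)
  have i1 : ∫⁻ θ, ‖(G (D θ) : ℂ) * u (D θ)‖ₑ ^ 2 = _ := (lintegral_congr fun θ => by
    rw [enorm_mul, mul_pow, enorm_sq_eq_ofReal (_ : ℂ), norm_real, norm_eq_abs, sq_abs]).trans
      (hdil 2)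
  have i2 : ∫⁻ θ, ofReal ((√(G (D θ)) * ‖u (D θ)‖) ^ 2) = _ := (lintegral_congr fun θ => by
    rw [mul_pow, sq_sqrt (hG0 _), ofReal_mul (hG0 _), ← enorm_sq_eq_ofReal, pow_one]).trans (hdil 1)
  have hFint : Integrable fun θ => (G (D θ) : ℂ) * u (D θ) := by
    have h2 : MemLp (fun η => (G η : ℂ)) 2 := MemLp.ofReal
      ((memLp_two_iff_integrable_sq hGm.aestronglyMeasurable).mpr
        (integrable_profile 2 two_ne_zero hξ0))
    exact ((PiLp.volume_preserving_toLp (Fin n)).integrable_comp_emb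
      (MeasurableEquiv.toLp 2 (Fin n → ℝ)).measurableEmbedding).mpr
      ((h2.integrable_mul (Lp.memLp (𝓕 f : L2 n))).comp_smul (inv_ne_zero hΔ.ne'))
  have hE := fun p => ENNReal.mul_ne_top (ofReal_ne_top (r := Δ ^ n))
    (profileEnergy_ne_top p (ξ : Rn n) f)
  have key := tsum_enorm_fourier_sq_le (v := fun θ => √(G (D θ)) * ‖u (D θ)‖) (τ := A * exp (-κ))
    (K := fun β β' => exp (-κ * ‖(WithLp.toLp 2 (latticePoint β) -
      WithLp.toLp 2 (latticePoint β') : Rn n)‖ ^ 2)) (by positivity) hFint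
    (i1.trans_ne (hE 2)) (((hGm.comp hDm).sqrt.mul (hum.comp hDm).norm).aemeasurable)
    (i2.trans_ne (hE 1)) (fun _ _ => (exp_pos _).le) (fun β β' => by simp only [norm_sub_rev])
    (fun β s hβ => hA' κ hκ1 β s hβ) (fun θ β β' _ => by
      have h1 := profile_mul_profile_le (ξ : Rn n) (D (θ + latticePoint β)) (D (θ + latticePoint β'))
      have h2 : D (θ + latticePoint β) - D (θ + latticePoint β') =
          Δ⁻¹ • (WithLp.toLp 2 (latticePoint β) - WithLp.toLp 2 (latticePoint β') : Rn n) := by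
        simp only [hD, WithLp.toLp_add, smul_add, smul_sub]
        abel
      rw [h2, norm_smul, mul_pow, norm_of_nonneg (inv_pos.mpr hΔ).le,
        ← mul_assoc (-(π ^ 2 / _)), neg_mul (π ^ 2 / _)] at h1
      have h3 := mul_le_mul_of_nonneg_right (h1.trans (mul_le_mul_of_nonneg_right
        (Real.exp_le_exp.mpr (mul_le_mul_of_nonneg_right (neg_le_neg hsparse) (sq_nonneg _)))
        (by positivity))) (by positivity : 0 ≤ ‖u (D (θ + latticePoint β))‖ *
          ‖u (D (θ + latticePoint β'))‖)
      simp only [norm_mul, norm_real, norm_of_nonneg (hG0 _)]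
      exact (le_of_eq (by ring)).trans (h3.trans_eq (by ring)))
  have hcoef : ∀ α, ‖frameCoeff Z ε c f ⟨k, ξ, α⟩‖ₑ ^ 2 = ofReal ((2 ^ n)⁻¹ * (Δ ^ n)⁻¹) *
      ‖∫ θ, character α θ * ((G (D θ) : ℂ) * u (D θ))‖ₑ ^ 2 := by
    intro α
    rw [frameCoeff_eq_integral hc, enorm_mul, mul_pow,
      enorm_sq_eq_ofReal ((√(spacing ε c k / 2) ^ n * (spacing ε c k ^ n)⁻¹ : ℝ) : ℂ)]
    congr 2
    rw [norm_real, norm_eq_abs, sq_abs, mul_pow, ← pow_mul, mul_comm n 2, pow_mul,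
      sq_sqrt (by positivity), div_pow, ← hΔd]
    field_simp
  simp_rw [hcoef]
  rw [ENNReal.tsum_mul_left]
  erw [i1, i2] at key
  have e0 : ofReal ((2 ^ n)⁻¹) = ofReal ((2 ^ n)⁻¹ * (Δ ^ n)⁻¹) * ofReal (Δ ^ n) := by
    rw [← ofReal_mul (by positivity), mul_assoc, inv_mul_cancel₀ (by positivity), mul_one]
  rw [ofReal_mul (q := A * _) (by positivity), e0, aliasing, ← hκ]
  exact ⟨(mul_le_mul_right key.1 _).trans_eq (by ring),
    (le_of_eq (by ring)).trans ((mul_le_mul_right key.2 _).trans_eq (by ring))⟩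

end

section

/-! ### The symbol of the frame operator -/

variable {n : ℕ} {Z : FrequencyNet n}

lemma exists_sum_profile_level_le (n : ℕ) : ∃ C : ℝ, 0 < C ∧ ∀ (Z : FrequencyNet n) (k : ℕ)
    (η : Rn n) (F : Finset (Z.pts k)),
    ∑ ξ ∈ F, exp (-(1 / 8 * (‖(2 * π) • η - (ξ : Rn n)‖ ^ 2 / 2 ^ k))) ≤ C := by
  obtain ⟨C, hC, h⟩ := exists_sum_exp_le_of_separated n
  refine ⟨C * exp (1 / 8) * ((√(1 / 8))⁻¹) ^ n, by positivity, fun Z k η F => ?_⟩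
  have hk : (0 : ℝ) < 2 ^ k := by positivity
  have h1 := h (Z.pts k) (fun ξ => (ξ : Rn n)) (scale k) (1 / 8 / 2 ^ k) (scale_pos k)
    (by positivity) (fun i j hij => by
      have := Z.separated k i i.2 j j.2 fun h => hij (Subtype.ext h)
      refine le_trans (le_of_eq ?_) this.le
      have h2 := scale_zpow k 1
      rw [zpow_one] at h2
      rw [h2]
      congr 1
      push_cast; ring) ((2 * π) • η) F
  rw [scale_sq, div_mul_cancel₀ _ hk.ne'] at h1
  have e2 : scale k * √(1 / 8 / 2 ^ k) = √(1 / 8) := by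
    rw [scale, ← sqrt_mul hk.le, mul_div_cancel₀ _ hk.ne']
  rw [e2] at h1
  refine le_trans (le_of_eq (sum_congr rfl fun ξ _ => ?_)) h1
  rw [norm_sub_rev]
  congr 1
  ring

/-- The frequencies at which a profile is not small have the size of its frequency. -/
lemma peetre_profile {b w s : ℝ} {η ξ : Rn n} (hb1 : 1 ≤ b) (hw1 : 1 ≤ w) (hs0 : 0 ≤ s)
    (hηw : ‖η‖ ≤ w) (hwη : w ≤ 1 + ‖η‖) (hξ1 : b / 2 ≤ ‖ξ‖) (hξ2 : ‖ξ‖ ≤ b)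
    (hds : ‖(2 * π) • η - ξ‖ ^ 2 = s * b) :
    b ≤ 32 * (1 + s) * w ∧ w ≤ 32 * (1 + s) * b := by
  have t1 := norm_sub_norm_le ξ ((2 * π) • η)
  have t2 := norm_sub_norm_le ((2 * π) • η) ξ
  rw [norm_sub_rev, norm_smul, norm_of_nonneg (by positivity : 0 ≤ 2 * π)] at t1
  rw [norm_smul, norm_of_nonneg (by positivity : 0 ≤ 2 * π)] at t2
  set d := ‖(2 * π) • η - ξ‖
  have hη0 := norm_nonneg η
  have u1 : 2 * π * ‖η‖ ≤ 8 * w :=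
    mul_le_mul (by linarith [Real.pi_lt_four]) hηw hη0 (by norm_num)
  have u2 : ‖η‖ ≤ 2 * π * ‖η‖ :=
    le_mul_of_one_le_left hη0 (by linarith [Real.pi_gt_three])
  have hsb : 0 ≤ s * b := mul_nonneg hs0 (by linarith)
  have hsw : s ≤ s * w := le_mul_of_one_le_right hs0 hw1
  constructor
  · have h1 : d ≤ b / 4 + s := le_of_sq_le_sq (by linarith [sq_nonneg (b / 4 - s)]) (by linarith)
    linarith
  · have h1 : d ≤ (1 + s) * b := by
      refine le_of_sq_le_sq ?_ (mul_nonneg (by linarith) (by linarith))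
      rw [hds, mul_pow]
      refine mul_le_mul (by linarith [sq_nonneg s]) (le_self_pow₀ hb1 two_ne_zero) (by linarith)
        (sq_nonneg _)
    linarith

lemma one_le_mul_pow_gap {j k : ℕ} {w s : ℝ} (hs0 : 0 ≤ s) (hj1 : (2 : ℝ) ^ (j : ℝ) ≤ w)
    (hj2 : w ≤ (2 : ℝ) ^ ((j : ℝ) + 1)) (p1 : (2 : ℝ) ^ k ≤ 32 * (1 + s) * w)
    (p2 : w ≤ 32 * (1 + s) * (2 : ℝ) ^ k) : 1 ≤ 64 * (1 + s) * (1 / 2 : ℝ) ^ gap j k := by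
  rw [rpow_natCast] at hj1
  rw [rpow_add two_pos, rpow_natCast, Real.rpow_one] at hj2
  have hb0 : (0 : ℝ) < 2 ^ k := by positivity
  have hj0 : (0 : ℝ) < 2 ^ j := by positivity
  have h2 : (2 : ℝ) ^ gap j k ≤ 64 * (1 + s) := by
    rcases le_total k j with h | h
    · have e : gap j k = j - k := by simp only [gap]; omega
      refine le_of_mul_le_mul_right ?_ hb0
      rw [e, ← pow_add, Nat.sub_add_cancel h]
      linarith
    · have e : gap j k = k - j := by simp only [gap]; omega
      refine le_of_mul_le_mul_right ?_ hj0
      rw [e, ← pow_add, Nat.sub_add_cancel h]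
      nlinarith
  rw [one_div, inv_pow, ← div_eq_mul_inv, le_div_iff₀ (by positivity), one_mul]
  exact h2

lemma rpow_le_of_comparable {b w A : ℝ} (hb0 : 0 < b) (hw0 : 0 < w) (hA : 0 < A) (p1 : b ≤ A * w)
    (p2 : w ≤ A * b) (r : ℝ) : b ^ r ≤ A ^ |r| * w ^ r := by
  rcases le_or_gt 0 r with h | h
  · rw [abs_of_nonneg h, ← Real.mul_rpow hA.le hw0.le]
    exact Real.rpow_le_rpow hb0.le p1 h
  · calc b ^ r ≤ (A⁻¹ * w) ^ r :=
          Real.rpow_le_rpow_of_nonpos (by positivity) ((inv_mul_le_iff₀ hA).mpr p2) h.le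
      _ = _ := by
          rw [Real.mul_rpow (by positivity) hw0.le, Real.inv_rpow hA.le, abs_of_neg h,
            Real.rpow_neg hA.le]

lemma exists_rpow_mul_exp_le (r : ℝ) : ∃ C : ℝ, 0 < C ∧ ∀ s : ℝ, 0 ≤ s →
    (1 + s) ^ |r| * (1 + s) * exp (-(1 / 8 * s)) ≤ C := by
  obtain ⟨C, hC, hexp⟩ := exists_one_add_pow_mul_exp_le (2 * (⌈|r|⌉₊ + 1))
    (by norm_num : (0:ℝ) < 1 / 8)
  refine ⟨C, hC, fun s hs0 => ?_⟩
  have h2 := hexp (√s) (sqrt_nonneg _)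
  rw [sq_sqrt hs0] at h2
  refine le_trans (mul_le_mul_of_nonneg_right ?_ (exp_pos _).le) h2
  have h3 : (1 + s) ^ |r| ≤ (1 + s) ^ ⌈|r|⌉₊ := by
    rw [← rpow_natCast]
    exact Real.rpow_le_rpow_of_exponent_le (by linarith) (Nat.le_ceil _)
  have h4 : (1 + s) ^ |r| * (1 + s) ≤ (1 + s) ^ (⌈|r|⌉₊ + 1) := by
    rw [pow_succ]
    gcongr
  refine h4.trans ?_
  rw [pow_mul]
  refine pow_le_pow_left₀ (by positivity) ?_ _
  have := sqrt_nonneg s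
  linarith [sq_sqrt hs0, add_sq 1 (√s)]

/-- The profiles of level `k` live at the frequencies of size `2^k`. -/
lemma exists_sum_profile_le (n : ℕ) (r : ℝ) : ∃ C : ℝ, 0 < C ∧ ∀ (Z : FrequencyNet n) (η : Rn n)
    (F : Finset (Σ k, Z.pts k)),
    ∑ y ∈ F, (2 : ℝ) ^ (r * y.1) * profile (y.2 : Rn n) η ≤ C * (1 + ‖η‖ ^ 2) ^ (r / 2) := by
  classical
  obtain ⟨C₁, hC₁, hsum⟩ := exists_sum_profile_level_le n
  obtain ⟨C₂, hC₂, hexp⟩ := exists_rpow_mul_exp_le r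
  refine ⟨64 * 32 ^ |r| * C₂ * C₁ * 4, by positivity, fun Z η F => ?_⟩
  obtain ⟨j, hj1, hj2⟩ := exists_dyadic_weight η
  set W := 1 + ‖η‖ ^ 2 with hW
  have hW0 : 0 < W := by rw [hW]; positivity
  set w := W ^ (1 / 2 : ℝ) with hw
  have hw0 : 0 < w := by positivity
  have hw2 : w ^ 2 = W := by
    rw [hw, ← rpow_natCast, ← rpow_mul hW0.le]; norm_num
  have hw1 : 1 ≤ w := by nlinarith [sq_nonneg ‖η‖]
  have hηw : ‖η‖ ≤ w := by
    refine le_of_sq_le_sq ?_ hw0.le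
    rw [hw2, hW]; linarith
  have hwη : w ≤ 1 + ‖η‖ := by
    refine le_of_sq_le_sq ?_ (by positivity)
    rw [hw2, hW]; nlinarith [norm_nonneg η]
  have hWr : W ^ (r / 2) = w ^ r := by
    rw [hw, ← rpow_mul hW0.le]; congr 1; ring
  have hpt : ∀ y : Σ k, Z.pts k, (2 : ℝ) ^ (r * y.1) * profile (y.2 : Rn n) η ≤
      64 * 32 ^ |r| * C₂ * w ^ r * ((1 / 2 : ℝ) ^ gap j y.1 *
        exp (-(1 / 8 * (‖(2 * π) • η - (y.2 : Rn n)‖ ^ 2 / 2 ^ y.1)))) := by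
    rintro ⟨k, ξ⟩
    simp only
    set s := ‖(2 * π) • η - (ξ : Rn n)‖ ^ 2 / 2 ^ k with hs
    have hs0 : 0 ≤ s := by positivity
    have hξ := Z.subset_annulus k ξ.2
    have hds : ‖(2 * π) • η - (ξ : Rn n)‖ ^ 2 = s * 2 ^ k := by rw [hs]; field_simp
    obtain ⟨p1, p2⟩ := peetre_profile (one_le_pow₀ one_le_two) hw1 hs0 hηw hwη hξ.1 hξ.2.le hds
    have g1 := one_le_mul_pow_gap hs0 hj1 hj2 p1 p2
    have r1 : (2 : ℝ) ^ (r * k) ≤ (32 * (1 + s)) ^ |r| * w ^ r := by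
      rw [mul_comm r, rpow_mul two_pos.le, rpow_natCast]
      exact rpow_le_of_comparable (by positivity) hw0 (by positivity) p1 p2 r
    have r2 : profile (ξ : Rn n) η ≤ exp (-(1 / 8 * s)) * exp (-(1 / 8 * s)) := by
      have h0 : 0 < ‖(ξ : Rn n)‖ := lt_of_lt_of_le (by positivity) hξ.1
      rw [profile, ← exp_add, hds, Real.exp_le_exp, neg_div, ← neg_add, neg_le_neg_iff,
        le_div_iff₀ (by positivity)]
      nlinarith [mul_le_mul_of_nonneg_left hξ.2.le hs0]
    set E := exp (-(1 / 8 * s))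
    calc (2 : ℝ) ^ (r * k) * profile (ξ : Rn n) η ≤ ((32 * (1 + s)) ^ |r| * w ^ r) *
          (E * E) * (64 * (1 + s) * (1 / 2 : ℝ) ^ gap j k) :=
          (mul_le_mul r1 r2 (profile_pos _ _).le (by positivity)).trans
            (le_mul_of_one_le_right (by positivity) g1)
      _ = 64 * 32 ^ |r| * ((1 + s) ^ |r| * (1 + s) * E) * (w ^ r *
          ((1 / 2 : ℝ) ^ gap j k * E)) := by
          rw [Real.mul_rpow (by norm_num) (by positivity)]; ring
      _ ≤ 64 * 32 ^ |r| * C₂ * (w ^ r * ((1 / 2 : ℝ) ^ gap j k * E)) := by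
          gcongr; exact hexp s hs0
      _ = _ := by ring
  rw [hWr]
  refine (sum_le_sum fun y _ => hpt y).trans ?_
  rw [← mul_sum]
  have e : ∑ y ∈ F, (1 / 2 : ℝ) ^ gap j y.1 *
      exp (-(1 / 8 * (‖(2 * π) • η - (y.2 : Rn n)‖ ^ 2 / 2 ^ y.1))) ≤ C₁ * 4 := by
    rw [← Finset.sigma_image_fst_preimage_mk F, Finset.sum_sigma]
    simp only [← mul_sum]
    calc _ ≤ ∑ k ∈ F.image Sigma.fst, (1 / 2 : ℝ) ^ gap j k * C₁ :=
          sum_le_sum fun k _ => mul_le_mul_of_nonneg_left (hsum Z k η _) (by positivity)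
      _ ≤ _ := by
          rw [← sum_mul, mul_comm]
          refine mul_le_mul_of_nonneg_left ?_ hC₁.le
          have := sum_pow_gap_le (by norm_num : (0:ℝ) ≤ 1 / 2) (by norm_num) j (F.image Sigma.fst)
          norm_num at this ⊢
          exact this
  calc _ ≤ 64 * 32 ^ |r| * C₂ * w ^ r * (C₁ * 4) := by gcongr
    _ = _ := by ring

/-- A sum of profiles with coefficients, the symbol of a Fourier multiplier. -/
def profileSymbol (Z : FrequencyNet n) (p : ℕ) (a : (Σ k, Z.pts k) → ℝ) (η : Rn n) : ℝ≥0∞ :=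
  ∑' y : Σ k, Z.pts k, ofReal (a y * profile (y.2 : Rn n) η ^ p)

lemma measurable_profileSymbol (Z : FrequencyNet n) (p : ℕ) (a : (Σ k, Z.pts k) → ℝ) :
    Measurable (profileSymbol Z p a) := by
  have := fun ξ : Rn n => (continuous_profile ξ).measurable
  have : ∀ k, Countable (Z.pts k) := fun k => (Z.countable_pts k).to_subtype
  exact Measurable.tsum fun y => by fun_prop

lemma lintegral_profileSymbol {p : ℕ} {a : (Σ k, Z.pts k) → ℝ} (ha : ∀ y, 0 ≤ a y) (f : L2 n) :
    ∫⁻ η, profileSymbol Z p a η * ‖(𝓕 f : L2 n) η‖ₑ ^ 2 =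
      ∑' y : Σ k, Z.pts k, ofReal (a y) * profileEnergy p (y.2 : Rn n) f := by
  have h1 := fun ξ : Rn n => (continuous_profile ξ).measurable
  have h2 := (Lp.stronglyMeasurable (𝓕 f : L2 n)).measurable
  have : ∀ k, Countable (Z.pts k) := fun k => (Z.countable_pts k).to_subtype
  simp_rw [profileSymbol, ← ENNReal.tsum_mul_right, ofReal_mul (ha _), mul_assoc]
  rw [lintegral_tsum fun y => by fun_prop]
  exact tsum_congr fun y => lintegral_const_mul' _ _ ofReal_ne_top

lemma exists_profileSymbol_le (n : ℕ) (r : ℝ) : ∃ C : ℝ, 0 < C ∧ ∀ (Z : FrequencyNet n) (p : ℕ)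
    (K : ℝ) (a : (Σ k, Z.pts k) → ℝ), p ≠ 0 → 0 ≤ K → (∀ y, 0 ≤ a y) →
    (∀ y, a y ≤ K * 2 ^ (r * y.1)) → ∀ η,
      profileSymbol Z p a η ≤ ofReal (K * C * (1 + ‖η‖ ^ 2) ^ (r / 2)) := by
  obtain ⟨C, hC, h⟩ := exists_sum_profile_le n r
  refine ⟨C, hC, fun Z p K a hp hK ha haK η => ?_⟩
  rw [profileSymbol, ENNReal.tsum_eq_iSup_sum]
  refine iSup_le fun F => ?_
  rw [← ofReal_sum_of_nonneg fun y _ => mul_nonneg (ha y) (pow_nonneg (profile_pos _ _).le p)]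
  refine ofReal_le_ofReal ?_
  calc _ ≤ ∑ y ∈ F, K * ((2 : ℝ) ^ (r * y.1) * profile (y.2 : Rn n) η) := by
        refine sum_le_sum fun y _ => ?_
        rw [← mul_assoc]
        exact mul_le_mul (haK y) (pow_le_of_le_one (profile_pos _ _).le (profile_le_one _ _) hp)
          (pow_nonneg (profile_pos _ _).le p) (by positivity)
    _ ≤ _ := by
        rw [← mul_sum, mul_assoc]
        gcongr
        exact h Z η F

/-- Every frequency is near one of the frequencies of the net. -/
lemma exists_le_profile (hn : 0 < n) (Z : FrequencyNet n) (η : Rn n) :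
    ∃ y : Σ k, Z.pts k, exp (-(9 / 4)) ≤ profile (y.2 : Rn n) η ^ 2 := by
  have key : ∀ (k : ℕ) (ξ : Z.pts k), ‖(2 * π) • η - (ξ : Rn n)‖ ^ 2 ≤ 9 / 4 * 2 ^ k →
      exp (-(9 / 4)) ≤ profile (ξ : Rn n) η ^ 2 := by
    intro k ξ h
    have h1 : (2 : ℝ) ^ k / 2 ≤ ‖(ξ : Rn n)‖ := (Z.subset_annulus k ξ.2).1
    have h0 : (0 : ℝ) < 2 ^ k := by positivity
    rw [profile, ← Real.exp_nat_mul]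
    refine Real.exp_le_exp.mpr ?_
    rw [neg_div, mul_neg]
    refine neg_le_neg ?_
    push_cast
    rw [← mul_div_assoc, div_le_iff₀ (by linarith)]
    nlinarith
  rcases le_or_gt (1 / 2) ‖(2 * π) • η‖ with h | h
  · obtain ⟨j, h1, h2⟩ := exists_nat_pow_near (by linarith : 1 ≤ 2 * ‖(2 * π) • η‖)
      (one_lt_two (α := ℝ))
    obtain ⟨ξ, hξ, hd⟩ := Z.maximal j ((2 * π) • η)
      ⟨by linarith, by rw [pow_succ] at h2; linarith⟩
    refine ⟨⟨j, ξ, hξ⟩, key j ⟨ξ, hξ⟩ ?_⟩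
    rw [dist_eq_norm] at hd
    have h3 := pow_le_pow_left₀ (norm_nonneg _) hd 2
    rw [← rpow_natCast ((2 : ℝ) ^ _), ← rpow_mul two_pos.le] at h3
    have e : (j : ℝ) / 2 * ((2 : ℕ) : ℝ) = j := by push_cast; ring
    rw [e, rpow_natCast] at h3
    have h0 : (0 : ℝ) < 2 ^ j := by positivity
    linarith
  · have : (single (⟨0, hn⟩ : Fin n) (1 / 2 : ℝ)) ∈ annulus n 0 := by
      constructor <;> norm_num
    obtain ⟨ξ, hξ, -⟩ := Z.maximal 0 _ this
    refine ⟨⟨0, ξ, hξ⟩, key 0 ⟨ξ, hξ⟩ ?_⟩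
    have h1 : ‖ξ‖ < 1 := by simpa using (Z.subset_annulus 0 hξ).2
    have h2 : ‖(2 * π) • η - ξ‖ ≤ 3 / 2 := (norm_sub_le _ _).trans (by linarith)
    have h3 := pow_le_pow_left₀ (norm_nonneg _) h2 2
    norm_num at h3 ⊢
    exact h3

end

section

/-! ### The energy of the frame coefficients -/

variable {n : ℕ} {Z : FrequencyNet n}

/-- The symbol of the Fourier multiplier that approximates the frame operator. -/
def frameSymbol (Z : FrequencyNet n) : Rn n → ℝ≥0∞ := profileSymbol Z 2 fun _ => (2 ^ n)⁻¹

/-- A bound for the error of this approximation. -/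
def aliasSymbol (Z : FrequencyNet n) (A ε c : ℝ) : Rn n → ℝ≥0∞ :=
  profileSymbol Z 1 fun y => (2 ^ n)⁻¹ * (A * aliasing ε c y.1)

lemma tsum_index (g : Index Z → ℝ≥0∞) :
    ∑' γ, g γ = ∑' (y : Σ k, Z.pts k) (α : Fin n → ℤ), g ⟨y.1, y.2, α⟩ := by
  rw [ENNReal.tsum_sigma', ENNReal.tsum_sigma']
  exact tsum_congr fun k =>
    ENNReal.tsum_prod (f := fun ξ α => g ⟨k, ξ, α⟩)

lemma aliasing_pos (ε c : ℝ) (k : ℕ) : 0 < aliasing ε c k := exp_pos _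

/-- The energy of the frame coefficients. -/
lemma exists_tsum_frameCoeff_le (n : ℕ) : ∃ A : ℝ, 0 < A ∧ ∀ (ε c : ℝ), 0 < ε → 0 < c → c ≤ 1 →
    ∀ (Z : FrequencyNet n) (f : L2 n),
    (∑' γ : Index Z, ‖frameCoeff Z ε c f γ‖ₑ ^ 2 ≤
      (∫⁻ η, frameSymbol Z η * ‖(𝓕 f : L2 n) η‖ₑ ^ 2) +
        ∫⁻ η, aliasSymbol Z A ε c η * ‖(𝓕 f : L2 n) η‖ₑ ^ 2) ∧
    (∫⁻ η, frameSymbol Z η * ‖(𝓕 f : L2 n) η‖ₑ ^ 2) ≤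
      ∑' γ : Index Z, ‖frameCoeff Z ε c f γ‖ₑ ^ 2 +
        ∫⁻ η, aliasSymbol Z A ε c η * ‖(𝓕 f : L2 n) η‖ₑ ^ 2 := by
  obtain ⟨A, hA, h⟩ := exists_tsum_frameCoeff_sq_le n
  refine ⟨A, hA, fun ε c hε hc hc1 Z f => ?_⟩
  rw [frameSymbol, aliasSymbol, lintegral_profileSymbol fun _ => by positivity,
    lintegral_profileSymbol fun y => by have := aliasing_pos ε c y.1; positivity, tsum_index,
    ← ENNReal.tsum_add, ← ENNReal.tsum_add]
  exact ⟨ENNReal.tsum_le_tsum fun y => (h ε c hε hc hc1 Z y.1 y.2 f).1,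
    ENNReal.tsum_le_tsum fun y => (h ε c hε hc hc1 Z y.1 y.2 f).2⟩

lemma exists_frameSymbol_le (n : ℕ) :
    ∃ C : ℝ, 0 < C ∧ ∀ (Z : FrequencyNet n) (η : Rn n), frameSymbol Z η ≤ ofReal C := by
  obtain ⟨C, hC, h⟩ := exists_profileSymbol_le n 0
  refine ⟨(2 ^ n)⁻¹ * C, by positivity, fun Z η => ?_⟩
  simpa [frameSymbol] using h Z 2 (2 ^ n)⁻¹ (fun _ => (2 ^ n)⁻¹) two_ne_zero (by positivity)
    (fun _ => by positivity) (fun _ => by simp) η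

lemma le_frameSymbol (hn : 0 < n) (Z : FrequencyNet n) (η : Rn n) :
    ofReal ((2 ^ n)⁻¹ * exp (-(9 / 4))) ≤ frameSymbol Z η := by
  obtain ⟨y, hy⟩ := exists_le_profile hn Z η
  refine le_trans (ofReal_le_ofReal (mul_le_mul_of_nonneg_left hy (by positivity))) ?_
  exact ENNReal.le_tsum y

lemma exists_aliasSymbol_le_mul_sq (n : ℕ) {A : ℝ} (hA : 0 < A) :
    ∃ C : ℝ, 0 < C ∧ ∀ (Z : FrequencyNet n) (ε c : ℝ), 0 < ε → 0 < c → ∀ η,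
      aliasSymbol Z A ε c η ≤ ofReal (C * c ^ 2) := by
  obtain ⟨C, hC, h⟩ := exists_profileSymbol_le n 0
  refine ⟨(2 ^ n)⁻¹ * A * C, by positivity, fun Z ε c hε hc η => ?_⟩
  refine (h Z 1 ((2 ^ n)⁻¹ * (A * c ^ 2)) _ one_ne_zero (by positivity)
    (fun y => by have := aliasing_pos ε c y.1; positivity) (fun y => ?_) η).trans_eq ?_
  · rw [zero_mul, Real.rpow_zero, mul_one]
    gcongr
    rw [aliasing, Real.exp_neg]
    refine inv_le_of_inv_le₀ (by positivity) ?_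
    have h3 : 1 / c ^ 2 ≤ (2 : ℝ) ^ (2 * ε * y.1) / c ^ 2 :=
      div_le_div_of_nonneg_right (Real.one_le_rpow one_le_two (by positivity)) (by positivity)
    rw [← one_div]
    linarith [Real.add_one_le_exp ((2 : ℝ) ^ (2 * ε * y.1) / c ^ 2)]
  · rw [zero_div, Real.rpow_zero, mul_one]
    ring_nf

/-- The error decreases faster than all powers of the frequency. -/
lemma exists_aliasSymbol_le_rpow (n : ℕ) {A ε c : ℝ} (hA : 0 < A) (hε : 0 < ε) (hc : 0 < c)
    (hc1 : c ≤ 1) {s : ℝ} (hs : 0 ≤ s) : ∃ C : ℝ, 0 < C ∧ ∀ (Z : FrequencyNet n) (η : Rn n),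
      aliasSymbol Z A ε c η ≤ ofReal (C * (1 + ‖η‖ ^ 2) ^ (-s)) := by
  obtain ⟨C, hC, h⟩ := exists_profileSymbol_le n (-(2 * s))
  obtain ⟨C', hC', hexp⟩ := exists_rpow_mul_exp_le (s / ε)
  refine ⟨(2 ^ n)⁻¹ * (A * C') * C, by positivity, fun Z η => ?_⟩
  have e : -(2 * s) / 2 = -s := by ring
  rw [← e]
  refine h Z 1 _ _ one_ne_zero (by positivity)
    (fun y => by have := aliasing_pos ε c y.1; positivity) (fun y => ?_) η
  rw [mul_assoc _ (A * C'), mul_assoc A]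
  gcongr
  set t := (2 : ℝ) ^ (2 * ε * y.1) with ht
  have ht1 : 1 ≤ t := Real.one_le_rpow one_le_two (by positivity)
  have h3 : aliasing ε c y.1 ≤ exp (-(1 / 8 * t)) := by
    rw [aliasing, Real.exp_le_exp, neg_le_neg_iff, ← ht]
    calc 1 / 8 * t ≤ t / 1 := by linarith
      _ ≤ t / c ^ 2 := by gcongr; exact pow_le_one₀ hc.le hc1
  have h4 : (2 : ℝ) ^ (2 * s * y.1) ≤ (1 + t) ^ |s / ε| * (1 + t) := by
    have h5 : (2 : ℝ) ^ (2 * s * y.1) = t ^ (s / ε) := by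
      rw [ht, ← rpow_mul two_pos.le]
      congr 1
      field_simp
    rw [h5, abs_of_nonneg (by positivity)]
    exact (Real.rpow_le_rpow (by positivity) (by linarith) (by positivity)).trans
      (le_mul_of_one_le_right (by positivity) (by linarith))
  rw [neg_mul, Real.rpow_neg two_pos.le, ← div_eq_mul_inv, le_div_iff₀ (by positivity), mul_comm]
  exact (mul_le_mul h4 h3 (exp_pos _).le (by positivity)).trans (hexp t (by positivity))

/-- The frame coefficients map `H^r` to the weighted `ℓ²` space. -/
lemma exists_seqEnergy_frameCoeff_le (n : ℕ) (r : ℝ) : ∃ C : ℝ≥0, ∀ (ε c : ℝ), 0 < ε → 0 < c →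
    c ≤ 1 → ∀ (Z : FrequencyNet n) (f : L2 n),
    seqEnergy r (frameCoeff Z ε c f) ≤ C * sobolevNorm r f ^ 2 := by
  obtain ⟨A, hA, h⟩ := exists_tsum_frameCoeff_sq_le n
  obtain ⟨B, hB, hsum⟩ := exists_profileSymbol_le n (2 * r)
  refine ⟨((2 ^ n)⁻¹ * (1 + A) * B).toNNReal, fun ε c hε hc hc1 Z f => ?_⟩
  have h1 : ∀ y : Σ k, Z.pts k, ∑' α : Fin n → ℤ, ‖frameCoeff Z ε c f ⟨y.1, y.2, α⟩‖ₑ ^ 2 ≤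
      ofReal ((2 ^ n)⁻¹ * (1 + A)) * profileEnergy 1 (y.2 : Rn n) f := by
    intro y
    refine (h ε c hε hc hc1 Z y.1 y.2 f).1.trans ?_
    rw [mul_add, mul_one, ENNReal.ofReal_add (by positivity) (by positivity), add_mul]
    gcongr
    · refine lintegral_mono fun η => ?_
      gcongr ofReal ?_ * _
      exact pow_le_pow_of_le_one (profile_pos _ _).le (profile_le_one _ _) one_le_two
    · refine mul_le_of_le_one_right hA.le ?_
      rw [aliasing, Real.exp_le_one_iff]
      exact neg_nonpos.mpr (by positivity)
  calc seqEnergy r (frameCoeff Z ε c f) ≤ ∑' y : Σ k, Z.pts k,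
        ofReal ((2 : ℝ) ^ (2 * r * y.1) * ((2 ^ n)⁻¹ * (1 + A))) *
          profileEnergy 1 (y.2 : Rn n) f := by
        rw [seqEnergy, tsum_index]
        refine ENNReal.tsum_le_tsum fun y => ?_
        rw [ofReal_mul (by positivity), mul_assoc]
        refine le_trans (le_of_eq ?_) (mul_le_mul_right (h1 y) _)
        rw [← ENNReal.tsum_mul_left]
        refine tsum_congr fun α => ?_
        rw [mul_pow, ofReal_mul (by positivity), enorm_sq_eq_ofReal, ← rpow_natCast,
          ← rpow_mul two_pos.le]
        congr 3
        push_cast; ring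
    _ = ∫⁻ η, profileSymbol Z 1 _ η * ‖(𝓕 f : L2 n) η‖ₑ ^ 2 :=
        (lintegral_profileSymbol (fun _ => by positivity) f).symm
    _ ≤ ∫⁻ η, ofReal ((2 ^ n)⁻¹ * (1 + A) * B) *
          (ofReal ((1 + ‖η‖ ^ 2) ^ r) * ‖(𝓕 f : L2 n) η‖ₑ ^ 2) := by
        refine lintegral_mono fun η => ?_
        rw [← mul_assoc, ← ofReal_mul (by positivity)]
        gcongr
        refine (hsum Z 1 ((2 ^ n)⁻¹ * (1 + A)) _ one_ne_zero (by positivity)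
          (fun _ => by positivity) (fun y => (mul_comm _ _).le) η).trans_eq ?_
        rw [mul_div_cancel_left₀ _ (two_ne_zero (α := ℝ))]
    _ = _ := by
        rw [lintegral_const_mul' _ _ ofReal_ne_top, sobolevNorm_sq]
        rfl

/-- The analysis operator as a bounded operator into `ℓ²`. -/
lemma exists_analysis (Z : FrequencyNet n) {ε c : ℝ} (hε : 0 < ε) (hc : 0 < c) (hc1 : c ≤ 1) :
    ∃ P : L2 n →L[ℂ] lp (fun _ : Index Z => ℂ) 2,
      (∀ f γ, P f γ = frameCoeff Z ε c f γ) ∧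
        ∀ f, ‖P f‖ₑ ^ 2 = ∑' γ : Index Z, ‖frameCoeff Z ε c f γ‖ₑ ^ 2 := by
  obtain ⟨C, hC⟩ := exists_seqEnergy_frameCoeff_le n 0
  have h1 : ∀ f : L2 n, ∑' γ : Index Z, ‖frameCoeff Z ε c f γ‖ₑ ^ 2 ≤ C * ‖f‖ₑ ^ 2 := by
    intro f
    have h := hC ε c hε hc hc1 Z f
    rw [sobolevNorm_zero_eq, seqEnergy] at h
    refine le_trans (le_of_eq (tsum_congr fun γ => ?_)) h
    rw [zero_mul, Real.rpow_zero, one_mul, enorm_sq_eq_ofReal]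
  have hs : ∀ f : L2 n, Summable fun γ : Index Z => ‖frameCoeff Z ε c f γ‖ ^ 2 := by
    intro f
    have := ENNReal.summable_toReal (ne_top_of_le_ne_top (by finiteness) (h1 f))
    exact this.congr fun γ => by rw [ENNReal.toReal_pow, toReal_enorm]
  have hm : ∀ f : L2 n, Memℓp (frameCoeff Z ε c f) 2 := by
    intro f
    rw [memℓp_gen_iff (by norm_num)]
    simpa using hs f
  have hlin : ∀ (a : ℂ) (f g : L2 n) (γ : Index Z), frameCoeff Z ε c (a • f + g) γ =
      a * frameCoeff Z ε c f γ + frameCoeff Z ε c g γ := by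
    intro a f g γ
    simp only [frameCoeff_eq_inner, inner_add_right, inner_smul_right]
  let P0 : L2 n →ₗ[ℂ] lp (fun _ : Index Z => ℂ) 2 :=
    { toFun := fun f => ⟨frameCoeff Z ε c f, hm f⟩
      map_add' := fun f g => by
        ext γ
        have := hlin 1 f g γ
        rw [one_smul, one_mul] at this
        exact this
      map_smul' := fun a f => by
        ext γ
        have := hlin a f 0 γ
        simpa [frameCoeff_eq_inner] using this }
  have h2 : ∀ f, ‖P0 f‖ₑ ^ 2 = ∑' γ : Index Z, ‖frameCoeff Z ε c f γ‖ₑ ^ 2 := fun f => by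
    have := lp.norm_rpow_eq_tsum (p := 2) (by norm_num) (P0 f)
    simp only [ENNReal.toReal_ofNat, Real.rpow_ofNat] at this
    rw [enorm_sq_eq_ofReal, this]
    exact (ENNReal.ofReal_tsum_of_nonneg (fun _ => sq_nonneg _) (hs f)).trans
      (tsum_congr fun γ => (enorm_sq_eq_ofReal _).symm)
  refine ⟨P0.mkContinuous (√C) fun f => ?_, fun f γ => rfl, h2⟩
  refine le_of_sq_le_sq ?_ (by positivity)
  have h3 := (h2 f).le.trans (h1 f)
  rwa [enorm_sq_eq_ofReal, enorm_sq_eq_ofReal, ← ENNReal.ofReal_coe_nnreal,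
    ← ofReal_mul C.coe_nonneg, ENNReal.ofReal_le_ofReal_iff (by positivity),
    ← sq_sqrt C.coe_nonneg, ← mul_pow] at h3

end

section

/-! ### Self-adjoint smoothing operators -/

variable {n : ℕ} {Z : FrequencyNet n}

lemma sobolevNorm_smul (r : ℝ) (a : ℂ) (u : L2 n) :
    sobolevNorm r (a • u) = ‖a‖ₑ * sobolevNorm r u := by
  have h : sobolevNorm r (a • u) ^ 2 = (‖a‖ₑ * sobolevNorm r u) ^ 2 := by
    rw [mul_pow, sobolevNorm_sq, sobolevNorm_sq, ← lintegral_const_mul' _ _ (by finiteness)]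
    refine lintegral_congr_ae ?_
    filter_upwards [coeFn_fourier_smul a u] with η h1
    rw [h1, enorm_mul]
    ring
  exact le_antisymm (le_of_sq_le_sq_ennreal h.le) (le_of_sq_le_sq_ennreal h.ge)

lemma sobolevNorm_neg (r : ℝ) (u : L2 n) : sobolevNorm r (-u) = sobolevNorm r u := by
  rw [← neg_one_smul ℂ u, sobolevNorm_smul]
  simp

lemma sobolevNorm_ne_top {s : ℝ} (hs : s ≤ 0) (u : L2 n) : sobolevNorm s u ≠ ∞ := by
  refine ne_top_of_le_ne_top ?_ (sobolevNorm_mono hs u)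
  rw [sobolevNorm_zero_eq]
  simp

/-- The duality of `H^r` and `H^(-r)`. -/
lemma enorm_inner_le (r : ℝ) (u v : L2 n) :
    ‖(inner ℂ u v : ℂ)‖ₑ ≤ sobolevNorm r u * sobolevNorm (-r) v := by
  rw [← Lp.inner_fourier_eq, L2.inner_def]
  have hw : ∀ r : ℝ, Measurable fun η : Rn n => ofReal ((1 + ‖η‖ ^ 2) ^ (r / 2)) := fun r =>
    measurable_weight _
  have hm : ∀ (r : ℝ) (w : L2 n), AEMeasurable (fun η => ofReal ((1 + ‖η‖ ^ 2) ^ (r / 2)) *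
      ‖(𝓕 w : L2 n) η‖ₑ) volume := fun r w =>
    (hw r).aemeasurable.mul (Lp.aestronglyMeasurable (𝓕 w : L2 n)).enorm
  have hnorm : ∀ (r : ℝ) (w : L2 n), sobolevNorm r w =
      (∫⁻ η, (ofReal ((1 + ‖η‖ ^ 2) ^ (r / 2)) * ‖(𝓕 w : L2 n) η‖ₑ) ^ (2 : ℝ)) ^ (1 / 2 : ℝ) := by
    intro r w
    have h1 : ∫⁻ η, (ofReal ((1 + ‖η‖ ^ 2) ^ (r / 2)) * ‖(𝓕 w : L2 n) η‖ₑ) ^ (2 : ℝ) =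
        sobolevNorm r w ^ 2 := by
      rw [sobolevNorm_sq]
      refine lintegral_congr fun η => ?_
      rw [ENNReal.rpow_ofNat, mul_pow, ← ofReal_pow (by positivity), ← rpow_natCast,
        ← rpow_mul (by positivity)]
      congr 3
      push_cast; ring
    rw [h1, ← ENNReal.rpow_natCast, ← ENNReal.rpow_mul]
    norm_num
  rw [hnorm r u, hnorm (-r) v]
  refine (enorm_integral_le_lintegral_enorm _).trans ?_
  refine le_trans (le_of_eq (lintegral_congr fun η => ?_))
    (ENNReal.lintegral_mul_le_Lp_mul_Lq volume Real.HolderConjugate.two_two (hm r u) (hm (-r) v))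
  rw [RCLike.inner_apply', Pi.mul_apply, enorm_mul, mul_mul_mul_comm,
    ← ofReal_mul (by positivity), ← rpow_add (by positivity)]
  have e : r / 2 + -r / 2 = 0 := by ring
  rw [e, Real.rpow_zero, ENNReal.ofReal_one, one_mul]
  congr 1
  rw [← ofReal_norm, ← ofReal_norm, RCLike.norm_conj]

/-- A symmetric operator whose quadratic form is bounded on `H^(-s)` maps `H^(-s)` to `H^s`. -/
lemma sobolevNorm_le_of_form_le {R : L2 n →L[ℂ] L2 n}
    (hR : ∀ u v, inner ℂ (R u) v = inner ℂ u (R v)) {s : ℝ} (hs : 0 ≤ s) {C : ℝ} (hC : 0 ≤ C)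
    (h : ∀ f, |(inner ℂ f (R f) : ℂ).re| ≤ C * (sobolevNorm (-s) f).toReal ^ 2) (f : L2 n) :
    sobolevNorm s (R f) ≤ ofReal (2 * C) * sobolevNorm (-s) f := by
  set N : L2 n → ℝ := fun f => (sobolevNorm (-s) f).toReal with hN
  have hfin : ∀ f : L2 n, sobolevNorm (-s) f ≠ ∞ := sobolevNorm_ne_top (by linarith)
  have hN0 : ∀ f, 0 ≤ N f := fun f => ENNReal.toReal_nonneg
  have hNadd : ∀ f g, N (f + g) ≤ N f + N g := fun f g => by
    simp only [hN]
    rw [← ENNReal.toReal_add (hfin _) (hfin _)]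
    exact ENNReal.toReal_mono (ENNReal.add_ne_top.mpr ⟨hfin _, hfin _⟩) (sobolevNorm_add_le _ _ _)
  have hNneg : ∀ f, N (-f) = N f := fun f => by simp only [hN]; rw [sobolevNorm_neg]
  -- polarization
  have hpol : ∀ f g, (inner ℂ g (R f) : ℂ).re ≤ C / 2 * (N g + N f) ^ 2 := by
    intro f g
    have e : (inner ℂ (g + f) (R (g + f)) : ℂ).re - (inner ℂ (g + -f) (R (g + -f)) : ℂ).re =
        4 * (inner ℂ g (R f) : ℂ).re := by
      have e2 : (inner ℂ f (R g) : ℂ).re = (inner ℂ g (R f) : ℂ).re := by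
        rw [← hR, ← inner_conj_symm, Complex.conj_re]
      simp only [map_add, map_neg, inner_add_left, inner_add_right, inner_neg_left, inner_neg_right,
        Complex.add_re, Complex.neg_re]
      linarith
    have h1 := (le_abs_self _).trans (h (g + f))
    have h2 := (neg_le_abs _).trans (h (g + -f))
    have h3 : N (g + f) ^ 2 ≤ (N g + N f) ^ 2 := pow_le_pow_left₀ (hN0 _) (hNadd g f) 2
    have h4 : N (g + -f) ^ 2 ≤ (N g + N f) ^ 2 := by
      refine pow_le_pow_left₀ (hN0 _) ((hNadd g (-f)).trans ?_) 2
      rw [hNneg]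
    have h5 := mul_le_mul_of_nonneg_left h3 hC
    have h6 := mul_le_mul_of_nonneg_left h4 hC
    simp only [hN] at h5 h6 h1 h2 ⊢
    linarith
  choose J hJ using exists_isFourierMul_cutoffWeight (n := n) s
  refine sobolevNorm_le_of_cutoff hJ fun k => ?_
  -- test with the function that represents the cut-off norm
  set X := ‖J k (R f)‖ with hX
  set g := J k (J k (R f)) with hg
  have hgX : N g = X := by
    have h1 : sobolevNorm (-s) g ^ 2 = ‖J k (R f)‖ₑ ^ 2 := by
      have hb : IsFourierMul (fun η => cutoffWeight s k η ^ 2) ((J k).comp (J k)) := by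
        intro u
        filter_upwards [hJ k (J k u), hJ k u] with η h1 h2
        rw [ContinuousLinearMap.comp_apply, h1, h2]
        push_cast; ring
      have h2 := hb.sobolevNorm_sq (-s) (R f)
      rw [ContinuousLinearMap.comp_apply] at h2
      rw [hg, h2, (hJ k).enorm_sq]
      refine lintegral_congr fun η => ?_
      congr 2
      rw [cutoffWeight, indicator]
      split_ifs
      · have h0 : (0 : ℝ) < 1 + ‖η‖ ^ 2 := by positivity
        rw [← rpow_natCast ((1 + ‖η‖ ^ 2) ^ (s / 2)), ← rpow_mul h0.le,
          ← rpow_natCast ((1 + ‖η‖ ^ 2) ^ (s / 2 * ((2 : ℕ) : ℝ))), ← rpow_mul h0.le,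
          ← rpow_add h0]
        congr 1
        push_cast; ring
      · simp
    have h2 : sobolevNorm (-s) g = ‖J k (R f)‖ₑ :=
      le_antisymm (le_of_sq_le_sq_ennreal h1.le) (le_of_sq_le_sq_ennreal h1.ge)
    simp only [hN, h2, toReal_enorm, hX]
  have hgi : ∀ t : ℝ, (inner ℂ ((t : ℂ) • g) (R f) : ℂ).re = t * X ^ 2 := by
    intro t
    rw [inner_smul_left, Complex.conj_ofReal, hg, (hJ k).inner_symm, inner_self_eq_norm_sq_to_K,
      hX]
    change ((t : ℂ) * ((‖J k (R f)‖ : ℝ) : ℂ) ^ 2).re = _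
    rw [← Complex.ofReal_pow, ← Complex.ofReal_mul, Complex.ofReal_re]
  have hNt : ∀ t : ℝ, 0 ≤ t → N ((t : ℂ) • g) = t * X := by
    intro t ht
    simp only [hN]
    rw [sobolevNorm_smul, ENNReal.toReal_mul, toReal_enorm, norm_real,
      norm_of_nonneg ht]
    rw [← hgX]
  have hX0 : 0 ≤ X := norm_nonneg _
  have hy0 : 0 ≤ N f := hN0 f
  have key : ∀ t : ℝ, 0 ≤ t → t * X ^ 2 ≤ C / 2 * (t * X + N f) ^ 2 := by
    intro t ht
    have := hpol f ((t : ℂ) • g)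
    rwa [hgi, hNt t ht] at this
  have hfinal : X ≤ 2 * C * N f := by
    rcases hX0.eq_or_lt with h0 | h0
    · rw [← h0]; positivity
    rcases hy0.eq_or_lt with h1 | h1
    · exfalso
      have h2 := key (1 / (C + 1)) (by positivity)
      rw [← h1, add_zero, mul_pow] at h2
      have h3 : 1 / (C + 1) * X ^ 2 ≤ (C / 2 * (1 / (C + 1))) * (1 / (C + 1) * X ^ 2) := by
        refine h2.trans (le_of_eq ?_); ring
      have h4 : C / 2 * (1 / (C + 1)) < 1 := by
        rw [mul_one_div, div_lt_one (by positivity)]; linarith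
      have h5 : 0 < 1 / (C + 1) * X ^ 2 := by positivity
      nlinarith
    · have h2 := key (N f / X) (by positivity)
      rw [div_mul_cancel₀ _ h0.ne'] at h2
      have h3 : N f / X * X ^ 2 = N f * X := by field_simp
      rw [h3] at h2
      have h4 : N f * X ≤ N f * (2 * C * N f) := h2.trans (le_of_eq (by ring))
      exact le_of_mul_le_mul_left h4 h1
  rw [← ofReal_norm, ← ENNReal.ofReal_toReal (hfin f), ← ofReal_mul (by positivity)]
  exact ofReal_le_ofReal hfinal

/-- A bounded operator with a positive lower bound for its symmetric form is invertible. -/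
lemma exists_equiv_of_form_ge {H : Type*} [NormedAddCommGroup H] [InnerProductSpace ℂ H]
    [CompleteSpace H] {S : H →L[ℂ] H} (hS : ∀ u v, inner ℂ (S u) v = inner ℂ u (S v)) {δ : ℝ}
    (hδ : 0 < δ) (h : ∀ f, δ * ‖f‖ ^ 2 ≤ (inner ℂ f (S f) : ℂ).re) :
    ∃ S' : H ≃L[ℂ] H, ∀ f, S' f = S f := by
  have hlow : ∀ f, δ * ‖f‖ ≤ ‖S f‖ := by
    intro f
    rcases (norm_nonneg f).eq_or_lt with h0 | h0
    · rw [← h0, mul_zero]; exact norm_nonneg _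
    · have h1 := (h f).trans ((Complex.re_le_norm _).trans (norm_inner_le_norm f (S f)))
      refine le_of_mul_le_mul_left ?_ h0
      calc ‖f‖ * (δ * ‖f‖) = δ * ‖f‖ ^ 2 := by ring
        _ ≤ _ := h1
  have hker : ∀ f, S f = 0 → f = 0 := by
    intro f hf
    have h1 := hlow f
    rw [hf, norm_zero] at h1
    exact norm_eq_zero.mp (le_antisymm (by nlinarith [norm_nonneg f]) (norm_nonneg f))
  have hinj : LinearMap.ker (S : H →ₗ[ℂ] H) = ⊥ := by
    rw [LinearMap.ker_eq_bot']
    exact hker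
  have hanti : AntilipschitzWith (Real.toNNReal δ⁻¹) S := by
    refine ContinuousLinearMap.antilipschitz_of_bound S fun f => ?_
    rw [Real.coe_toNNReal _ (inv_pos.mpr hδ).le, inv_mul_eq_div, le_div_iff₀ hδ, mul_comm]
    exact hlow f
  have hclosed : IsClosed (LinearMap.range (S : H →ₗ[ℂ] H) : Set H) := by
    rw [LinearMap.coe_range]
    exact hanti.isClosed_range S.uniformContinuous
  have hrange : LinearMap.range (S : H →ₗ[ℂ] H) = ⊤ := by
    have : Submodule.HasOrthogonalProjection (LinearMap.range (S : H →ₗ[ℂ] H)) := by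
      have : CompleteSpace (LinearMap.range (S : H →ₗ[ℂ] H)) := hclosed.completeSpace_coe
      infer_instance
    rw [← Submodule.orthogonal_eq_bot_iff, Submodule.eq_bot_iff]
    intro v hv
    refine hker v ?_
    rw [Submodule.mem_orthogonal] at hv
    have h1 := hv (S (S v)) ⟨S v, rfl⟩
    rw [hS] at h1
    exact inner_self_eq_zero.mp h1
  exact ⟨ContinuousLinearEquiv.ofBijective S hinj hrange, fun f => rfl⟩

end

section

/-! ### Inversion of the frame operator -/

variable {n : ℕ} {Z : FrequencyNet n}

/-- The frame operator as `P₁* P₁`. -/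
lemma exists_isFrameOperator (Z : FrequencyNet n) {ε c : ℝ} (hε : 0 < ε) (hc : 0 < c)
    (hc1 : c ≤ 1) : ∃ S : L2 n →L[ℂ] L2 n, IsFrameOperator Z ε c S ∧
      (∀ u v, inner ℂ (S u) v = inner ℂ u (S v)) ∧
      ∀ f, ofReal (inner ℂ f (S f) : ℂ).re = ∑' γ : Index Z, ‖frameCoeff Z ε c f γ‖ₑ ^ 2 ∧
        0 ≤ (inner ℂ f (S f) : ℂ).re := by
  obtain ⟨P, hP, hnorm⟩ := exists_analysis Z hε hc hc1
  set Q := ContinuousLinearMap.adjoint P with hQ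
  have hsingle : ∀ (γ : Index Z) (a : ℂ), Q (lp.single 2 γ a) = a • frameVec ε c γ := by
    intro γ a
    refine ext_inner_left ℂ fun v => ?_
    rw [hQ, ContinuousLinearMap.adjoint_inner_right, lp.inner_single_right, hP,
      frameCoeff_eq_inner, inner_smul_right, RCLike.inner_apply, inner_conj_symm]
  have hform : ∀ f, (inner ℂ f (Q (P f)) : ℂ).re = ‖P f‖ ^ 2 := fun f => by
    rw [hQ, ContinuousLinearMap.adjoint_inner_right, inner_self_eq_norm_sq_to_K]
    change ((‖P f‖ : ℝ) ^ 2 : ℂ).re = _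
    rw [← Complex.ofReal_pow, Complex.ofReal_re]
  refine ⟨Q.comp P, fun f => ?_, fun u v => ?_, fun f => ⟨?_, ?_⟩⟩
  · have h1 := (lp.hasSum_single (p := 2) (by norm_num) (P f)).mapL Q
    simp only [hsingle, hP] at h1
    exact h1
  · rw [ContinuousLinearMap.comp_apply, ContinuousLinearMap.comp_apply, hQ,
      ContinuousLinearMap.adjoint_inner_left, ContinuousLinearMap.adjoint_inner_right]
  · rw [ContinuousLinearMap.comp_apply, hform, ofReal_pow (norm_nonneg _), ofReal_norm,
      hnorm]
  · rw [ContinuousLinearMap.comp_apply, hform]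
    positivity

lemma IsFourierMul.re_inner {b : Rn n → ℝ} {A : L2 n →L[ℂ] L2 n} (h : IsFourierMul b A)
    (hb : Measurable b) (hb0 : ∀ η, 0 ≤ b η) (u : L2 n) : (inner ℂ u (A u) : ℂ).re =
      (∫⁻ η, ofReal (b η) * ‖(𝓕 u : L2 n) η‖ₑ ^ 2).toReal := by
  rw [← h.inner_symm, h.inner_eq]
  have e : ∀ η, (b η : ℂ) * (conj ((𝓕 u : L2 n) η) * (𝓕 u : L2 n) η) =
      ((b η * ‖(𝓕 u : L2 n) η‖ ^ 2 : ℝ) : ℂ) := fun η => by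
    rw [Complex.conj_mul']
    push_cast
    rfl
  rw [integral_congr_ae (.of_forall e), integral_complex_ofReal]
  rw [Complex.ofReal_re, integral_eq_lintegral_of_nonneg_ae
    (.of_forall fun η => mul_nonneg (hb0 η) (sq_nonneg _))
    (hb.aestronglyMeasurable.mul ((Lp.aestronglyMeasurable (𝓕 u : L2 n)).norm.pow 2))]
  congr 1
  refine lintegral_congr fun η => ?_
  rw [ofReal_mul (hb0 η), ofReal_pow (norm_nonneg _), ofReal_norm]

lemma abs_toReal_sub_le {x y z : ℝ≥0∞} (hx : x ≠ ∞) (hy : y ≠ ∞) (hz : z ≠ ∞) (h1 : x ≤ y + z)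
    (h2 : y ≤ x + z) : |x.toReal - y.toReal| ≤ z.toReal := by
  have h3 := ENNReal.toReal_mono (by finiteness) h1
  have h4 := ENNReal.toReal_mono (by finiteness) h2
  rw [ENNReal.toReal_add hy hz] at h3
  rw [ENNReal.toReal_add hx hz] at h4
  rw [abs_le]
  constructor <;> linarith

lemma IsFourierMul.sobolevNorm_le {b : Rn n → ℝ} {A : L2 n →L[ℂ] L2 n} (h : IsFourierMul b A)
    {m : ℝ} (hm : 0 < m) (hb : ∀ η, m ≤ b η) (r : ℝ) (u : L2 n) :
    sobolevNorm r u ≤ ofReal m⁻¹ * sobolevNorm r (A u) := by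
  refine le_of_sq_le_sq_ennreal ?_
  rw [mul_pow, h.sobolevNorm_sq, GaussianFrame.sobolevNorm_sq,
    ← lintegral_const_mul' _ _ (by finiteness)]
  refine lintegral_mono fun η => ?_
  rw [← mul_assoc, ← ofReal_pow (by positivity), ← ofReal_mul (by positivity)]
  refine mul_le_mul_left (ofReal_le_ofReal ?_) _
  have h1 : 1 ≤ m⁻¹ * b η := by
    rw [inv_mul_eq_div, one_le_div hm]; exact hb η
  have h2 : (1 + ‖η‖ ^ 2) ^ r * 1 ≤ (1 + ‖η‖ ^ 2) ^ r * (m⁻¹ * b η) ^ 2 :=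
    by gcongr; exact one_le_pow₀ h1
  calc (1 + ‖η‖ ^ 2) ^ r = (1 + ‖η‖ ^ 2) ^ r * 1 := (mul_one _).symm
    _ ≤ _ := h2
    _ = _ := by ring

/-- The inverse of an invertible symmetric operator is bounded on every `H^r` when the operator is
an elliptic Fourier multiplier of order `0` plus a smoothing operator. For `r ≥ 0` the equation is
solved for the multiplier part; for `r < 0` the smoothing part is estimated by duality. -/
lemma exists_sobolevNorm_symm_le {S : L2 n ≃L[ℂ] L2 n}
    (hS : ∀ u v, inner ℂ (S u) v = inner ℂ u (S v)) {b : Rn n → ℝ} {M R : L2 n →L[ℂ] L2 n}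
    (hM : IsFourierMul b M) {m : ℝ} (hm : 0 < m) (hb : ∀ η, m ≤ b η)
    (hR : ∀ u v, inner ℂ (R u) v = inner ℂ u (R v)) (hSR : ∀ u, S u = M u + R u)
    (h : ∀ s : ℝ, 0 ≤ s → ∃ C : ℝ≥0, ∀ f, sobolevNorm s (R f) ≤ C * sobolevNorm (-s) f) (r : ℝ) :
    ∃ C : ℝ≥0, ∀ f, sobolevNorm r (S.symm f) ≤ C * sobolevNorm r f := by
  have hMu : ∀ f, M (S.symm f) = f + -R (S.symm f) := fun f => by
    have := hSR (S.symm f)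
    rw [S.apply_symm_apply] at this
    exact eq_add_neg_of_add_eq this.symm
  have hmain : ∀ r f, sobolevNorm r (S.symm f) ≤
      ofReal m⁻¹ * (sobolevNorm r f + sobolevNorm r (R (S.symm f))) := fun r f => by
    refine (hM.sobolevNorm_le hm hb r _).trans (mul_le_mul_right ?_ _)
    rw [hMu]
    refine (sobolevNorm_add_le r _ _).trans ?_
    rw [sobolevNorm_neg]
  have hpos : ∀ r : ℝ, 0 ≤ r → ∃ C : ℝ≥0, ∀ f, sobolevNorm r (S.symm f) ≤ C * sobolevNorm r f := by
    intro r hr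
    obtain ⟨C, hC⟩ := h r hr
    refine ⟨Real.toNNReal m⁻¹ * (1 + C * ‖(S.symm : L2 n →L[ℂ] L2 n)‖₊), fun f => ?_⟩
    refine (hmain r f).trans ?_
    rw [ENNReal.coe_mul, mul_assoc, ENNReal.coe_add, add_mul, ENNReal.coe_one, one_mul]
    refine mul_le_mul_right (add_le_add le_rfl ?_) _
    refine (hC _).trans ?_
    rw [ENNReal.coe_mul, mul_assoc]
    refine mul_le_mul_right ?_ _
    refine (sobolevNorm_mono (by linarith : -r ≤ 0) _).trans ?_
    rw [sobolevNorm_zero_eq]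
    refine ((S.symm : L2 n →L[ℂ] L2 n).le_opENorm f).trans (mul_le_mul_right ?_ _)
    rw [← sobolevNorm_zero_eq]
    exact sobolevNorm_mono hr f
  rcases le_total 0 r with hr | hr
  · exact hpos r hr
  obtain ⟨C, hC⟩ := h (-r) (by linarith)
  obtain ⟨C', hC'⟩ := hpos (-r) (by linarith)
  refine ⟨Real.toNNReal m⁻¹ * (1 + C' * C), fun f => ?_⟩
  refine (hmain r f).trans ?_
  rw [ENNReal.coe_mul, mul_assoc, ENNReal.coe_add, add_mul, ENNReal.coe_one, one_mul]
  refine mul_le_mul_right (add_le_add le_rfl ?_) _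
  set v := R (S.symm f) with hv
  refine (sobolevNorm_mono hr v).trans ?_
  rw [sobolevNorm_zero_eq]
  rcases eq_or_ne v 0 with h0 | h0
  · rw [h0]; simp
  have h1 : ‖v‖ₑ * ‖v‖ₑ ≤ C' * C * sobolevNorm r f * ‖v‖ₑ := by
    have e1 : ‖v‖ₑ * ‖v‖ₑ = ‖(inner ℂ v v : ℂ)‖ₑ := by
      rw [← ofReal_norm, ← ofReal_norm, inner_self_eq_norm_sq_to_K, norm_pow, RCLike.norm_ofReal,
        abs_of_nonneg (norm_nonneg _), ofReal_pow (norm_nonneg _), sq]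
    have e2 : (inner ℂ v v : ℂ) = inner ℂ f (S.symm (R v)) := by
      have := hS (S.symm f) (S.symm (R v))
      rw [S.apply_symm_apply, S.apply_symm_apply] at this
      rw [this, ← hR (S.symm f) v]
    rw [e1, e2]
    refine (enorm_inner_le r _ _).trans ?_
    have h2 : sobolevNorm (-r) (S.symm (R v)) ≤ C' * (C * ‖v‖ₑ) := by
      refine (hC' _).trans (mul_le_mul_right ((hC v).trans (mul_le_mul_right ?_ _)) _)
      rw [neg_neg, ← sobolevNorm_zero_eq]
      exact sobolevNorm_mono hr v
    refine (mul_le_mul_right h2 _).trans (le_of_eq (by ring))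
  rw [ENNReal.coe_mul]
  exact (ENNReal.mul_le_mul_iff_left (by simpa using h0) (by simp)).mp h1

/-- For a small lattice constant the frame operator is invertible, and its inverse is bounded on
every Sobolev space. -/
theorem exists_frameOperator_equiv (hn : 0 < n) {ε : ℝ} (hε : 0 < ε) :
    ∃ c₀ : ℝ, 0 < c₀ ∧ c₀ ≤ 1 ∧ ∀ c ∈ Ioc (0 : ℝ) c₀, ∀ Z : FrequencyNet n,
      ∃ S : L2 n ≃L[ℂ] L2 n, IsFrameOperator Z ε c S ∧
        ∀ r : ℝ, ∃ C : ℝ≥0, ∀ f, sobolevNorm r (S.symm f) ≤ C * sobolevNorm r f := by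
  obtain ⟨A, hA, hframe⟩ := exists_tsum_frameCoeff_le n
  obtain ⟨C₁, hC₁, halias⟩ := exists_aliasSymbol_le_mul_sq n hA
  obtain ⟨C₂, hC₂, hupper⟩ := exists_frameSymbol_le n
  set m : ℝ := (2 ^ n)⁻¹ * exp (-(9 / 4)) with hm
  have hm0 : 0 < m := by positivity
  -- the aliasing error `C₁ c²` is to be at most half of the lower bound `m` of the symbol
  refine ⟨min 1 √(m / (2 * C₁)), lt_min one_pos (by positivity), min_le_left _ _, ?_⟩
  intro c hc Z
  have hc0 : 0 < c := hc.1
  have hc1 : c ≤ 1 := hc.2.trans (min_le_left _ _)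
  have hcm : C₁ * c ^ 2 ≤ m / 2 := by
    have h1 : c ^ 2 ≤ m / (2 * C₁) := by
      rw [← Real.le_sqrt' hc0]
      exact hc.2.trans (min_le_right _ _)
    calc C₁ * c ^ 2 ≤ C₁ * (m / (2 * C₁)) := by gcongr
      _ = m / 2 := by field_simp
  obtain ⟨S, hSf, hSs, hSe⟩ := exists_isFrameOperator Z hε hc0 hc1
  set b : Rn n → ℝ := fun η => (frameSymbol Z η).toReal with hb
  have hfin : ∀ η, frameSymbol Z η ≠ ∞ := fun η => ne_top_of_le_ne_top (by finiteness) (hupper Z η)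
  have hbm : Measurable b := (measurable_profileSymbol Z _ _).ennreal_toReal
  have hbup : ∀ η, b η ≤ C₂ := fun η => ENNReal.toReal_le_of_le_ofReal hC₂.le (hupper Z η)
  have hblow : ∀ η, m ≤ b η := fun η =>
    (ENNReal.ofReal_le_iff_le_toReal (hfin η)).mp (le_frameSymbol hn Z η)
  obtain ⟨M, hM⟩ := exists_isFourierMul hbm (M := C₂) fun η => by
    rw [abs_of_nonneg ENNReal.toReal_nonneg]; exact hbup η
  have hMs := hM.inner_symm
  set R := S - M with hRdef
  have hR : ∀ u v, inner ℂ (R u) v = inner ℂ u (R v) := fun u v => by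
    rw [hRdef, sub_apply, sub_apply, inner_sub_left, inner_sub_right, hSs, hMs]
  have hMre : ∀ f, (inner ℂ f (M f) : ℂ).re =
      (∫⁻ η, frameSymbol Z η * ‖(𝓕 f : L2 n) η‖ₑ ^ 2).toReal := fun f => by
    rw [hM.re_inner hbm (fun _ => ENNReal.toReal_nonneg)]
    congr 1
    exact lintegral_congr fun η => by rw [hb, ENNReal.ofReal_toReal (hfin η)]
  have hbound : ∀ (s C : ℝ), 0 ≤ s → 0 ≤ C →
      (∀ η, aliasSymbol Z A ε c η ≤ ofReal (C * (1 + ‖η‖ ^ 2) ^ (-s))) →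
      ∀ f, |(inner ℂ f (R f) : ℂ).re| ≤ C * (sobolevNorm (-s) f).toReal ^ 2 := by
    intro s C hs hC hal f
    have h1 : (∫⁻ η, aliasSymbol Z A ε c η * ‖(𝓕 f : L2 n) η‖ₑ ^ 2) ≤
        ofReal C * sobolevNorm (-s) f ^ 2 := by
      rw [sobolevNorm_sq, ← lintegral_const_mul' _ _ (by finiteness)]
      refine lintegral_mono fun η => ?_
      rw [← mul_assoc, ← ofReal_mul hC]
      exact mul_le_mul_left (hal η) _
    have hN : sobolevNorm (-s) f ≠ ∞ := sobolevNorm_ne_top (by linarith) f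
    have hz := ne_top_of_le_ne_top (by finiteness) h1
    have hx : ∑' γ : Index Z, ‖frameCoeff Z ε c f γ‖ₑ ^ 2 ≠ ∞ := by
      rw [← (hSe f).1]; exact ofReal_ne_top
    obtain ⟨h2, h3⟩ := hframe ε c hε hc0 hc1 Z f
    have hy : (∫⁻ η, frameSymbol Z η * ‖(𝓕 f : L2 n) η‖ₑ ^ 2) ≠ ∞ :=
      ne_top_of_le_ne_top (ENNReal.add_ne_top.mpr ⟨hx, hz⟩) h3
    have h4 := abs_toReal_sub_le hx hy hz h2 h3
    rw [← (hSe f).1, ENNReal.toReal_ofReal (hSe f).2, ← hMre, ← Complex.sub_re, ← inner_sub_right]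
      at h4
    refine h4.trans ((ENNReal.toReal_mono (by finiteness) h1).trans (le_of_eq ?_))
    rw [ENNReal.toReal_mul, ENNReal.toReal_ofReal hC, ENNReal.toReal_pow]
  have hlow : ∀ f, m / 2 * ‖f‖ ^ 2 ≤ (inner ℂ f (S f) : ℂ).re := by
    intro f
    have h1 := hbound 0 (C₁ * c ^ 2) le_rfl (by positivity) (fun η => by
      rw [neg_zero, Real.rpow_zero, mul_one]
      exact halias Z ε c hε hc0 η) f
    rw [neg_zero, sobolevNorm_zero_eq, toReal_enorm] at h1
    have h2 : m * ‖f‖ ^ 2 ≤ (inner ℂ f (M f) : ℂ).re := by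
      have h3 : ofReal (m * ‖f‖ ^ 2) ≤
          ∫⁻ η, ofReal (b η) * ‖(𝓕 f : L2 n) η‖ₑ ^ 2 := by
        rw [ofReal_mul hm0.le, ofReal_pow (norm_nonneg _), ofReal_norm,
          ← enorm_fourier, enorm_sq_eq_lintegral, ← lintegral_const_mul' _ _ (by finiteness)]
        exact lintegral_mono fun η => mul_le_mul_left (ofReal_le_ofReal (hblow η)) _
      have h4 : (∫⁻ η, ofReal (b η) * ‖(𝓕 f : L2 n) η‖ₑ ^ 2) ≤
          ofReal C₂ * ‖f‖ₑ ^ 2 := by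
        rw [← enorm_fourier, enorm_sq_eq_lintegral, ← lintegral_const_mul' _ _ (by finiteness)]
        exact lintegral_mono fun η => mul_le_mul_left (ofReal_le_ofReal (hbup η)) _
      rw [hM.re_inner hbm (fun _ => ENNReal.toReal_nonneg)]
      exact (ENNReal.ofReal_le_iff_le_toReal (ne_top_of_le_ne_top (by finiteness) h4)).mp h3
    have h3 : (inner ℂ f (R f) : ℂ).re = (inner ℂ f (S f) : ℂ).re - (inner ℂ f (M f) : ℂ).re := by
      rw [hRdef, sub_apply, inner_sub_right, Complex.sub_re]
    have h4 := (abs_le.mp h1).1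
    have h5 : C₁ * c ^ 2 * ‖f‖ ^ 2 ≤ m / 2 * ‖f‖ ^ 2 := by gcongr
    rw [h3] at h4
    linarith
  obtain ⟨S', hS'⟩ := exists_equiv_of_form_ge hSs (half_pos hm0) hlow
  refine ⟨S', fun f => by rw [hS']; exact hSf f, fun r => ?_⟩
  refine exists_sobolevNorm_symm_le (fun u v => by rw [hS', hS', hSs]) hM hm0 hblow hR
    (fun u => by rw [hS', hRdef, sub_apply]; abel) (fun s hs => ?_) r
  obtain ⟨C, hC, hal⟩ := exists_aliasSymbol_le_rpow n hA hε hc0 hc1 hs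
  exact ⟨Real.toNNReal (2 * C), sobolevNorm_le_of_form_le hR hs hC.le (hbound s C hs hC.le (hal Z))⟩

end

section

/-! ### Operators given by matrices with respect to the frame -/

variable {n : ℕ} {Z : FrequencyNet n} {Θ : Type*} {ε c : ℝ} {X Ξ : Θ → Index Z → Rn n}
  {m : ℤ} {f : Amplitude Z Θ}

/-- The coefficients of the matrix image are the frame coefficients of `∑ c(γ') P_γ'`. -/
lemma IsFrameOperator.hasMatrixImage {S : L2 n → L2 n} (hS : IsFrameOperator Z ε c S)
    {P : Index Z → L2 n} {B : Index Z → Index Z → ℂ}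
    (hB : ∀ γ γ', B γ γ' = inner ℂ (frameVec ε c γ) (P γ')) {f u : L2 n}
    (hu : HasSum (fun γ => frameCoeff Z ε c f γ • P γ) u) : HasMatrixImage Z ε c B f (S u) := by
  have h : ∀ γ, HasSum (fun γ' => B γ γ' * frameCoeff Z ε c f γ') (frameCoeff Z ε c u γ) := by
    intro γ
    have h1 := hu.mapL (innerSL ℂ (frameVec ε c γ))
    simp only [innerSL_apply_apply, inner_smul_right] at h1
    rw [frameCoeff_eq_inner]
    refine h1.congr_fun fun γ' => ?_
    rw [hB, mul_comm]
  refine ⟨fun γ => (h γ).summable, ?_⟩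
  have e : (fun γ => ∑' γ', B γ γ' * frameCoeff Z ε c f γ') = frameCoeff Z ε c u :=
    funext fun γ => (h γ).tsum_eq
  rw [e]
  exact hS u

lemma SobolevBound.exists_operator {P : Θ → Index Z → L2 n} {w : ℝ} (h : SobolevBound P 0 w)
    (hε : 0 < ε) (hc : 0 < c) (hc1 : c ≤ 1) {S : L2 n ≃L[ℂ] L2 n}
    (hS : ∀ r : ℝ, ∃ C : ℝ≥0, ∀ f, sobolevNorm r (S.symm f) ≤ C * sobolevNorm r f) :
    ∃ A : Θ → (sobolevSpace n w →ₗ[ℂ] L2 n), ∀ θ (u : sobolevSpace n w),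
      HasSum (fun γ => frameCoeff Z ε c (S.symm (u : L2 n)) γ • P θ γ) (A θ u) := by
  obtain ⟨C, hC⟩ := hS w
  obtain ⟨C', hC'⟩ := exists_seqEnergy_frameCoeff_le n w
  have hsum : ∀ (u : sobolevSpace n w) (θ : Θ),
      Summable fun γ => frameCoeff Z ε c (S.symm (u : L2 n)) γ • P θ γ := by
    intro u θ
    refine h.summable θ (ne_top_of_le_ne_top ?_ (hC' ε c hε hc hc1 Z _))
    have h1 : sobolevNorm w (u : L2 n) ≠ ∞ := u.2.ne
    have h2 := ne_top_of_le_ne_top (by finiteness) (hC (u : L2 n))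
    finiteness
  refine ⟨fun θ =>
    { toFun := fun u => ∑' γ, frameCoeff Z ε c (S.symm (u : L2 n)) γ • P θ γ
      map_add' := fun u v => ?_
      map_smul' := fun a u => ?_ }, fun θ u => (hsum u θ).hasSum⟩
  · rw [← (hsum u θ).tsum_add (hsum v θ)]
    refine tsum_congr fun γ => ?_
    rw [← add_smul, Submodule.coe_add, map_add]
    simp only [frameCoeff_eq_inner, inner_add_right]
  · rw [RingHom.id_apply, ← (hsum u θ).tsum_const_smul a]
    refine tsum_congr fun γ => ?_
    rw [smul_smul, Submodule.coe_smul, map_smul]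
    simp only [frameCoeff_eq_inner, inner_smul_right]

lemma SobolevBound.exists_operator_bound {P : Θ → Index Z → L2 n} {s r : ℝ}
    (h : SobolevBound P s r) (hε : 0 < ε) (hc : 0 < c) (hc1 : c ≤ 1) {S : L2 n ≃L[ℂ] L2 n}
    (hS : ∀ r : ℝ, ∃ C : ℝ≥0, ∀ f, sobolevNorm r (S.symm f) ≤ C * sobolevNorm r f) :
    ∃ C : ℝ≥0, ∀ θ (f u : L2 n), HasSum (fun γ => frameCoeff Z ε c (S.symm f) γ • P θ γ) u →
      sobolevNorm s u ≤ C * sobolevNorm r f := by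
  obtain ⟨C₁, h₁⟩ := hS r
  obtain ⟨C₂, h₂⟩ := exists_seqEnergy_frameCoeff_le n r
  obtain ⟨C₃, h₃⟩ := h.exists_sobolevNorm_le
  refine ⟨NNReal.sqrt (C₃ * C₂) * C₁, fun θ f u hu => ?_⟩
  refine le_of_sq_le_sq_ennreal ?_
  calc sobolevNorm s u ^ 2 ≤ C₃ * (C₂ * sobolevNorm r (S.symm f) ^ 2) :=
        (h₃ θ _ u hu).trans (mul_le_mul_right (h₂ ε c hε hc hc1 Z _) _)
    _ ≤ C₃ * (C₂ * (C₁ * sobolevNorm r f) ^ 2) :=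
        mul_le_mul_right (mul_le_mul_right (ENNReal.pow_le_pow_left (h₁ f)) _) _
    _ = (C₃ * C₂ : ℝ≥0) * (C₁ * sobolevNorm r f) ^ 2 := by rw [ENNReal.coe_mul, mul_assoc]
    _ = ((NNReal.sqrt (C₃ * C₂) * C₁ : ℝ≥0) * sobolevNorm r f) ^ 2 := by
        conv_lhs => rw [← NNReal.sq_sqrt (C₃ * C₂)]
        push_cast
        ring

/-! ### The operator `E(t)` -/

variable {T K : ℝ} {a : ℝ → Rn n → Matrix (Fin n) (Fin n) ℝ}

/-- The moved frame functions at a set of times form a packet system. -/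
lemma WaveBound.isPacketSystem (ha : WaveBound T a K) (hT : 0 < T) (hε : 0 < ε) (hc : 0 < c)
    {J : Set ℝ} (hJ : J ⊆ Icc (-T) T) : IsPacketSystem Z ε c
      (fun (t : J) γ => (framePath ε c T a γ t).1)
      (fun (t : J) γ => (framePath ε c T a γ t).2) := by
  obtain ⟨M, L, hM, hL, h⟩ := ha.exists_phaseFamily hT Z ε c
  exact ⟨hε, hc, M, L, hM, by linarith, fun t => h t (hJ t.2)⟩

/-- A packet paired with a frame function. -/
lemma IsMultiplier.inner_packet (hP : IsPacketSystem Z ε c X Ξ) (hf : IsMultiplier X m f) (θ : Θ)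
    (γ γ' : Index Z) :
    inner ℂ (frameVec ε c γ) (packet ε c X Ξ f θ γ') = ∫ x, conj (frameFun ε c γ x) *
      (f θ γ' x * gaussian (spacing ε c γ'.1) (X θ γ') (Ξ θ γ') x) := by
  rw [← frameCoeff_eq_inner, frameCoeff]
  refine integral_congr_ae ?_
  filter_upwards [hf.coeFn_packet hP θ γ'] with x hx
  rw [hx]

/-- `E(t) h` is the sum of the moved frame functions with the frame coefficients of `(Π⁰)⁻¹ h`. -/
lemma WaveBound.exists_E (ha : WaveBound T a K) (hT : 0 < T) (hε : 0 < ε) (hc : 0 < c)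
    (hc1 : c ≤ 1) {S : L2 n ≃L[ℂ] L2 n} (hSf : IsFrameOperator Z ε c S)
    (hS : ∀ r : ℝ, ∃ C : ℝ≥0, ∀ f, sobolevNorm r (S.symm f) ≤ C * sobolevNorm r f) :
    ∃ E : ℝ → (L2 n →L[ℂ] L2 n),
      (∀ t ∈ Icc (-T) T, ∀ f : L2 n, HasMatrixImage Z ε c (bE ε c T a t) f (S (E t (S f)))) ∧
      ∀ r : ℝ, ∃ C : ℝ≥0, ∀ t ∈ Icc (-T) T, ∀ h : L2 n,
        sobolevNorm r (E t h) ≤ C * sobolevNorm r h := by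
  have hP := ha.isPacketSystem (Z := Z) hT hε hc (J := Icc (-T) T) subset_rfl
  set X := fun (t : Icc (-T) T) (γ : Index Z) => (framePath ε c T a γ t).1 with hX
  set Ξ := fun (t : Icc (-T) T) (γ : Index Z) => (framePath ε c T a γ t).2 with hΞ
  set P := packet ε c X Ξ fun _ _ _ => 1 with hPdef
  have hb : ∀ r : ℝ, SobolevBound P r r := by
    intro r
    have h1 := ((hP.isSymbol_complex ⌈|r|⌉₊ 1).isSobolevBounded_pos hP).sobolevBound
    have h2 := ((hP.isSymbol_complex (2 * ⌈|r|⌉₊) 1).isSobolevBounded_neg hP).sobolevBound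
    have hr := abs_le.mp (Nat.le_ceil |r|)
    have h3 := h2.interpolate (s := r) h1 (by push_cast; ring) hr.1 hr.2
    convert h3 using 1
    push_cast
    ring
  obtain ⟨A, hA⟩ := (hb 0).exists_operator hε hc hc1 hS
  have hmem : ∀ u : L2 n, u ∈ sobolevSpace n 0 := fun u => by
    change sobolevNorm 0 u < ∞
    rw [sobolevNorm_zero_eq]
    exact enorm_lt_top
  obtain ⟨C₀, hC₀⟩ := (hb 0).exists_operator_bound hε hc hc1 hS
  let E0 : Icc (-T) T → L2 n →L[ℂ] L2 n := fun t =>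
    LinearMap.mkContinuous
      { toFun := fun u => A t ⟨u, hmem u⟩
        map_add' := fun u v => (A t).map_add (⟨u, hmem u⟩ : sobolevSpace n 0) ⟨v, hmem v⟩
        map_smul' := fun b u => (A t).map_smul b (⟨u, hmem u⟩ : sobolevSpace n 0) } C₀ fun u => by
      have := hC₀ t u _ (hA t (⟨u, hmem u⟩ : sobolevSpace n 0))
      rw [sobolevNorm_zero_eq, sobolevNorm_zero_eq] at this
      simpa [enorm, ← ENNReal.coe_mul, ← NNReal.coe_le_coe] using this
  have hE0 : ∀ t u, HasSum (fun γ => frameCoeff Z ε c (S.symm u) γ • P t γ) (E0 t u) :=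
    fun t u => hA t (⟨u, hmem u⟩ : sobolevSpace n 0)
  classical
  refine ⟨fun t => if h : t ∈ Icc (-T) T then E0 ⟨t, h⟩ else 0, fun t ht f => ?_, fun r => ?_⟩
  · simp only [dif_pos ht]
    have h1 := hE0 ⟨t, ht⟩ (S f)
    rw [S.symm_apply_apply] at h1
    refine hSf.hasMatrixImage (fun γ γ' => ?_) h1
    rw [(isMultiplier_complex 1).inner_packet hP]
    simp only [one_mul]
    rfl
  · obtain ⟨C, hC⟩ := (hb r).exists_operator_bound hε hc hc1 hS
    refine ⟨C, fun t ht u => ?_⟩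
    simp only [dif_pos ht]
    exact hC ⟨t, ht⟩ u _ (hE0 ⟨t, ht⟩ u)

end

section

/-! ### Symbols from functions with Lipschitz derivatives -/

variable {n : ℕ} {Z : FrequencyNet n} {Θ : Type*} {ε c : ℝ} {X Ξ : Θ → Index Z → Rn n}
  {m m' : ℤ} {r : ℕ} {f g : Amplitude Z Θ} {f' g' : Fin n → Amplitude Z Θ}

lemma IsSymbol.of_eq (hf : IsSymbol ε c X Ξ r m f) (h : ∀ θ γ x, g θ γ x = f θ γ x) :
    IsSymbol ε c X Ξ r m g := by
  have : g = f := funext fun θ => funext fun γ => funext (h θ γ)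
  rwa [this]

lemma IsPacketSystem.isSymbol_add (hS : IsPacketSystem Z ε c X Ξ) (hf : IsSymbol ε c X Ξ r m f)
    (hg : IsSymbol ε c X Ξ r m' g) (h : m' ≤ m := by norm_num) :
    IsSymbol ε c X Ξ r m fun θ γ x => f θ γ x + g θ γ x :=
  hf.add hS (hg.mono h)

/-- A bounded function that does not depend on the index acts on sums of packets by
multiplication. -/
lemma IsPacketSystem.isSymbol_of_bounded (hS : IsPacketSystem Z ε c X Ξ) {u : Θ → Rn n → ℂ} {A : ℝ}
    (hu : ∀ θ, Measurable (u θ)) (h : ∀ θ x, ‖u θ x‖ ≤ A) :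
    IsSymbol ε c X Ξ 0 0 fun θ _ x => u θ x := by
  have hm : IsMultiplier X 0 fun θ (_ : Index Z) x => u θ x := isMultiplier_of_bounded hu h
  refine ⟨hm, fun m g hg => ?_⟩
  obtain ⟨C, hC, hb⟩ := hS.isBoundedFamily_of_lip hg
  refine ⟨(|A| + 1) ^ 2 * C, by positivity, fun θ F d => ?_⟩
  have h1 : ‖∑ γ ∈ F, d γ • packet ε c X Ξ (fun θ γ x => u θ x * g θ γ x) θ γ‖ ≤
      (|A| + 1) * ‖∑ γ ∈ F, d γ • packet ε c X Ξ g θ γ‖ := by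
    refine Lp.norm_le_mul_norm_of_ae_le_mul ?_
    have h2 : ∀ᵐ x, ∀ γ ∈ F, packet ε c X Ξ (fun θ γ x => u θ x * g θ γ x) θ γ x =
        u θ x * packet ε c X Ξ g θ γ x := by
      rw [Filter.eventually_all_finset]
      intro γ _
      filter_upwards [(hm.mul hg.1).coeFn_packet hS θ γ, hg.1.coeFn_packet hS θ γ] with x e1 e2
      rw [e1, e2, mul_assoc]
    filter_upwards [coeFn_sum_smul F d _, coeFn_sum_smul F d (packet ε c X Ξ g θ), h2] with x e1 e2 e3
    rw [e1, e2, sum_congr rfl fun γ hγ => by rw [e3 γ hγ, mul_left_comm], ← mul_sum,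
      norm_mul]
    gcongr
    exact by linarith [h θ x, le_abs_self A]
  rw [zero_add, mul_assoc]
  calc _ ≤ ((|A| + 1) * ‖∑ γ ∈ F, d γ • packet ε c X Ξ g θ γ‖) ^ 2 :=
        pow_le_pow_left₀ (norm_nonneg _) h1 2
    _ ≤ _ := by
        rw [mul_pow]
        gcongr
        exact hb θ F d

/-- The increments of a Lipschitz function, from the positions on; its derivatives exist almost
everywhere by Rademacher's theorem. -/
lemma IsPacketSystem.isSymbol_sub_of_lipschitz (hS : IsPacketSystem Z ε c X Ξ)
    {h : Θ → Rn n → ℝ} {K : ℝ} (hK : 0 ≤ K) (hh : ∀ θ x y, |h θ x - h θ y| ≤ K * ‖x - y‖) :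
    IsSymbol ε c X Ξ 1 (-1) fun θ γ x => ((h θ x - h θ (X θ γ) : ℝ) : ℂ) := by
  have hL : ∀ θ, LipschitzWith K.toNNReal (h θ) := fun θ => LipschitzWith.of_dist_le_mul fun x y => by
    simpa [dist_eq_norm, hK] using hh θ x y
  refine ⟨isMultiplier_sub_of_lipschitz hK hh,
    fun j θ _ x => ((lineDeriv ℝ (h θ) x (single j 1) : ℝ) : ℂ),
    ⟨fun θ γ => polyLip_of_lipschitz (A := K) fun x y => ?_, fun j θ γ => ?_⟩, fun j => ?_⟩
  · rw [← Complex.ofReal_sub, norm_real, sub_sub_sub_cancel_right]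
    exact hh θ x y
  · filter_upwards [(hL θ).ae_lineDifferentiableAt (μ := volume) (single j 1)] with x hx
    exact (HasDerivAt.sub_const _ hx.hasLineDerivAt).ofReal_comp
  · refine (hS.isSymbol_of_bounded (A := K) (fun θ => Complex.measurable_ofReal.comp
      (measurable_lineDeriv (hL θ).continuous)) fun θ x => ?_).congr_order (by norm_num)
    simpa [hK] using norm_lineDeriv_le_of_lipschitz ℝ (x₀ := x) (v := single j 1) (hL θ)

/-- The remainder in Taylor's formula of first order at the positions. -/
lemma IsPacketSystem.isSymbol_taylor (hS : IsPacketSystem Z ε c X Ξ) {g : Θ → Rn n → ℝ} {K : ℝ}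
    (hK : 0 ≤ K) (hd : ∀ θ, Differentiable ℝ (g θ))
    (hg : ∀ θ x y, ‖gradient (g θ) x - gradient (g θ) y‖ ≤ K * ‖x - y‖) :
    IsSymbol ε c X Ξ 2 (-2) fun θ γ x =>
      ((g θ x - g θ (X θ γ) - inner ℝ (gradient (g θ) (X θ γ)) (x - X θ γ) : ℝ) : ℂ) := by
  have ht : ∀ θ x y, |g θ y - g θ x - inner ℝ (gradient (g θ) x) (y - x)| ≤ K * ‖y - x‖ ^ 2 :=
    fun θ => abs_sub_taylor_le (hd θ) (hg θ) hK
  have hs : ∀ θ (y x v : Rn n), g θ (x + v) - g θ y - inner ℝ (gradient (g θ) y) (x + v - y) =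
      g θ x - g θ y - inner ℝ (gradient (g θ) y) (x - y) + (g θ (x + v) - g θ x -
        inner ℝ (gradient (g θ) x) v + inner ℝ (gradient (g θ) x - gradient (g θ) y) v) :=
    fun θ y x v => by
      rw [add_sub_right_comm x v, inner_add_right, inner_sub_left]
      ring
  refine ⟨?_, fun j θ γ x => ((gradient (g θ) x j - gradient (g θ) (X θ γ) j : ℝ) : ℂ),
    ⟨fun θ γ => ⟨1, (K + 1) * (1 + ‖X θ γ‖), by positivity, fun x v hv => ?_⟩, fun j θ γ => ?_⟩,
    fun j => ?_⟩
  · refine isMultiplier_of_homogeneous (ι := Unit ⊕ Unit ⊕ Fin n) (N := 2) (K := K + 1)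
      (φ := fun θ y x => g θ x - g θ y - inner ℝ (gradient (g θ) y) (x - y)) (by positivity)
      (Sum.elim (fun _ => 2) (Sum.elim (fun _ => 0) fun _ => 1)) (by rintro (_ | _ | j) <;> simp)
      (fun θ z => Sum.elim (fun _ x => g θ x - g θ z - inner ℝ (gradient (g θ) z) (x - z))
        (Sum.elim (fun _ _ => 1) fun j x => (x - z) j))
      (fun θ z => Sum.elim (fun _ _ => 1) (Sum.elim
        (fun _ y => g θ z - g θ y - inner ℝ (gradient (g θ) y) (z - y))
        fun j y => (gradient (g θ) z - gradient (g θ) y) j)) ?_ ?_ ?_ ?_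
    · have := fun θ => (hd θ).continuous
      rintro θ z (_ | _ | j) <;> refine Continuous.measurable ?_ <;> dsimp <;> fun_prop
    · intro θ z y x
      have := hs θ y z (x - z)
      rw [add_sub_cancel] at this
      simp only [Fintype.sum_sum_type, Sum.elim_inl, Sum.elim_inr, Finset.univ_unique,
        Finset.sum_singleton, mul_one, one_mul]
      rw [← inner_eq_sum, this]
      ring
    · rintro θ z (_ | _ | j) x
      · exact (ht θ z x).trans (mul_le_mul_of_nonneg_right (by linarith) (sq_nonneg _))
      · simp [hK]
      · refine (abs_coord_le _ _).trans ?_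
        rw [Sum.elim_inr, Sum.elim_inr, pow_one]
        exact le_mul_of_one_le_left (norm_nonneg _) (by linarith)
    · rintro θ z (_ | _ | j) y
      · simp [hK]
      · exact (ht θ y z).trans (mul_le_mul_of_nonneg_right (by linarith) (sq_nonneg _))
      · exact (abs_coord_le _ _).trans ((hg θ _ _).trans (by simp; gcongr; linarith))
  · have h1 := ht θ x (x + v)
    have h2 : |inner ℝ (gradient (g θ) x - gradient (g θ) (X θ γ)) v| ≤ K * ‖x - X θ γ‖ * ‖v‖ :=
      (abs_real_inner_le_norm _ _).trans (by gcongr; exact hg θ _ _)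
    rw [add_sub_cancel_left] at h1
    rw [← Complex.ofReal_sub, norm_real, norm_eq_abs, pow_one, hs, add_sub_cancel_left]
    refine (abs_add_le _ _).trans ((add_le_add h1 h2).trans ?_)
    calc _ = K * (‖v‖ + ‖x - X θ γ‖) * ‖v‖ := by ring
      _ ≤ (K + 1) * ((1 + ‖X θ γ‖) * (1 + ‖x‖)) * ‖v‖ := by
        gcongr
        · linarith
        · nlinarith [norm_sub_le x (X θ γ), mul_nonneg (norm_nonneg x) (norm_nonneg (X θ γ))]
      _ = _ := by ring
  · refine .of_forall fun x => HasDerivAt.ofReal_comp ?_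
    have h1 := ((hd θ x).hasFDerivAt.hasLineDerivAt (single j 1))
    have h2 : HasDerivAt (fun t : ℝ => inner ℝ (gradient (g θ) (X θ γ))
        (x + t • single j 1 - X θ γ)) (gradient (g θ) (X θ γ) j) 0 := by
      simp only [add_sub_right_comm x, inner_add_right, real_inner_smul_right]
      rw [← inner_single_one, real_inner_comm]
      simpa using ((hasDerivAt_id (0 : ℝ)).mul_const _).const_add
        (inner ℝ (gradient (g θ) (X θ γ)) (x - X θ γ))
    have h3 : fderiv ℝ (g θ) x (single j 1) = gradient (g θ) x j := by
      rw [← inner_gradient, real_inner_comm, inner_single_one]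
    rw [h3] at h1
    exact (HasDerivAt.sub_const _ h1).sub h2
  · exact (hS.isSymbol_sub_of_lipschitz (h := fun θ x => gradient (g θ) x j) hK fun θ x y =>
      (abs_coord_le _ j).trans (hg θ x y)).congr_order (by norm_num)

lemma IsPacketSystem.isSymbol_ofReal (hS : IsPacketSystem Z ε c X Ξ) (r : ℕ)
    {u : Θ → Index Z → ℝ} {A : ℝ} (h : ∀ θ γ, |u θ γ| ≤ A * scale γ.1 ^ m) :
    IsSymbol ε c X Ξ r m fun θ γ _ => (u θ γ : ℂ) :=
  hS.isSymbol_const r (isMultiplier_const (A := A) fun θ γ => by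
    rw [norm_real]; exact h θ γ)

/-- The component of `x - X_γ` along a vector of order `m / 2`. -/
lemma IsPacketSystem.isSymbol_inner (hS : IsPacketSystem Z ε c X Ξ) (r : ℕ)
    {v : Θ → Index Z → Rn n} {A : ℝ} (h : ∀ θ γ, ‖v θ γ‖ ≤ A * scale γ.1 ^ m) :
    IsSymbol ε c X Ξ r (m - 1) fun θ γ x => ((inner ℝ (v θ γ) (x - X θ γ) : ℝ) : ℂ) :=
  (IsSymbol.finsetSum hS Finset.univ fun j _ => IsSymbol.const_mul hS (u := fun θ γ => (v θ γ j : ℂ))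
    (isMultiplier_const (A := A) fun θ γ => by
      rw [norm_real]; exact (abs_coord_le _ j).trans (h θ γ)) (hS.isSymbol_coord r j)).of_eq
    fun θ γ x => by rw [inner_eq_sum]; push_cast; rfl

lemma IsPacketSystem.isSymbol_norm_sq (hS : IsPacketSystem Z ε c X Ξ) (r : ℕ) :
    IsSymbol ε c X Ξ r (-2) fun θ γ x => ((‖x - X θ γ‖ ^ 2 : ℝ) : ℂ) :=
  (IsSymbol.finsetSum hS Finset.univ fun j _ => (IsSymbol.mul_succ hS (hS.isSymbol_coord r j)
    (hS.isSymbol_coord _ j)).congr_order (by norm_num)).of_eq fun θ γ x => by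
      rw [norm_sq_eq_sum]; push_cast; simp only [sq]

end

section

/-! ### The wave operator on moving Gaussians -/

variable {n : ℕ}

/-- The real part of the logarithmic time derivative of a Gaussian whose centre `(X, Ξ)` has the
velocity `(V, W)`. -/
def rateRe (X Ξ V W x : Rn n) : ℝ :=
  n / 2 * (inner ℝ Ξ W / ‖Ξ‖ ^ 2) - inner ℝ Ξ W / ‖Ξ‖ * ‖x - X‖ ^ 2 + 2 * ‖Ξ‖ * inner ℝ V (x - X)

/-- The imaginary part of the logarithmic time derivative of a Gaussian whose centre `(X, Ξ)` has
the velocity `(V, W)`. -/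
def rateIm (X Ξ V W x : Rn n) : ℝ := inner ℝ W (x - X) - inner ℝ Ξ V

/-- The logarithmic time derivative of a Gaussian whose centre `(X, Ξ)` has the velocity
`(V, W)`. -/
def rate (X Ξ V W x : Rn n) : ℂ := rateRe X Ξ V W x + I * rateIm X Ξ V W x

lemma hasDerivWithinAt_norm {ξ : ℝ → Rn n} {w : Rn n} {J : Set ℝ} {s : ℝ}
    (h : HasDerivWithinAt ξ w J s) (h0 : ξ s ≠ 0) :
    HasDerivWithinAt (fun τ => ‖ξ τ‖) (inner ℝ (ξ s) w / ‖ξ s‖) J s := by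
  have h1 := h.norm_sq.sqrt (pow_ne_zero 2 (norm_ne_zero_iff.mpr h0))
  simp only [Real.sqrt_sq (norm_nonneg _)] at h1
  refine h1.congr_deriv ?_
  have := norm_ne_zero_iff.mpr h0
  field_simp

lemma gaussian_eq_exp {δ : ℝ} (hδ : 0 < δ) (y : Rn n) {η : Rn n} (hη : η ≠ 0) (x : Rn n) :
    gaussian δ y η x = Complex.exp (((Real.log (‖η‖ * δ / (2 * π)) * (n / 2) -
      ‖η‖ * ‖x - y‖ ^ 2 : ℝ) : ℂ) + I * ((inner ℝ η (x - y) : ℝ) : ℂ)) := by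
  have h : 0 < ‖η‖ := norm_pos_iff.mpr hη
  rw [gaussian, Real.rpow_def_of_pos (by positivity), Complex.ofReal_exp, ← Complex.exp_add]
  congr 1
  push_cast
  ring

section Time

variable {ξ χ : ℝ → Rn n} {V W : ℝ → Rn n} {J : Set ℝ} {s : ℝ} {v w : Rn n}

lemma hasDerivWithinAt_gaussian {δ : ℝ} (hδ : 0 < δ) (hX : HasDerivWithinAt χ (V s) J s)
    (hΞ : HasDerivWithinAt ξ (W s) J s) (h0 : ∀ τ ∈ J, ξ τ ≠ 0) (hs : s ∈ J) (x : Rn n) :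
    HasDerivWithinAt (fun τ => gaussian δ (χ τ) (ξ τ) x)
      (rate (χ s) (ξ s) (V s) (W s) x * gaussian δ (χ s) (ξ s) x) J s := by
  have hn : 0 < ‖ξ s‖ := norm_pos_iff.mpr (h0 s hs)
  have hy : HasDerivWithinAt (fun τ => x - χ τ) (-V s) J s := hX.const_sub x
  have h1 := hasDerivWithinAt_norm hΞ (h0 s hs)
  have h2 : HasDerivWithinAt (fun τ => Real.log (‖ξ τ‖ * δ / (2 * π)) * (n / 2) -
      ‖ξ τ‖ * ‖x - χ τ‖ ^ 2) (rateRe (χ s) (ξ s) (V s) (W s) x) J s := by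
    refine ((((h1.mul_const δ).div_const (2 * π)).log (by positivity)).mul_const
      ((n : ℝ) / 2)).sub (h1.mul hy.norm_sq) |>.congr_deriv ?_
    rw [rateRe, inner_neg_right, real_inner_comm (x - χ s)]
    field_simp
    ring
  have h3 : HasDerivWithinAt (fun τ => inner ℝ (ξ τ) (x - χ τ))
      (rateIm (χ s) (ξ s) (V s) (W s) x) J s := by
    refine (hΞ.inner ℝ hy).congr_deriv ?_
    rw [rateIm, inner_neg_right]
    ring
  have h4 := (h2.ofReal_comp.add (h3.ofReal_comp.const_mul I)).cexp
  rw [mul_comm]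
  refine HasDerivWithinAt.congr_deriv (HasDerivWithinAt.congr h4 (fun τ hτ => ?_) ?_) ?_
  · exact gaussian_eq_exp hδ _ (h0 τ hτ) x
  · exact gaussian_eq_exp hδ _ (h0 s hs) x
  · rw [gaussian_eq_exp hδ _ (h0 s hs), rate]
    rfl

/-- The time derivative of the real part of the rate, where `(v, w)` is the acceleration of the
centre. -/
def rateReDeriv (X Ξ V W v w x : Rn n) : ℝ :=
  n / 2 * ((‖W‖ ^ 2 + inner ℝ Ξ w) / ‖Ξ‖ ^ 2 - 2 * inner ℝ Ξ W ^ 2 / ‖Ξ‖ ^ 4) -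
    ((‖W‖ ^ 2 + inner ℝ Ξ w) / ‖Ξ‖ - inner ℝ Ξ W ^ 2 / ‖Ξ‖ ^ 3) * ‖x - X‖ ^ 2 +
    4 * (inner ℝ Ξ W / ‖Ξ‖) * inner ℝ V (x - X) + 2 * ‖Ξ‖ * inner ℝ v (x - X) - 2 * ‖Ξ‖ * ‖V‖ ^ 2

/-- The time derivative of the imaginary part of the rate. -/
def rateImDeriv (X Ξ V W v w x : Rn n) : ℝ :=
  inner ℝ w (x - X) - 2 * inner ℝ W V - inner ℝ Ξ v

lemma hasDerivWithinAt_rateRe (hX : HasDerivWithinAt χ (V s) J s)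
    (hΞ : HasDerivWithinAt ξ (W s) J s) (hV : HasDerivWithinAt V v J s)
    (hW : HasDerivWithinAt W w J s) (h0 : ξ s ≠ 0) (x : Rn n) :
    HasDerivWithinAt (fun τ => rateRe (χ τ) (ξ τ) (V τ) (W τ) x)
      (rateReDeriv (χ s) (ξ s) (V s) (W s) v w x) J s := by
  have hn : 0 < ‖ξ s‖ := norm_pos_iff.mpr h0
  have hy : HasDerivWithinAt (fun τ => x - χ τ) (-V s) J s := hX.const_sub x
  have h1 := hasDerivWithinAt_norm hΞ h0
  have h2 := hΞ.inner ℝ hW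
  refine ((((h2.div hΞ.norm_sq (by positivity)).const_mul ((n : ℝ) / 2)).sub
    ((h2.div h1 hn.ne').mul hy.norm_sq)).add ((h1.const_mul 2).mul (hV.inner ℝ hy))).congr_deriv ?_
  rw [rateReDeriv, inner_neg_right, inner_neg_right, real_inner_comm (x - χ s) (V s),
    real_inner_self_eq_norm_sq, real_inner_self_eq_norm_sq, Pi.div_apply]
  field_simp
  ring

lemma hasDerivWithinAt_rateIm (hX : HasDerivWithinAt χ (V s) J s)
    (hΞ : HasDerivWithinAt ξ (W s) J s) (hV : HasDerivWithinAt V v J s)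
    (hW : HasDerivWithinAt W w J s) (x : Rn n) :
    HasDerivWithinAt (fun τ => rateIm (χ τ) (ξ τ) (V τ) (W τ) x)
      (rateImDeriv (χ s) (ξ s) (V s) (W s) v w x) J s := by
  have hy : HasDerivWithinAt (fun τ => x - χ τ) (-V s) J s := hX.const_sub x
  refine ((hW.inner ℝ hy).sub (hΞ.inner ℝ hV)).congr_deriv ?_
  rw [rateImDeriv, inner_neg_right]
  ring

end Time

/-- Second space derivatives of a Gaussian. -/
lemma lineDeriv_lineDeriv_gaussian (δ : ℝ) (y η x : Rn n) (i j : Fin n) :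
    lineDeriv ℝ (fun z => lineDeriv ℝ (gaussian δ y η) z (single j 1)) x
      (single i 1) = ((I * η i - 2 * ‖η‖ * ((x - y) i : ℝ)) *
        (I * η j - 2 * ‖η‖ * ((x - y) j : ℝ)) - 2 * ‖η‖ * (if i = j then 1 else 0)) *
          gaussian δ y η x := by
  have h : ∀ j z, HasLineDerivAt ℝ (gaussian δ y η)
      ((I * η j - 2 * ‖η‖ * ((z - y) j : ℝ)) * gaussian δ y η z) z
        (single j 1) := fun j z => by
    have := hasLineDerivAt_gaussian δ y η z (single j 1)
    rw [real_inner_comm, inner_single_one, real_inner_comm, inner_single_one] at this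
    convert this using 1
    push_cast
    ring
  have e : (fun z => lineDeriv ℝ (gaussian δ y η) z (single j 1)) =
      fun z => (I * η j - 2 * ‖η‖ * ((z - y) j : ℝ)) * gaussian δ y η z :=
    funext fun z => (h j z).lineDeriv
  have h2 : HasLineDerivAt ℝ (fun z : Rn n => I * (η j : ℂ) - 2 * ‖η‖ * ((z - y) j : ℝ))
      (-(2 * ‖η‖ * (if i = j then 1 else 0))) x (single i 1) := by
    have h3 : HasDerivAt (fun t : ℝ => I * (η j : ℂ) -
        2 * ‖η‖ * (((x - y) j + t * (if i = j then 1 else 0) : ℝ) : ℂ))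
        (-(2 * ‖η‖ * (((1 * (if i = j then 1 else 0) : ℝ)) : ℂ))) 0 :=
      (((((hasDerivAt_id (0 : ℝ)).mul_const (if i = j then (1 : ℝ) else 0)).const_add
        ((x - y) j)).ofReal_comp).const_mul _).const_sub _
    refine HasDerivAt.congr_deriv (HasDerivAt.congr_of_eventuallyEq h3
      (.of_forall fun t => ?_)) (by split_ifs <;> simp)
    simp only [PiLp.sub_apply, PiLp.add_apply, PiLp.smul_apply, smul_eq_mul, PiLp.single_apply,
      eq_comm (a := j)]
    congr 3
    ring
  rw [e, (h2.mul_apply (h i x)).lineDeriv]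
  ring

variable {T : ℝ} {a : ℝ → Rn n → Matrix (Fin n) (Fin n) ℝ}

/-- The wave operator multiplies a moving Gaussian by a function. -/
lemma waveOp_gaussian {δ : ℝ} (hδ : 0 < δ) (hT : 0 < T) {χ ξ V W : ℝ → Rn n} {v w : Rn n}
    (hX : ∀ s ∈ Icc (-T) T, HasDerivWithinAt χ (V s) (Icc (-T) T) s)
    (hΞ : ∀ s ∈ Icc (-T) T, HasDerivWithinAt ξ (W s) (Icc (-T) T) s)
    (h0 : ∀ s ∈ Icc (-T) T, ξ s ≠ 0) {t : ℝ} (ht : t ∈ Icc (-T) T)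
    (hV : HasDerivWithinAt V v (Icc (-T) T) t) (hW : HasDerivWithinAt W w (Icc (-T) T) t)
    (x : Rn n) :
    waveOp a T (fun s => gaussian δ (χ s) (ξ s)) t x =
      (rateReDeriv (χ t) (ξ t) (V t) (W t) v w x + I *
        rateImDeriv (χ t) (ξ t) (V t) (W t) v w x + rate (χ t) (ξ t) (V t) (W t) x ^ 2 -
        ∑ i, ∑ j, (a t x i j : ℂ) *
          ((I * ξ t i - 2 * ‖ξ t‖ * ((x - χ t) i : ℝ)) *
            (I * ξ t j - 2 * ‖ξ t‖ * ((x - χ t) j : ℝ)) -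
              2 * ‖ξ t‖ * (if i = j then 1 else 0))) * gaussian δ (χ t) (ξ t) x := by
  have hu := uniqueDiffOn_window hT
  have h1 : ∀ s ∈ Icc (-T) T, HasDerivWithinAt (fun τ => gaussian δ (χ τ) (ξ τ) x)
      (rate (χ s) (ξ s) (V s) (W s) x * gaussian δ (χ s) (ξ s) x) (Icc (-T) T) s :=
    fun s hs => hasDerivWithinAt_gaussian hδ (hX s hs) (hΞ s hs) h0 hs x
  have h2 : HasDerivWithinAt (fun s => rate (χ s) (ξ s) (V s) (W s) x)
      (rateReDeriv (χ t) (ξ t) (V t) (W t) v w x + I *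
        rateImDeriv (χ t) (ξ t) (V t) (W t) v w x) (Icc (-T) T) t :=
    (hasDerivWithinAt_rateRe (hX t ht) (hΞ t ht) hV hW (h0 t ht) x).ofReal_comp.add
      ((hasDerivWithinAt_rateIm (hX t ht) (hΞ t ht) hV hW x).ofReal_comp.const_mul _)
  have h3 : HasDerivWithinAt (fun s => rate (χ s) (ξ s) (V s) (W s) x * gaussian δ (χ s) (ξ s) x)
      _ (Icc (-T) T) t := h2.mul (h1 t ht)
  rw [waveOp, derivWithin_congr (fun s hs => (h1 s hs).derivWithin (hu s hs))
    ((h1 t ht).derivWithin (hu t ht)), h3.derivWithin (hu t ht), sub_mul,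
    sum_mul]
  congr 1
  · ring
  · refine sum_congr rfl fun i _ => ?_
    rw [sum_mul]
    refine sum_congr rfl fun j _ => ?_
    rw [lineDeriv_lineDeriv_gaussian]
    ring

end

section

/-! ### The symbol of the wave operator -/

variable {n : ℕ} {Z : FrequencyNet n} {Θ : Type*} {ε c : ℝ} {X Ξ : Θ → Index Z → Rn n}
  {m m' : ℤ} {r : ℕ} {f g : Amplitude Z Θ} {f' g' : Fin n → Amplitude Z Θ}

/-- The cancellation of the terms of order `2` and `3 / 2` in the wave operator. The hypotheses are
the eikonal equation and the Hamiltonian system for the centre: `a` is the coefficient matrix at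
the point considered, `a₀` at the centre, and `b` is the linear part of `a - a₀`. -/
lemma waveSymbol_eq {a a₀ b : Fin n → Fin n → ℂ} {ξ y : Fin n → ℂ} {l q P Q R R' I' : ℂ}
    (h1 : ∑ i, ∑ j, a₀ i j * ξ i * ξ j = q ^ 2) (h2 : ∑ i, ∑ j, b i j * ξ i * ξ j = 2 * q * Q)
    (h3 : ∑ i, ∑ j, a₀ i j * ξ i * y j = -q * P) (h4 : ∑ i, ∑ j, a₀ i j * ξ j * y i = -q * P) :
    R' + I * I' + (R + I * (Q + q)) ^ 2 - ∑ i, ∑ j, a i j *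
      ((I * ξ i - 2 * l * y i) * (I * ξ j - 2 * l * y j) -
        2 * l * (if i = j then 1 else 0)) =
    R' + I * I' + R * R + 2 * I * (R * Q) +
      2 * I * (q * (R + -2 * (l * P))) + -1 * (Q * Q) +
      ∑ i, ∑ j, ((a i j - a₀ i j - b i j) * (ξ i * ξ j) +
        2 * I * (l * ((a i j - a₀ i j) * (ξ i * y j + ξ j * y i))) +
        -4 * (l * l * (a i j * (y i * y j))) + 2 * (l * (a i j * (if i = j then 1 else 0)))) := by
  have hI := Complex.I_sq
  have e : ∀ i j, a i j * ((I * ξ i - 2 * l * y i) * (I * ξ j - 2 * l * y j) -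
      2 * l * (if i = j then 1 else 0)) =
      -((a i j - a₀ i j - b i j) * (ξ i * ξ j) +
        2 * I * (l * ((a i j - a₀ i j) * (ξ i * y j + ξ j * y i))) +
        -4 * (l * l * (a i j * (y i * y j))) + 2 * (l * (a i j * (if i = j then 1 else 0)))) -
        a₀ i j * ξ i * ξ j - b i j * ξ i * ξ j - 2 * I * l * (a₀ i j * ξ i * y j) -
          2 * I * l * (a₀ i j * ξ j * y i) := fun i j => by
    linear_combination a i j * ξ i * ξ j * hI
  simp only [e, Finset.sum_sub_distrib, Finset.sum_neg_distrib, ← mul_sum, h1, h2, h3, h4]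
  linear_combination (Q + q) ^ 2 * hI

/-- Sizes of the coefficients in the rates and their derivatives: `p` and `r` stand for the inner
products of the frequency with its first and second derivatives, `u` for the norm of the former. -/
lemma abs_rate_coeff_le {l B p u r : ℝ} (hl : 0 < l) (hp : |p| ≤ l * (B * l))
    (hu : |u| ≤ B * l) (hr : |r| ≤ l * (B * l)) :
    |p / l| ≤ B * l ∧ |p / l ^ 2| ≤ B ∧ |(u ^ 2 + r) / l - p ^ 2 / l ^ 3| ≤ (2 * B ^ 2 + B) * l ∧
      |(u ^ 2 + r) / l ^ 2 - 2 * p ^ 2 / l ^ 4| ≤ 3 * B ^ 2 + B := by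
  obtain ⟨a, rfl⟩ : ∃ a, p = a * l ^ 2 := ⟨p / l ^ 2, by field_simp⟩
  obtain ⟨b, rfl⟩ : ∃ b, u = b * l := ⟨u / l, by field_simp⟩
  obtain ⟨d, rfl⟩ : ∃ d, r = d * l ^ 2 := ⟨r / l ^ 2, by field_simp⟩
  have hl2 := pow_pos hl 2
  rw [abs_mul, abs_of_pos hl2] at hp hr
  rw [abs_mul, abs_of_pos hl] at hu
  have ha : |a| ≤ B := le_of_mul_le_mul_right (hp.trans_eq (by ring)) hl2
  have hd := abs_le.mp (le_of_mul_le_mul_right (hr.trans_eq (by ring)) hl2 : |d| ≤ B)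
  have ha2 := sq_le_sq' (abs_le.mp ha).1 (abs_le.mp ha).2
  have hb := abs_le.mp (le_of_mul_le_mul_right hu hl)
  have hb2 := sq_le_sq' hb.1 hb.2
  refine ⟨?_, by rwa [mul_div_cancel_right₀ _ hl2.ne'], ?_, ?_⟩
  · rw [show a * l ^ 2 / l = a * l by field_simp, abs_mul, abs_of_pos hl]
    gcongr
  · rw [show ((b * l) ^ 2 + d * l ^ 2) / l - (a * l ^ 2) ^ 2 / l ^ 3 = (b ^ 2 + d - a ^ 2) * l by
      field_simp, abs_mul, abs_of_pos hl]
    refine mul_le_mul_of_nonneg_right (abs_le.mpr ⟨?_, ?_⟩) hl.le <;>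
      linarith [sq_nonneg a, sq_nonneg b]
  · rw [show ((b * l) ^ 2 + d * l ^ 2) / l ^ 2 - 2 * (a * l ^ 2) ^ 2 / l ^ 4 =
      b ^ 2 + d - 2 * a ^ 2 by field_simp]
    exact abs_le.mpr ⟨by linarith [sq_nonneg a, sq_nonneg b],
      by linarith [sq_nonneg a, sq_nonneg b]⟩

/-- Under the Hamiltonian system, the factor by which the wave operator multiplies the moving
Gaussians is of order `1`. -/
lemma IsPacketSystem.isSymbol_wave (hS : IsPacketSystem Z ε c X Ξ)
    {V W v w : Θ → Index Z → Rn n} {q : Θ → Index Z → ℝ}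
    {m : Θ → Rn n → Matrix (Fin n) (Fin n) ℝ} {B K : ℝ} (hB : 0 ≤ B) (hK : 0 ≤ K)
    (hV : ∀ θ γ, ‖V θ γ‖ ≤ B) (hv : ∀ θ γ, ‖v θ γ‖ ≤ B) (hW : ∀ θ γ, ‖W θ γ‖ ≤ B * ‖Ξ θ γ‖)
    (hw : ∀ θ γ, ‖w θ γ‖ ≤ B * ‖Ξ θ γ‖) (hm : ∀ θ x i j, |m θ x i j| ≤ K)
    (hd : ∀ θ i j, Differentiable ℝ fun x => m θ x i j)
    (hG : ∀ θ x i j, ‖gradient (fun x => m θ x i j) x‖ ≤ K)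
    (hGL : ∀ θ x y i j, ‖gradient (fun x => m θ x i j) x - gradient (fun x => m θ x i j) y‖ ≤
      K * ‖x - y‖)
    (hq : ∀ θ γ, quadForm (m θ (X θ γ)) (Ξ θ γ) = q θ γ ^ 2)
    (hqV : ∀ θ γ, inner ℝ (Ξ θ γ) (V θ γ) = -q θ γ)
    (hV' : ∀ θ γ y, inner ℝ (matVec (m θ (X θ γ)) (Ξ θ γ)) y = -q θ γ * inner ℝ (V θ γ) y)
    (hsymm : ∀ θ x i j, m θ x i j = m θ x j i)
    (hW' : ∀ θ γ y, inner ℝ (gradForm (fun i j => gradient (fun x => m θ x i j) (X θ γ)) (Ξ θ γ)) y =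
      2 * q θ γ * inner ℝ (W θ γ) y) :
    IsSymbol ε c X Ξ 2 2 fun θ γ x =>
      rateReDeriv (X θ γ) (Ξ θ γ) (V θ γ) (W θ γ) (v θ γ) (w θ γ) x + I *
        rateImDeriv (X θ γ) (Ξ θ γ) (V θ γ) (W θ γ) (v θ γ) (w θ γ) x +
        rate (X θ γ) (Ξ θ γ) (V θ γ) (W θ γ) x ^ 2 -
        ∑ i, ∑ j, (m θ x i j : ℂ) *
          ((I * Ξ θ γ i - 2 * ‖Ξ θ γ‖ * ((x - X θ γ) i : ℝ)) *
            (I * Ξ θ γ j - 2 * ‖Ξ θ γ‖ * ((x - X θ γ) j : ℝ)) -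
              2 * ‖Ξ θ γ‖ * (if i = j then 1 else 0)) := by
  obtain ⟨M, hM, hfreq⟩ := hS.exists_freq_bound
  have hl : ∀ θ γ, 0 < ‖Ξ θ γ‖ := fun θ γ => norm_pos_iff.mpr (hS.freq_ne_zero θ γ)
  have up : ∀ {x D : ℝ} {θ γ}, 0 ≤ D → x ≤ D * ‖Ξ θ γ‖ → x ≤ D * M * scale γ.1 ^ (2 : ℤ) :=
    fun hD h => h.trans ((mul_le_mul_of_nonneg_left (hfreq _ _).2 hD).trans
      (le_of_eq (by rw [zpow_ofNat]; ring)))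
  have k2 : ∀ {u : Θ → Index Z → ℝ} {D : ℝ}, 0 ≤ D → (∀ θ γ, |u θ γ| ≤ D * ‖Ξ θ γ‖) →
      IsSymbol ε c X Ξ 2 2 fun θ γ _ => (u θ γ : ℂ) := fun hD h =>
    hS.isSymbol_ofReal 2 fun θ γ => up hD (h θ γ)
  have k0 : ∀ {u : Θ → Index Z → ℝ} {D : ℝ}, (∀ θ γ, |u θ γ| ≤ D) →
      IsSymbol ε c X Ξ 2 0 fun θ γ _ => (u θ γ : ℂ) := fun h =>
    hS.isSymbol_ofReal 2 (A := _) fun θ γ => by rw [zpow_zero, mul_one]; exact h θ γ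
  have kc := fun u : ℂ => hS.isSymbol_complex 2 u
  have y0 : ∀ {u : Θ → Index Z → Rn n} {D : ℝ}, (∀ θ γ, ‖u θ γ‖ ≤ D) →
      IsSymbol ε c X Ξ 2 (-1) fun θ γ x => ((inner ℝ (u θ γ) (x - X θ γ) : ℝ) : ℂ) := fun h =>
    (hS.isSymbol_inner 2 (m := 0) (A := _) fun θ γ => by
      rw [zpow_zero, mul_one]; exact h θ γ).congr_order (by norm_num)
  have y2 : ∀ {u : Θ → Index Z → Rn n}, (∀ θ γ, ‖u θ γ‖ ≤ B * ‖Ξ θ γ‖) →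
      IsSymbol ε c X Ξ 2 1 fun θ γ x => ((inner ℝ (u θ γ) (x - X θ γ) : ℝ) : ℂ) := fun h =>
    (hS.isSymbol_inner 2 (m := 2) fun θ γ => up hB (h θ γ)).congr_order (by norm_num)
  have mul : ∀ {m₁ m₂ : ℤ} {f g : Amplitude Z Θ}, IsSymbol ε c X Ξ 2 m₁ f →
      IsSymbol ε c X Ξ 2 m₂ g → IsSymbol ε c X Ξ 2 (m₁ + m₂) fun θ γ x => f θ γ x * g θ γ x :=
    fun hf hg => IsSymbol.mul hS hf hg
  have yy := hS.isSymbol_norm_sq 2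
  have yj := fun j => hS.isSymbol_coord 2 j
  have sl : IsSymbol ε c X Ξ 2 2 fun θ γ _ => (‖Ξ θ γ‖ : ℂ) :=
    k2 (D := 1) zero_le_one fun θ γ => by rw [abs_of_pos (hl θ γ), one_mul]
  have sξ : ∀ j, IsSymbol ε c X Ξ 2 2 fun θ γ _ => (Ξ θ γ j : ℂ) := fun j =>
    k2 (D := 1) zero_le_one fun θ γ => by rw [one_mul]; exact abs_coord_le _ _
  have ip : ∀ {x y : Rn n} {D E : ℝ}, 0 ≤ D → ‖x‖ ≤ D → ‖y‖ ≤ E → |inner ℝ x y| ≤ D * E :=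
    fun hD hx hy => (abs_real_inner_le_norm _ _).trans (mul_le_mul hx hy (norm_nonneg _) hD)
  have hc := fun θ γ => abs_rate_coeff_le (u := ‖W θ γ‖) (hl θ γ) (ip (hl θ γ).le le_rfl (hW θ γ))
    (by rw [abs_norm]; exact hW θ γ) (ip (hl θ γ).le le_rfl (hw θ γ))
  have sq' : IsSymbol ε c X Ξ 2 2 fun θ γ _ => (q θ γ : ℂ) := k2 hB fun θ γ => by
    rw [← abs_neg, ← hqV, mul_comm]
    exact ip (hl θ γ).le le_rfl (hV θ γ)
  have sν := k2 hB fun θ γ => (hc θ γ).1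
  have sP := y0 hV
  have sQ := y2 hW
  have sR₁ : IsSymbol ε c X Ξ 2 0 fun θ γ x => (rateRe (X θ γ) (Ξ θ γ) (V θ γ) (W θ γ) x : ℂ) +
      -2 * ((‖Ξ θ γ‖ : ℂ) * ((inner ℝ (V θ γ) (x - X θ γ) : ℝ) : ℂ)) :=
    (hS.isSymbol_add (mul (kc (n / 2)) (k0 fun θ γ => (hc θ γ).2.1))
      (mul (kc (-1)) (mul sν yy))).of_eq fun θ γ x => by rw [rateRe]; push_cast; ring
  have sR : IsSymbol ε c X Ξ 2 1 fun θ γ x => (rateRe (X θ γ) (Ξ θ γ) (V θ γ) (W θ γ) x : ℂ) :=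
    (hS.isSymbol_add (mul (kc 2) (mul sl sP)) sR₁).of_eq fun θ γ x => by ring
  have sR' : IsSymbol ε c X Ξ 2 2 fun θ γ x =>
      (rateReDeriv (X θ γ) (Ξ θ γ) (V θ γ) (W θ γ) (v θ γ) (w θ γ) x : ℂ) := by
    have t : IsSymbol ε c X Ξ 2 2 fun θ γ _ => ((‖Ξ θ γ‖ * ‖V θ γ‖ ^ 2 : ℝ) : ℂ) :=
      k2 (D := B ^ 2) (by positivity) fun θ γ => by
        rw [abs_of_nonneg (by positivity), mul_comm]
        gcongr
        exact hV θ γ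
    refine (hS.isSymbol_add (hS.isSymbol_add (hS.isSymbol_add (hS.isSymbol_add (mul (kc (-2)) t)
      (mul (kc (n / 2)) (k0 fun θ γ => (hc θ γ).2.2.2)))
      (mul (kc (-1)) (mul (k2 (by positivity) fun θ γ => (hc θ γ).2.2.1) yy)))
      (mul (kc 4) (mul sν sP))) (mul (kc 2) (mul sl (y0 hv)))).of_eq fun θ γ x => ?_
    rw [rateReDeriv]
    push_cast
    ring
  have sI' : IsSymbol ε c X Ξ 2 2 fun θ γ x =>
      (rateImDeriv (X θ γ) (Ξ θ γ) (V θ γ) (W θ γ) (v θ γ) (w θ γ) x : ℂ) := by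
    have t : IsSymbol ε c X Ξ 2 2 fun θ γ _ =>
        ((-(2 * inner ℝ (W θ γ) (V θ γ)) - inner ℝ (Ξ θ γ) (v θ γ) : ℝ) : ℂ) :=
      k2 (D := 2 * B ^ 2 + B) (by positivity) fun θ γ => by
        refine (abs_sub _ _).trans ?_
        rw [abs_neg, abs_mul, abs_two]
        have e1 := ip (by have := hl θ γ; positivity) (hW θ γ) (hV θ γ)
        have e2 := ip (hl θ γ).le le_rfl (hv θ γ)
        linarith
    exact (hS.isSymbol_add t (y2 hw)).of_eq fun θ γ x => by rw [rateImDeriv]; push_cast; ring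
  have sρ := fun i j => hS.isSymbol_taylor hK (fun θ => hd θ i j) fun θ x y => hGL θ x y i j
  have sda : ∀ i j, IsSymbol ε c X Ξ 2 (-1) fun θ γ x => (m θ x i j : ℂ) - m θ (X θ γ) i j :=
    fun i j => (hS.isSymbol_add (y0 fun θ γ => hG θ (X θ γ) i j) (sρ i j)).of_eq fun θ γ x => by
      push_cast; ring
  have sa : ∀ i j, IsSymbol ε c X Ξ 2 0 fun θ _ x => (m θ x i j : ℂ) := fun i j =>
    (hS.isSymbol_add (k0 fun θ γ => hm θ (X θ γ) i j) (sda i j)).of_eq fun θ γ x => by ring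
  refine (hS.isSymbol_add (hS.isSymbol_add (hS.isSymbol_add (hS.isSymbol_add (hS.isSymbol_add
    (hS.isSymbol_add sR' (mul (kc I) sI')) (mul sR sR)) (mul (kc (2 * I)) (mul sR sQ)))
    (mul (kc (2 * I)) (mul sq' sR₁))) (mul (kc (-1)) (mul sQ sQ)))
    (IsSymbol.finsetSum hS Finset.univ fun i _ => IsSymbol.finsetSum hS Finset.univ fun j _ =>
      hS.isSymbol_add (hS.isSymbol_add (hS.isSymbol_add (mul (sρ i j) (mul (sξ i) (sξ j)))
        (mul (kc (2 * I)) (mul sl (mul (sda i j)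
          (hS.isSymbol_add (mul (sξ i) (yj j)) (mul (sξ j) (yj i)))))))
        (mul (kc (-4)) (mul (mul sl sl) (mul (sa i j) (mul (yj i) (yj j))))))
        (mul (kc 2) (mul sl (mul (sa i j) (kc (if i = j then 1 else 0))))))).of_eq
    fun θ γ x => ?_
  have h1 : ∑ i, ∑ j, (m θ (X θ γ) i j : ℂ) * Ξ θ γ i * Ξ θ γ j = (q θ γ : ℂ) ^ 2 := by
    exact_mod_cast hq θ γ
  have h2 : ∑ i, ∑ j, ((inner ℝ (gradient (fun x => m θ x i j) (X θ γ)) (x - X θ γ) : ℝ) : ℂ) *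
      Ξ θ γ i * Ξ θ γ j = 2 * q θ γ * ((inner ℝ (W θ γ) (x - X θ γ) : ℝ) : ℂ) := by
    have := hW' θ γ (x - X θ γ)
    rw [inner_gradForm] at this
    exact_mod_cast (sum_congr rfl fun i _ => sum_congr rfl fun j _ => by ring).trans this
  have h4 : ∑ i, ∑ j, (m θ (X θ γ) i j : ℂ) * Ξ θ γ j * ((x - X θ γ) i : ℝ) =
      -q θ γ * ((inner ℝ (V θ γ) (x - X θ γ) : ℝ) : ℂ) := by
    have := hV' θ γ (x - X θ γ)
    rw [inner_matVec] at this
    exact_mod_cast this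
  have h3 : ∑ i, ∑ j, (m θ (X θ γ) i j : ℂ) * Ξ θ γ i * ((x - X θ γ) j : ℝ) =
      -q θ γ * ((inner ℝ (V θ γ) (x - X θ γ) : ℝ) : ℂ) := by
    rw [← h4, Finset.sum_comm]
    exact sum_congr rfl fun i _ => sum_congr rfl fun j _ => by rw [hsymm]
  rw [rate, rateIm, hqV, sub_neg_eq_add, Complex.ofReal_add, waveSymbol_eq h1 h2 h3 h4]
  push_cast
  rfl

end

section

/-! ### The operator `TE(t)` -/

variable {n : ℕ} {Z : FrequencyNet n} {ε c T K : ℝ} {a : ℝ → Rn n → Matrix (Fin n) (Fin n) ℝ}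

lemma WaveBound.fieldPos_spec (ha : WaveBound T a K) {t : ℝ} (ht : t ∈ Icc (-T) T) (x : Rn n)
    {ξ : Rn n} (hξ : ξ ≠ 0) (y : Rn n) :
    inner ℝ (matVec (a t x) ξ) y = -√(quadForm (a t x) ξ) * inner ℝ (fieldPos 0 (a t x) ξ) y ∧
      inner ℝ ξ (fieldPos 0 (a t x) ξ) = -√(quadForm (a t x) ξ) ∧
      inner ℝ (gradForm (gradCoeff a t x) ξ) y = 2 * √(quadForm (a t x) ξ) *
        inner ℝ (fieldFreq 0 (a t x) (gradCoeff a t x) ξ) y := by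
  have hq := ha.quadForm_pos ht x hξ
  have hs := Real.sqrt_pos.mpr hq
  rw [fieldPos_eq hs.le, fieldFreq_eq hs.le]
  refine ⟨?_, ?_, ?_⟩
  · rw [inner_neg_left, real_inner_smul_left]
    field_simp
  · have h : inner ℝ ξ (matVec (a t x) ξ) = √(quadForm (a t x) ξ) ^ 2 := by
      rw [real_inner_comm, inner_matVec, sq_sqrt hq.le, quadForm]
      exact sum_congr rfl fun i _ => sum_congr rfl fun j _ => by ring
    rw [inner_neg_right, real_inner_smul_right, h]
    field_simp
  · rw [real_inner_smul_left]
    field_simp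

/-- The wave operator maps the moved frame functions to packets with symbols of order `1`. -/
lemma WaveBound.exists_waveSymbol (ha : WaveBound T a K) (hT : 0 < T) (hε : 0 < ε) (hc : 0 < c)
    (hg : GradLipschitzInTime T a) (Z : FrequencyNet n) :
    ∃ f : regularTimes Z ε c T a → Index Z → Rn n → ℂ,
      IsSymbol ε c (fun (t : regularTimes Z ε c T a) γ => (framePath ε c T a γ t).1)
        (fun (t : regularTimes Z ε c T a) γ => (framePath ε c T a γ t).2) 2 2 f ∧
      ∀ (t : regularTimes Z ε c T a) γ x, waveOp a T (movedFrameFun ε c T a γ) t x =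
        f t γ x * gaussian (spacing ε c γ.1) (framePath ε c T a γ t).1
          (framePath ε c T a γ t).2 x := by
  obtain ⟨C, hC, hacc⟩ := ha.exists_second_deriv hT hg Z ε c
  choose v w hv hw hvC hwC using fun (t : regularTimes Z ε c T a) γ => hacc t t.2 γ
  have hS := ha.isPacketSystem (Z := Z) hT hε hc (J := regularTimes Z ε c T a) fun t ht => ht.1
  have hI : ∀ t : regularTimes Z ε c T a, (t : ℝ) ∈ Icc (-T) T := fun t => t.2.1
  have hpath := fun γ : Index Z => ha.isBicharacteristic_framePath hT.le ε c γ
  have hder := fun (γ : Index Z) {t : ℝ} (ht : t ∈ Icc (-T) T) =>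
    ha.derivWithin_framePath hT ε c γ ht
  have hK := ha.one_le
  have hF := one_le_flowFactor (n := n) (K := K) hT.le
  set B : ℝ := n ^ 2 * K ^ 2 + C * flowFactor n K T with hBdef
  have hB1 : n ^ 2 * K ^ 2 ≤ B := le_add_of_nonneg_right (by positivity)
  have hB2 : C * flowFactor n K T ≤ B := le_add_of_nonneg_left (by positivity)
  have hCB : C ≤ B := (le_mul_of_one_le_right hC hF).trans hB2
  have hfreq : ∀ (t : regularTimes Z ε c T a) (γ : Index Z),
      ‖freq γ‖ ≤ flowFactor n K T * ‖(framePath ε c T a γ t).2‖ := fun t γ => by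
    have h := (hpath γ).norm_freq_le ha ⟨by linarith, hT.le⟩ (hI t)
    rwa [(hpath γ).init] at h
  have hspec := fun (t : regularTimes Z ε c T a) (γ : Index Z) => ha.fieldPos_spec (hI t)
    (framePath ε c T a γ t).1 ((hpath γ).ne_zero t (hI t))
  refine ⟨_, hS.isSymbol_wave (m := fun t => a t)
    (V := fun t γ => (derivWithin (framePath ε c T a γ) (Icc (-T) T) t).1)
    (W := fun t γ => (derivWithin (framePath ε c T a γ) (Icc (-T) T) t).2)
    (v := v) (w := w) (q := fun t γ => √(quadForm (a t (framePath ε c T a γ t).1)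
      (framePath ε c T a γ t).2))
    (by positivity : 0 ≤ B) (by linarith : 0 ≤ K) (fun t γ => ?_) (fun t γ => (hvC t γ).trans hCB)
    (fun t γ => ?_) (fun t γ => ?_) (fun t => ha.entry t (hI t))
    (fun t => ha.differentiable t (hI t)) (fun t => ha.grad t (hI t))
    (fun t => ha.grad_lipschitz t (hI t)) (fun t γ => ?_) (fun t γ => ?_) (fun t γ y => ?_)
    (fun t => ha.symm t (hI t)) (fun t γ y => ?_), fun t γ x => ?_⟩
  · rw [hder γ (hI t)]
    exact (ha.norm_fieldPos_le (hI t) 0 _ _).trans hB1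
  · rw [hder γ (hI t)]
    exact (ha.norm_fieldFreq_le (hI t) 0 _ _).trans (by gcongr)
  · refine (hwC t γ).trans ((mul_le_mul_of_nonneg_left (hfreq t γ) hC).trans ?_)
    rw [← mul_assoc]
    gcongr
  · exact (sq_sqrt (ha.quadForm_pos (hI t) _ ((hpath γ).ne_zero t (hI t))).le).symm
  · rw [hder γ (hI t)]
    exact (hspec t γ 0).2.1
  · rw [hder γ (hI t)]
    exact (hspec t γ y).1
  · rw [hder γ (hI t)]
    exact (hspec t γ y).2.2
  · refine waveOp_gaussian (spacing_pos hc _) hT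
      (χ := fun s => (framePath ε c T a γ s).1)
      (ξ := fun s => (framePath ε c T a γ s).2)
      (V := fun s => (derivWithin (framePath ε c T a γ) (Icc (-T) T) s).1)
      (W := fun s => (derivWithin (framePath ε c T a γ) (Icc (-T) T) s).2)
      (fun s hs => ?_) (fun s hs => ?_) (hpath γ).ne_zero (hI t) (hv t γ) (hw t γ) x
    · rw [hder γ hs]
      exact (hpath γ).hasDeriv_pos ha hs
    · rw [hder γ hs]
      exact (hpath γ).hasDeriv_freq ha hs

/-- `TE(t) h` is the corresponding sum of the images of these functions under the wave operator. -/
lemma WaveBound.exists_TE (ha : WaveBound T a K) (hT : 0 < T) (hε : 0 < ε) (hc : 0 < c)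
    (hc1 : c ≤ 1) (hg : GradLipschitzInTime T a) {S : L2 n ≃L[ℂ] L2 n}
    (hSf : IsFrameOperator Z ε c S)
    (hS : ∀ r : ℝ, ∃ C : ℝ≥0, ∀ f, sobolevNorm r (S.symm f) ≤ C * sobolevNorm r f) :
    ∃ TE : ℝ → (sobolevSpace n 1 →ₗ[ℂ] L2 n),
      (∀ t ∈ regularTimes Z ε c T a, ∀ f : L2 n, ∀ hf : S f ∈ sobolevSpace n 1,
        HasMatrixImage Z ε c (bT ε c T a t) f (S (TE t ⟨S f, hf⟩))) ∧
      ∀ r ∈ Icc (0 : ℝ) 3, ∃ C : ℝ≥0, ∀ t ∈ regularTimes Z ε c T a, ∀ h : sobolevSpace n 1,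
        sobolevNorm (r - 1) (TE t h) ≤ C * sobolevNorm r (h : L2 n) := by
  have hP := ha.isPacketSystem (Z := Z) hT hε hc (J := regularTimes Z ε c T a) fun t ht => ht.1
  obtain ⟨f, hf, hwave⟩ := ha.exists_waveSymbol hT hε hc hg Z
  set P := packet ε c (fun (t : regularTimes Z ε c T a) γ => (framePath ε c T a γ t).1)
    (fun (t : regularTimes Z ε c T a) γ => (framePath ε c T a γ t).2) f with hPdef
  -- the two derivatives of the symbol give the bounds into `H⁻¹` and into `H²`
  have hb : ∀ r ∈ Icc (0 : ℝ) 3, SobolevBound P (r - 1) r := by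
    intro r hr
    have h1 := (hf.isSobolevBounded_pos hP 2).sobolevBound
    have h2 := (IsSymbol.isSobolevBounded_neg hP 1 hf).sobolevBound
    have h3 := h2.interpolate (s := r - 1) h1 (by norm_num)
      (by push_cast; linarith [hr.1]) (by push_cast; linarith [hr.2])
    convert h3 using 1
    push_cast
    ring
  have hb1 : SobolevBound P 0 1 := by
    have := hb 1 ⟨zero_le_one, by norm_num⟩
    rwa [sub_self] at this
  obtain ⟨A, hA⟩ := hb1.exists_operator hε hc hc1 hS
  classical
  refine ⟨fun t => if h : t ∈ regularTimes Z ε c T a then A ⟨t, h⟩ else 0, fun t ht u hu => ?_,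
    fun r hr => ?_⟩
  · simp only [dif_pos ht]
    have h1 := hA ⟨t, ht⟩ ⟨S u, hu⟩
    rw [S.symm_apply_apply] at h1
    refine hSf.hasMatrixImage (fun γ γ' => ?_) h1
    rw [hf.isMultiplier.inner_packet hP]
    exact integral_congr_ae (.of_forall fun x => by
      change _ * waveOp a T (movedFrameFun ε c T a γ') t x = _
      rw [hwave ⟨t, ht⟩ γ' x])
  · obtain ⟨C, hC⟩ := (hb r hr).exists_operator_bound hε hc hc1 hS
    refine ⟨C, fun t ht u => ?_⟩
    simp only [dif_pos ht]
    exact hC ⟨t, ht⟩ u _ (hA ⟨t, ht⟩ u)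

end

end GaussianFrame

end

open GaussianFrame

theorem theorem3 (n : ℕ) (hn : 0 < n) (ε : ℝ) (hε : 0 < ε) :
    ∃ c₀ > 0, ∀ c ∈ Ioc (0 : ℝ) c₀, ∀ Z : FrequencyNet n,
      ∃ S : L2 n ≃L[ℂ] L2 n, IsFrameOperator Z ε c S ∧
        ∀ (T : ℝ), 0 < T → ∀ (a : ℝ → Rn n → Matrix (Fin n) (Fin n) ℝ),
          IsWaveCoefficient T a →
          -- the row and column sums of the matrix of `E(t)`
          (∃ C : ℝ≥0, ∀ t ∈ Icc (-T) T,
            (∀ γ : Index Z, ∑' γ' : Index Z, ‖bE ε c T a t γ γ'‖ₑ ≤ C) ∧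
            (∀ γ' : Index Z, ∑' γ : Index Z, ‖bE ε c T a t γ γ'‖ₑ ≤ C)) ∧
          -- `E(t)` is bounded of order `0`
          (∃ E : ℝ → (L2 n →L[ℂ] L2 n),
            (∀ t ∈ Icc (-T) T, ∀ f : L2 n,
              HasMatrixImage Z ε c (bE ε c T a t) f (S (E t (S f)))) ∧
            ∀ r : ℝ, ∃ C : ℝ≥0, ∀ t ∈ Icc (-T) T, ∀ h : L2 n,
              sobolevNorm r (E t h) ≤ C * sobolevNorm r h) ∧
          -- `TE(t)` is bounded of order `1`
          (GradLipschitzInTime T a →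
            (∀ᵐ t ∂(volume.restrict (Icc (-T) T)), t ∈ regularTimes Z ε c T a) ∧
            ∃ TE : ℝ → (sobolevSpace n 1 →ₗ[ℂ] L2 n),
              (∀ t ∈ regularTimes Z ε c T a, ∀ f : L2 n, ∀ hf : S f ∈ sobolevSpace n 1,
                HasMatrixImage Z ε c (bT ε c T a t) f (S (TE t ⟨S f, hf⟩))) ∧
              ∀ r ∈ Icc (0 : ℝ) 3, ∃ C : ℝ≥0, ∀ t ∈ regularTimes Z ε c T a,
                ∀ h : sobolevSpace n 1,
                  sobolevNorm (r - 1) (TE t h) ≤ C * sobolevNorm r (h : L2 n)) := by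
  obtain ⟨c₀, hc₀, hc₁, h⟩ := exists_frameOperator_equiv hn hε
  refine ⟨c₀, hc₀, fun c hc Z => ?_⟩
  obtain ⟨S, hSf, hS⟩ := h c hc Z
  refine ⟨S, hSf, fun T hT a hcoeff => ?_⟩
  obtain ⟨K, ha⟩ := hcoeff.exists_waveBound
  have hc1 := hc.2.trans hc₁
  exact ⟨ha.exists_tsum_bE_le hε hc.1 hT, ha.exists_E hT hε hc.1 hc1 hSf hS,
    fun hg => ⟨ha.ae_mem_regularTimes hT hg Z ε c, ha.exists_TE hT hε hc.1 hc1 hg hSf hS⟩⟩
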